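/- **Setting.** Let $\Gamma$ be a finite group, $V$ a finite-dimensional real linear $\Gamma$-representation with a $\Gamma$-invariant scalar product. For $\gamma\in\Gamma$ let $V^\gamma$ be the fixed space, $N^\gamma=(V^\gamma)^\perp$ and $\ell(\gamma)=\dim N^\gamma$. Write $\gamma(f)=f\circ\gamma^{-1}$ for functions $f$ on $V$. The elements $\sum_\gamma f_\gamma\delta_\gamma$ of $A\rtimes\Gamma$, where $A=C^\infty_{\rm cpt}(V)$ (real-valued), are multiplied by $f\delta_\gamma\cdot f'\delta_{\gamma'}=f\,\gamma(f')\,\delta_{\gamma\gamma'}$ and identified with the functions $(\gamma,t)\mapsto f_\gamma(t)$ on $\Gamma\times V$. *Hochschild complex.* $C^k=C^k(A\rtimes\Gamma,A\rtimes\Gamma)$ is the space of bounded linear maps $C^\infty_{\rm cpt}((\Gamma\times V)^k)=(A\rtimes\Gamma)^{\hat\otimes k}\to C^\infty(\Gamma\times V)$ with the Hochschild coboundary $bF(a_1,\dots,a_{k+1})=a_1F(a_2,\dots)+\sum_{i=1}^{k}(-1)^iF(\dots,a_ia_{i+1},\dots)+(-1)^{k+1}F(a_1,\dots,a_k)a_{k+1}$.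 (A set of test functions is bounded if the supports lie in a common compact set and all derivatives are uniformly bounded; a set of smooth functions is bounded if all derivatives are uniformly bounded on compact sets.) Similarly $C^k(A,A\rtimes\Gamma)$ consists of bounded linear maps $C^\infty_{\rm cpt}(V^k)\to C^\infty(\Gamma\times V)$; $\Gamma$ acts on it by $(gF)(f_1,\dots,f_k)=\delta_gF(g^{-1}f_1,\dots,g^{-1}f_k)\delta_{g^{-1}}$, and $P=\frac1{|\Gamma|}\sum_g g$ is the projection onto the invariants. *Twisted multivector fields.* $\mathcal X^k=\big(\bigoplus_\gamma\Gamma^\infty(\Lambda^{k-\ell(\gamma)}TV^\gamma\otimes\Lambda^{\ell(\gamma)}N^\gamma)\big)^\Gamma$ with zero differential; its elements are families of smooth maps $\xi_\gamma:V^\gamma\to\Lambda^{k-\ell(\gamma)}V^\gamma\otimes\Lambda^{\ell(\gamma)}N^\gamma\subset\Lambda^kV$ with $\xi_{g\gamma g^{-1}}(gx)=\Lambda^k(g)\,\xi_\gamma(x)$. *The map $L=L_3L_2L_1:C^k\to\mathcal X^k$.* $L_1=P\circ\mathrm{res}$ with $\mathrm{res}F(f_1,\dots,f_k)=F(f_1\delta_e,\dots,f_k\delta_e)$.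 Fix $\varepsilon>0$ and a smooth $\varrho:\mathbb R\to[0,1]$ with support in $(-\infty,\frac34]$ and $\varrho=1$ on $(-\infty,\frac12]$, and put $\Psi_{k,\varepsilon}(y_0,\dots,y_{k+1})=\prod_{j=0}^{k}\varrho(|y_j-y_{j+1}|^2/\varepsilon)$. In orthonormal coordinates, $$L_2(F)_\gamma(x)=\sum_{i_1,\dots,i_k}F_\gamma\Big(\Psi_{k,\varepsilon}(\gamma x,y_1,\dots,y_k,x)\textstyle\prod_j(y_j-x)^{i_j}\Big)(\gamma x)\;\partial_{i_1}\wedge\dots\wedge\partial_{i_k},$$ where $F=\sum_\gamma F_\gamma\delta_\gamma$, the argument of $F_\gamma$ is a function of $y_1,\dots,y_k$, and all indices run independently (equivalently, one antisymmetrizes and sums over $i_1<\dots<i_k$). $L_3(X)_\gamma=\mathrm{pr}^\gamma(X_\gamma|_{V^\gamma})$, where $\mathrm{pr}^\gamma$ is the orthogonal projection of $\Lambda^kV$ onto $\Lambda^{k-\ell(\gamma)}V^\gamma\otimes\Lambda^{\ell(\gamma)}N^\gamma$. *The map $T=T_2T_1:\mathcal X^k\to C^k$.* Choose for every $\gamma$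 linear coordinates $y_1,\dots,y_\ell$ on $N^\gamma$, $\ell=\ell(\gamma)$, and let $\tilde y_j=\gamma(y_j)=y_j\circ\gamma^{-1}$. For $\sigma\in S_\ell$ let $z^i=z^i_\sigma$ be the vector with coordinates $\tilde y_m$ for $m\in\{\sigma(1),\dots,\sigma(i)\}$ and $y_m$ otherwise. The normal twisted cocycle is $$\Omega_\gamma(f_1,\dots,f_\ell)(x,y)=\frac1{\ell!}\sum_{\sigma\in S_\ell}\mathrm{sgn}(\sigma)\,\frac{\prod_{i=1}^{\ell}\big(f_i(x,z^{i-1})-f_i(x,z^i)\big)}{\prod_{j=1}^{\ell}(y_j-\tilde y_j)}\qquad(x\in V^\gamma,\ y\in N^\gamma),$$ extended by continuity to the zeros of the denominator. Put $T_1^\gamma(X\otimes Y)=Y(y_1,\dots,y_\ell)\,X\sharp\Omega_\gamma$, where $X\sharp\Omega_\gamma(f_1,\dots,f_k)=X(f_1,\dots,f_p)\,\Omega_\gamma(f_{p+1},\dots,f_k)$, $p=k-\ell$, with $X,Y$ extended constantly in the normal directions, $X(f_1,\dots,f_p)=\frac1{p!}\langle X,df_1\wedge\dots\wedge df_p\rangle$,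 $Y(y_1,\dots,y_\ell)=\langle Y,dy_1\wedge\dots\wedge dy_\ell\rangle$ (determinant pairings). Let $T_1(\xi)=P\big(\sum_\gamma T_1^\gamma(\xi_\gamma)\delta_\gamma\big)$ and let $T_2$ be the Eilenberg–Zilber map $T_2(F)(f_1\delta_{\gamma_1},\dots,f_k\delta_{\gamma_k})=F(f_1,\gamma_1(f_2),\dots,\gamma_1\cdots\gamma_{k-1}(f_k))\,\delta_{\gamma_1\cdots\gamma_k}$. All maps are extended to the completed tensor products. **Theorem.** For all choices of $\varrho$, $\varepsilon$ and coordinates, and for all $k\ge 0$: $(C^\bullet,b)$ is a cochain complex; $L:C^\bullet\to\mathcal X^\bullet$ and $T:\mathcal X^\bullet\to C^\bullet$ are well-defined linear cochain maps; and $$L\circ T=\mathrm{id}.$$ In particular $T$ is a quasi-inverse to $L$: $L$ and $T$ induce mutually inverse isomorphisms $H^k(A\rtimes\Gamma,A\rtimes\Gamma)\cong\mathcal X^k$. Moreover $L\circ T=\mathrm{id}$ on $\mathcal X^\bullet$ also holds if the projections $P$ are omitted from $L_1$ and $T_1$, and omitting $P$ from $L_1$ does not change $L$ on cocycles. -/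

import Mathlib

open scoped ContDiff

noncomputable section

namespace OrbHoch

/-! ### Test functions and smooth functions -/

section TestFunctions

variable (Γ V : Type*) [NormedAddCommGroup V] [NormedSpace ℝ V]

/-- The space of smooth compactly supported real functions on `V ^ k`; this is the `k`-th completed
bornological tensor power of the space of smooth compactly supported functions on `V`. -/
def testFun (k : ℕ) : Submodule ℝ ((Fin k → V) → ℝ) where
  carrier := {φ | ContDiff ℝ ∞ φ ∧ HasCompactSupport φ}
  add_mem' := fun ha hb => ⟨ha.1.add hb.1, ha.2.add hb.2⟩
  zero_mem' := ⟨contDiff_const, HasCompactSupport.zero⟩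
  smul_mem' := fun c _ ha => ⟨ha.1.const_smul c, ha.2.smul_left (f := fun _ => c)⟩

/-- The space of smooth compactly supported real functions on `(Γ × V) ^ k`, where `Γ` is finite and
discrete.  A point `(γ, t)` of `Γ × V` stands for the arrow of the action groupoid with label `γ`
and target `t` (so with source `γ⁻¹ t`).  An element `∑ f_γ δ_γ` of the crossed product algebra is
the function `(γ, t) ↦ f_γ t`, and the present space is the `k`-th completed bornological tensor
power of the crossed product algebra. -/
def crossTest (k : ℕ) : Submodule ℝ ((Fin k → Γ × V) → ℝ) where
  carrier := {φ | ∀ c : Fin k → Γ, (fun x : Fin k → V => φ fun i => (c i, x i)) ∈ testFun V k}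
  add_mem' := fun ha hb c => (testFun V k).add_mem (ha c) (hb c)
  zero_mem' := fun _ => (testFun V k).zero_mem
  smul_mem' := fun r _ ha c => (testFun V k).smul_mem r (ha c)

variable {Γ V}

/-- A set of test functions on `(Γ × V) ^ k` is bounded if the supports lie in a common compact set
and all derivatives are uniformly bounded. -/
def IsBoundedTest {k : ℕ} (S : Set (crossTest Γ V k)) : Prop :=
  (∃ K : Set (Fin k → V), IsCompact K ∧
    ∀ φ ∈ S, ∀ c : Fin k → Γ, tsupport (fun x : Fin k → V => φ.1 fun i => (c i, x i)) ⊆ K) ∧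
  ∀ n : ℕ, ∃ C : ℝ, ∀ φ ∈ S, ∀ (c : Fin k → Γ) (x : Fin k → V),
    ‖iteratedFDeriv ℝ n (fun x : Fin k → V => φ.1 fun i => (c i, x i)) x‖ ≤ C

/-- Smooth functions on `Γ × V`. -/
def IsSmooth (f : Γ × V → ℝ) : Prop :=
  ∀ g : Γ, ContDiff ℝ ∞ fun t : V => f (g, t)

/-- A set of smooth functions on `Γ × V` is bounded if all derivatives are uniformly bounded on all
compact sets. -/
def IsBoundedSmooth (S : Set (Γ × V → ℝ)) : Prop :=
  ∀ K : Set V, IsCompact K → ∀ n : ℕ, ∃ C : ℝ, ∀ f ∈ S, ∀ g : Γ, ∀ t ∈ K,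
    ‖iteratedFDeriv ℝ n (fun t : V => f (g, t)) t‖ ≤ C

/-- Precomposition with a smooth map that has a continuous left inverse preserves test functions. -/
theorem comp_mem_testFun {m n : ℕ} {φ : (Fin n → V) → ℝ} (hφ : φ ∈ testFun V n)
    {j : (Fin m → V) → (Fin n → V)} {r : (Fin n → V) → (Fin m → V)} (hj : ContDiff ℝ ∞ j)
    (hr : Continuous r) (h : Function.LeftInverse r j) : (fun x => φ (j x)) ∈ testFun V m :=
  ⟨hφ.1.comp hj, hφ.2.comp_isClosedEmbedding (h.isClosedEmbedding hr hj.continuous)⟩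

end TestFunctions

/-! ### The Hochschild cochain complex of the crossed product -/

section Hochschild

variable (Γ V : Type*) [Group Γ] [Fintype Γ] [NormedAddCommGroup V] [InnerProductSpace ℝ V]

/-- The Hochschild `k`-cochains of the crossed product: the bounded linear maps from the smooth
compactly supported functions on `(Γ × V) ^ k` to the smooth functions on `Γ × V`. -/
def cochains (k : ℕ) : Submodule ℝ (crossTest Γ V k → Γ × V → ℝ) where
  carrier := {F | IsLinearMap ℝ F ∧ (∀ φ, IsSmooth (F φ)) ∧
    ∀ S : Set (crossTest Γ V k), IsBoundedTest S → IsBoundedSmooth (F '' S)}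
  add_mem' := by
    rintro F G ⟨hF, hF', hF''⟩ ⟨hG, hG', hG''⟩
    refine ⟨⟨fun x y => ?_, fun c x => ?_⟩, fun φ g => (hF' φ g).add (hG' φ g), ?_⟩
    · simp only [Pi.add_apply, hF.map_add, hG.map_add]; abel
    · simp only [Pi.add_apply, hF.map_smul, hG.map_smul, smul_add]
    · intro S hS K hK n
      obtain ⟨C, hC⟩ := hF'' S hS K hK n
      obtain ⟨D, hD⟩ := hG'' S hS K hK n
      refine ⟨C + D, ?_⟩
      rintro _ ⟨φ, hφ, rfl⟩ g t ht
      have h1 := hC _ ⟨φ, hφ, rfl⟩ g t ht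
      have h2 := hD _ ⟨φ, hφ, rfl⟩ g t ht
      have e : (fun t : V => (F + G) φ (g, t)) =
          (fun t : V => F φ (g, t)) + fun t : V => G φ (g, t) := rfl
      rw [e, iteratedFDeriv_add_apply ((hF' φ g).of_le (by exact_mod_cast le_top)).contDiffAt
        ((hG' φ g).of_le (by exact_mod_cast le_top)).contDiffAt]
      exact (norm_add_le _ _).trans (add_le_add h1 h2)
  zero_mem' := by
    refine ⟨⟨fun x y => by simp, fun c x => by simp⟩, fun φ g => contDiff_const, ?_⟩
    intro S hS K hK n
    refine ⟨0, ?_⟩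
    rintro _ ⟨φ, hφ, rfl⟩ g t ht
    have e : (fun t : V => (0 : crossTest Γ V k → Γ × V → ℝ) φ (g, t)) = 0 := rfl
    rw [e]
    change ‖iteratedFDeriv ℝ n (fun _ : V => (0 : ℝ)) t‖ ≤ 0
    rw [iteratedFDeriv_fun_zero]
    simp
  smul_mem' := by
    rintro c F ⟨hF, hF', hF''⟩
    refine ⟨⟨fun x y => ?_, fun r x => ?_⟩, fun φ g => (hF' φ g).const_smul c, ?_⟩
    · simp only [Pi.smul_apply, hF.map_add, smul_add]
    · simp only [Pi.smul_apply, hF.map_smul, smul_comm c r]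
    · intro S hS K hK n
      obtain ⟨C, hC⟩ := hF'' S hS K hK n
      refine ⟨‖c‖ * C, ?_⟩
      rintro _ ⟨φ, hφ, rfl⟩ g t ht
      have h1 := hC _ ⟨φ, hφ, rfl⟩ g t ht
      have e : (fun t : V => (c • F) φ (g, t)) = c • (fun t : V => F φ (g, t)) := rfl
      rw [e, iteratedFDeriv_const_smul_apply
        ((hF' φ g).of_le (by exact_mod_cast le_top)).contDiffAt, norm_smul]
      exact mul_le_mul_of_nonneg_left h1 (norm_nonneg _)

variable {Γ V}

/-- `consSlice q φ = φ (q, -)`. -/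
def consSlice {k : ℕ} (q : Γ × V) (φ : crossTest Γ V (k + 1)) : crossTest Γ V k :=
  ⟨fun p => φ.1 (Fin.cons q p), fun c => by
    have h := comp_mem_testFun (φ.2 (Fin.cons q.1 c)) (j := fun x : Fin k → V => Fin.cons q.2 x)
      (r := fun x i => x i.succ)
      (contDiff_pi.2 fun i => by
        refine Fin.cases ?_ (fun i => ?_) i
        · simpa using contDiff_const
        · simpa using contDiff_apply ℝ V i)
      (by fun_prop) (fun x => by ext i; simp)
    convert h using 3 with x
    refine congrArg φ.1 ?_
    funext i
    refine Fin.cases ?_ (fun i => ?_) i <;> simp⟩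

/-- `snocSlice q φ = φ (-, q)`. -/
def snocSlice {k : ℕ} (q : Γ × V) (φ : crossTest Γ V (k + 1)) : crossTest Γ V k :=
  ⟨fun p => φ.1 (Fin.snoc (α := fun _ => Γ × V) p q), fun c => by
    have h := comp_mem_testFun (φ.2 (Fin.snoc (α := fun _ => Γ) c q.1))
      (j := fun x : Fin k → V => Fin.snoc (α := fun _ => V) x q.2)
      (r := fun x i => x i.castSucc)
      (contDiff_pi.2 fun i => by
        refine Fin.lastCases ?_ (fun i => ?_) i
        · simpa using contDiff_const
        · simpa using contDiff_apply ℝ V i)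
      (by fun_prop) (fun x => by ext i; simp)
    convert h using 3 with x
    refine congrArg φ.1 ?_
    funext i
    refine Fin.lastCases ?_ (fun i => ?_) i <;> simp⟩

variable (ρ : Γ →* (V ≃ₗᵢ[ℝ] V))

/-- The effect of the convolution product of the `i`-th and the `(i + 1)`-st argument,
`(a * b) (g, t) = ∑ h, a (h, t) * b (h⁻¹ g, h⁻¹ t)`,
i.e. of `f δ_h * f' δ_h' = f h(f') δ_{h h'}` with `h(f') = f' ∘ h⁻¹`. -/
def merge {k : ℕ} (i : Fin k) (φ : crossTest Γ V (k + 1)) : crossTest Γ V k :=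
  ⟨∑ h : Γ, fun p => φ.1 (Fin.insertNth i.castSucc (h, (p i).2)
      (Function.update p i (h⁻¹ * (p i).1, ρ h⁻¹ (p i).2))),
    Submodule.sum_mem _ fun h _ c => by
      have hh := comp_mem_testFun
        (φ.2 (Fin.insertNth i.castSucc h (Function.update c i (h⁻¹ * c i))))
        (j := fun x : Fin k → V => Fin.insertNth i.castSucc (x i)
          (Function.update x i (ρ h⁻¹ (x i))))
        (r := fun x l => if l = i then x i.castSucc else x (i.castSucc.succAbove l))
        (contDiff_pi.2 fun l => by
          refine Fin.succAboveCases i.castSucc ?_ (fun l => ?_) l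
          · simpa using contDiff_apply ℝ V i
          · by_cases hl : l = i
            · subst hl
              simpa [Function.comp_def] using (ρ h⁻¹).contDiff.comp (contDiff_apply ℝ V l)
            · simpa [Function.update_of_ne hl] using contDiff_apply ℝ V l)
        (continuous_pi fun l => by split_ifs <;> fun_prop)
        (fun x => by
          ext l
          by_cases hl : l = i
          · simp [hl]
          · simp [hl])
      convert hh using 3 with x
      funext l
      refine Fin.succAboveCases i.castSucc ?_ (fun l => ?_) l
      · simp
      · by_cases hl : l = i
        · subst hl; simp
        · simp [Function.update_of_ne hl]⟩

/-- The Hochschild coboundary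
`b F (a₁, …, a_{k+1}) = a₁ * F (a₂, …) + ∑ (-1) ^ i F (…, a_i * a_{i+1}, …)
  + (-1) ^ (k + 1) F (a₁, …, a_k) * a_{k+1}`. -/
def hochB (k : ℕ) : (crossTest Γ V k → Γ × V → ℝ) →ₗ[ℝ] (crossTest Γ V (k + 1) → Γ × V → ℝ) where
  toFun F := fun φ q =>
    (∑ h : Γ, F (consSlice (h, q.2) φ) (h⁻¹ * q.1, ρ h⁻¹ q.2)) +
    (∑ i : Fin k, (-1 : ℝ) ^ ((i : ℕ) + 1) * F (merge ρ i φ) q) +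
    (-1 : ℝ) ^ (k + 1) * ∑ h : Γ, F (snocSlice (h⁻¹ * q.1, ρ h⁻¹ q.2) φ) (h, q.2)
  map_add' F G := by
    funext φ q
    simp only [Pi.add_apply, Finset.sum_add_distrib, mul_add]
    ring
  map_smul' c F := by
    funext φ q
    simp only [Pi.smul_apply, smul_eq_mul, RingHom.id_apply, mul_add, Finset.mul_sum]
    congr 1
    · congr 1
      exact Finset.sum_congr rfl fun i _ => by ring
    · exact Finset.sum_congr rfl fun i _ => by ring

/-- Hochschild cocycles. -/
def cocycles (k : ℕ) : Submodule ℝ (crossTest Γ V k → Γ × V → ℝ) :=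
  cochains Γ V k ⊓ LinearMap.ker (hochB ρ k)

/-- Hochschild coboundaries. -/
def coboundaries : (k : ℕ) → Submodule ℝ (crossTest Γ V k → Γ × V → ℝ)
  | 0 => ⊥
  | k + 1 => (cochains Γ V k).map (hochB ρ k)

/-- Hochschild cohomology of the crossed product. -/
abbrev HH (k : ℕ) : Type _ :=
  cocycles ρ k ⧸ (coboundaries ρ k).submoduleOf (cocycles ρ k)

/-! ### Cochains on functions on `V` with values in the crossed product -/

/-- The action of `g` on a cochain `F` on functions on `V` with values in the crossed product,
`(g F) (f₁, …, f_k) = δ_g F (g⁻¹ f₁, …, g⁻¹ f_k) δ_{g⁻¹}`. -/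
def act {k : ℕ} (g : Γ) (F : testFun V k → Γ × V → ℝ) : testFun V k → Γ × V → ℝ :=
  fun φ q => F ⟨fun x => φ.1 fun i => ρ g (x i),
      comp_mem_testFun φ.2 (j := fun (x : Fin k → V) i => ρ g (x i))
        (r := fun (x : Fin k → V) i => ρ g⁻¹ (x i))
        (contDiff_pi.2 fun i => (ρ g).contDiff.comp (contDiff_apply ℝ V i))
        (by fun_prop)
        (fun x => by
          funext i
          change (ρ g⁻¹ * ρ g) (x i) = x i
          rw [← map_mul]; simp)⟩
    (g⁻¹ * q.1 * g, ρ g⁻¹ q.2)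

/-- The projection onto the `Γ`-invariant cochains, by averaging. -/
def avg {k : ℕ} (F : testFun V k → Γ × V → ℝ) : testFun V k → Γ × V → ℝ :=
  (Fintype.card Γ : ℝ)⁻¹ • ∑ g : Γ, act ρ g F

open Classical in
/-- The map `f₁ ⊗ ⋯ ⊗ f_k ↦ f₁ δ_e ⊗ ⋯ ⊗ f_k δ_e`. -/
def extendUnit {k : ℕ} (φ : testFun V k) : crossTest Γ V k :=
  ⟨fun p => if ∀ i, (p i).1 = 1 then φ.1 fun i => (p i).2 else 0, fun c => by
    by_cases hc : ∀ i, c i = 1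
    · simp only [hc, implies_true, if_true]; exact φ.2
    · simp only [hc, if_false]; exact (testFun V k).zero_mem⟩

/-- Restriction of a cochain on the crossed product to the functions on `V`,
`(f₁, …, f_k) ↦ F (f₁ δ_e, …, f_k δ_e)`. -/
def restrict {k : ℕ} (F : crossTest Γ V k → Γ × V → ℝ) : testFun V k → Γ × V → ℝ :=
  fun φ => F (extendUnit φ)

/-- For `φ = f₁ δ_{c₁} ⊗ ⋯ ⊗ f_k δ_{c_k}` this is
`f₁ ⊗ c₁(f₂) ⊗ ⋯ ⊗ c₁ ⋯ c_{k-1}(f_k)`. -/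
def twist {k : ℕ} (c : Fin k → Γ) (φ : crossTest Γ V k) : testFun V k :=
  ⟨fun x => φ.1 fun i => (c i, ρ (Fin.partialProd c i.castSucc)⁻¹ (x i)),
    comp_mem_testFun (φ.2 c)
      (j := fun (x : Fin k → V) i => ρ (Fin.partialProd c i.castSucc)⁻¹ (x i))
      (r := fun (x : Fin k → V) i => ρ (Fin.partialProd c i.castSucc) (x i))
      (contDiff_pi.2 fun i => (ρ (Fin.partialProd c i.castSucc)⁻¹).contDiff.comp
        (contDiff_apply ℝ V i))
      (by fun_prop)
      (fun x => by
        funext i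
        change (ρ (Fin.partialProd c i.castSucc) * ρ (Fin.partialProd c i.castSucc)⁻¹) (x i) = x i
        rw [← map_mul]; simp)⟩

/-- The Eilenberg-Zilber map `T₂`, `T₂ F (f₁ δ_{c₁}, …, f_k δ_{c_k}) =
F (f₁, c₁(f₂), …, c₁ ⋯ c_{k-1}(f_k)) δ_{c₁ ⋯ c_k}`. -/
def T₂ {k : ℕ} (F : testFun V k → Γ × V → ℝ) : crossTest Γ V k → Γ × V → ℝ :=
  fun φ q => ∑ c : Fin k → Γ,
    F (twist ρ c φ) (q.1 * (Fin.partialProd c (Fin.last k))⁻¹, q.2)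

end Hochschild

/-! ### Twisted multivector fields -/

section Multivectors

variable {Γ V : Type*} [Group Γ] [Fintype Γ] [NormedAddCommGroup V] [InnerProductSpace ℝ V]
  [FiniteDimensional ℝ V] (ρ : Γ →* (V ≃ₗᵢ[ℝ] V))

/-- The fixed space `V ^ γ`. -/
def fixed (γ : Γ) : Submodule ℝ V where
  carrier := {v | ρ γ v = v}
  add_mem' := fun {a b} (ha : ρ γ a = a) (hb : ρ γ b = b) => by
    change ρ γ (a + b) = a + b
    rw [map_add, ha, hb]
  zero_mem' := map_zero (ρ γ)
  smul_mem' := fun c a (ha : ρ γ a = a) => by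
    change ρ γ (c • a) = c • a
    rw [map_smul, ha]

/-- The normal space to `V ^ γ`. -/
abbrev normal (γ : Γ) : Submodule ℝ V := (fixed ρ γ)ᗮ

/-- The codimension of `V ^ γ`. -/
abbrev ell (γ : Γ) : ℕ := Module.finrank ℝ (normal ρ γ)

/-- The action of `g` on `V` maps `V ^ γ` to `V ^ (g γ g⁻¹)`. -/
def fixedMap (g γ : Γ) (x : fixed ρ γ) : fixed ρ (g * γ * g⁻¹) :=
  ⟨ρ g x, by
    have hx : ρ γ (x : V) = x := x.2
    change ρ (g * γ * g⁻¹) (ρ g x) = ρ g x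
    change (ρ (g * γ * g⁻¹) * ρ g) (x : V) = ρ g x
    rw [← map_mul, inv_mul_cancel_right, map_mul]
    change ρ g (ρ γ x) = ρ g x
    rw [hx]⟩

/-- The subspace `Λ^{k-ℓ(γ)} V^γ ⊗ Λ^{ℓ(γ)} N^γ` of `Λ^k V` (zero if `k < ℓ(γ)`). -/
def twistedPart (γ : Γ) (k : ℕ) : Submodule ℝ (⋀[ℝ]^k V) :=
  Submodule.span ℝ {τ | ∃ (S : Finset (Fin k)) (w : Fin k → V), S.card = ell ρ γ ∧
    (∀ i ∈ S, w i ∈ normal ρ γ) ∧ (∀ i ∉ S, w i ∈ fixed ρ γ) ∧ τ = exteriorPower.ιMulti ℝ k w}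

/-- The space of `Γ`-invariant twisted multivector fields of degree `k`, that is of `Γ`-invariant
families of smooth sections of `Λ^{k-ℓ(γ)} TV^γ ⊗ Λ^{ℓ(γ)} N^γ`, `γ ∈ Γ`. -/
def twistedFields (k : ℕ) : Submodule ℝ ((γ : Γ) → fixed ρ γ → ⋀[ℝ]^k V) where
  carrier := {ξ | (∀ (γ : Γ) (α : Module.Dual ℝ (⋀[ℝ]^k V)), ContDiff ℝ ∞ fun x => α (ξ γ x)) ∧
    (∀ γ x, ξ γ x ∈ twistedPart ρ γ k) ∧
    ∀ g γ x, ξ (g * γ * g⁻¹) (fixedMap ρ g γ x) =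
      exteriorPower.map k ((ρ g).toLinearEquiv : V →ₗ[ℝ] V) (ξ γ x)}
  add_mem' := by
    rintro a b ⟨ha, ha', ha''⟩ ⟨hb, hb', hb''⟩
    refine ⟨fun γ α => ?_, fun γ x => Submodule.add_mem _ (ha' γ x) (hb' γ x), fun g γ x => ?_⟩
    · simpa using (ha γ α).add (hb γ α)
    · simp only [Pi.add_apply, ha'', hb'', map_add]
  zero_mem' := by
    refine ⟨fun γ α => ?_, fun γ x => Submodule.zero_mem _, fun g γ x => ?_⟩
    · simpa using contDiff_const
    · simp
  smul_mem' := by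
    rintro c a ⟨ha, ha', ha''⟩
    refine ⟨fun γ α => ?_, fun γ x => Submodule.smul_mem _ c (ha' γ x), fun g γ x => ?_⟩
    · simpa using (contDiff_const (c := c)).mul (ha γ α)
    · simp only [Pi.smul_apply, ha'', map_smul]

/-- Tangential (orthogonal) projection of `V` onto `V ^ γ`, as an endomorphism of `V`. -/
def tanProj (γ : Γ) : V →ₗ[ℝ] V := (fixed ρ γ).starProjection

/-- Orthogonal projection of `V` onto the normal space, as an endomorphism of `V`. -/
def norProj (γ : Γ) : V →ₗ[ℝ] V := (normal ρ γ).starProjection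

/-- The orthogonal projection `Λ^k V → Λ^{k-ℓ(γ)} V^γ ⊗ Λ^{ℓ(γ)} N^γ`: in `w₁ ∧ ⋯ ∧ w_k` one
decomposes each `w_i` into its tangential and its normal part, expands, and keeps the terms with
exactly `ℓ(γ)` normal factors. -/
def pr (γ : Γ) (k : ℕ) : ⋀[ℝ]^k V →ₗ[ℝ] ⋀[ℝ]^k V :=
  exteriorPower.alternatingMapLinearEquiv
    { toMultilinearMap := ∑ S ∈ Finset.powersetCard (ell ρ γ) (Finset.univ : Finset (Fin k)),
        (exteriorPower.ιMulti ℝ k).toMultilinearMap.compLinearMap fun i =>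
          if i ∈ S then norProj ρ γ else tanProj ρ γ
      map_eq_zero_of_eq' := fun w i j hw hij => by
        classical
        change (∑ S ∈ Finset.powersetCard (ell ρ γ) (Finset.univ : Finset (Fin k)),
          (exteriorPower.ιMulti ℝ k).toMultilinearMap.compLinearMap (fun i =>
            if i ∈ S then norProj ρ γ else tanProj ρ γ)) w = 0
        simp only [sum_apply, MultilinearMap.compLinearMap_apply,
          AlternatingMap.coe_multilinearMap]
        have hsw : ∀ l, w (Equiv.swap i j l) = w l := fun l => by
          rcases eq_or_ne l i with rfl | hi
          · rw [Equiv.swap_apply_left, hw]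
          rcases eq_or_ne l j with rfl | hj
          · rw [Equiv.swap_apply_right, hw]
          · rw [Equiv.swap_apply_of_ne_of_ne hi hj]
        have key : ∀ S : Finset (Fin k),
            (fun l => (if l ∈ S.map (Equiv.swap i j).toEmbedding then norProj ρ γ
              else tanProj ρ γ) (w l)) =
            (fun l => (if l ∈ S then norProj ρ γ else tanProj ρ γ) (w l)) ∘ Equiv.swap i j := by
          intro S
          funext l
          simp only [Function.comp_apply, Finset.mem_map_equiv, Equiv.symm_swap, hsw]
        refine Finset.sum_involution (fun S _ => S.map (Equiv.swap i j).toEmbedding)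
          (fun S _ => ?_) (fun S _ hS heq => hS ?_) (fun S hS => ?_) (fun S _ => ?_)
        · rw [key, AlternatingMap.map_swap _ _ hij, add_neg_cancel]
        · refine AlternatingMap.map_eq_zero_of_eq _ _ ?_ hij
          have h := congrFun (key S) i
          rw [heq] at h
          simpa using h
        · simpa using hS
        · ext l
          simp }

/-! ### The localization map `L` -/

/-- A smooth cut-off function `ℝ → [0, 1]` with support in `(-∞, 3/4]` that is `1` on
`(-∞, 1/2]`. -/
structure CutOff where
  toFun : ℝ → ℝ
  smooth : ContDiff ℝ ∞ toFun
  mem_Icc : ∀ r, toFun r ∈ Set.Icc (0 : ℝ) 1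
  eq_zero : ∀ r, 3 / 4 < r → toFun r = 0
  eq_one : ∀ r, r ≤ 1 / 2 → toFun r = 1

/-- The chain of points `(x₀, y₁, …, y_k, x)`. -/
def chain {k : ℕ} (x₀ x : V) (y : Fin k → V) : Fin (k + 2) → V :=
  Fin.cons x₀ (Fin.snoc (α := fun _ => V) y x)

/-- The cut-off function `Ψ_{k,ε}`, the product of the `ϱ (d² / ε)` over the consecutive points of
the chain `(x₀, y₁, …, y_k, x)`. -/
def cutPsi (ϱ : CutOff) (ε : ℝ) {k : ℕ} (x₀ x : V) (y : Fin k → V) : ℝ :=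
  ∏ j : Fin (k + 1), ϱ.toFun (‖chain x₀ x y j.castSucc - chain x₀ x y j.succ‖ ^ 2 / ε)

theorem contDiff_cutPsi (ϱ : CutOff) (ε : ℝ) {k : ℕ} (x₀ x : V) :
    ContDiff ℝ ∞ (cutPsi (k := k) ϱ ε x₀ x) := by
  have hc : ∀ j : Fin (k + 2), ContDiff ℝ ∞ fun y : Fin k → V => chain x₀ x y j := by
    intro j
    refine Fin.cases ?_ (fun j => ?_) j
    · simpa [chain] using contDiff_const
    · refine Fin.lastCases ?_ (fun j => ?_) j
      · simpa [chain] using contDiff_const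
      · simpa only [chain, Fin.cons_succ, Fin.snoc_castSucc] using contDiff_apply ℝ V j
  exact contDiff_prod fun j _ => ϱ.smooth.comp ((((hc _).sub (hc _)).norm_sq ℝ).div_const ε)

theorem hasCompactSupport_cutPsi (ϱ : CutOff) {ε : ℝ} (hε : 0 < ε) {k : ℕ} (x₀ x : V) :
    HasCompactSupport (cutPsi (k := k) ϱ ε x₀ x) := by
  refine HasCompactSupport.intro
    (isCompact_closedBall (fun _ : Fin k => x₀) ((k + 1) * √ε)) fun y hy => ?_
  by_contra hne
  refine hy ?_
  have hstep : ∀ j : Fin (k + 1), ‖chain x₀ x y j.castSucc - chain x₀ x y j.succ‖ ≤ √ε := by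
    intro j
    have h1 := Finset.prod_ne_zero_iff.1 hne j (Finset.mem_univ _)
    have h2 : ‖chain x₀ x y j.castSucc - chain x₀ x y j.succ‖ ^ 2 / ε ≤ 3 / 4 := by
      by_contra h
      exact h1 (ϱ.eq_zero _ (not_le.1 h))
    rw [div_le_iff₀ hε] at h2
    exact Real.le_sqrt_of_sq_le (by linarith)
  have hdist : ∀ j : Fin (k + 2), ‖chain x₀ x y j - x₀‖ ≤ (j : ℕ) * √ε := by
    intro j
    induction j using Fin.induction with
    | zero => simp [chain]
    | succ j ih =>
      have h1 := hstep j
      rw [norm_sub_rev] at h1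
      calc ‖chain x₀ x y j.succ - x₀‖
          = ‖(chain x₀ x y j.succ - chain x₀ x y j.castSucc) +
              (chain x₀ x y j.castSucc - x₀)‖ := by congr 1; abel
        _ ≤ √ε + (j : ℕ) * √ε := (norm_add_le _ _).trans (add_le_add h1 (by simpa using ih))
        _ = ((j.succ : Fin (k + 2)) : ℕ) * √ε := by rw [Fin.val_succ]; push_cast; ring
  rw [mem_closedBall_iff_norm, pi_norm_le_iff_of_nonneg (by positivity)]
  intro i
  have h := hdist i.castSucc.succ
  have e : chain x₀ x y i.castSucc.succ = y i := by
    simp only [chain, Fin.cons_succ, Fin.snoc_castSucc]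
  rw [e] at h
  refine h.trans (mul_le_mul_of_nonneg_right ?_ (Real.sqrt_nonneg ε))
  have := i.2
  simp only [Fin.val_succ, Fin.val_castSucc]
  push_cast
  have : (i : ℝ) ≤ k := by exact_mod_cast i.2.le
  linarith

/-- The test function `y ↦ Ψ_{k,ε} (x₀, y, x) ∏ (y_j - x) ^ {I_j}` on `V ^ k`, with respect to
orthonormal coordinates on `V`. -/
def cutMonomial (ϱ : CutOff) {ε : ℝ} (hε : 0 < ε) {k : ℕ} (x₀ x : V)
    (I : Fin k → Fin (Module.finrank ℝ V)) : testFun V k :=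
  ⟨fun y => cutPsi ϱ ε x₀ x y * ∏ j, inner ℝ (stdOrthonormalBasis ℝ V (I j)) (y j - x), by
    exact ⟨(contDiff_cutPsi ϱ ε x₀ x).mul (contDiff_prod fun j _ =>
      contDiff_const.inner ℝ ((contDiff_apply ℝ V j).sub contDiff_const)),
      HasCompactSupport.mul_right (hasCompactSupport_cutPsi ϱ hε x₀ x)⟩⟩

/-- The map `L₂`: the value at `x` is the `k`-vector
`F (Ψ_{k,ε} ξ (y₁, x) ∧ ⋯ ∧ ξ (y_k, x))` with `ξ (y, x) = ∑ (y - x) ^ i ∂_i`, where the result is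
evaluated at the arrow with label `γ` and source `x`. -/
def L₂ (ϱ : CutOff) {ε : ℝ} (hε : 0 < ε) {k : ℕ} (F : testFun V k → Γ × V → ℝ) :
    Γ → V → ⋀[ℝ]^k V :=
  fun γ x => ∑ I : Fin k → Fin (Module.finrank ℝ V),
    F (cutMonomial ϱ hε (ρ γ x) x I) (γ, ρ γ x) •
      exteriorPower.ιMulti ℝ k fun j => stdOrthonormalBasis ℝ V (I j)

/-- The map `L₃`: restriction to the fixed spaces, followed by orthogonal projection. -/
def L₃ {k : ℕ} (X : Γ → V → ⋀[ℝ]^k V) : (γ : Γ) → fixed ρ γ → ⋀[ℝ]^k V :=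
  fun γ x => pr ρ γ k (X γ x)

/-- The map `L₁`: restriction, followed by the projection onto the `Γ`-invariant cochains. -/
def L₁ {k : ℕ} (F : crossTest Γ V k → Γ × V → ℝ) : testFun V k → Γ × V → ℝ :=
  avg ρ (restrict F)

/-- The localization map `L = L₃ ∘ L₂ ∘ L₁`. -/
def L (ϱ : CutOff) {ε : ℝ} (hε : 0 < ε) {k : ℕ} (F : crossTest Γ V k → Γ × V → ℝ) :
    (γ : Γ) → fixed ρ γ → ⋀[ℝ]^k V :=
  L₃ ρ (L₂ ρ ϱ hε (L₁ ρ F))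

/-! ### The map `T` -/

/-- Linear coordinates `y_j` on the normal spaces. -/
abbrev NormalCoordinates : Type _ :=
  (γ : Γ) → Module.Basis (Fin (ell ρ γ)) ℝ (normal ρ γ)

variable {ρ} in
/-- The coordinate function `y_j` as a linear form on `V` (vanishing on `V ^ γ`). -/
def coordY (β : NormalCoordinates ρ) (γ : Γ) (j : Fin (ell ρ γ)) : Module.Dual ℝ V :=
  (β γ).coord j ∘ₗ ((normal ρ γ).orthogonalProjectionOnto : V →ₗ[ℝ] normal ρ γ)

variable {ρ} in
/-- The transformed coordinate function `ỹ_j = γ (y_j) = y_j ∘ γ⁻¹`. -/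
def coordY' (β : NormalCoordinates ρ) (γ : Γ) (j : Fin (ell ρ γ)) (v : V) : ℝ :=
  coordY β γ j (ρ γ⁻¹ v)

variable {ρ} in
/-- The point `(x, z^i)`, where `x` is the tangential part of `v` and `z^i` has the coordinates
`ỹ_{σ(1)}, …, ỹ_{σ(i)}` in the places `σ(1), …, σ(i)` and the coordinates `y_m` of `v` elsewhere. -/
def zPoint (β : NormalCoordinates ρ) (γ : Γ) (σ : Equiv.Perm (Fin (ell ρ γ))) (i : ℕ) (v : V) : V :=
  tanProj ρ γ v + ∑ m, (if (σ.symm m : ℕ) < i then coordY' β γ m v else coordY β γ m v) •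
    (β γ m : V)

variable {ρ} in
/-- The normal twisted cocycle `Ω_γ`, as a functional of functions `ψ` on `V ^ ℓ(γ)`.  For
`ψ = f₁ ⊗ ⋯ ⊗ f_ℓ` it is
`1 / ℓ! ∑_σ sgn σ ∏_i (f_i (x, z^{i-1}) - f_i (x, z^i)) / ∏_j (y_j - ỹ_j)`;
the quotient is extended by continuity to the points where the denominator vanishes. -/
def Omega (β : NormalCoordinates ρ) (γ : Γ) (ψ : (Fin (ell ρ γ) → V) → ℝ) : V → ℝ :=
  extendFrom {v | ∀ j, coordY β γ j v ≠ coordY' β γ j v} fun v =>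
    ((ell ρ γ).factorial : ℝ)⁻¹ *
      (∑ σ : Equiv.Perm (Fin (ell ρ γ)), ((Equiv.Perm.sign σ : ℤ) : ℝ) *
        ∑ S : Finset (Fin (ell ρ γ)), (-1 : ℝ) ^ S.card *
          ψ fun i => zPoint β γ σ (if i ∈ S then (i : ℕ) + 1 else i) v) /
      ∏ j, (coordY β γ j v - coordY' β γ j v)

variable {ρ} in
/-- For `ξ = X ⊗ Y` and `φ = f₁ ⊗ ⋯ ⊗ f_k`, with `p = k - ℓ(γ)`, this is
`Y (y₁, …, y_ℓ) X (f₁, …, f_p) (v) f_{p+1} (w₁) ⋯ f_k (w_ℓ)`, where `X` and `Y` are extended to `V`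
constantly in the normal directions, where
`X (f₁, …, f_p) = 1 / p! ∑ ⟨X, dx^{a₁} ∧ ⋯ ∧ dx^{a_p}⟩ ∂_{a₁} f₁ ⋯ ∂_{a_p} f_p` in orthonormal
coordinates on `V ^ γ`, and where `Y (y₁, …, y_ℓ) = ⟨Y, dy₁ ∧ ⋯ ∧ dy_ℓ⟩`. -/
def polyAct (β : NormalCoordinates ρ) (γ : Γ) {k : ℕ} (ξ : fixed ρ γ → ⋀[ℝ]^k V)
    (φ : testFun V k) (v : V) (w : Fin (ell ρ γ) → V) : ℝ :=
  ((k - ell ρ γ).factorial : ℝ)⁻¹ *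
    ∑ a : Fin (k - ell ρ γ) → Fin (Module.finrank ℝ (fixed ρ γ)),
      exteriorPower.pairingDual ℝ V k
        (exteriorPower.ιMulti ℝ k fun i : Fin k =>
          if h : (i : ℕ) < k - ell ρ γ then
            (innerₗ V) (stdOrthonormalBasis ℝ (fixed ρ γ) (a ⟨i, h⟩) : V)
          else coordY β γ ⟨i - (k - ell ρ γ), by omega⟩)
        (ξ ((fixed ρ γ).orthogonalProjectionOnto v)) *
      iteratedFDeriv ℝ (k - ell ρ γ) φ.1
        (fun i : Fin k => if h : (i : ℕ) < k - ell ρ γ then v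
          else w ⟨i - (k - ell ρ γ), by omega⟩)
        (fun i => Pi.single (Fin.castLE (Nat.sub_le _ _) i)
          (stdOrthonormalBasis ℝ (fixed ρ γ) (a i) : V))

variable {ρ} in
/-- The map `∑_γ T₁^γ`, `T₁^γ (X ⊗ Y) = Y (y₁, …, y_ℓ) X ♯ Ω_γ`. -/
def preT₁ (β : NormalCoordinates ρ) {k : ℕ} (ξ : (γ : Γ) → fixed ρ γ → ⋀[ℝ]^k V) :
    testFun V k → Γ × V → ℝ :=
  fun φ q => Omega β q.1 (polyAct β q.1 (ξ q.1) φ q.2) q.2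

variable {ρ} in
/-- The map `T₁`: the sum of the `T₁^γ`, followed by the projection onto the `Γ`-invariant
cochains. -/
def T₁ (β : NormalCoordinates ρ) {k : ℕ} (ξ : (γ : Γ) → fixed ρ γ → ⋀[ℝ]^k V) :
    testFun V k → Γ × V → ℝ :=
  avg ρ (preT₁ β ξ)

variable {ρ} in
/-- The map `T = T₂ ∘ T₁`. -/
def T (β : NormalCoordinates ρ) {k : ℕ} (ξ : (γ : Γ) → fixed ρ γ → ⋀[ℝ]^k V) :
    crossTest Γ V k → Γ × V → ℝ :=
  T₂ ρ (T₁ β ξ)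

end Multivectors

end OrbHoch

end

open OrbHoch

set_option linter.unusedSectionVars false

noncomputable section

namespace OrbHoch

/-! ### Smooth dependence on parameters -/

section Calculus

variable {X : Type*} [NormedAddCommGroup X] [NormedSpace ℝ X]
  {B : Type*} [NormedAddCommGroup B] [NormedSpace ℝ B]

/-! Three facts are computations. `T` lands in cocycles: after multiplication by the denominator of
`Omega`, the cochain is a sum of products of derivatives at `v` and of differences along a chain `v
= z⁰, …, z^ℓ = γ⁻¹ v`; the product rule splits every inner face into two terms, and these telescope
against the outer faces (`slotSum_tMerge`, `slotSum_bA`). `L` kills coboundaries: at a fixed point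
the outer faces of the cut-off monomial contain a linear factor evaluated at its zero, and the inner
faces are symmetric in two neighbouring indices, hence cancel against the wedge product
(`L₂_bA_fixed`). Finally `L T = id`: near a fixed point the cut-off is `1`, so the argument is a
product of linear functions; the tangential factors are differentiated, the difference quotients of
the normal factors are exact, and the sum over the multi-indices reassembles `ξ`
(`omega_polyAct_cutMonomial`, `sum_pairing_smul`).

What remains is that a cocycle `F` with `L F = 0` is a coboundary. The last face `faceL F` is a
functional with one more argument which is annihilated by the coordinates of the source of the last
arrow relative to the source of the evaluation arrow; it carries the same information as `F`. On
functionals with values in the exterior algebra there are two commuting differentials: `bar`,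
consisting of all faces but the last, and the Koszul differential `kos`, the wedge product with
these coordinates. The first is contracted by the insertion of an additional last arrow
(`bar_pull_ins`), the second is exact in positive exterior degree, because test functions can be
divided by coordinates (`exists_koszul`).

A zigzag with `k` contractions leads from `faceL F` down to functionals of a single arrow. There the
`bar`-closed functionals are multiplications by functions of `(γ, t)`, and `kos` becomes the wedge
product with the displacement `t - γ⁻¹ t` (`eq_augF`, `kos_augF`). The cut-offs and coordinates
collected on the way are those of `cutMonomial`, so the zigzag, summed over the inserted labels,
ends in the localization `L₂ (L₁ F)` before projection (`sum_kIter_faceL`). It is annihilated by the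
displacement, and it can be divided by the displacement because its projection vanishes on the fixed
spaces, which is `L F = 0` (`exists_eq_wed_displ`). Climbing back up (`exists_isBdry`) gives `faceL
F = bar z` with `z` annihilated by the coordinates, and filling the last argument with cut-off
functions turns this into `F = b (…)` (`sum_appPull_bar`, `mem_coboundaries_of_L_eq_zero`).

The analytic input is that a bounded map takes bounded families of test functions to smooth
functions with values in bounded families of reals, and therefore takes families depending smoothly
on a parameter to such families (`PFam.usmooth`). All divisions rest on Hadamard's lemma for
functions with values in a Banach space. -/

theorem hasFDerivAt_of_sq_bound {f : X → B} {L : X →L[ℝ] B} {x : X} {C : ℝ}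
    (h : ∀ y, ‖y‖ ≤ 1 → ‖f (x + y) - f x - L y‖ ≤ C * ‖y‖ ^ 2) : HasFDerivAt f L x := by
  rw [hasFDerivAt_iff_isLittleO_nhds_zero]
  have h1 : (fun y => f (x + y) - f x - L y) =O[nhds 0] fun y : X => ‖y‖ ^ 2 := by
    refine Asymptotics.IsBigO.of_bound C ?_
    filter_upwards [Metric.closedBall_mem_nhds (0 : X) one_pos] with y hy
    simpa using h y (by simpa using hy)
  refine h1.trans_isLittleO ?_
  simpa using Asymptotics.isLittleO_norm_pow_id (E' := X) one_lt_two

variable [FiniteDimensional ℝ X]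

/-- A directional derivative of the integral is the integral of a directional derivative, which is
an integral of the same kind. The induction on the order therefore has to vary `f`. Finite dimension
provides compact balls for the domination and reduces the Fréchet derivative to directional ones. -/
theorem contDiff_param_integral {f : X × ℝ → B} (hf : ContDiff ℝ ∞ f) :
    ContDiff ℝ ∞ fun x => ∫ θ in (0 : ℝ)..1, f (x, θ) := by
  rw [contDiff_infty]
  intro n
  induction n generalizing f with
  | zero =>
    refine contDiff_zero.2 ?_
    exact intervalIntegral.continuous_parametric_intervalIntegral_of_continuous'
      (f := fun x θ => f (x, θ)) (by simpa [Function.uncurry_def] using hf.continuous) 0 1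
  | succ n ih =>
    set f' : X → ℝ → X →L[ℝ] B := fun x θ =>
      (fderiv ℝ f (x, θ)).comp (ContinuousLinearMap.inl ℝ X ℝ) with hf'
    have hfd : ContDiff ℝ ∞ (fderiv ℝ f) := hf.fderiv_right (by simp)
    have hc' : Continuous fun p : X × ℝ => f' p.1 p.2 := by
      have := hfd.continuous
      simp only [hf']
      exact this.clm_comp_const _
    have hd : ∀ x, HasFDerivAt (fun x => ∫ θ in (0 : ℝ)..1, f (x, θ))
        (∫ θ in (0 : ℝ)..1, f' x θ) x := by
      intro x
      obtain ⟨C, hC⟩ := ((isCompact_closedBall x 1).prod (isCompact_Icc (a := (0 : ℝ))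
        (b := 1))).exists_bound_of_continuousOn hc'.continuousOn
      refine (intervalIntegral.hasFDerivAt_integral_of_dominated_of_fderiv_le
        (F := fun x θ => f (x, θ)) (F' := f') (bound := fun _ => C)
        (Metric.closedBall_mem_nhds x one_pos) ?_ ?_ ?_ ?_ ?_ ?_)
      · exact Filter.Eventually.of_forall fun y => Continuous.aestronglyMeasurable
          (by have := hf.continuous; fun_prop)
      · exact Continuous.intervalIntegrable (by have := hf.continuous; fun_prop) _ _
      · exact Continuous.aestronglyMeasurable (hc'.comp (by fun_prop : Continuous fun θ : ℝ => (x, θ)))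
      · refine Filter.Eventually.of_forall fun θ hθ y hy => hC (y, θ) ⟨hy, ?_⟩
        rw [Set.uIoc_of_le zero_le_one] at hθ
        exact ⟨hθ.1.le, hθ.2⟩
      · exact intervalIntegrable_const
      · refine Filter.Eventually.of_forall fun θ _ y _ => ?_
        exact ((hf.differentiable (by simp)) (y, θ)).hasFDerivAt.comp y
          (hasFDerivAt_prodMk_left y θ)
    have hn : ((n + 1 : ℕ) : WithTop ℕ∞) = (n : WithTop ℕ∞) + 1 := by norm_cast
    rw [hn]
    refine contDiff_succ_iff_fderiv_apply.2
      ⟨fun x => (hd x).differentiableAt, fun h => absurd h (by exact_mod_cast WithTop.coe_ne_top), fun y => ?_⟩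
    have e : (fun x => fderiv ℝ (fun x => ∫ θ in (0 : ℝ)..1, f (x, θ)) x y) =
        fun x => ∫ θ in (0 : ℝ)..1, (fun p : X × ℝ => fderiv ℝ f p (y, 0)) (x, θ) := by
      funext x
      rw [(hd x).fderiv]
      rw [ContinuousLinearMap.intervalIntegral_apply]
      · simp [hf']
      · exact Continuous.intervalIntegrable
          (hc'.comp (by fun_prop : Continuous fun θ : ℝ => (x, θ))) _ _
    rw [e]
    exact ih (hfd.clm_apply contDiff_const)

/-- Hadamard's lemma with parameters. -/
theorem exists_hadamard [CompleteSpace B] {f : X × ℝ → B} (hf : ContDiff ℝ ∞ f) :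
    ∃ g : X × ℝ → B, ContDiff ℝ ∞ g ∧ (∀ x r, f (x, r) - f (x, 0) = r • g (x, r)) ∧
      ∀ x, g (x, 0) = fderiv ℝ f (x, 0) (0, 1) := by
  have hfd : ContDiff ℝ ∞ (fderiv ℝ f) := hf.fderiv_right (by simp)
  refine ⟨fun p => ∫ θ in (0 : ℝ)..1, fderiv ℝ f (p.1, θ * p.2) (0, 1), ?_, fun x r => ?_,
    fun x => ?_⟩
  · refine contDiff_param_integral (X := X × ℝ)
      (f := fun q : (X × ℝ) × ℝ => fderiv ℝ f (q.1.1, q.2 * q.1.2) (0, 1)) ?_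
    exact (hfd.comp (by fun_prop)).clm_apply contDiff_const
  · have hd : ∀ θ : ℝ, HasDerivAt (fun θ : ℝ => f (x, θ * r))
        (r • fderiv ℝ f (x, θ * r) (0, 1)) θ := by
      intro θ
      have h1 : HasDerivAt (fun θ : ℝ => ((x, θ * r) : X × ℝ)) (0, r) θ := by
        refine (hasDerivAt_const θ x).prodMk ?_
        simpa using (hasDerivAt_id θ).mul_const r
      have h2 := ((hf.differentiable (by simp)) (x, θ * r)).hasFDerivAt.comp_hasDerivAt θ h1
      have e : ((0, r) : X × ℝ) = r • (0, 1) := by simp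
      rw [e, map_smul] at h2
      exact h2
    have h3 := intervalIntegral.integral_eq_sub_of_hasDerivAt (a := 0) (b := 1)
      (fun θ _ => hd θ) (Continuous.intervalIntegrable (by
        have := hfd.continuous
        exact continuous_const.smul ((this.comp (by fun_prop)).clm_apply continuous_const)) _ _)
    rw [intervalIntegral.integral_smul] at h3
    simpa using h3.symm
  · simp

end Calculus

/-! ### Uniformly smooth families -/

section Families

/-- Bounded families of real numbers. -/
abbrev Linf (ι : Type*) : Type _ := lp (fun _ : ι => ℝ) ⊤

/-- Bounded families from a bound. -/
def Linf.mk {ι : Type*} (f : ι → ℝ) (h : ∃ C, ∀ i, |f i| ≤ C) : Linf ι :=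
  ⟨f, memℓp_infty (by obtain ⟨C, hC⟩ := h; exact ⟨C, by rintro _ ⟨i, rfl⟩; exact hC i⟩)⟩

/-- Evaluation of a bounded family. -/
def Linf.ev {ι : Type*} (i : ι) : Linf ι →L[ℝ] ℝ :=
  LinearMap.mkContinuous
    { toFun := fun f => f i
      map_add' := fun _ _ => rfl
      map_smul' := fun _ _ => rfl } 1 fun f => by
    rw [one_mul]
    exact lp.norm_apply_le_norm (p := ⊤) (by simp) f i

@[simp] theorem Linf.ev_mk {ι : Type*} (i : ι) (f : ι → ℝ) (h : ∃ C, ∀ i, |f i| ≤ C) :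
    Linf.ev i (Linf.mk f h) = f i := rfl

theorem Linf.ext {ι : Type*} {f g : Linf ι} (h : ∀ i, Linf.ev i f = Linf.ev i g) : f = g :=
  lp.ext (funext h)

theorem Linf.norm_le {ι : Type*} {f : Linf ι} {C : ℝ} (hC : 0 ≤ C)
    (h : ∀ i, |Linf.ev i f| ≤ C) : ‖f‖ ≤ C :=
  lp.norm_le_of_forall_le hC h

variable {ι : Type*} {X Y : Type*} [NormedAddCommGroup X] [NormedSpace ℝ X]
  [NormedAddCommGroup Y] [NormedSpace ℝ Y]

/-- A family of functions is uniformly smooth if it is a smooth function with values in the bounded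
families. -/
def USmooth (f : ι → X → ℝ) : Prop :=
  ∃ Φ : X → Linf ι, ContDiff ℝ ∞ Φ ∧ ∀ i x, Linf.ev i (Φ x) = f i x

theorem USmooth.contDiff {f : ι → X → ℝ} (h : USmooth f) (i : ι) : ContDiff ℝ ∞ (f i) := by
  obtain ⟨Φ, hΦ, e⟩ := h
  have : f i = fun x => Linf.ev i (Φ x) := by funext x; simp [e]
  rw [this]
  exact (Linf.ev i).contDiff.comp hΦ

theorem USmooth.comp {f : ι → X → ℝ} (h : USmooth f) {u : Y → X} (hu : ContDiff ℝ ∞ u) :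
    USmooth fun i y => f i (u y) := by
  obtain ⟨Φ, hΦ, e⟩ := h
  exact ⟨fun y => Φ (u y), hΦ.comp hu, fun i y => e i (u y)⟩

theorem USmooth.add {f g : ι → X → ℝ} (hf : USmooth f) (hg : USmooth g) :
    USmooth fun i x => f i x + g i x := by
  obtain ⟨Φ, hΦ, e⟩ := hf
  obtain ⟨Ψ, hΨ, e'⟩ := hg
  exact ⟨fun x => Φ x + Ψ x, hΦ.add hΨ, fun i x => by simp [e, e']⟩

theorem USmooth.smul {f : ι → X → ℝ} (hf : USmooth f) {c : X → ℝ} (hc : ContDiff ℝ ∞ c) :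
    USmooth fun i x => c x * f i x := by
  obtain ⟨Φ, hΦ, e⟩ := hf
  exact ⟨fun x => c x • Φ x, hc.smul hΦ, fun i x => by simp [e]⟩

theorem USmooth.const_mul {f : ι → X → ℝ} (hf : USmooth f) (c : ℝ) :
    USmooth fun i x => c * f i x := hf.smul contDiff_const

theorem USmooth.zero : USmooth fun (_ : ι) (_ : X) => (0 : ℝ) :=
  ⟨fun _ => 0, contDiff_const, fun _ _ => rfl⟩

theorem USmooth.sum {κ : Type*} (s : Finset κ) {f : κ → ι → X → ℝ} (h : ∀ k ∈ s, USmooth (f k)) :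
    USmooth fun i x => ∑ k ∈ s, f k i x := by
  classical
  induction s using Finset.induction_on with
  | empty => simpa using USmooth.zero
  | insert a s ha ih =>
    simp only [Finset.sum_insert ha]
    exact (h a (by simp)).add (ih fun k hk => h k (by simp [hk]))

theorem USmooth.fderiv {f : ι → X → ℝ} (hf : USmooth f) (v : X) :
    USmooth fun i x => fderiv ℝ (f i) x v := by
  obtain ⟨Φ, hΦ, e⟩ := hf
  refine ⟨fun x => _root_.fderiv ℝ Φ x v, (hΦ.fderiv_right (by simp)).clm_apply contDiff_const,
    fun i x => ?_⟩
  have h1 : f i = fun x => Linf.ev i (Φ x) := by funext x; simp [e]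
  have h2 : HasFDerivAt (f i) ((Linf.ev i).comp (_root_.fderiv ℝ Φ x)) x := by
    rw [h1]
    exact (Linf.ev i).hasFDerivAt.comp x (hΦ.differentiable (by simp) x).hasFDerivAt
  change _ = _root_.fderiv ℝ (f i) x v
  rw [h2.fderiv]
  rfl

theorem USmooth.of_single [Subsingleton ι] {f : ι → X → ℝ} (h : ∀ i, ContDiff ℝ ∞ (f i)) :
    USmooth f := by
  rcases isEmpty_or_nonempty ι with hι | ⟨⟨i₀⟩⟩
  · exact ⟨fun _ => 0, contDiff_const, fun i => (hι.false i).elim⟩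
  · refine ⟨fun x => f i₀ x • Linf.mk (fun _ => 1) ⟨1, fun _ => by simp⟩,
      (h i₀).smul contDiff_const, fun i x => ?_⟩
    rw [Subsingleton.elim i i₀]
    simp

theorem norm_iteratedFDeriv_eq_of_eval {Φ : X → Linf ι} (hΦ : ContDiff ℝ ∞ Φ) (i : ι) (n : ℕ)
    (x : X) : ‖iteratedFDeriv ℝ n (fun x => Linf.ev i (Φ x)) x‖ ≤
      ‖iteratedFDeriv ℝ n Φ x‖ := by
  have h1 : (fun x => Linf.ev i (Φ x)) = (Linf.ev i) ∘ Φ := rfl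
  rw [h1]
  have h2 : ‖Linf.ev i‖ ≤ 1 := LinearMap.mkContinuous_norm_le _ zero_le_one _
  refine ((Linf.ev i).norm_iteratedFDeriv_comp_left hΦ.contDiffAt
    (by exact_mod_cast le_top)).trans ?_
  exact mul_le_of_le_one_left (norm_nonneg _) h2

theorem USmooth.bounds {f : ι → X → ℝ} (hf : USmooth f) {K : Set X} (hK : IsCompact K) (n : ℕ) :
    ∃ C : ℝ, ∀ i, ∀ x ∈ K, ‖iteratedFDeriv ℝ n (f i) x‖ ≤ C := by
  obtain ⟨Φ, hΦ, e⟩ := hf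
  have hc : Continuous (iteratedFDeriv ℝ n Φ) := hΦ.continuous_iteratedFDeriv (by exact_mod_cast le_top)
  obtain ⟨C, hC⟩ := hK.exists_bound_of_continuousOn hc.continuousOn
  refine ⟨C, fun i x hx => ?_⟩
  have h1 : f i = fun x => Linf.ev i (Φ x) := by funext x; simp [e]
  rw [h1]
  exact (norm_iteratedFDeriv_eq_of_eval hΦ i n x).trans (hC x hx)

theorem norm_fderiv_sub_le {f : X → ℝ} (hf : ContDiff ℝ ∞ f) {x : X} {C : ℝ}
    (hC : ∀ z ∈ Metric.closedBall x 1, ‖iteratedFDeriv ℝ 2 f z‖ ≤ C) {z : X}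
    (hz : z ∈ Metric.closedBall x 1) : ‖fderiv ℝ f z - fderiv ℝ f x‖ ≤ C * ‖z - x‖ := by
  have hfd : ContDiff ℝ ∞ (fderiv ℝ f) := hf.fderiv_right (by simp)
  have h2 : ∀ z ∈ Metric.closedBall x 1, ‖fderiv ℝ (fderiv ℝ f) z‖ ≤ C := by
    intro z hz
    have h := hC z hz
    rwa [← norm_iteratedFDeriv_fderiv, ← norm_iteratedFDeriv_fderiv, norm_iteratedFDeriv_zero] at h
  exact (convex_closedBall x 1).norm_image_sub_le_of_norm_fderiv_le (𝕜 := ℝ)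
      (fun w _ => hfd.differentiable (by simp) w) h2 (Metric.mem_closedBall_self zero_le_one) hz

theorem norm_taylor_le {f : X → ℝ} (hf : ContDiff ℝ ∞ f) {x : X} {C : ℝ}
    (hC : ∀ z ∈ Metric.closedBall x 1, ‖iteratedFDeriv ℝ 2 f z‖ ≤ C) {y : X} (hy : ‖y‖ ≤ 1) :
    ‖f (x + y) - f x - fderiv ℝ f x y‖ ≤ C * ‖y‖ ^ 2 := by
  have hC0 : 0 ≤ C := (norm_nonneg _).trans (hC x (Metric.mem_closedBall_self zero_le_one))
  have h1 : ∀ z ∈ Metric.closedBall x ‖y‖, ‖fderiv ℝ f z - fderiv ℝ f x‖ ≤ C * ‖y‖ := by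
    intro z hz
    refine (norm_fderiv_sub_le hf hC (Metric.closedBall_subset_closedBall hy hz)).trans ?_
    exact mul_le_mul_of_nonneg_left (by simpa using mem_closedBall_iff_norm.1 hz) hC0
  have h3 := (convex_closedBall x ‖y‖).norm_image_sub_le_of_norm_fderiv_le' (𝕜 := ℝ)
    (f := f) (fun w _ => hf.differentiable (by simp) w) h1
    (Metric.mem_closedBall_self (norm_nonneg _)) (y := x + y) (by simp)
  simpa [pow_two, mul_assoc] using h3

variable [FiniteDimensional ℝ X]

/-- The converse of `USmooth.bounds`. A uniform bound on second derivatives bounds the Taylor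
remainder uniformly in the index, so the family of derivatives is the derivative in the sup norm.
The directional derivatives satisfy bounds of the same type, and the argument repeats. -/
theorem USmooth.of_bounds {f : ι → X → ℝ} (hf : ∀ i, ContDiff ℝ ∞ (f i))
    (hb : ∀ K : Set X, IsCompact K → ∀ n : ℕ, ∃ C : ℝ, ∀ i, ∀ x ∈ K,
      ‖iteratedFDeriv ℝ n (f i) x‖ ≤ C) : USmooth f := by
  have hval : ∀ (f : ι → X → ℝ), (∀ K : Set X, IsCompact K → ∀ n : ℕ, ∃ C : ℝ, ∀ i, ∀ x ∈ K,
      ‖iteratedFDeriv ℝ n (f i) x‖ ≤ C) → ∀ x, ∃ C, ∀ i, |f i x| ≤ C := by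
    intro f hb x
    obtain ⟨C, hC⟩ := hb {x} isCompact_singleton 0
    exact ⟨C, fun i => by simpa using hC i x rfl⟩
  have hder : ∀ f : ι → X → ℝ, (∀ i, ContDiff ℝ ∞ (f i)) →
      (∀ K : Set X, IsCompact K → ∀ n : ℕ, ∃ C : ℝ, ∀ i, ∀ x ∈ K,
        ‖iteratedFDeriv ℝ n (f i) x‖ ≤ C) → ∀ v, ∀ K : Set X, IsCompact K → ∀ n : ℕ, ∃ C : ℝ,
        ∀ i, ∀ x ∈ K, ‖iteratedFDeriv ℝ n (fun x => _root_.fderiv ℝ (f i) x v) x‖ ≤ C := by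
    intro f hf hb v K hK n
    obtain ⟨C, hC⟩ := hb K hK (n + 1)
    refine ⟨‖v‖ * C, fun i x hx => ?_⟩
    have hfd : ContDiff ℝ ∞ (_root_.fderiv ℝ (f i)) := (hf i).fderiv_right (by simp)
    refine (norm_iteratedFDeriv_clm_apply_const hfd.contDiffAt (by exact_mod_cast le_top)).trans ?_
    rw [norm_iteratedFDeriv_fderiv]
    exact mul_le_mul_of_nonneg_left (hC i x hx) (norm_nonneg _)
  refine ⟨fun x => Linf.mk (fun i => f i x) (hval f hb x), ?_, fun i x => rfl⟩
  -- The lift `Φ` becomes arbitrary, so that the induction hypothesis applies to the derivative of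
  -- `Φ` as the lift of the family of derivatives.
  suffices H : ∀ (Φ : X → Linf ι), (∀ i x, Linf.ev i (Φ x) = f i x) → ContDiff ℝ ∞ Φ from
    H _ fun _ _ => rfl
  simp_rw [contDiff_infty]
  intro Φ hΦ n
  have hfd : ∀ f : ι → X → ℝ, (∀ i, ContDiff ℝ ∞ (f i)) →
      (∀ K : Set X, IsCompact K → ∀ n : ℕ, ∃ C : ℝ, ∀ i, ∀ x ∈ K,
        ‖iteratedFDeriv ℝ n (f i) x‖ ≤ C) → ∀ (Φ : X → Linf ι),
        (∀ i x, Linf.ev i (Φ x) = f i x) → ∀ x, ∃ L : X →L[ℝ] Linf ι, HasFDerivAt Φ L x ∧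
          ∀ i v, Linf.ev i (L v) = _root_.fderiv ℝ (f i) x v := by
    intro f hf hb Φ hΦ x
    let L : X →ₗ[ℝ] Linf ι :=
      { toFun := fun v => Linf.mk (fun i => _root_.fderiv ℝ (f i) x v)
          (hval _ (hder f hf hb v) x)
        map_add' := fun v w => Linf.ext fun i => by simp
        map_smul' := fun c v => Linf.ext fun i => by simp }
    refine ⟨LinearMap.toContinuousLinearMap L, ?_, fun i v => rfl⟩
    obtain ⟨C, hC⟩ := hb _ (isCompact_closedBall x 1) 2
    refine hasFDerivAt_of_sq_bound (C := |C|) fun y hy => Linf.norm_le (by positivity) fun i => ?_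
    have h1 := norm_taylor_le (hf i) (hC i) hy
    simp only [map_sub, hΦ]
    refine le_trans h1 (mul_le_mul_of_nonneg_right (le_abs_self C) (by positivity))
  induction n generalizing f Φ with
  | zero =>
    refine contDiff_zero.2 (continuous_iff_continuousAt.2 fun x => ?_)
    obtain ⟨L, hL, -⟩ := hfd f hf hb Φ hΦ x
    exact hL.continuousAt
  | succ n ih =>
    have hn : ((n + 1 : ℕ) : WithTop ℕ∞) = (n : WithTop ℕ∞) + 1 := by norm_cast
    rw [hn]
    choose L hL hL' using hfd f hf hb Φ hΦ
    refine contDiff_succ_iff_fderiv_apply.2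
      ⟨fun x => (hL x).differentiableAt, fun h => absurd h (by exact_mod_cast WithTop.coe_ne_top),
        fun v => ?_⟩
    refine ih (f := fun i x => _root_.fderiv ℝ (f i) x v) (fun i => ?_) (hder f hf hb v) _
      fun i x => ?_
    · exact ((hf i).fderiv_right (by simp)).clm_apply contDiff_const
    · rw [(hL x).fderiv, hL']

theorem USmooth.reindex {κ : Type*} {f : ι → X → ℝ} (hf : USmooth f) (e : κ → ι) :
    USmooth fun k x => f (e k) x :=
  USmooth.of_bounds (fun k => hf.contDiff _) fun K hK n => by
    obtain ⟨C, hC⟩ := hf.bounds hK n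
    exact ⟨C, fun k => hC (e k)⟩

/-- Hadamard's lemma for uniformly smooth families. -/
theorem USmooth.exists_hadamard {f : ι → X × ℝ → ℝ} (hf : USmooth f) :
    ∃ g : ι → X × ℝ → ℝ, USmooth g ∧ (∀ i x r, f i (x, r) - f i (x, 0) = r * g i (x, r)) ∧
      ∀ i x, g i (x, 0) = _root_.fderiv ℝ (f i) (x, 0) (0, 1) := by
  obtain ⟨Φ, hΦ, e⟩ := hf
  obtain ⟨G, hG, h1, h2⟩ := OrbHoch.exists_hadamard hΦ
  refine ⟨fun i p => Linf.ev i (G p), ⟨G, hG, fun _ _ => rfl⟩, fun i x r => ?_, fun i x => ?_⟩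
  · have := congrArg (Linf.ev i) (h1 x r)
    simpa [e] using this
  · have h3 : f i = fun x => Linf.ev i (Φ x) := by funext x; simp [e]
    have h4 : HasFDerivAt (f i) ((Linf.ev i).comp (_root_.fderiv ℝ Φ (x, 0))) (x, 0) := by
      rw [h3]
      exact (Linf.ev i).hasFDerivAt.comp _ (hΦ.differentiable (by simp) _).hasFDerivAt
    rw [h4.fderiv]
    change Linf.ev i (G (x, 0)) = _
    rw [h2]
    rfl

end Families

/-! ### Bounded families of test functions -/

section TestFamilies

variable {Γ V : Type*} [NormedAddCommGroup V] [NormedSpace ℝ V] {ι X : Type*}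
  [NormedAddCommGroup X] [NormedSpace ℝ X] {k : ℕ}

/-- The component of a test function on `(Γ × V) ^ k` with labels `c`. -/
def comp (φ : crossTest Γ V k) (c : Fin k → Γ) (x : Fin k → V) : ℝ := φ.1 fun i => (c i, x i)

theorem comp_eq_zero_of_notMem_tsupport {φ : crossTest Γ V k} {K : Set (Fin k → V)}
    {c : Fin k → Γ} (h : tsupport (comp φ c) ⊆ K) {x : Fin k → V} (hx : x ∉ K) :
    comp φ c x = 0 :=
  image_eq_zero_of_notMem_tsupport fun hx' => hx (h hx')

/-- Bounded families of test functions on `(Γ × V) ^ k`. -/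
def BFam (φ : ι → crossTest Γ V k) : Prop :=
  (∃ K : Set (Fin k → V), IsCompact K ∧ ∀ i c, ∀ x ∉ K, comp (φ i) c x = 0) ∧
    ∀ c, USmooth fun i x => comp (φ i) c x

/-- Families of test functions that depend smoothly on a parameter, with locally uniform
supports. -/
def PFam (Φ : ι → X → crossTest Γ V k) : Prop :=
  (∀ A : Set X, IsCompact A → ∃ K : Set (Fin k → V), IsCompact K ∧
    ∀ i c, ∀ s ∈ A, ∀ x ∉ K, comp (Φ i s) c x = 0) ∧
    ∀ c, USmooth fun i (p : X × (Fin k → V)) => comp (Φ i p.1) c p.2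

theorem PFam.comp_right {Y : Type*} [NormedAddCommGroup Y] [NormedSpace ℝ Y]
    {Φ : ι → X → crossTest Γ V k} (h : PFam Φ) {u : Y → X} (hu : ContDiff ℝ ∞ u) :
    PFam fun i y => Φ i (u y) :=
  ⟨fun A hA => by
    obtain ⟨K, hK, h'⟩ := h.1 (u '' A) (hA.image hu.continuous)
    exact ⟨K, hK, fun i c s hs x hx => h' i c _ ⟨s, hs, rfl⟩ x hx⟩,
  fun c => (h.2 c).comp (u := fun p : Y × (Fin k → V) => (u p.1, p.2))
    ((hu.comp contDiff_fst).prodMk contDiff_snd)⟩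

variable [FiniteDimensional ℝ V]

/-- This translates the bornology on test functions into uniform smoothness. `USmooth` only controls
derivatives on compact sets; that is enough, since outside the common support all derivatives
vanish. -/
theorem isBoundedTest_range_iff {φ : ι → crossTest Γ V k} [Finite Γ] :
    IsBoundedTest (Set.range φ) ↔ BFam φ := by
  constructor
  · rintro ⟨⟨K, hK, hs⟩, hd⟩
    refine ⟨⟨K, hK, fun i c x hx => comp_eq_zero_of_notMem_tsupport (hs _ ⟨i, rfl⟩ c) hx⟩,
      fun c => USmooth.of_bounds (fun i => ((φ i).2 c).1) fun A _ n => ?_⟩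
    obtain ⟨C, hC⟩ := hd n
    exact ⟨C, fun i x _ => hC _ ⟨i, rfl⟩ c x⟩
  · rintro ⟨⟨K, hK, hs⟩, hd⟩
    have hsupp : ∀ i c, tsupport (comp (φ i) c) ⊆ K := fun i c =>
      closure_minimal (fun x hx => by_contra fun h => hx (hs i c x h)) hK.isClosed
    refine ⟨⟨K, hK, ?_⟩, fun n => ?_⟩
    · rintro _ ⟨i, rfl⟩ c
      exact hsupp i c
    · choose C hC using fun c => (hd c).bounds hK n
      cases nonempty_fintype Γ
      refine ⟨∑ c, |C c|, ?_⟩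
      rintro _ ⟨i, rfl⟩ c x
      have hle : |C c| ≤ ∑ c, |C c| :=
        Finset.single_le_sum (f := fun c => |C c|) (fun _ _ => abs_nonneg _) (Finset.mem_univ c)
      by_cases hx : x ∈ K
      · exact (hC c i x hx).trans ((le_abs_self _).trans hle)
      · have h0 : iteratedFDeriv ℝ n (comp (φ i) c) x = 0 :=
          image_eq_zero_of_notMem_tsupport fun h =>
            hx (hsupp i c (tsupport_iteratedFDeriv_subset n h))
        change ‖iteratedFDeriv ℝ n (comp (φ i) c) x‖ ≤ _
        rw [h0, norm_zero]
        exact Finset.sum_nonneg fun _ _ => abs_nonneg _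

/-- With the parameter in a compact set, index and parameter together index a bounded family: a
derivative in `x` alone is a derivative in `(s, x)` composed with the inclusion of the second
factor, which has norm at most `1`. -/
theorem PFam.bFam [FiniteDimensional ℝ X] {Φ : ι → X → crossTest Γ V k} (h : PFam Φ) {A : Set X} (hA : IsCompact A) :
    BFam fun p : ι × A => Φ p.1 p.2 := by
  obtain ⟨K, hK, hs⟩ := h.1 A hA
  refine ⟨⟨K, hK, fun p c x hx => hs p.1 c p.2 p.2.2 x hx⟩, fun c => ?_⟩
  refine USmooth.of_bounds (fun p => ((Φ p.1 p.2).2 c).1) fun B hB n => ?_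
  obtain ⟨C, hC⟩ := (h.2 c).bounds (hA.prod hB) n
  refine ⟨C, ?_⟩
  rintro ⟨i, s⟩ x hx
  refine le_trans ?_ (hC i (s, x) ⟨s.2, hx⟩)
  have e : (fun x => comp (Φ i s) c x) = fun x => (fun y : X × (Fin k → V) =>
      comp (Φ i ((s : X) + y.1)) c y.2) (ContinuousLinearMap.inr ℝ X (Fin k → V) x) := by
    funext x; simp
  have e2 : ∀ y, comp (Φ i ((s : X) + y.1)) c y.2 =
      (fun p : X × (Fin k → V) => comp (Φ i p.1) c p.2) (((s : X), 0) + y) := by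
    intro y; simp
  simp only [e]
  have hcd : ContDiff ℝ ∞ fun y : X × (Fin k → V) => comp (Φ i ((s : X) + y.1)) c y.2 := by
    simp_rw [e2]
    exact ((h.2 c).contDiff i).comp (contDiff_const.add contDiff_id)
  have h3 := (ContinuousLinearMap.inr ℝ X (Fin k → V)).iteratedFDeriv_comp_right hcd x
    (i := n) (by exact_mod_cast le_top)
  change ‖iteratedFDeriv ℝ n ((fun y : X × (Fin k → V) =>
      comp (Φ i ((s : X) + y.1)) c y.2) ∘ (ContinuousLinearMap.inr ℝ X (Fin k → V))) x‖ ≤ _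
  rw [h3]
  refine (ContinuousMultilinearMap.norm_compContinuousLinearMap_le _ _).trans ?_
  simp_rw [e2]
  have h5 := iteratedFDeriv_comp_add_left (𝕜 := ℝ) (f := fun p : X × (Fin k → V) =>
    comp (Φ i p.1) c p.2) n ((s : X), (0 : Fin k → V))
  simp only [h5]
  refine (mul_le_of_le_one_right (norm_nonneg _) (Finset.prod_le_one (fun _ _ => norm_nonneg _)
    fun _ _ => ContinuousLinearMap.norm_inr_le_one ℝ X _)).trans ?_
  simp

end TestFamilies
/-! ### Cochains and smooth families -/

section ParamCalc

universe u v

variable {Γ : Type u} {V : Type v} [NormedAddCommGroup V] {ι : Type*}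

section
variable [NormedSpace ℝ V] {k : ℕ}

theorem crossTest_ext {φ ψ : crossTest Γ V k} (h : ∀ c x, comp φ c x = comp ψ c x) : φ = ψ :=
  Subtype.ext (funext fun p => h (fun i => (p i).1) fun i => (p i).2)

@[simp] theorem comp_add (φ ψ : crossTest Γ V k) (c : Fin k → Γ) (x : Fin k → V) :
    comp (φ + ψ) c x = comp φ c x + comp ψ c x := rfl

@[simp] theorem comp_smul (r : ℝ) (φ : crossTest Γ V k) (c : Fin k → Γ) (x : Fin k → V) :
    comp (r • φ) c x = r * comp φ c x := rfl

/-- The test function with given components. -/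
def ofComp (f : (Fin k → Γ) → (Fin k → V) → ℝ) (hf : ∀ c, f c ∈ testFun V k) : crossTest Γ V k :=
  ⟨fun p => f (fun i => (p i).1) fun i => (p i).2, hf⟩

theorem mem_testFun_of_support {f : (Fin k → V) → ℝ} (hf : ContDiff ℝ ∞ f) {K : Set (Fin k → V)}
    (hK : IsCompact K) (h : ∀ x ∉ K, f x = 0) : f ∈ testFun V k :=
  ⟨hf, HasCompactSupport.intro hK h⟩

variable {X : Type*} [NormedAddCommGroup X] [NormedSpace ℝ X]

theorem exists_pFam {f : ι → X → (Fin k → Γ) → (Fin k → V) → ℝ}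
    (hs : ∀ A : Set X, IsCompact A → ∃ K : Set (Fin k → V), IsCompact K ∧
      ∀ i c, ∀ s ∈ A, ∀ x ∉ K, f i s c x = 0)
    (hu : ∀ c, USmooth fun i (p : X × (Fin k → V)) => f i p.1 c p.2) :
    ∃ Φ : ι → X → crossTest Γ V k, PFam Φ ∧ ∀ i s c x, comp (Φ i s) c x = f i s c x :=
  ⟨fun i s => ofComp (f i s) fun c => by
    obtain ⟨K, hK, h⟩ := hs {s} isCompact_singleton
    exact mem_testFun_of_support (((hu c).contDiff i).comp (contDiff_prodMk_right s)) hK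
      fun x hx => h i c s rfl x hx,
    ⟨hs, hu⟩, fun _ _ _ _ => rfl⟩

variable [FiniteDimensional ℝ V] [FiniteDimensional ℝ X]

/-- Taylor expansion of a family of test functions in the parameter. -/
theorem PFam.taylor {Φ : ι → X → crossTest Γ V k} (hΦ : PFam Φ) :
    ∃ (D : ι → X × X → crossTest Γ V k) (R : ι → (X × X) × ℝ → crossTest Γ V k),
      PFam D ∧ PFam R ∧
      (∀ i s c x e, comp (D i (s, e)) c x =
        fderiv ℝ (fun p : X × (Fin k → V) => comp (Φ i p.1) c p.2) (s, x) (e, 0)) ∧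
      ∀ i s e (r : ℝ), Φ i (s + r • e) = Φ i s + r • D i (s, e) + r ^ 2 • R i ((s, e), r) := by
  have hu : ∀ c, USmooth fun i (p : ((X × X) × (Fin k → V)) × ℝ) =>
      comp (Φ i (p.1.1.1 + p.2 • p.1.1.2)) c p.1.2 := fun c =>
    (hΦ.2 c).comp (u := fun p : ((X × X) × (Fin k → V)) × ℝ =>
      (p.1.1.1 + p.2 • p.1.1.2, p.1.2)) (by fun_prop)
  -- Hadamard division in `r` is carried out twice. The first quotient `g` at `r = 0` becomes `D`,
  -- the second quotient `g'` becomes `R`.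
  choose g hg hg1 hg2 using fun c => (hu c).exists_hadamard
  choose g' hg' hg1' _ using fun c => (hg c).exists_hadamard
  -- supports
  have hlim : ∀ {f : ι → ((X × X) × (Fin k → V)) × ℝ → ℝ}, USmooth f → ∀ i p,
      (∀ r : ℝ, |r| < 1 → r ≠ 0 → f i (p, r) = 0) → f i (p, 0) = 0 := by
    intro f hf i p h
    have hc : Continuous fun r : ℝ => f i (p, r) :=
      (hf.contDiff i).continuous.comp (by fun_prop)
    have h1 : Filter.Tendsto (fun r : ℝ => f i (p, r)) (nhdsWithin 0 {0}ᶜ) (nhds (f i (p, 0))) :=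
      (hc.tendsto 0).mono_left nhdsWithin_le_nhds
    have h2 : Filter.Tendsto (fun r : ℝ => f i (p, r)) (nhdsWithin 0 {0}ᶜ) (nhds 0) := by
      refine tendsto_const_nhds.congr' ?_
      filter_upwards [self_mem_nhdsWithin, mem_nhdsWithin_of_mem_nhds
        (Metric.ball_mem_nhds (0 : ℝ) one_pos)] with r hr hr'
      exact (h r (by simpa using hr') hr).symm
    exact tendsto_nhds_unique h1 h2
  -- For `r ≠ 0` a quotient vanishes wherever the family vanishes at `r` and at `0`. At `r = 0` it
  -- vanishes as a limit of such values, so the support must be controlled for all small `r` besides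
  -- the given one.
  have hsupp : ∀ A : Set ((X × X) × ℝ), IsCompact A → ∃ K : Set (Fin k → V), IsCompact K ∧
      ∀ i c, ∀ s ∈ A, ∀ x ∉ K, ∀ r : ℝ, (|r| < 1 ∨ r = s.2) →
        comp (Φ i (s.1.1 + r • s.1.2)) c x = 0 := by
    intro A hA
    obtain ⟨K, hK, h⟩ := hΦ.1
      (((fun p : (X × X) × ℝ => p.1.1 + p.2 • p.1.2) '' A) ∪
        ((fun p : (X × X) × ℝ => p.1.1 + p.2 • p.1.2) ''
          ((Prod.fst '' A) ×ˢ Metric.closedBall (0 : ℝ) 1)))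
      ((hA.image (by fun_prop)).union
        (((hA.image continuous_fst).prod (isCompact_closedBall 0 1)).image (by fun_prop)))
    refine ⟨K, hK, fun i c s hs x hx r hr => h i c _ ?_ x hx⟩
    rcases hr with hr | hr
    · exact Or.inr ⟨(s.1, r), ⟨⟨s, hs, rfl⟩, by simpa using hr.le⟩, rfl⟩
    · exact Or.inl ⟨s, hs, by rw [hr]⟩
  have hgz : ∀ i c (s : X × X) x, (∀ r : ℝ, |r| < 1 → comp (Φ i (s.1 + r • s.2)) c x = 0) →
      g c i ((s, x), 0) = 0 := by
    intro i c s x h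
    refine hlim (hg c) i _ fun r hr hr0 => ?_
    have h0 := hg1 c i (s, x) r
    simp only [h r hr, h 0 (by simp), sub_zero] at h0
    exact (mul_eq_zero.1 h0.symm).resolve_left hr0
  obtain ⟨D, hD, hD'⟩ := exists_pFam (f := fun i (s : X × X) c x => g c i ((s, x), 0))
    (fun A hA => by
      obtain ⟨K, hK, h⟩ := hsupp ((fun s => (s, (0 : ℝ))) '' A) (hA.image (by fun_prop))
      exact ⟨K, hK, fun i c s hs x hx => hgz i c s x fun r hr =>
        h i c _ ⟨s, hs, rfl⟩ x hx r (Or.inl hr)⟩)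
    (fun c => (hg c).comp (u := fun p : (X × X) × (Fin k → V) => (p, (0 : ℝ))) (by fun_prop))
  obtain ⟨R, hR, hR'⟩ := exists_pFam (f := fun i (s : (X × X) × ℝ) c x => g' c i ((s.1, x), s.2))
    (fun A hA => by
      obtain ⟨K, hK, h⟩ := hsupp A hA
      refine ⟨K, hK, fun i c s hs x hx => ?_⟩
      have h0 := hgz i c s.1 x fun r hr => h i c s hs x hx r (Or.inl hr)
      have h1 : ∀ r : ℝ, (|r| < 1 ∨ r = s.2) → r ≠ 0 → g' c i ((s.1, x), r) = 0 := by
        intro r hr hr0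
        have h2 := hg1 c i (s.1, x) r
        simp only [h i c s hs x hx r hr, h i c s hs x hx 0 (by simp), sub_zero] at h2
        have h3 := hg1' c i (s.1, x) r
        rw [(mul_eq_zero.1 h2.symm).resolve_left hr0, h0, sub_zero] at h3
        exact (mul_eq_zero.1 h3.symm).resolve_left hr0
      by_cases hs2 : s.2 = 0
      · rw [hs2]
        exact hlim (hg' c) i _ fun r hr hr0 => h1 r (Or.inl hr) hr0
      · exact h1 _ (Or.inr rfl) hs2)
    (fun c => (hg' c).comp (u := fun p : ((X × X) × ℝ) × (Fin k → V) => ((p.1.1, p.2), p.1.2))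
      (by fun_prop))
  refine ⟨D, R, hD, hR, fun i s c x e => ?_, fun i s e r => crossTest_ext fun c x => ?_⟩
  · rw [hD', hg2]
    have h1 : HasFDerivAt (fun p : X × (Fin k → V) => comp (Φ i p.1) c p.2)
        (fderiv ℝ (fun p : X × (Fin k → V) => comp (Φ i p.1) c p.2) (s, x)) (s, x) :=
      (((hΦ.2 c).contDiff i).differentiable (by simp) _).hasFDerivAt
    have h2 : HasDerivAt (fun r : ℝ => comp (Φ i (s + r • e)) c x)
        (fderiv ℝ (fun p : X × (Fin k → V) => comp (Φ i p.1) c p.2) (s, x) (e, 0)) 0 := by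
      have h3 : HasDerivAt (fun r : ℝ => ((s + r • e, x) : X × (Fin k → V))) (e, 0) 0 := by
        refine HasDerivAt.prodMk ?_ (hasDerivAt_const _ _)
        simpa using ((hasDerivAt_id (0 : ℝ)).smul_const e).const_add s
      have h1' : HasFDerivAt (fun p : X × (Fin k → V) => comp (Φ i p.1) c p.2)
        (fderiv ℝ (fun p : X × (Fin k → V) => comp (Φ i p.1) c p.2) (s, x))
          ((fun r : ℝ => ((s + r • e, x) : X × (Fin k → V))) 0) := by simpa using h1
      exact h1'.comp_hasDerivAt (0 : ℝ) h3
    have h4 : HasDerivAt (fun r : ℝ => comp (Φ i (s + r • e)) c x)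
        (fderiv ℝ (fun p : ((X × X) × (Fin k → V)) × ℝ =>
          comp (Φ i (p.1.1.1 + p.2 • p.1.1.2)) c p.1.2) (((s, e), x), 0) (0, 1)) 0 := by
      have h3 : HasDerivAt (fun r : ℝ => ((((s, e), x), r) : ((X × X) × (Fin k → V)) × ℝ))
        (0, 1) 0 := (hasDerivAt_const _ _).prodMk (hasDerivAt_id _)
      exact (((hu c).contDiff i).differentiable (by simp) _).hasFDerivAt.comp_hasDerivAt (0 : ℝ) h3
    exact h4.unique h2
  · have h1 := hg1 c i ((s, e), x) r
    have h2 := hg1' c i ((s, e), x) r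
    simp only [comp_add, comp_smul, hD', hR']
    simp only [zero_smul, add_zero] at h1
    linear_combination h1 + r * h2

end

variable [Group Γ] [Fintype Γ] [InnerProductSpace ℝ V] [FiniteDimensional ℝ V] {k : ℕ}

theorem usmooth_of_mem_cochains {F : crossTest Γ V k → Γ × V → ℝ} (hF : F ∈ cochains Γ V k)
    {φ : ι → crossTest Γ V k} (hφ : BFam φ) (g : Γ) : USmooth fun i t => F (φ i) (g, t) := by
  refine USmooth.of_bounds (fun i => hF.2.1 (φ i) g) fun K hK n => ?_
  obtain ⟨C, hC⟩ := hF.2.2 _ (isBoundedTest_range_iff.2 hφ) K hK n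
  exact ⟨C, fun i t ht => hC _ ⟨_, ⟨i, rfl⟩, rfl⟩ g t ht⟩

/-- Together with `usmooth_of_mem_cochains` this replaces the bornological definition: cochains are
the linear maps taking `BFam` to `USmooth`. Index types in `max u v` suffice because a bounded set
is indexed by itself; smoothness of a single value is the case of a one-element family. -/
theorem mem_cochains_of_usmooth {F : crossTest Γ V k → Γ × V → ℝ} (hl : IsLinearMap ℝ F)
    (h : ∀ {ι : Type (max u v)} (φ : ι → crossTest Γ V k), BFam φ → ∀ g,
      USmooth fun i t => F (φ i) (g, t)) : F ∈ cochains Γ V k := by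
  refine ⟨hl, fun φ g => ?_, fun S hS K hK n => ?_⟩
  · have hb : BFam fun _ : PUnit.{max u v + 1} => φ := by
      refine ⟨?_, fun c => USmooth.of_single fun _ => (φ.2 c).1⟩
      refine ⟨⋃ c, tsupport (comp φ c), isCompact_iUnion fun c => (φ.2 c).2, fun _ c x hx => ?_⟩
      exact comp_eq_zero_of_notMem_tsupport subset_rfl fun h => hx (Set.mem_iUnion_of_mem c h)
    exact (h _ hb g).contDiff PUnit.unit
  · have hb : BFam (Subtype.val : S → crossTest Γ V k) := by
      rw [← isBoundedTest_range_iff, Subtype.range_coe]; exact hS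
    choose C hC using fun g => (h _ hb g).bounds hK n
    refine ⟨∑ g, |C g|, ?_⟩
    rintro _ ⟨φ, hφ, rfl⟩ g t ht
    exact (hC g ⟨φ, hφ⟩ t ht).trans ((le_abs_self _).trans
      (Finset.single_le_sum (f := fun g => |C g|) (fun _ _ => abs_nonneg _) (Finset.mem_univ g)))

/-- With this, the derivative in the point of evaluation is again the value of a cochain, which
keeps the induction in `PFam.usmooth` within one class of functions. -/
theorem fderiv_mem_cochains {F : crossTest Γ V k → Γ × V → ℝ} (hF : F ∈ cochains Γ V k) (τ : V) :
    (fun φ q => fderiv ℝ (fun t => F φ (q.1, t)) q.2 τ) ∈ cochains Γ V k := by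
  have hd : ∀ φ g, Differentiable ℝ fun t => F φ (g, t) := fun φ g =>
    (hF.2.1 φ g).differentiable (by simp)
  refine mem_cochains_of_usmooth ⟨fun φ ψ => ?_, fun c φ => ?_⟩ fun φ hφ g =>
    (usmooth_of_mem_cochains hF hφ g).fderiv τ
  · funext q
    simp only [hF.1.map_add, Pi.add_apply]
    rw [fderiv_fun_add (hd φ q.1 q.2) (hd ψ q.1 q.2)]
    rfl
  · funext q
    simp only [hF.1.map_smul, Pi.smul_apply]
    rw [fderiv_fun_const_smul (hd φ q.1 q.2)]
    rfl

variable {X : Type*} [NormedAddCommGroup X] [NormedSpace ℝ X] [FiniteDimensional ℝ X]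

/-- A cochain maps families that depend smoothly on a parameter to families that depend smoothly on
this parameter. -/
theorem PFam.usmooth {Φ : ι → X → crossTest Γ V k} (hΦ : PFam Φ)
    {F : crossTest Γ V k → Γ × V → ℝ} (hF : F ∈ cochains Γ V k) (g : Γ) :
    USmooth fun i (p : X × V) => F (Φ i p.1) (g, p.2) := by
  have hfix : ∀ {Φ : ι → X → crossTest Γ V k}, PFam Φ → ∀ s, BFam fun i => Φ i s := by
    intro Φ hΦ s
    have h := hΦ.bFam (A := {s}) isCompact_singleton
    exact ⟨by
      obtain ⟨K, hK, h'⟩ := h.1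
      exact ⟨K, hK, fun i => h' (i, ⟨s, rfl⟩)⟩, fun c => (h.2 c).reindex fun i => (i, ⟨s, rfl⟩)⟩
  have hval : ∀ {Φ : ι → X → crossTest Γ V k}, PFam Φ → ∀ {F : crossTest Γ V k → Γ × V → ℝ},
      F ∈ cochains Γ V k → ∀ p : X × V, ∃ C, ∀ i, |F (Φ i p.1) (g, p.2)| ≤ C := by
    intro Φ hΦ F hF p
    obtain ⟨C, hC⟩ := (usmooth_of_mem_cochains hF (hfix hΦ p.1) g).bounds
      (isCompact_singleton (x := p.2)) 0
    exact ⟨C, fun i => by simpa using hC i _ rfl⟩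
  refine ⟨fun p => Linf.mk (fun i => F (Φ i p.1) (g, p.2)) (hval hΦ hF p), ?_, fun _ _ => rfl⟩
  suffices H : ∀ n : ℕ, ∀ G : X × V → Linf ι,
      (∀ i p, Linf.ev i (G p) = F (Φ i p.1) (g, p.2)) → ContDiff ℝ n G from
    contDiff_infty.2 fun n => H n _ fun _ _ => rfl
  -- The derivative in direction `(σ, τ)` consists of `F` applied to the parameter derivative `D` of
  -- the family, and of the cochain differentiated in direction `τ`. Both summands have the shape of
  -- the original function, so the induction on the order can vary `Φ` and `F`.
  have key : ∀ {Φ : ι → X → crossTest Γ V k} (hΦ : PFam Φ) {F : crossTest Γ V k → Γ × V → ℝ}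
      (hF : F ∈ cochains Γ V k), ∃ D : ι → X × X → crossTest Γ V k, PFam D ∧
      ∀ G : X × V → Linf ι, (∀ i p, Linf.ev i (G p) = F (Φ i p.1) (g, p.2)) →
      ∀ p, ∃ L : X × V →L[ℝ] Linf ι, HasFDerivAt G L p ∧ ∀ i y, Linf.ev i (L y) =
        F (D i (p.1, y.1)) (g, p.2) + fderiv ℝ (fun t => F (Φ i p.1) (g, t)) p.2 y.2 := by
    intro Φ hΦ F hF
    obtain ⟨D, R, hD, hR, hD', hT⟩ := hΦ.taylor
    refine ⟨D, hD, fun G hG p => ?_⟩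
    have hDs : ∀ e : X, PFam fun i s => D i (s, e) := fun e =>
      hD.comp_right (u := fun s => (s, e)) (by fun_prop)
    have hDadd : ∀ i s e e', D i (s, e + e') = D i (s, e) + D i (s, e') := fun i s e e' =>
      crossTest_ext fun c x => by
        rw [comp_add, hD', hD', hD', ← map_add]; simp
    have hDsmul : ∀ i s (r : ℝ) e, D i (s, r • e) = r • D i (s, e) := fun i s r e =>
      crossTest_ext fun c x => by
        rw [comp_smul, hD', hD', ← smul_eq_mul, ← map_smul]; simp
    let L : X × V →ₗ[ℝ] Linf ι :=
      { toFun := fun y => Linf.mk (fun i => F (D i (p.1, y.1)) (g, p.2)) (hval (hDs y.1) hF p) +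
          Linf.mk (fun i => fderiv ℝ (fun t => F (Φ i p.1) (g, t)) p.2 y.2)
            (hval hΦ (fderiv_mem_cochains hF y.2) p)
        map_add' := fun y z => Linf.ext fun i => by
          simp only [map_add, Linf.ev_mk, Prod.fst_add, Prod.snd_add, hDadd, hF.1.map_add,
            Pi.add_apply]
          ring
        map_smul' := fun r y => Linf.ext fun i => by
          simp only [map_add, Linf.ev_mk, Prod.smul_fst, Prod.smul_snd, hDsmul, hF.1.map_smul,
            Pi.smul_apply, map_smul, RingHom.id_apply, smul_eq_mul]
          ring }
    refine ⟨LinearMap.toContinuousLinearMap L, ?_, fun i y => by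
      change Linf.ev i (L y) = _
      simp [L]⟩
    -- The three constants bound the three parts of the remainder: the second-order term in the
    -- point of evaluation, the mixed term, and the second-order Taylor remainder `R` in the
    -- parameter.
    obtain ⟨C₁, hC₁⟩ := (usmooth_of_mem_cochains hF (hfix hΦ p.1) g).bounds
      (isCompact_closedBall p.2 1) 2
    obtain ⟨C₂, hC₂⟩ := (usmooth_of_mem_cochains hF (hD.bFam
      ((isCompact_singleton (x := p.1)).prod (isCompact_closedBall (0 : X) 1))) g).bounds
      (isCompact_closedBall p.2 1) 1
    obtain ⟨C₃, hC₃⟩ := (usmooth_of_mem_cochains hF (hR.bFam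
      (((isCompact_singleton (x := p.1)).prod (isCompact_closedBall (0 : X) 1)).prod
        (isCompact_closedBall (0 : ℝ) 1))) g).bounds (isCompact_closedBall p.2 1) 0
    refine hasFDerivAt_of_sq_bound (C := |C₁| + |C₂| + |C₃|) fun y hy =>
      Linf.norm_le (by positivity) fun i => ?_
    obtain ⟨s, t⟩ := p
    obtain ⟨σ, τ⟩ := y
    have hσ : ‖σ‖ ≤ ‖(σ, τ)‖ := norm_fst_le (σ, τ)
    have hτ : ‖τ‖ ≤ ‖(σ, τ)‖ := norm_snd_le (σ, τ)
    set N := ‖(σ, τ)‖ with hN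
    have hN0 : 0 ≤ N := norm_nonneg _
    -- The direction is normalized so that `D` and `R` are only evaluated over compact parameter
    -- sets, where `PFam.bFam` makes them bounded families.
    obtain ⟨e, he, hσe⟩ : ∃ e : X, ‖e‖ ≤ 1 ∧ σ = ‖σ‖ • e := by
      by_cases h0 : σ = 0
      · exact ⟨0, by simp, by simp [h0]⟩
      · refine ⟨‖σ‖⁻¹ • σ, ?_, ?_⟩
        · rw [norm_smul, norm_inv, norm_norm, inv_mul_cancel₀ (norm_ne_zero_iff.2 h0)]
        · rw [smul_smul, mul_inv_cancel₀ (norm_ne_zero_iff.2 h0), one_smul]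
    have hval1 : Linf.ev i (G ((s, t) + (σ, τ)) - G (s, t) - L (σ, τ)) =
        (F (Φ i s) (g, t + τ) - F (Φ i s) (g, t) - fderiv ℝ (fun t => F (Φ i s) (g, t)) t τ) +
        ‖σ‖ * (F (D i (s, e)) (g, t + τ) - F (D i (s, e)) (g, t)) +
        ‖σ‖ ^ 2 * F (R i ((s, e), ‖σ‖)) (g, t + τ) := by
      have h1 : F (Φ i (s + σ)) (g, t + τ) = F (Φ i s) (g, t + τ) +
          ‖σ‖ * F (D i (s, e)) (g, t + τ) + ‖σ‖ ^ 2 * F (R i ((s, e), ‖σ‖)) (g, t + τ) := by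
        have h2 := hT i s e ‖σ‖
        rw [← hσe] at h2
        rw [h2]
        simp [hF.1.map_add, hF.1.map_smul]
      have h3 : F (D i (s, σ)) (g, t) = ‖σ‖ * F (D i (s, e)) (g, t) := by
        conv_lhs => rw [hσe, hDsmul]
        simp [hF.1.map_smul]
      simp only [map_sub, hG, Prod.mk_add_mk, h1]
      simp only [L, LinearMap.coe_mk, AddHom.coe_mk, map_add, Linf.ev_mk, h3]
      ring
    change |Linf.ev i (G ((s, t) + (σ, τ)) - G (s, t) - L (σ, τ))| ≤ _
    rw [hval1]
    have b1 := norm_taylor_le (hF.2.1 (Φ i s) g) (hC₁ i) (hτ.trans hy)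
    have hmem : t + τ ∈ Metric.closedBall t 1 := by simpa using hτ.trans hy
    have b2 : ‖F (D i (s, e)) (g, t + τ) - F (D i (s, e)) (g, t)‖ ≤ C₂ * ‖τ‖ := by
      have h := (convex_closedBall t 1).norm_image_sub_le_of_norm_fderiv_le (𝕜 := ℝ)
        (f := fun t => F (D i (s, e)) (g, t)) (C := C₂)
        (fun w _ => (hF.2.1 (D i (s, e)) g).differentiable (by simp) w)
        (fun w hw => by
          have := hC₂ (i, ⟨(s, e), rfl, by simpa using he⟩) w hw
          rwa [← norm_iteratedFDeriv_fderiv, norm_iteratedFDeriv_zero] at this)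
        (Metric.mem_closedBall_self zero_le_one) hmem
      simpa using h
    have b3 : ‖F (R i ((s, e), ‖σ‖)) (g, t + τ)‖ ≤ C₃ := by
      have := hC₃ (i, ⟨((s, e), ‖σ‖), ⟨rfl, by simpa using he⟩, by simpa using hσ.trans hy⟩)
        (t + τ) hmem
      rwa [norm_iteratedFDeriv_zero] at this
    simp only [Real.norm_eq_abs] at b1 b2 b3
    refine (abs_add_three _ _ _).trans ?_
    rw [abs_mul, abs_mul, abs_of_nonneg (norm_nonneg σ), abs_of_nonneg (sq_nonneg ‖σ‖)]
    have c1 : C₁ * ‖τ‖ ^ 2 ≤ |C₁| * N ^ 2 := by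
      gcongr
      exact le_abs_self _
    have c2 : ‖σ‖ * |F (D i (s, e)) (g, t + τ) - F (D i (s, e)) (g, t)| ≤ |C₂| * N ^ 2 := by
      calc _ ≤ N * (|C₂| * N) := by
            gcongr
            exact b2.trans (by gcongr; exact le_abs_self _)
        _ = _ := by ring
    have c3 : ‖σ‖ ^ 2 * |F (R i ((s, e), ‖σ‖)) (g, t + τ)| ≤ |C₃| * N ^ 2 := by
      rw [mul_comm]
      exact mul_le_mul (b3.trans (le_abs_self _)) (by gcongr) (by positivity) (by positivity)
    linarith
  intro n
  induction n generalizing F Φ with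
  | zero =>
    intro G hG
    obtain ⟨D, hD, h⟩ := key hΦ hF
    refine contDiff_zero.2 (continuous_iff_continuousAt.2 fun x => ?_)
    obtain ⟨L, hL, -⟩ := h G hG x
    exact hL.continuousAt
  | succ n ih =>
    intro G hG
    obtain ⟨D, hD, h⟩ := key hΦ hF
    choose L hL hL' using h G hG
    have hn : ((n + 1 : ℕ) : WithTop ℕ∞) = (n : WithTop ℕ∞) + 1 := by norm_cast
    rw [hn]
    refine contDiff_succ_iff_fderiv_apply.2
      ⟨fun x => (hL x).differentiableAt, fun h => absurd h (by exact_mod_cast WithTop.coe_ne_top),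
        fun y => ?_⟩
    have hDs : PFam fun i s => D i (s, y.1) := hD.comp_right (u := fun s => (s, y.1)) (by fun_prop)
    have e : (fun p => fderiv ℝ G p y) = fun p =>
        Linf.mk (fun i => F (D i (p.1, y.1)) (g, p.2)) (hval hDs hF p) +
          Linf.mk (fun i => fderiv ℝ (fun t => F (Φ i p.1) (g, t)) p.2 y.2)
            (hval hΦ (fderiv_mem_cochains hF y.2) p) := by
      funext p
      refine Linf.ext fun i => ?_
      rw [(hL p).fderiv, hL']
      simp
    rw [e]
    exact (ih hDs hF _ fun _ _ => rfl).add
      (ih hΦ (fderiv_mem_cochains hF y.2) _ fun _ _ => rfl)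

end ParamCalc
/-! ### Substitution operators on test functions -/

section Operators

universe u v

variable {Γ : Type u} {V : Type v} [NormedAddCommGroup V]

section
variable [NormedSpace ℝ V] {ι X : Type*} [NormedAddCommGroup X] [NormedSpace ℝ X] {m l : ℕ}

/-- Weighted substitutions map bounded families to families depending smoothly on a parameter. -/
theorem BFam.pFam_of_formula {κ : Type*} [Fintype κ] {φ : ι → crossTest Γ V m} (hφ : BFam φ)
    {Φ : ι → X → crossTest Γ V l} [Finite Γ]
    (w : κ → (Fin l → Γ) → X × (Fin l → V) → ℝ)
    (e : κ → (Fin l → Γ) → Fin m → Γ)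
    (A : κ → (Fin l → Γ) → X × (Fin l → V) → Fin m → V)
    (hw : ∀ a c, ContDiff ℝ ∞ (w a c)) (hA : ∀ a c, ContDiff ℝ ∞ (A a c))
    (hsupp : ∀ a c, ∀ S : Set X, IsCompact S → ∀ K : Set (Fin m → V), IsCompact K →
      ∃ K' : Set (Fin l → V), IsCompact K' ∧ ∀ s ∈ S, ∀ x ∉ K', A a c (s, x) ∈ K → w a c (s, x) = 0)
    (h : ∀ i s c x, comp (Φ i s) c x = ∑ a, w a c (s, x) * comp (φ i) (e a c) (A a c (s, x))) :
    PFam Φ := by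
  obtain ⟨⟨K, hK, hz⟩, hu⟩ := hφ
  refine ⟨fun S hS => ?_, fun c => ?_⟩
  · choose K' hK' h' using fun p : κ × (Fin l → Γ) => hsupp p.1 p.2 S hS K hK
    refine ⟨⋃ p, K' p, isCompact_iUnion hK', fun i c s hs x hx => ?_⟩
    rw [h]
    refine Finset.sum_eq_zero fun a _ => ?_
    by_cases hA' : A a c (s, x) ∈ K
    · rw [h' (a, c) s hs x (fun hx' => hx (Set.mem_iUnion_of_mem (a, c) hx')) hA', zero_mul]
    · rw [hz i _ _ hA', mul_zero]
  · simp_rw [h]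
    exact USmooth.sum _ fun a _ => ((hu (e a c)).comp (hA a c)).smul (hw a c)

variable (Γ V) in
/-- Operators on test functions that depend smoothly on a point of `Γ × V`. -/
def SmoothOp (m l : ℕ) (𝒜 : Γ × V → crossTest Γ V m → crossTest Γ V l) : Prop :=
  (∀ q, IsLinearMap ℝ (𝒜 q)) ∧ ∀ {ι : Type (max u v)} (φ : ι → crossTest Γ V m), BFam φ →
    ∀ g, PFam fun i t => 𝒜 (g, t) (φ i)

end

variable [Group Γ] [Fintype Γ] [InnerProductSpace ℝ V] [FiniteDimensional ℝ V] {m l k : ℕ}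

/-- The operator and the point of evaluation depend on the same `t`. The function is first shown to
be smooth with two independent variables, by `PFam.usmooth`, and then restricted to a graph. All
cochain constructions below pass through this. -/
theorem SmoothOp.mem_cochains {𝒜 : Γ × V → crossTest Γ V m → crossTest Γ V l}
    (h : SmoothOp Γ V m l 𝒜) {F : crossTest Γ V l → Γ × V → ℝ} (hF : F ∈ cochains Γ V l)
    (σ : Γ → Γ) {a : Γ → V → V} (ha : ∀ g, ContDiff ℝ ∞ (a g)) :
    (fun φ q => F (𝒜 q φ) (σ q.1, a q.1 q.2)) ∈ cochains Γ V m := by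
  refine mem_cochains_of_usmooth ⟨fun φ ψ => ?_, fun c φ => ?_⟩ fun φ hφ g => ?_
  · funext q; simp [(h.1 q).map_add, hF.1.map_add]
  · funext q; simp [(h.1 q).map_smul, hF.1.map_smul]
  · exact ((h.2 φ hφ g).usmooth hF (σ g)).comp (u := fun t => (t, a g t))
      (contDiff_id.prodMk (ha g))

/-- Cochains with values in a vector space. -/
def vCochains (Γ V : Type*) [Group Γ] [Fintype Γ] [NormedAddCommGroup V] [InnerProductSpace ℝ V]
    (N : Type*) [AddCommGroup N] [Module ℝ N] (k : ℕ) :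
    Submodule ℝ (crossTest Γ V k → Γ × V → N) where
  carrier := {E | ∀ α : Module.Dual ℝ N, (fun φ q => α (E φ q)) ∈ cochains Γ V k}
  add_mem' := fun {a b} ha hb α => by
    simp only [Pi.add_apply, map_add]
    exact (cochains Γ V k).add_mem (ha α) (hb α)
  zero_mem' := fun α => by
    simp only [Pi.zero_apply, map_zero]
    exact (cochains Γ V k).zero_mem
  smul_mem' := fun c a ha α => by
    simp only [Pi.smul_apply, map_smul]
    exact (cochains Γ V k).smul_mem c (ha α)

section Vector

variable {N N' : Type*} [AddCommGroup N] [Module ℝ N] [AddCommGroup N'] [Module ℝ N']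

theorem mem_vCochains_real {F : crossTest Γ V k → Γ × V → ℝ} :
    F ∈ vCochains Γ V ℝ k ↔ F ∈ cochains Γ V k := by
  refine ⟨fun h => h LinearMap.id, fun h α => ?_⟩
  have e : (fun φ q => α (F φ q)) = α 1 • F := by
    funext φ q
    rw [← mul_one (F φ q), ← smul_eq_mul, map_smul]
    simp [mul_comm]
  rw [e]
  exact (cochains Γ V k).smul_mem _ h

theorem map_mem_vCochains (T : N →ₗ[ℝ] N') {E : crossTest Γ V k → Γ × V → N}
    (hE : E ∈ vCochains Γ V N k) : (fun φ q => T (E φ q)) ∈ vCochains Γ V N' k :=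
  fun α => hE (α ∘ₗ T)

theorem isLinearMap_of_mem_vCochains {E : crossTest Γ V k → Γ × V → N}
    (hE : E ∈ vCochains Γ V N k) : IsLinearMap ℝ E := by
  refine ⟨fun φ ψ => ?_, fun c φ => ?_⟩
  · funext q
    refine sub_eq_zero.1 ((Module.forall_dual_apply_eq_zero_iff ℝ _).1 fun α => ?_)
    rw [map_sub, sub_eq_zero]
    simpa using congrFun ((hE α).1.map_add φ ψ) q
  · funext q
    refine sub_eq_zero.1 ((Module.forall_dual_apply_eq_zero_iff ℝ _).1 fun α => ?_)
    rw [map_sub, sub_eq_zero]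
    simpa using congrFun ((hE α).1.map_smul c φ) q

theorem SmoothOp.mem_vCochains {𝒜 : Γ × V → crossTest Γ V m → crossTest Γ V l}
    (h : SmoothOp Γ V m l 𝒜) {E : crossTest Γ V l → Γ × V → N} (hE : E ∈ vCochains Γ V N l)
    (σ : Γ → Γ) {a : Γ → V → V} (ha : ∀ g, ContDiff ℝ ∞ (a g)) :
    (fun φ q => E (𝒜 q φ) (σ q.1, a q.1 q.2)) ∈ vCochains Γ V N m :=
  fun α => h.mem_cochains (hE α) σ ha

theorem SmoothOp.mem_vCochains' {𝒜 : Γ × V → crossTest Γ V m → crossTest Γ V l}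
    (h : SmoothOp Γ V m l 𝒜) {E : crossTest Γ V l → Γ × V → N} (hE : E ∈ vCochains Γ V N l) :
    (fun φ q => E (𝒜 q φ) q) ∈ vCochains Γ V N m :=
  h.mem_vCochains hE (fun g => g) (a := fun _ t => t) fun _ => contDiff_id

end Vector

/-! ### Faces -/

section Slices

theorem comp_consSlice (h : Γ) (t : V) (φ : crossTest Γ V (k + 1)) (c : Fin k → Γ)
    (x : Fin k → V) : comp (consSlice (h, t) φ) c x =
      comp φ (Fin.cons h c : Fin (k + 1) → Γ) (Fin.cons t x : Fin (k + 1) → V) := by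
  refine congrArg φ.1 (funext fun i => ?_)
  refine Fin.cases ?_ (fun i => ?_) i <;> simp

theorem comp_snocSlice (h : Γ) (t : V) (φ : crossTest Γ V (k + 1)) (c : Fin k → Γ)
    (x : Fin k → V) : comp (snocSlice (h, t) φ) c x =
      comp φ (Fin.snoc (α := fun _ => Γ) c h) (Fin.snoc (α := fun _ => V) x t) := by
  refine congrArg φ.1 (funext fun i => ?_)
  refine Fin.lastCases ?_ (fun i => ?_) i <;> simp

theorem contDiff_cons {Y : Type*} [NormedAddCommGroup Y] [NormedSpace ℝ Y] {a : Y → V}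
    {b : Y → Fin k → V} (ha : ContDiff ℝ ∞ a) (hb : ContDiff ℝ ∞ b) :
    ContDiff ℝ ∞ fun y => (Fin.cons (a y) (b y) : Fin (k + 1) → V) :=
  contDiff_pi.2 fun i => by
    refine Fin.cases ?_ (fun i => ?_) i
    · simpa using ha
    · simpa using (contDiff_pi.1 hb i)

theorem contDiff_snoc {Y : Type*} [NormedAddCommGroup Y] [NormedSpace ℝ Y] {a : Y → V}
    {b : Y → Fin k → V} (ha : ContDiff ℝ ∞ a) (hb : ContDiff ℝ ∞ b) :
    ContDiff ℝ ∞ fun y => (Fin.snoc (α := fun _ => V) (b y) (a y) : Fin (k + 1) → V) :=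
  contDiff_pi.2 fun i => by
    refine Fin.lastCases ?_ (fun i => ?_) i
    · simpa using ha
    · simpa using (contDiff_pi.1 hb i)

variable (ρ : Γ →* (V ≃ₗᵢ[ℝ] V))

theorem smoothOp_consSlice (h : Γ) :
    SmoothOp Γ V (k + 1) k fun q φ => consSlice (h, q.2) φ := by
  refine ⟨fun q => ⟨fun _ _ => rfl, fun _ _ => rfl⟩, fun φ hφ g => ?_⟩
  refine hφ.pFam_of_formula (κ := Unit) (fun _ _ _ => 1) (fun _ c => Fin.cons h c)
    (fun _ _ p => Fin.cons p.1 p.2) (fun _ _ => contDiff_const)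
    (fun _ _ => contDiff_cons contDiff_fst contDiff_snd) (fun _ _ S hS K hK => ?_)
    fun i s c x => by simp [comp_consSlice]
  refine ⟨(fun y : Fin (k + 1) → V => fun i => y (Fin.succ i)) '' K, hK.image (by fun_prop),
    fun s _ x hx hA => (hx ⟨_, hA, by funext i; simp⟩).elim⟩

theorem smoothOp_snocSlice (h : Γ) :
    SmoothOp Γ V (k + 1) k fun q φ => snocSlice (h⁻¹ * q.1, ρ h⁻¹ q.2) φ := by
  refine ⟨fun q => ⟨fun _ _ => rfl, fun _ _ => rfl⟩, fun φ hφ g => ?_⟩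
  refine hφ.pFam_of_formula (κ := Unit) (fun _ _ _ => 1)
    (fun _ c => Fin.snoc (α := fun _ => Γ) c (h⁻¹ * g))
    (fun _ _ p => Fin.snoc (α := fun _ => V) p.2 (ρ h⁻¹ p.1)) (fun _ _ => contDiff_const)
    (fun _ _ => contDiff_snoc ((ρ h⁻¹).contDiff.comp contDiff_fst) contDiff_snd)
    (fun _ _ S hS K hK => ?_)
    fun i s c x => by simp [comp_snocSlice]
  refine ⟨(fun y : Fin (k + 1) → V => fun i => y (Fin.castSucc i)) '' K, hK.image (by fun_prop),
    fun s _ x hx hA => (hx ⟨_, hA, by funext i; simp⟩).elim⟩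

theorem predAbove_eq {n : ℕ} (i : Fin n) (l : Fin (n + 1)) :
    i.predAbove l = ⟨if (i : ℕ) < l then l - 1 else l, by split_ifs <;> omega⟩ := by
  refine Fin.ext ?_
  simp only [Fin.predAbove, Fin.lt_def, Fin.val_castSucc]
  split_ifs <;> simp

/-- Splitting the `i`-th label as `h * (h⁻¹ * c i)`. -/
def splitLabel (i : Fin k) (h : Γ) (c : Fin k → Γ) (l : Fin (k + 1)) : Γ :=
  if l = i.castSucc then h else if l = i.succ then h⁻¹ * c i else c (i.predAbove l)

/-- The points corresponding to `splitLabel`. -/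
def splitPoint (i : Fin k) (h : Γ) (x : Fin k → V) (l : Fin (k + 1)) : V :=
  if l = i.succ then ρ h⁻¹ (x i) else x (i.predAbove l)

theorem comp_merge (i : Fin k) (φ : crossTest Γ V (k + 1)) (c : Fin k → Γ) (x : Fin k → V) :
    comp (merge ρ i φ) c x = ∑ h, comp φ (splitLabel i h c) (splitPoint ρ i h x) := by
  change (∑ h : Γ, fun p : Fin k → Γ × V => φ.1 (Fin.insertNth i.castSucc (h, (p i).2)
      (Function.update p i (h⁻¹ * (p i).1, ρ h⁻¹ (p i).2)))) (fun i => (c i, x i)) = _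
  rw [Finset.sum_apply]
  refine Finset.sum_congr rfl fun h _ => congrArg φ.1 (funext fun l => ?_)
  refine Fin.succAboveCases i.castSucc ?_ (fun l => ?_) l
  · have h1 : i.castSucc ≠ i.succ := by simp [Fin.ext_iff]
    simp [splitLabel, splitPoint, h1]
  · have h0 : i.castSucc.succAbove l ≠ i.castSucc := Fin.succAbove_ne _ _
    simp only [Fin.insertNth_apply_succAbove, splitLabel, splitPoint, h0, if_false]
    by_cases hl : l = i
    · subst hl
      simp
    · have h2 : l.castSucc < i.castSucc ∨ i.succ < l.succ := by
        rcases lt_or_gt_of_ne hl with h | h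
        · exact Or.inl (by simpa using h)
        · exact Or.inr (by simpa using h)
      have h3 : i.castSucc.succAbove l ≠ i.succ := by
        rw [← Fin.succAbove_castSucc_self]
        exact fun h => hl (Fin.succAbove_right_injective h)
      have h4 : i.predAbove (i.castSucc.succAbove l) = l := by
        simp
      simp [Function.update_of_ne hl, h3, h4]

theorem contDiff_splitPoint {Y : Type*} [NormedAddCommGroup Y] [NormedSpace ℝ Y] (i : Fin k)
    (h : Γ) {b : Y → Fin k → V} (hb : ContDiff ℝ ∞ b) :
    ContDiff ℝ ∞ fun y => splitPoint ρ i h (b y) :=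
  contDiff_pi.2 fun l => by
    unfold splitPoint
    split_ifs
    · exact (ρ h⁻¹).contDiff.comp (contDiff_pi.1 hb i)
    · exact contDiff_pi.1 hb _

/-- Deleting the slot `i + 1` undoes the duplication of the `i`-th point. This left inverse bounds
the supports after `merge`. -/
theorem splitPoint_succAbove (i : Fin k) (h : Γ) (x : Fin k → V) :
    (fun l => splitPoint ρ i h x (i.succ.succAbove l)) = x := by
  funext l
  have h0 : i.succ.succAbove l ≠ i.succ := Fin.succAbove_ne _ _
  simp only [splitPoint, h0, if_false]
  refine congrArg x (Fin.ext ?_)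
  simp only [predAbove_eq, Fin.succAbove, Fin.lt_def, Fin.val_succ, Fin.val_castSucc]
  split_ifs <;> simp only [Fin.val_succ, Fin.val_castSucc] at * <;> omega

theorem smoothOp_merge (i : Fin k) : SmoothOp Γ V (k + 1) k fun _ φ => merge ρ i φ := by
  refine ⟨fun q => ⟨fun φ ψ => crossTest_ext fun c x => ?_, fun r φ => crossTest_ext fun c x => ?_⟩,
    fun φ hφ g => ?_⟩
  · simp [comp_merge, Finset.sum_add_distrib]
  · simp [comp_merge, Finset.mul_sum]
  · refine hφ.pFam_of_formula (κ := Γ) (fun _ _ _ => 1) (fun h c => splitLabel i h c)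
      (fun h _ p => splitPoint ρ i h p.2) (fun _ _ => contDiff_const)
      (fun h _ => contDiff_splitPoint ρ i h contDiff_snd) (fun h _ S hS K hK => ?_)
      fun _ s c x => by simp [comp_merge]
    exact ⟨(fun y : Fin (k + 1) → V => fun l => y (i.succ.succAbove l)) '' K,
      hK.image (by fun_prop), fun s _ x hx hA =>
        (hx ⟨_, hA, splitPoint_succAbove ρ i h x⟩).elim⟩

end Slices

/-! ### Faces of cochains, the Hochschild coboundary and the bar differential. -/

section Faces

variable {N N' : Type*} [AddCommGroup N] [Module ℝ N] [AddCommGroup N'] [Module ℝ N']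
  (ρ : Γ →* (V ≃ₗᵢ[ℝ] V))

/-- Left multiplication by the first argument. -/
def face0 (E : crossTest Γ V k → Γ × V → N) : crossTest Γ V (k + 1) → Γ × V → N :=
  fun φ q => ∑ h : Γ, E (consSlice (h, q.2) φ) (h⁻¹ * q.1, ρ h⁻¹ q.2)

/-- Multiplication of two consecutive arguments. -/
def faceM (i : Fin k) (E : crossTest Γ V k → Γ × V → N) : crossTest Γ V (k + 1) → Γ × V → N :=
  fun φ q => E (merge ρ i φ) q

/-- Right multiplication by the last argument. -/
def faceL (E : crossTest Γ V k → Γ × V → N) : crossTest Γ V (k + 1) → Γ × V → N :=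
  fun φ q => ∑ h : Γ, E (snocSlice (h⁻¹ * q.1, ρ h⁻¹ q.2) φ) (h, q.2)

/-- The faces of the Hochschild coboundary. -/
def face (j : Fin (k + 2)) : (crossTest Γ V k → Γ × V → N) → crossTest Γ V (k + 1) → Γ × V → N :=
  Fin.cases (face0 ρ) (fun j => Fin.lastCases (faceL ρ) (fun i => faceM ρ i) j) j

@[simp] theorem face_zero : face (k := k) (N := N) ρ 0 = face0 ρ := rfl

@[simp] theorem face_succ_castSucc (i : Fin k) : face (N := N) ρ i.castSucc.succ = faceM ρ i := by
  simp [face]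

@[simp] theorem face_last : face (k := k) (N := N) ρ (Fin.last (k + 1)) = faceL ρ := by
  rw [← Fin.succ_last]
  simp only [face, Fin.cases_succ, Fin.lastCases_last]

theorem face_add (j : Fin (k + 2)) (E E' : crossTest Γ V k → Γ × V → N) :
    face ρ j (E + E') = face ρ j E + face ρ j E' := by
  refine Fin.cases ?_ (fun j => ?_) j
  · funext φ q; simp [face0, Finset.sum_add_distrib]
  · refine Fin.lastCases ?_ (fun i => ?_) j
    · rw [Fin.succ_last, face_last]; funext φ q; simp [faceL, Finset.sum_add_distrib]
    · rw [face_succ_castSucc]; rfl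

theorem face_smul (j : Fin (k + 2)) (c : ℝ) (E : crossTest Γ V k → Γ × V → N) :
    face ρ j (c • E) = c • face ρ j E := by
  refine Fin.cases ?_ (fun j => ?_) j
  · funext φ q; simp [face0, Finset.smul_sum]
  · refine Fin.lastCases ?_ (fun i => ?_) j
    · rw [Fin.succ_last, face_last]; funext φ q; simp [faceL, Finset.smul_sum]
    · rw [face_succ_castSucc]; rfl

/-- Faces commute with linear maps of the coefficients. -/
theorem face_mem (j : Fin (k + 2)) {E : crossTest Γ V k → Γ × V → N} (hE : E ∈ vCochains Γ V N k) :
    face ρ j E ∈ vCochains Γ V N (k + 1) := by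
  induction j using Fin.cases with | zero => ?_ | succ j => ?_
  · have e : face (k := k) (N := N) ρ 0 E = ∑ h : Γ, fun φ q =>
        E (consSlice (h, q.2) φ) (h⁻¹ * q.1, ρ h⁻¹ q.2) := by
      funext φ q; simp [face0]
    rw [e]
    exact Submodule.sum_mem _ fun h _ => (smoothOp_consSlice h).mem_vCochains hE
      (fun g => h⁻¹ * g) (a := fun _ t => ρ h⁻¹ t) fun _ => (ρ h⁻¹).contDiff
  · refine Fin.lastCases ?_ (fun i => ?_) j
    · have e : face (k := k) (N := N) ρ (Fin.last k).succ E = ∑ h : Γ, fun φ q =>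
          E (snocSlice (h⁻¹ * q.1, ρ h⁻¹ q.2) φ) (h, q.2) := by
        rw [Fin.succ_last, face_last]
        funext φ q; simp [faceL]
      rw [e]
      exact Submodule.sum_mem _ fun h _ => (smoothOp_snocSlice ρ h).mem_vCochains hE
        (fun _ => h) (a := fun _ t => t) fun _ => contDiff_id
    · rw [face_succ_castSucc]
      exact (smoothOp_merge ρ i).mem_vCochains' hE

theorem hochB_eq (F : crossTest Γ V k → Γ × V → ℝ) :
    hochB ρ k F = ∑ j : Fin (k + 2), (-1 : ℝ) ^ (j : ℕ) • face ρ j F := by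
  rw [Fin.sum_univ_succ, Fin.sum_univ_castSucc]
  simp only [face_succ_castSucc, Fin.succ_last, face_last, face_zero]
  funext φ q
  simp [hochB, face0, faceM, faceL, Finset.sum_apply, add_assoc]

theorem hochB_mem {F : crossTest Γ V k → Γ × V → ℝ} (hF : F ∈ cochains Γ V k) :
    hochB ρ k F ∈ cochains Γ V (k + 1) := by
  rw [hochB_eq, ← mem_vCochains_real]
  exact Submodule.sum_mem _ fun j _ => Submodule.smul_mem _ _ (face_mem ρ j (mem_vCochains_real.2 hF))

/-- The bar differential: all faces except the last one. -/
def bar (E : crossTest Γ V k → Γ × V → N) : crossTest Γ V (k + 1) → Γ × V → N :=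
  ∑ j : Fin (k + 1), (-1 : ℝ) ^ (j : ℕ) • face ρ j.castSucc E

theorem hochB_eq_bar (F : crossTest Γ V k → Γ × V → ℝ) :
    hochB ρ k F = bar ρ F + (-1 : ℝ) ^ (k + 1) • faceL ρ F := by
  rw [hochB_eq, Fin.sum_univ_castSucc, face_last]
  rfl

theorem bar_mem {E : crossTest Γ V k → Γ × V → N} (hE : E ∈ vCochains Γ V N k) :
    bar ρ E ∈ vCochains Γ V N (k + 1) :=
  Submodule.sum_mem _ fun _ _ => Submodule.smul_mem _ _ (face_mem ρ _ hE)

end Faces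

end Operators
/-! ### Cosimplicial identities -/

section Identities

universe u v

variable {Γ : Type u} {V : Type v} [NormedAddCommGroup V] [Group Γ] [Fintype Γ]
  [InnerProductSpace ℝ V] [FiniteDimensional ℝ V] {m l k : ℕ} (ρ : Γ →* (V ≃ₗᵢ[ℝ] V))


theorem rho_mul (a b : Γ) (v : V) : ρ (a * b) v = ρ a (ρ b v) := by rw [map_mul]; rfl

@[simp] theorem comp_sum {α : Type*} (s : Finset α) (f : α → crossTest Γ V k) (c : Fin k → Γ)
    (x : Fin k → V) : comp (∑ a ∈ s, f a) c x = ∑ a ∈ s, comp (f a) c x := by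
  classical
  induction s using Finset.induction_on with
  | empty => simp only [Finset.sum_empty]; rfl
  | insert a s ha ih => rw [Finset.sum_insert ha, Finset.sum_insert ha, comp_add, ih]

theorem splitLabel_comm {i j : Fin k} (hij : i < j) (h h' : Γ) (c : Fin k → Γ) :
    splitLabel j.succ h' (splitLabel i h c) = splitLabel i.castSucc h (splitLabel j h' c) := by
  funext l
  simp only [splitLabel, predAbove_eq, Fin.ext_iff, Fin.val_succ, Fin.val_castSucc, Fin.lt_def] at *
  grind

theorem splitLabel_assoc (i : Fin k) (h h' : Γ) (c : Fin k → Γ) :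
    splitLabel i.succ h' (splitLabel i h c) =
      splitLabel i.castSucc h (splitLabel i (h * h') c) := by
  funext l
  simp only [splitLabel, predAbove_eq, Fin.ext_iff, Fin.val_succ, Fin.val_castSucc,
    mul_inv_rev, mul_assoc] at *
  have e : h⁻¹ * (h * h') = h' := inv_mul_cancel_left h h'
  grind

theorem splitPoint_comm {i j : Fin k} (hij : i < j) (h h' : Γ) (c : Fin k → V) :
    splitPoint ρ j.succ h' (splitPoint ρ i h c) =
      splitPoint ρ i.castSucc h (splitPoint ρ j h' c) := by
  funext l
  simp only [splitPoint, predAbove_eq, Fin.ext_iff, Fin.val_succ, Fin.val_castSucc, Fin.lt_def] at *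
  grind

theorem splitPoint_assoc (i : Fin k) (h h' : Γ) (c : Fin k → V) :
    splitPoint ρ i.succ h' (splitPoint ρ i h c) =
      splitPoint ρ i.castSucc h (splitPoint ρ i (h * h') c) := by
  funext l
  simp only [splitPoint, predAbove_eq, Fin.ext_iff, Fin.val_succ, Fin.val_castSucc, mul_inv_rev,
    rho_mul] at *
  grind

/-- For `i < j` the two products involve different pairs of slots, up to the order of summation. For
`i = j` this is associativity of the convolution, seen after the substitution `h' ↦ h h'` in the sum
over labels. -/
theorem merge_merge {i j : Fin k} (hij : i ≤ j) (φ : crossTest Γ V (k + 1 + 1)) :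
    merge ρ i (merge ρ j.succ φ) = merge ρ j (merge ρ i.castSucc φ) := by
  refine crossTest_ext fun c x => ?_
  simp only [comp_merge]
  rcases hij.lt_or_eq with hij | rfl
  · rw [Finset.sum_comm]
    simp only [splitLabel_comm hij, splitPoint_comm ρ hij]
  · simp only [splitLabel_assoc, splitPoint_assoc]
    rw [Finset.sum_comm (s := (Finset.univ : Finset Γ)) (t := (Finset.univ : Finset Γ))
      (f := fun x_1 x_2 => comp φ (splitLabel i.castSucc x_2 (splitLabel i x_1 c))
        (splitPoint ρ i.castSucc x_2 (splitPoint ρ i x_1 x)))]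
    exact Finset.sum_congr rfl fun h _ => Fintype.sum_equiv (Equiv.mulLeft h) _ _ fun h' => rfl

theorem consSlice_merge_succ (i : Fin k) (q : Γ × V) (φ : crossTest Γ V (k + 1 + 1)) :
    consSlice q (merge ρ i.succ φ) = merge ρ i (consSlice q φ) := by
  obtain ⟨g, t⟩ := q
  refine crossTest_ext fun c x => ?_
  simp only [comp_consSlice, comp_merge]
  refine Finset.sum_congr rfl fun h _ => ?_
  congr 1
  · funext l
    refine Fin.cases ?_ (fun l => ?_) l
    · simp [splitLabel, Fin.ext_iff]
    · simp [splitLabel, Fin.ext_iff]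
  · funext l
    refine Fin.cases ?_ (fun l => ?_) l
    · simp [splitPoint, Fin.ext_iff]
    · simp [splitPoint, Fin.ext_iff]

theorem snocSlice_merge_castSucc (i : Fin k) (q : Γ × V) (φ : crossTest Γ V (k + 1 + 1)) :
    snocSlice q (merge ρ i.castSucc φ) = merge ρ i (snocSlice q φ) := by
  obtain ⟨g, t⟩ := q
  refine crossTest_ext fun c x => ?_
  simp only [comp_snocSlice, comp_merge]
  refine Finset.sum_congr rfl fun h _ => ?_
  have hi := i.2
  congr 1
  · funext l
    refine Fin.lastCases ?_ (fun l => ?_) l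
    · have h1 : (k + 1 : ℕ) ≠ i := by omega
      have h2 : (k : ℕ) ≠ i := by omega
      simp [splitLabel, Fin.ext_iff, h1, h2]
    · simp [splitLabel, Fin.ext_iff]
  · funext l
    refine Fin.lastCases ?_ (fun l => ?_) l
    · have h2 : (k : ℕ) ≠ i := by omega
      simp [splitPoint, Fin.ext_iff, h2]
    · simp [splitPoint, Fin.ext_iff]

theorem consSlice_snocSlice (q q' : Γ × V) (φ : crossTest Γ V (k + 1 + 1)) :
    consSlice q (snocSlice q' φ) = snocSlice q' (consSlice q φ) := by
  obtain ⟨g, t⟩ := q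
  obtain ⟨g', t'⟩ := q'
  refine crossTest_ext fun c x => ?_
  simp only [comp_consSlice, comp_snocSlice, Fin.cons_snoc_eq_snoc_cons]

theorem consSlice_merge_zero (h : Γ) (t : V) (φ : crossTest Γ V (k + 1 + 1)) :
    consSlice (h, t) (merge ρ 0 φ) =
      ∑ h', consSlice (h'⁻¹ * h, ρ h'⁻¹ t) (consSlice (h', t) φ) := by
  refine crossTest_ext fun c x => ?_
  simp only [comp_sum, comp_consSlice, comp_merge]
  refine Finset.sum_congr rfl fun h' _ => ?_
  congr 1
  · funext l
    refine Fin.cases ?_ (fun l => Fin.cases ?_ (fun l => ?_) l) l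
    · simp [splitLabel]
    · simp [splitLabel]
    · simp [splitLabel, Fin.ext_iff]
  · funext l
    refine Fin.cases ?_ (fun l => Fin.cases ?_ (fun l => ?_) l) l
    · simp [splitPoint]
    · simp [splitPoint]
    · simp [splitPoint, Fin.ext_iff]

theorem snocSlice_merge_last (g : Γ) (t : V) (φ : crossTest Γ V (k + 1 + 1)) :
    snocSlice (g, t) (merge ρ (Fin.last k) φ) =
      ∑ h, snocSlice (h, t) (snocSlice (h⁻¹ * g, ρ h⁻¹ t) φ) := by
  refine crossTest_ext fun c x => ?_
  simp only [comp_sum, comp_snocSlice, comp_merge]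
  refine Finset.sum_congr rfl fun h _ => ?_
  congr 1
  · funext l
    refine Fin.lastCases ?_ (fun l => Fin.lastCases ?_ (fun l => ?_) l) l
    · simp [splitLabel, Fin.ext_iff]
    · simp [splitLabel]
    · have := l.2
      have h1 : (l : ℕ) ≠ k := by omega
      have h2 : (l : ℕ) ≠ k + 1 := by omega
      have h3 : (Fin.last k).predAbove l.castSucc.castSucc = l.castSucc := by
        simp only [predAbove_eq, Fin.ext_iff]
        simp [this.le, not_lt]
      simp [splitLabel, Fin.ext_iff, h1, h2, h3]
  · funext l
    refine Fin.lastCases ?_ (fun l => Fin.lastCases ?_ (fun l => ?_) l) l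
    · simp [splitPoint]
    · simp [splitPoint, Fin.ext_iff]
    · have := l.2
      have h2 : (l : ℕ) ≠ k + 1 := by omega
      have h3 : (Fin.last k).predAbove l.castSucc.castSucc = l.castSucc := by
        simp only [predAbove_eq, Fin.ext_iff]
        simp [this.le, not_lt]
      simp [splitPoint, Fin.ext_iff, h2, h3]

section Faces

variable {N : Type*} [AddCommGroup N] [Module ℝ N]

/-- The cosimplicial identities. Linearity of `E` enters only where the action of `A ⋊ Γ` from the
left or the right meets a product of two arguments, since such a product is a sum over labels. -/
theorem face_face {i j : Fin (k + 2)} (hij : i ≤ j) {E : crossTest Γ V k → Γ × V → N}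
    (hE : IsLinearMap ℝ E) :
    face ρ j.succ (face ρ i E) = face ρ i.castSucc (face ρ j E) := by
  have hsum : ∀ (f : Γ → crossTest Γ V k) (q : Γ × V), E (∑ h, f h) q = ∑ h, E (f h) q := by
    intro f q
    have := congrFun (map_sum (hE.mk' E) f Finset.univ) q
    rw [Finset.sum_apply] at this
    exact this
  induction i using Fin.cases with
  | zero =>
    induction j using Fin.cases with
    | zero =>
      have e : (0 : Fin (k + 2)).succ = (Fin.castSucc 0 : Fin (k + 2)).succ := rfl
      rw [e, face_succ_castSucc]
      rw [Fin.castSucc_zero]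
      simp only [face_zero]
      funext φ q
      simp only [faceM, face0, consSlice_merge_zero, hsum]
      rw [Finset.sum_comm]
      refine Finset.sum_congr rfl fun h _ => ?_
      refine Fintype.sum_equiv (Equiv.mulLeft h⁻¹) _ _ fun h' => ?_
      simp [mul_assoc]
    | succ j =>
      induction j using Fin.lastCases with
      | last =>
        simp only [Fin.succ_last, face_last, Fin.castSucc_zero, face_zero]
        funext φ q
        simp only [faceL, face0, consSlice_snocSlice]
        rw [Finset.sum_comm]
        refine Finset.sum_congr rfl fun h _ => ?_
        refine Fintype.sum_equiv (Equiv.mulLeft h⁻¹) _ _ fun h' => ?_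
        simp [mul_assoc]
      | cast j =>
        have e : face (N := N) ρ j.castSucc.succ.succ = faceM ρ j.succ := by
          rw [Fin.succ_castSucc, face_succ_castSucc]
        rw [e, face_succ_castSucc]
        simp only [Fin.castSucc_zero, face_zero]
        funext φ q
        simp only [faceM, face0, consSlice_merge_succ]
  | succ i =>
    induction j using Fin.cases with
    | zero => simp at hij
    | succ j =>
      induction j using Fin.lastCases with
      | last =>
        induction i using Fin.lastCases with
        | last =>
          rw [← Fin.succ_castSucc, face_succ_castSucc]
          simp only [Fin.succ_last, face_last]
          funext φ q
          simp only [faceM, faceL, snocSlice_merge_last, hsum]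
          rw [Finset.sum_comm]
          refine Finset.sum_congr rfl fun h _ => ?_
          refine Fintype.sum_equiv (Equiv.mulLeft h⁻¹) _ _ fun h' => ?_
          simp [mul_assoc]
        | cast i =>
          simp only [Fin.succ_last, face_last]
          rw [← Fin.succ_castSucc, face_succ_castSucc, face_succ_castSucc]
          funext φ q
          simp only [faceM, faceL, snocSlice_merge_castSucc]
      | cast j =>
        induction i using Fin.lastCases with
        | last =>
          have := j.2
          simp [Fin.le_def] at hij
          omega
        | cast i =>
          have e : face (N := N) ρ j.castSucc.succ.succ = faceM ρ j.succ := by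
            rw [Fin.succ_castSucc, face_succ_castSucc]
          rw [e, ← Fin.succ_castSucc, face_succ_castSucc, face_succ_castSucc, face_succ_castSucc]
          funext φ q
          simp only [faceM]
          rw [merge_merge ρ (by simpa using hij)]

/-- The term at `(j + 1, i)` cancels the one at `(i, j)` for `i ≤ j`, the signs being opposite.
`split` separates the outer indices at most `i` from those above `i`. -/
theorem alternating_sum_eq_zero {n : ℕ} (a : Fin (n + 1) → Fin n → N)
    (h : ∀ i j : Fin n, i ≤ j → a j.succ i = a i.castSucc j) :
    ∑ j : Fin (n + 1), ∑ i : Fin n, (-1 : ℝ) ^ (j : ℕ) • (-1 : ℝ) ^ (i : ℕ) • a j i = 0 := by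
  have split : ∀ (i : Fin n) (f : Fin (n + 1) → N), ∑ j, f j =
      (∑ j : Fin n, if j ≤ i then f j.castSucc else 0) +
        ∑ j : Fin n, if i ≤ j then f j.succ else 0 := by
    intro i f
    rw [Fin.sum_univ_succAbove f i.succ]
    have e : ∀ j : Fin n, f (i.succ.succAbove j) =
        (if j ≤ i then f j.castSucc else 0) + ((if i ≤ j then f j.succ else 0) -
          if i = j then f i.succ else 0) := by
      intro j
      simp only [Fin.succAbove, Fin.castSucc_lt_succ_iff]
      rcases lt_trichotomy i j with h | rfl | h
      · simp [h.le, h.not_ge, h.ne]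
      · simp
      · simp [h.le, h.not_ge, h.ne']
    simp only [e, Finset.sum_add_distrib, Finset.sum_sub_distrib, Finset.sum_ite_eq,
      Finset.mem_univ, if_true]
    abel
  rw [Finset.sum_comm]
  simp only [fun i => split i fun j => (-1 : ℝ) ^ (j : ℕ) • (-1 : ℝ) ^ (i : ℕ) • a j i,
    Finset.sum_add_distrib]
  rw [Finset.sum_comm (s := (Finset.univ : Finset (Fin n))), ← Finset.sum_add_distrib]
  refine Finset.sum_eq_zero fun i _ => ?_
  rw [← Finset.sum_add_distrib]
  refine Finset.sum_eq_zero fun j _ => ?_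
  split_ifs with hij
  · rw [h i j hij, smul_smul, smul_smul, ← add_smul]
    simp [pow_succ, mul_comm]
  · simp

/-- Faces as linear maps. -/
def faceₗ (j : Fin (k + 2)) :
    (crossTest Γ V k → Γ × V → N) →ₗ[ℝ] crossTest Γ V (k + 1) → Γ × V → N where
  toFun := face ρ j
  map_add' := face_add ρ j
  map_smul' := face_smul ρ j

theorem hochB_hochB {F : crossTest Γ V k → Γ × V → ℝ} (hF : IsLinearMap ℝ F) :
    hochB ρ (k + 1) (hochB ρ k F) = 0 := by
  rw [hochB_eq ρ F, hochB_eq]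
  have e : ∀ j : Fin (k + 3), face ρ j (∑ i : Fin (k + 2), (-1 : ℝ) ^ (i : ℕ) • face ρ i F) =
      ∑ i : Fin (k + 2), (-1 : ℝ) ^ (i : ℕ) • face ρ j (face ρ i F) := fun j =>
    (map_sum (faceₗ ρ j) _ _).trans (Finset.sum_congr rfl fun i _ => map_smul (faceₗ ρ j) _ _)
  simp only [e, Finset.smul_sum]
  exact alternating_sum_eq_zero (fun j i => face ρ j (face ρ i F)) fun i j hij => face_face ρ hij hF

theorem bar_bar {E : crossTest Γ V k → Γ × V → N} (hE : IsLinearMap ℝ E) :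
    bar ρ (bar ρ E) = 0 := by
  have e : ∀ j : Fin (k + 3), face ρ j (bar ρ E) =
      ∑ i : Fin (k + 1), (-1 : ℝ) ^ (i : ℕ) • face ρ j (face ρ i.castSucc E) := fun j =>
    (map_sum (faceₗ ρ j) _ _).trans (Finset.sum_congr rfl fun i _ => map_smul (faceₗ ρ j) _ _)
  rw [bar]
  simp only [e, Finset.smul_sum]
  refine alternating_sum_eq_zero (fun (j : Fin (k + 2)) (i : Fin (k + 1)) =>
    face ρ j.castSucc (face ρ i.castSucc E)) fun i j hij => ?_
  rw [← Fin.succ_castSucc]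
  exact face_face ρ (by simpa using hij) hE

end Faces

end Identities
/-! ### Cochains on functions on `V` -/

section Functions

universe u v

variable {Γ : Type u} {V : Type v} [NormedAddCommGroup V] [Group Γ] [Fintype Γ]
  [InnerProductSpace ℝ V] [FiniteDimensional ℝ V] {k : ℕ} (ρ : Γ →* (V ≃ₗᵢ[ℝ] V))

/-- Substitution of the first argument. -/
def tCons (t : V) (ψ : testFun V (k + 1)) : testFun V k :=
  ⟨fun y => ψ.1 (Fin.cons t y), comp_mem_testFun ψ.2 (j := fun y : Fin k → V => Fin.cons t y)
    (r := fun x i => x i.succ) (contDiff_cons contDiff_const contDiff_id) (by fun_prop)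
    (fun x => by ext i; simp)⟩

/-- Substitution of the last argument. -/
def tSnoc (t : V) (ψ : testFun V (k + 1)) : testFun V k :=
  ⟨fun y => ψ.1 (Fin.snoc (α := fun _ => V) y t), comp_mem_testFun ψ.2
    (j := fun y : Fin k → V => Fin.snoc (α := fun _ => V) y t)
    (r := fun x i => x i.castSucc) (contDiff_snoc contDiff_const contDiff_id) (by fun_prop)
    (fun x => by ext i; simp)⟩

/-- Multiplication of two consecutive arguments. -/
def tMerge (i : Fin k) (ψ : testFun V (k + 1)) : testFun V k :=
  ⟨fun y => ψ.1 fun l => y (i.predAbove l), comp_mem_testFun ψ.2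
    (j := fun (y : Fin k → V) l => y (i.predAbove l))
    (r := fun x l => x (i.succ.succAbove l)) (contDiff_pi.2 fun l => contDiff_apply ℝ V _)
    (by fun_prop) (fun x => by
      funext l
      have h := congrFun (splitPoint_succAbove (1 : Unit →* (V ≃ₗᵢ[ℝ] V)) i 1 x) l
      have h0 : i.succ.succAbove l ≠ i.succ := Fin.succAbove_ne _ _
      simpa only [splitPoint, h0, if_false] using h)⟩

/-- The coboundary on cochains on functions on `V` with values in the crossed product. -/
def bA (k : ℕ) : (testFun V k → Γ × V → ℝ) →ₗ[ℝ] (testFun V (k + 1) → Γ × V → ℝ) where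
  toFun f := fun ψ q => f (tCons q.2 ψ) q + (∑ i : Fin k, (-1 : ℝ) ^ ((i : ℕ) + 1) * f (tMerge i ψ) q)
    + (-1 : ℝ) ^ (k + 1) * f (tSnoc (ρ q.1⁻¹ q.2) ψ) q
  map_add' f g := by
    funext φ q
    simp only [Pi.add_apply, Finset.sum_add_distrib, mul_add]
    ring
  map_smul' c f := by
    funext φ q
    simp only [Pi.smul_apply, smul_eq_mul, RingHom.id_apply, mul_add, Finset.mul_sum]
    congr 1
    · congr 1
      exact Finset.sum_congr rfl fun i _ => by ring
    · ring

theorem bA_apply (f : testFun V k → Γ × V → ℝ) (ψ : testFun V (k + 1)) (q : Γ × V) :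
    bA ρ k f ψ q = f (tCons q.2 ψ) q + (∑ i : Fin k, (-1 : ℝ) ^ ((i : ℕ) + 1) * f (tMerge i ψ) q)
      + (-1 : ℝ) ^ (k + 1) * f (tSnoc (ρ q.1⁻¹ q.2) ψ) q := rfl

/-! ### Restriction to the functions on `V`, as a cochain map and as a left inverse of `T₂`. -/

section Restrict

open Classical in
theorem comp_extendUnit (ψ : testFun V k) (c : Fin k → Γ) (x : Fin k → V) :
    comp (extendUnit ψ) c x = if ∀ i, c i = 1 then ψ.1 x else 0 := rfl

open Classical in
theorem consSlice_extendUnit_one (t : V) (ψ : testFun V (k + 1)) :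
    consSlice ((1 : Γ), t) (extendUnit ψ) = extendUnit (tCons t ψ) := by
  refine crossTest_ext fun c x => ?_
  simp only [comp_consSlice, comp_extendUnit]
  exact if_congr (by rw [Fin.forall_fin_succ]; simp) rfl rfl

open Classical in
theorem consSlice_extendUnit_ne {h : Γ} (hh : h ≠ 1) (t : V) (ψ : testFun V (k + 1)) :
    consSlice (h, t) (extendUnit ψ) = 0 := by
  refine crossTest_ext fun c x => ?_
  simp only [comp_consSlice, comp_extendUnit]
  exact if_neg (by rw [Fin.forall_fin_succ]; simp [hh])

open Classical in
theorem snocSlice_extendUnit_one (t : V) (ψ : testFun V (k + 1)) :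
    snocSlice ((1 : Γ), t) (extendUnit ψ) = extendUnit (tSnoc t ψ) := by
  refine crossTest_ext fun c x => ?_
  simp only [comp_snocSlice, comp_extendUnit]
  exact if_congr (by rw [Fin.forall_fin_succ']; simp) rfl rfl

open Classical in
theorem snocSlice_extendUnit_ne {h : Γ} (hh : h ≠ 1) (t : V) (ψ : testFun V (k + 1)) :
    snocSlice (h, t) (extendUnit ψ) = 0 := by
  refine crossTest_ext fun c x => ?_
  simp only [comp_snocSlice, comp_extendUnit]
  exact if_neg (by rw [Fin.forall_fin_succ']; simp [hh])

theorem splitPoint_one (i : Fin k) (x : Fin k → V) :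
    splitPoint ρ i 1 x = fun l => x (i.predAbove l) := by
  funext l
  unfold splitPoint
  split_ifs with h
  · subst h; simp
  · rfl

theorem splitLabel_eq_one_iff (i : Fin k) (h : Γ) (c : Fin k → Γ) :
    (∀ l, splitLabel i h c l = 1) ↔ h = 1 ∧ ∀ l, c l = 1 := by
  constructor
  · intro H
    have h1 : h = 1 := by simpa [splitLabel] using H i.castSucc
    refine ⟨h1, fun l => ?_⟩
    have hl := H (i.succ.succAbove l)
    have h0 : i.succ.succAbove l ≠ i.succ := Fin.succAbove_ne _ _
    -- The index identity `i.predAbove (i.succ.succAbove l) = l` is read off from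
    -- `splitPoint_succAbove` for a trivial action on `ℝ` and the injective family `l ↦ (l : ℝ)`.
    have h2 := congrFun (splitPoint_succAbove (1 : Unit →* (ℝ ≃ₗᵢ[ℝ] ℝ)) i 1
      (fun l => (l : ℝ))) l
    simp only [splitPoint, h0, if_false, Nat.cast_inj, Fin.val_inj] at h2
    by_cases h3 : l = i
    · subst h3
      have := H l.succ
      have h4 : l.succ ≠ l.castSucc := by simp [Fin.ext_iff]
      simpa [splitLabel, h4, h1] using this
    · have h4 : i.succ.succAbove l ≠ i.castSucc := by
        intro e
        rw [e] at h2
        simp at h2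
        exact h3 h2.symm
      simpa [splitLabel, h0, h4, h2] using hl
  · rintro ⟨rfl, hc⟩ l
    simp [splitLabel, hc]

open Classical in
theorem merge_extendUnit (i : Fin k) (ψ : testFun V (k + 1)) :
    merge ρ i (extendUnit (Γ := Γ) ψ) = extendUnit (tMerge i ψ) := by
  refine crossTest_ext fun c x => ?_
  simp only [comp_merge, comp_extendUnit]
  rw [Finset.sum_eq_single 1 (fun h _ hh => if_neg fun H => hh ((splitLabel_eq_one_iff i h c).1 H).1)
    (by simp), splitPoint_one]
  exact if_congr (by simp [splitLabel_eq_one_iff]) rfl rfl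

/-- Arrows with label `e` are closed under splitting only into arrows with label `e`, so in each sum
over labels one term survives; the others are values of `F` at `0`. In the last face the surviving
label is that of `q`, which explains the point `γ⁻¹ t` in `bA`. -/
theorem restrict_hochB {F : crossTest Γ V k → Γ × V → ℝ} (hF : F 0 = 0) :
    restrict (hochB ρ k F) = bA ρ k (restrict F) := by
  funext ψ q
  simp only [restrict, hochB, LinearMap.coe_mk, AddHom.coe_mk, bA_apply, merge_extendUnit]
  rw [Finset.sum_eq_single 1
    (fun h _ hh => by rw [consSlice_extendUnit_ne hh, hF]; rfl) (by simp),
    Finset.sum_eq_single q.1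
    (fun h _ hh => by
      rw [snocSlice_extendUnit_ne (by simpa [inv_mul_eq_one] using hh), hF]; rfl) (by simp)]
  simp [consSlice_extendUnit_one, snocSlice_extendUnit_one]

theorem twist_one_extendUnit (ψ : testFun V k) : twist ρ 1 (extendUnit ψ) = ψ := by
  refine Subtype.ext (funext fun x => ?_)
  have h : ∀ j, Fin.partialProd (1 : Fin k → Γ) j = 1 := fun j => by
    induction j using Fin.induction with
    | zero => simp
    | succ j ih => rw [Fin.partialProd_succ, ih]; simp
  simp [twist, extendUnit, h]

/-- Only the tuple of trivial labels contributes, and for it the twist is trivial. Hence the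
composition of `L₁` with `T₂` is the averaging. -/
theorem restrict_T₂ {f : testFun V k → Γ × V → ℝ} (hf : f 0 = 0) : restrict (T₂ ρ f) = f := by
  funext ψ q
  simp only [restrict, T₂]
  rw [Finset.sum_eq_single 1]
  · rw [twist_one_extendUnit]
    have h : ∀ j, Fin.partialProd (1 : Fin k → Γ) j = 1 := fun j => by
      induction j using Fin.induction with
      | zero => simp
      | succ j ih => rw [Fin.partialProd_succ, ih]; simp
    simp [h]
  · intro c _ hc
    have e : twist ρ c (extendUnit ψ) = 0 := by
      refine Subtype.ext (funext fun x => ?_)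
      have : ¬ ∀ i, c i = 1 := fun h => hc (funext h)
      simp [twist, extendUnit, this]
    rw [e, hf]; rfl
  · simp

end Restrict

/-! ### The action of the group on cochains and the averaging projection. -/

section Action

/-- Diagonal translation of the arguments. -/
def tMap (g : Γ) (ψ : testFun V k) : testFun V k :=
  ⟨fun x => ψ.1 fun i => ρ g (x i),
      comp_mem_testFun ψ.2 (j := fun (x : Fin k → V) i => ρ g (x i))
        (r := fun (x : Fin k → V) i => ρ g⁻¹ (x i))
        (contDiff_pi.2 fun i => (ρ g).contDiff.comp (contDiff_apply ℝ V i))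
        (by fun_prop)
        (fun x => by
          funext i
          change ρ g⁻¹ (ρ g (x i)) = x i
          rw [← rho_mul]; simp)⟩

theorem act_apply (g : Γ) (f : testFun V k → Γ × V → ℝ) (ψ : testFun V k) (q : Γ × V) :
    act ρ g f ψ q = f (tMap ρ g ψ) (g⁻¹ * q.1 * g, ρ g⁻¹ q.2) := rfl

theorem act_act (g h : Γ) (f : testFun V k → Γ × V → ℝ) :
    act ρ g (act ρ h f) = act ρ (g * h) f := by
  funext ψ q
  have e : tMap ρ h (tMap ρ g ψ) = tMap ρ (g * h) ψ :=
    Subtype.ext (funext fun x => by simp [tMap])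
  simp only [act_apply, e, mul_inv_rev, rho_mul, mul_assoc]

/-- The action as a linear map. -/
def actₗ (g : Γ) : (testFun V k → Γ × V → ℝ) →ₗ[ℝ] (testFun V k → Γ × V → ℝ) where
  toFun := act ρ g
  map_add' _ _ := rfl
  map_smul' _ _ := rfl

theorem act_avg (g : Γ) (f : testFun V k → Γ × V → ℝ) : act ρ g (avg ρ f) = avg ρ f := by
  have h : actₗ ρ g (avg ρ f) = avg ρ f := by
    unfold avg
    rw [map_smul, map_sum]
    congr 1
    exact Fintype.sum_equiv (Equiv.mulLeft g) _ _ fun h => act_act ρ g h f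
  exact h

theorem avg_eq_self {f : testFun V k → Γ × V → ℝ} (hf : ∀ g, act ρ g f = f) : avg ρ f = f := by
  unfold avg
  simp only [hf, Finset.sum_const, Finset.card_univ]
  rw [← Nat.cast_smul_eq_nsmul ℝ, smul_smul, inv_mul_cancel₀ (by simp), one_smul]

theorem bA_act (g : Γ) (f : testFun V k → Γ × V → ℝ) :
    bA ρ k (act ρ g f) = act ρ g (bA ρ k f) := by
  funext ψ q
  simp only [bA_apply, act_apply]
  congr 2
  · congr 2
    refine Subtype.ext (funext fun x => congrArg ψ.1 (funext fun i => ?_))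
    refine Fin.cases ?_ (fun i => ?_) i
    · simp
    · simp
  · congr 2
    refine Subtype.ext (funext fun x => congrArg ψ.1 (funext fun i => ?_))
    refine Fin.lastCases ?_ (fun i => ?_) i
    · simp [mul_assoc]
    · simp

theorem bA_avg (f : testFun V k → Γ × V → ℝ) : bA ρ k (avg ρ f) = avg ρ (bA ρ k f) := by
  unfold avg
  rw [map_smul, map_sum]
  simp only [bA_act]

end Action

/-! ### Compatibility of the Eilenberg-Zilber map with the coboundaries. -/

section EilenbergZilber

/-- Splitting a label inserts one new partial product at `i + 1` and leaves the others as they were.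
Therefore the twists on both sides of an inner face agree. -/
theorem partialProd_splitLabel (i : Fin k) (h : Γ) (c : Fin k → Γ) (l : Fin (k + 1)) :
    Fin.partialProd (splitLabel i h c) l.castSucc =
      if l = i.succ then Fin.partialProd c i.castSucc * h
      else Fin.partialProd c (i.predAbove l).castSucc := by
  induction l using Fin.induction with
  | zero =>
    have h0 : (0 : Fin (k + 1)) ≠ i.succ := (Fin.succ_ne_zero i).symm
    have h1 : (i.predAbove 0).castSucc = 0 := by simp [predAbove_eq]
    rw [if_neg h0, h1]
    simp
  | succ l ih =>
    rw [Fin.castSucc_succ, Fin.partialProd_succ, ih]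
    by_cases h1 : l = i
    · subst h1
      have h2 : l.castSucc ≠ l.succ := by simp [Fin.ext_iff]
      simp [splitLabel, h2]
    · have h2 : l.succ ≠ i.succ := by simpa using h1
      have h3 : l.castSucc ≠ i.castSucc := by simpa using h1
      rw [if_neg h2]
      by_cases h4 : l.castSucc = i.succ
      · have h6 : (i.predAbove l.succ).castSucc = i.succ := by
          simp only [Fin.ext_iff, predAbove_eq, Fin.val_succ, Fin.val_castSucc] at *
          split_ifs <;> omega
        rw [if_pos h4, h6, Fin.partialProd_succ]
        simp [splitLabel, h4, Fin.ext_iff]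
      · have h6 : (i.predAbove l.succ).castSucc = (i.predAbove l.castSucc).succ := by
          simp only [Fin.ext_iff, predAbove_eq, Fin.val_succ, Fin.val_castSucc] at *
          split_ifs <;> omega
        rw [if_neg h4, h6, Fin.partialProd_succ]
        simp [splitLabel, h3, h4]

theorem partialProd_splitLabel_last (i : Fin k) (h : Γ) (c : Fin k → Γ) :
    Fin.partialProd (splitLabel i h c) (Fin.last (k + 1)) =
      Fin.partialProd c (Fin.last k) := by
  rw [← Fin.succ_last, Fin.partialProd_succ, partialProd_splitLabel]
  by_cases h1 : Fin.last k = i.succ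
  · have h2 : Fin.last k ≠ i.castSucc := fun h => by simp [h, Fin.ext_iff] at h1
    rw [if_pos h1, h1, Fin.partialProd_succ]
    have h3 : i.succ ≠ i.castSucc := by simp [Fin.ext_iff]
    simp [splitLabel, h3]
  · have hi := i.2
    have h2 : Fin.last k ≠ i.castSucc := by simp [Fin.ext_iff]; omega
    have h3 : Fin.last k = (i.predAbove (Fin.last k)).succ := by
      simp only [Fin.ext_iff, predAbove_eq, Fin.val_succ, Fin.val_last] at *
      split_ifs; omega
    conv_rhs => rw [h3, Fin.partialProd_succ]
    simp [splitLabel, h1, h2]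

theorem twist_merge (i : Fin k) (c : Fin k → Γ) (φ : crossTest Γ V (k + 1)) :
    twist ρ c (merge ρ i φ) = ∑ h, tMerge i (twist ρ (splitLabel i h c) φ) := by
  refine Subtype.ext (funext fun y => ?_)
  have e : (∑ h, tMerge i (twist ρ (splitLabel i h c) φ)).1 y =
      ∑ h, (tMerge i (twist ρ (splitLabel i h c) φ)).1 y := by
    rw [AddSubmonoidClass.coe_finsetSum, Finset.sum_apply]
  rw [e]
  refine (comp_merge ρ i φ c _).trans (Finset.sum_congr rfl fun h _ => ?_)
  refine congrArg φ.1 (funext fun l => ?_)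
  simp only [partialProd_splitLabel, splitPoint]
  by_cases hl : l = i.succ
  · subst hl
    simp
  · simp [hl]

/-- Labels of length `k + 1` are obtained from labels of length `k` by splitting. -/
def splitEquiv (i : Fin k) : Γ × (Fin k → Γ) ≃ (Fin (k + 1) → Γ) where
  toFun p := splitLabel i p.1 p.2
  invFun d := (d i.castSucc, fun l => if l = i then d i.castSucc * d i.succ
    else d (i.succ.succAbove l))
  left_inv p := by
    have h1 : i.succ ≠ i.castSucc := by simp [Fin.ext_iff]
    refine Prod.ext (by simp [splitLabel]) (funext fun l => ?_)
    by_cases hl : l = i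
    · subst hl; simp [splitLabel, h1]
    · have h0 : i.succ.succAbove l ≠ i.succ := Fin.succAbove_ne _ _
      have h2 : i.succ.succAbove l ≠ i.castSucc := by
        simp only [Fin.succAbove, ne_eq, Fin.ext_iff, Fin.lt_def] at *
        split_ifs <;> simp at * <;> omega
      have h3 : i.predAbove (i.succ.succAbove l) = l := by
        simp only [Fin.succAbove, ne_eq, Fin.ext_iff, Fin.lt_def, predAbove_eq] at *
        split_ifs at * <;> simp at * <;> omega
      simp [splitLabel, hl, h0, h2, h3]
  right_inv d := by
    funext l
    by_cases h1 : l = i.castSucc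
    · simp [splitLabel, h1]
    by_cases h2 : l = i.succ
    · have h1 : i.succ ≠ i.castSucc := by simp [Fin.ext_iff]
      simp [splitLabel, h2, h1]
    · have h3 : i.predAbove l ≠ i := by
        simp only [ne_eq, Fin.ext_iff, predAbove_eq, Fin.val_succ, Fin.val_castSucc] at *
        split_ifs at * <;> omega
      have h4 : i.succ.succAbove (i.predAbove l) = l := by
        simp only [Fin.succAbove, ne_eq, Fin.ext_iff, Fin.lt_def, predAbove_eq, Fin.val_succ,
          Fin.val_castSucc] at *
        split_ifs at * <;> simp at * <;> omega
      simp [splitLabel, h1, h2, h3, h4]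

theorem partialProd_cons_succ (h : Γ) (c : Fin k → Γ) (j : Fin (k + 1)) :
    Fin.partialProd (Fin.cons h c : Fin (k + 1) → Γ) j.succ = h * Fin.partialProd c j := by
  rw [Fin.partialProd_succ']
  simp

theorem partialProd_snoc_castSucc (a : Γ) (c : Fin k → Γ) (j : Fin (k + 1)) :
    Fin.partialProd (Fin.snoc (α := fun _ => Γ) c a) j.castSucc = Fin.partialProd c j := by
  induction j using Fin.induction with
  | zero => simp
  | succ j ih => rw [Fin.castSucc_succ, Fin.partialProd_succ, ih, Fin.partialProd_succ]; simp

theorem twist_apply (c : Fin k → Γ) (φ : crossTest Γ V k) (x : Fin k → V) :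
    (twist ρ c φ).1 x = φ.1 fun i => (c i, ρ (Fin.partialProd c i.castSucc)⁻¹ (x i)) := rfl

theorem tMap_apply (g : Γ) (ψ : testFun V k) (x : Fin k → V) :
    (tMap ρ g ψ).1 x = ψ.1 fun i => ρ g (x i) := rfl

theorem tCons_apply (t : V) (ψ : testFun V (k + 1)) (x : Fin k → V) :
    (tCons t ψ).1 x = ψ.1 (Fin.cons t x) := rfl

theorem tSnoc_apply (t : V) (ψ : testFun V (k + 1)) (x : Fin k → V) :
    (tSnoc t ψ).1 x = ψ.1 (Fin.snoc (α := fun _ => V) x t) := rfl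

theorem consSlice_apply (q : Γ × V) (φ : crossTest Γ V (k + 1)) (p : Fin k → Γ × V) :
    (consSlice q φ).1 p = φ.1 (Fin.cons q p) := rfl

theorem snocSlice_apply (q : Γ × V) (φ : crossTest Γ V (k + 1)) (p : Fin k → Γ × V) :
    (snocSlice q φ).1 p = φ.1 (Fin.snoc (α := fun _ => Γ × V) p q) := rfl

/-- The Eilenberg-Zilber map is a cochain map on invariant cochains. -/
theorem hochB_T₂ {f : testFun V k → Γ × V → ℝ} (hf : IsLinearMap ℝ f)
    (hinv : ∀ g, act ρ g f = f) : hochB ρ k (T₂ ρ f) = T₂ ρ (bA ρ k f) := by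
  have hsum : ∀ (a : Γ → testFun V k) (q : Γ × V), f (∑ h, a h) q = ∑ h, f (a h) q := by
    intro a q
    have := congrFun (map_sum (hf.mk' f) a Finset.univ) q
    rw [Finset.sum_apply] at this
    exact this
  funext φ ⟨g, t⟩
  change (∑ h : Γ, T₂ ρ f (consSlice (h, t) φ) (h⁻¹ * g, ρ h⁻¹ t)) +
    (∑ i : Fin k, (-1 : ℝ) ^ ((i : ℕ) + 1) * T₂ ρ f (merge ρ i φ) (g, t)) +
    (-1 : ℝ) ^ (k + 1) * ∑ h : Γ, T₂ ρ f (snocSlice (h⁻¹ * g, ρ h⁻¹ t) φ) (h, t) =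
    ∑ c : Fin (k + 1) → Γ, bA ρ k f (twist ρ c φ) (g * (Fin.partialProd c (Fin.last (k + 1)))⁻¹, t)
  simp only [bA_apply, Finset.sum_add_distrib, ← Finset.mul_sum]
  congr 1
  · congr 1
    · simp only [T₂]
      rw [← Fintype.sum_prod_type']
      refine Fintype.sum_equiv (Fin.consEquiv fun _ => Γ) _ _ fun p => ?_
      obtain ⟨h, c⟩ := p
      -- The only use of invariance: splitting off the first arrow `h` translates all remaining
      -- arguments and the point of evaluation by `h`.
      conv_rhs => rw [← hinv h, act_apply]
      have e : (Fin.consEquiv fun _ => Γ) (h, c) = (Fin.cons h c : Fin (k + 1) → Γ) := rfl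
      rw [e]
      congr 2
      · refine Subtype.ext (funext fun x => ?_)
        rw [twist_apply, tMap_apply, tCons_apply, twist_apply, consSlice_apply]
        refine congrArg φ.1 (funext fun i => ?_)
        refine Fin.cases ?_ (fun i => ?_) i
        · simp
        · simp only [Fin.cons_succ, ← Fin.succ_castSucc, partialProd_cons_succ, mul_inv_rev, ← rho_mul]
          simp
      · rw [← Fin.succ_last, partialProd_cons_succ]
        simp [mul_assoc]
    · rw [Finset.sum_comm]
      refine Finset.sum_congr rfl fun i _ => ?_
      rw [← Finset.mul_sum]
      congr 1
      simp only [T₂, twist_merge, hsum]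
      rw [Finset.sum_comm, ← Fintype.sum_prod_type']
      refine Fintype.sum_equiv (splitEquiv i) _ _ fun p => ?_
      simp only [splitEquiv, Equiv.coe_fn_mk, partialProd_splitLabel_last]
  · congr 1
    simp only [T₂]
    rw [← Fintype.sum_prod_type']
    -- In the last face the split-off arrow has label `h⁻¹ g`; the sum over `h` is turned into the
    -- sum over the last label by `h ↦ h⁻¹ g`.
    refine Fintype.sum_equiv (((Equiv.inv Γ).trans (Equiv.mulRight g)).prodCongr (Equiv.refl _) |>.trans
      (Fin.snocEquiv fun _ => Γ)) _ _ fun p => ?_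
    obtain ⟨h, c⟩ := p
    simp only [Equiv.trans_apply, Equiv.prodCongr_apply, Fin.snocEquiv, Equiv.coe_fn_mk,
      Prod.map_apply, Equiv.inv_apply, Equiv.coe_mulRight, Equiv.refl_apply]
    have e : g * (Fin.partialProd (Fin.snoc (α := fun _ => Γ) c (h⁻¹ * g)) (Fin.last (k + 1)))⁻¹ =
        h * (Fin.partialProd c (Fin.last k))⁻¹ := by
      rw [← Fin.succ_last, Fin.partialProd_succ, partialProd_snoc_castSucc]
      simp [← mul_assoc]
    rw [e]
    congr 2
    refine Subtype.ext (funext fun x => ?_)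
    rw [twist_apply, tSnoc_apply, twist_apply, snocSlice_apply]
    refine congrArg φ.1 (funext fun i => ?_)
    refine Fin.lastCases ?_ (fun i => ?_) i
    · simp [partialProd_snoc_castSucc]
    · simp [partialProd_snoc_castSucc]

end EilenbergZilber

end Functions
/-! ### Properties of the localization map -/

section Localization

universe u v

variable {Γ : Type u} {V : Type v} [NormedAddCommGroup V] [Group Γ] [Fintype Γ]
  [InnerProductSpace ℝ V] [FiniteDimensional ℝ V] {k : ℕ} (ρ : Γ →* (V ≃ₗᵢ[ℝ] V))
  (ϱ : CutOff) {ε : ℝ} (hε : 0 < ε)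

theorem rho_inv_apply_self (g : Γ) (v : V) : ρ g⁻¹ (ρ g v) = v := by rw [← rho_mul]; simp

theorem rho_apply_inv_self (g : Γ) (v : V) : ρ g (ρ g⁻¹ v) = v := by rw [← rho_mul]; simp

theorem inner_rho (g : Γ) (v w : V) : inner ℝ v (ρ g w) = inner ℝ (ρ g⁻¹ v) w := by
  rw [← (ρ g⁻¹).inner_map_map v (ρ g w), rho_inv_apply_self]

theorem cutMonomial_apply (x₀ x : V) (I : Fin k → Fin (Module.finrank ℝ V)) (y : Fin k → V) :
    (cutMonomial ϱ hε x₀ x I).1 y =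
      cutPsi ϱ ε x₀ x y * ∏ j, inner ℝ (stdOrthonormalBasis ℝ V (I j)) (y j - x) := rfl

theorem chain_map (g : Γ) (a b : V) (y : Fin k → V) (j : Fin (k + 2)) :
    chain (ρ g a) (ρ g b) (fun i => ρ g (y i)) j = ρ g (chain a b y j) := by
  unfold chain
  refine Fin.cases ?_ (fun j => ?_) j
  · simp
  · refine Fin.lastCases ?_ (fun j => ?_) j <;> simp

theorem cutPsi_map (g : Γ) (a b : V) (y : Fin k → V) :
    cutPsi ϱ ε (ρ g a) (ρ g b) (fun i => ρ g (y i)) = cutPsi ϱ ε a b y := by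
  unfold cutPsi
  simp only [chain_map, ← map_sub, LinearIsometryEquiv.norm_map]

/-! #### The coboundary is annihilated -/

theorem tCons_cutMonomial (x : V) (I : Fin (k + 1) → Fin (Module.finrank ℝ V)) :
    tCons x (cutMonomial ϱ hε x x I) = 0 := by
  refine Subtype.ext (funext fun y => ?_)
  rw [tCons_apply, cutMonomial_apply, Fin.prod_univ_succ]
  simp

theorem tSnoc_cutMonomial (x₀ x : V) (I : Fin (k + 1) → Fin (Module.finrank ℝ V)) :
    tSnoc x (cutMonomial ϱ hε x₀ x I) = 0 := by
  refine Subtype.ext (funext fun y => ?_)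
  rw [tSnoc_apply, cutMonomial_apply, Fin.prod_univ_castSucc]
  simp

theorem tMerge_apply (i : Fin k) (ψ : testFun V (k + 1)) (y : Fin k → V) :
    (tMerge i ψ).1 y = ψ.1 fun l => y (i.predAbove l) := rfl

theorem tMerge_cutMonomial_swap (i : Fin k) (x₀ x : V)
    (I : Fin (k + 1) → Fin (Module.finrank ℝ V)) :
    tMerge i (cutMonomial ϱ hε x₀ x (I ∘ Equiv.swap i.castSucc i.succ)) =
      tMerge i (cutMonomial ϱ hε x₀ x I) := by
  refine Subtype.ext (funext fun y => ?_)
  rw [tMerge_apply, tMerge_apply, cutMonomial_apply, cutMonomial_apply]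
  congr 1
  refine Fintype.prod_equiv (Equiv.swap i.castSucc i.succ) _ _ fun j => ?_
  have e : i.predAbove (Equiv.swap i.castSucc i.succ j) = i.predAbove j := by
    rcases eq_or_ne j i.castSucc with rfl | h1
    · simp
    rcases eq_or_ne j i.succ with rfl | h2
    · simp
    · rw [Equiv.swap_apply_of_ne_of_ne h1 h2]
  rw [e]
  rfl

/-- Coefficients symmetric under a transposition are paired with vectors that change sign under it.
-/
theorem sum_smul_ιMulti_eq_zero {J : Type*} [Fintype J] {i j : Fin k} (hij : i ≠ j)
    (A : (Fin k → J) → ℝ) (hA : ∀ I, A (I ∘ Equiv.swap i j) = A I) (e : J → V) :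
    ∑ I : Fin k → J, A I • exteriorPower.ιMulti ℝ k (fun l => e (I l)) = 0 := by
  have h : ∑ I : Fin k → J, A I • exteriorPower.ιMulti ℝ k (fun l => e (I l)) =
      -∑ I : Fin k → J, A I • exteriorPower.ιMulti ℝ k (fun l => e (I l)) := by
    rw [← Finset.sum_neg_distrib]
    refine Fintype.sum_equiv (Equiv.arrowCongr (Equiv.swap i j) (Equiv.refl J)) _ _ fun I => ?_
    have e1 : Equiv.arrowCongr (Equiv.swap i j) (Equiv.refl J) I = I ∘ Equiv.swap i j := by
      funext l; simp [Equiv.arrowCongr]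
    have e2 : (fun l => e ((I ∘ Equiv.swap i j) l)) = (fun l => e (I l)) ∘ Equiv.swap i j := rfl
    rw [e1, hA, e2, AlternatingMap.map_swap _ _ hij]
    simp
  have h2 : (2 : ℝ) • ∑ I : Fin k → J, A I • exteriorPower.ιMulti ℝ k (fun l => e (I l)) = 0 := by
    rw [two_smul]
    nth_rw 1 [h]
    exact neg_add_cancel _
  exact (smul_eq_zero.1 h2).resolve_left two_ne_zero

/-- At a fixed point the chain of `cutMonomial` begins and ends at `x`. The outer faces put `y₁ = x`
or `y_{k+1} = x`, which kills one linear factor; an inner face puts `y_i = y_{i+1}`, which makes the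
monomial symmetric in the indices `I_i` and `I_{i+1}`. Away from fixed points the first face need
not vanish. -/
theorem L₂_bA_fixed {f : testFun V k → Γ × V → ℝ} (hf : f 0 = 0) (γ : Γ) {x : V}
    (hx : ρ γ x = x) : L₂ ρ ϱ hε (bA ρ k f) γ x = 0 := by
  unfold L₂
  have hx' : ρ γ⁻¹ x = x := by conv_lhs => rw [← hx, rho_inv_apply_self]
  simp only [hx, bA_apply, hx', tCons_cutMonomial, tSnoc_cutMonomial, hf]
  simp only [Pi.zero_apply, zero_add, mul_zero, add_zero, Finset.sum_smul]
  rw [Finset.sum_comm]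
  refine Finset.sum_eq_zero fun i _ => ?_
  exact sum_smul_ιMulti_eq_zero (i := i.castSucc) (j := i.succ) (by simp [Fin.ext_iff])
    (fun I => (-1 : ℝ) ^ ((i : ℕ) + 1) * f (tMerge i (cutMonomial ϱ hε x x I)) (γ, x))
    (fun I => by simp only [tMerge_cutMonomial_swap]) _

theorem L₃_L₂_bA {f : testFun V k → Γ × V → ℝ} (hf : f 0 = 0) :
    L₃ ρ (L₂ ρ ϱ hε (bA ρ k f)) = 0 := by
  funext γ x
  simp only [L₃, L₂_bA_fixed ρ ϱ hε hf γ x.2, map_zero]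
  rfl

/-! #### Equivariance -/

theorem tMap_cutMonomial (g : Γ) (x₀ x : V) (I : Fin k → Fin (Module.finrank ℝ V)) :
    tMap ρ g (cutMonomial ϱ hε (ρ g x₀) (ρ g x) I) = ∑ J : Fin k → Fin (Module.finrank ℝ V),
      (∏ j, inner ℝ (stdOrthonormalBasis ℝ V (I j)) (ρ g (stdOrthonormalBasis ℝ V (J j)))) •
        cutMonomial ϱ hε x₀ x J := by
  refine Subtype.ext (funext fun y => ?_)
  rw [AddSubmonoidClass.coe_finsetSum, Finset.sum_apply]
  simp only [tMap_apply, cutMonomial_apply, cutPsi_map, SetLike.val_smul, Pi.smul_apply, smul_eq_mul]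
  have e : ∀ j, inner ℝ (stdOrthonormalBasis ℝ V (I j)) (ρ g (y j) - ρ g x) =
      ∑ m, inner ℝ (stdOrthonormalBasis ℝ V (I j)) (ρ g (stdOrthonormalBasis ℝ V m)) *
        inner ℝ (stdOrthonormalBasis ℝ V m) (y j - x) := by
    intro j
    rw [← map_sub]
    conv_lhs => rw [← (stdOrthonormalBasis ℝ V).sum_repr' (y j - x)]
    simp [inner_sum, inner_smul_right, mul_comm]
  simp only [e, Fintype.prod_sum, Finset.mul_sum, Finset.prod_mul_distrib]
  exact Finset.sum_congr rfl fun J _ => by ring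

theorem sum_prod_inner_smul_ιMulti (w : Fin k → V) :
    ∑ I : Fin k → Fin (Module.finrank ℝ V),
      (∏ j, inner ℝ (stdOrthonormalBasis ℝ V (I j)) (w j)) •
        exteriorPower.ιMulti ℝ k (fun j => stdOrthonormalBasis ℝ V (I j)) =
      exteriorPower.ιMulti ℝ k w := by
  have e : w = fun j => ∑ m, inner ℝ (stdOrthonormalBasis ℝ V m) (w j) •
      stdOrthonormalBasis ℝ V m := funext fun j => ((stdOrthonormalBasis ℝ V).sum_repr' (w j)).symm
  conv_rhs => rw [e, ← AlternatingMap.coe_multilinearMap, MultilinearMap.map_sum]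
  refine Finset.sum_congr rfl fun I _ => ?_
  rw [MultilinearMap.map_smul_univ]
  rfl

/-- The cut-off is invariant under isometries. The monomials transform by the matrix of `ρ g` in the
orthonormal basis, and the same matrix expresses the rotated basis vectors in the wedge product. -/
theorem L₂_act {f : testFun V k → Γ × V → ℝ} (hf : IsLinearMap ℝ f) (g γ : Γ) (x : V) :
    L₂ ρ ϱ hε (act ρ g f) (g * γ * g⁻¹) (ρ g x) =
      exteriorPower.map k ((ρ g).toLinearEquiv : V →ₗ[ℝ] V) (L₂ ρ ϱ hε f γ x) := by
  have hsum : ∀ (J : Type) [Fintype J] (a : J → testFun V k) (q : Γ × V),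
      f (∑ h, a h) q = ∑ h, f (a h) q := by
    intro J _ a q
    have := congrFun (map_sum (hf.mk' f) a Finset.univ) q
    rw [Finset.sum_apply] at this
    exact this
  have e1 : ρ (g * γ * g⁻¹) (ρ g x) = ρ g (ρ γ x) := by
    rw [rho_mul, rho_mul, rho_inv_apply_self]
  simp only [L₂, e1, act_apply, tMap_cutMonomial, hsum, hf.map_smul, Pi.smul_apply, map_sum,
    map_smul, exteriorPower.map_apply_ιMulti, rho_inv_apply_self]
  have e2 : g⁻¹ * (g * γ * g⁻¹) * g = γ := by group
  simp only [e2, Finset.sum_smul]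
  rw [Finset.sum_comm]
  refine Finset.sum_congr rfl fun J _ => ?_
  have e3 := sum_prod_inner_smul_ιMulti fun j => ρ g (stdOrthonormalBasis ℝ V (J j))
  have e4 : (⇑((ρ g).toLinearEquiv : V →ₗ[ℝ] V) ∘ fun j => stdOrthonormalBasis ℝ V (J j)) =
      fun j => ρ g (stdOrthonormalBasis ℝ V (J j)) := rfl
  rw [e4, ← e3, Finset.smul_sum]
  exact Finset.sum_congr rfl fun I _ => by rw [smul_smul, smul_eq_mul, mul_comm]

theorem pr_ιMulti (γ : Γ) (w : Fin k → V) : pr ρ γ k (exteriorPower.ιMulti ℝ k w) =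
    ∑ S ∈ Finset.powersetCard (ell ρ γ) (Finset.univ : Finset (Fin k)),
      exteriorPower.ιMulti ℝ k fun i => (if i ∈ S then norProj ρ γ else tanProj ρ γ) (w i) := by
  classical
  unfold pr
  rw [exteriorPower.alternatingMapLinearEquiv_apply_ιMulti]
  change (∑ S ∈ Finset.powersetCard (ell ρ γ) (Finset.univ : Finset (Fin k)),
    (exteriorPower.ιMulti ℝ k).toMultilinearMap.compLinearMap (fun i =>
      if i ∈ S then norProj ρ γ else tanProj ρ γ)) w = _
  simp only [sum_apply, MultilinearMap.compLinearMap_apply, AlternatingMap.coe_multilinearMap]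

theorem tanProj_mem (γ : Γ) (v : V) : tanProj ρ γ v ∈ fixed ρ γ :=
  (fixed ρ γ).starProjection_apply_mem v

theorem norProj_mem (γ : Γ) (v : V) : norProj ρ γ v ∈ normal ρ γ :=
  (normal ρ γ).starProjection_apply_mem v

theorem tan_add_nor (γ : Γ) (v : V) : tanProj ρ γ v + norProj ρ γ v = v :=
  (fixed ρ γ).starProjection_add_starProjection_orthogonal v

theorem tanProj_eq (γ : Γ) {v : V} (hv : v ∈ fixed ρ γ) : tanProj ρ γ v = v :=
  Submodule.starProjection_eq_self_iff.2 hv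

theorem tanProj_normal (γ : Γ) {v : V} (hv : v ∈ normal ρ γ) : tanProj ρ γ v = 0 :=
  ((fixed ρ γ).starProjection_apply_eq_zero_iff).2 hv

theorem norProj_fixed (γ : Γ) {v : V} (hv : v ∈ fixed ρ γ) : norProj ρ γ v = 0 := by
  have := tan_add_nor ρ γ v
  rwa [tanProj_eq ρ γ hv, add_eq_left] at this

theorem norProj_eq (γ : Γ) {v : V} (hv : v ∈ normal ρ γ) : norProj ρ γ v = v := by
  have := tan_add_nor ρ γ v
  rwa [tanProj_normal ρ γ hv, zero_add] at this

theorem mem_fixed {γ : Γ} {v : V} : v ∈ fixed ρ γ ↔ ρ γ v = v := Iff.rfl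

theorem map_mem_fixed (g γ : Γ) {v : V} (hv : v ∈ fixed ρ γ) : ρ g v ∈ fixed ρ (g * γ * g⁻¹) :=
  (fixedMap ρ g γ ⟨v, hv⟩).2

theorem map_mem_normal (g γ : Γ) {v : V} (hv : v ∈ normal ρ γ) :
    ρ g v ∈ normal ρ (g * γ * g⁻¹) := by
  rw [Submodule.mem_orthogonal] at hv ⊢
  intro u hu
  rw [inner_rho]
  refine hv _ ?_
  have := map_mem_fixed ρ g⁻¹ _ hu
  have e : g⁻¹ * (g * γ * g⁻¹) * g⁻¹⁻¹ = γ := by group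
  rwa [e] at this

theorem tanProj_map (g γ : Γ) (v : V) : tanProj ρ (g * γ * g⁻¹) (ρ g v) = ρ g (tanProj ρ γ v) := by
  conv_lhs => rw [← tan_add_nor ρ γ v, map_add, map_add,
    tanProj_eq ρ _ (map_mem_fixed ρ g γ (tanProj_mem ρ γ v)),
    tanProj_normal ρ _ (map_mem_normal ρ g γ (norProj_mem ρ γ v)), add_zero]

theorem norProj_map (g γ : Γ) (v : V) : norProj ρ (g * γ * g⁻¹) (ρ g v) = ρ g (norProj ρ γ v) := by
  conv_lhs => rw [← tan_add_nor ρ γ v, map_add, map_add,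
    norProj_eq ρ _ (map_mem_normal ρ g γ (norProj_mem ρ γ v)),
    norProj_fixed ρ _ (map_mem_fixed ρ g γ (tanProj_mem ρ γ v)), zero_add]

/-- The representation maps the normal space of `γ` injectively into that of `g γ g⁻¹`; equality
follows by applying this to `g⁻¹` as well. -/
theorem ell_conj (g γ : Γ) : ell ρ (g * γ * g⁻¹) = ell ρ γ := by
  have key : ∀ g γ, ell ρ γ ≤ ell ρ (g * γ * g⁻¹) := fun g γ =>
    LinearMap.finrank_le_finrank_of_injective
      (f := LinearMap.restrict ((ρ g).toLinearEquiv : V →ₗ[ℝ] V)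
        fun v hv => map_mem_normal ρ g γ hv) fun a b hab => by
          refine Subtype.ext ((ρ g).injective ?_)
          exact congrArg Subtype.val hab
  refine le_antisymm ?_ (key g γ)
  have := key g⁻¹ (g * γ * g⁻¹)
  have e : g⁻¹ * (g * γ * g⁻¹) * g⁻¹⁻¹ = γ := by group
  rwa [e] at this

/-- Linear maps on an exterior power are determined by decomposable vectors. -/
theorem exteriorPower_ext {N : Type*} [AddCommGroup N] [Module ℝ N] {f g : ⋀[ℝ]^k V →ₗ[ℝ] N}
    (h : ∀ w, f (exteriorPower.ιMulti ℝ k w) = g (exteriorPower.ιMulti ℝ k w)) : f = g :=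
  exteriorPower.linearMap_ext (AlternatingMap.ext h)

theorem pr_map (g γ : Γ) (τ : ⋀[ℝ]^k V) :
    pr ρ (g * γ * g⁻¹) k (exteriorPower.map k ((ρ g).toLinearEquiv : V →ₗ[ℝ] V) τ) =
      exteriorPower.map k ((ρ g).toLinearEquiv : V →ₗ[ℝ] V) (pr ρ γ k τ) := by
  refine LinearMap.congr_fun (f := pr ρ (g * γ * g⁻¹) k ∘ₗ
    exteriorPower.map k ((ρ g).toLinearEquiv : V →ₗ[ℝ] V))
    (g := exteriorPower.map k ((ρ g).toLinearEquiv : V →ₗ[ℝ] V) ∘ₗ pr ρ γ k)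
    (exteriorPower_ext fun w => ?_) τ
  simp only [LinearMap.comp_apply, exteriorPower.map_apply_ιMulti, pr_ιMulti, map_sum, ell_conj]
  refine Finset.sum_congr rfl fun S _ => congrArg _ (funext fun i => ?_)
  change (if i ∈ S then norProj ρ (g * γ * g⁻¹) else tanProj ρ (g * γ * g⁻¹)) (ρ g (w i)) =
    ρ g ((if i ∈ S then norProj ρ γ else tanProj ρ γ) (w i))
  split_ifs
  · exact norProj_map ρ g γ _
  · exact tanProj_map ρ g γ _

theorem pr_mem (γ : Γ) (τ : ⋀[ℝ]^k V) : pr ρ γ k τ ∈ twistedPart ρ γ k := by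
  have h : (⊤ : Submodule ℝ (⋀[ℝ]^k V)) ≤ (twistedPart ρ γ k).comap (pr ρ γ k) := by
    rw [← exteriorPower.ιMulti_span ℝ k V, Submodule.span_le]
    rintro _ ⟨w, rfl⟩
    change pr ρ γ k (exteriorPower.ιMulti ℝ k w) ∈ twistedPart ρ γ k
    rw [pr_ιMulti]
    refine Submodule.sum_mem _ fun S hS => Submodule.subset_span
      ⟨S, _, (Finset.mem_powersetCard.1 hS).2, fun i hi => ?_, fun i hi => ?_, rfl⟩
    · rw [if_pos hi]; exact norProj_mem ρ γ _
    · rw [if_neg hi]; exact tanProj_mem ρ γ _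
  exact h (x := τ) trivial

theorem pr_eq_self {γ : Γ} {τ : ⋀[ℝ]^k V} (hτ : τ ∈ twistedPart ρ γ k) : pr ρ γ k τ = τ := by
  induction hτ using Submodule.span_induction with
  | zero => exact map_zero _
  | add a b _ _ ha hb => rw [map_add, ha, hb]
  | smul c a _ ha => rw [map_smul, ha]
  | mem τ h =>
    obtain ⟨S, w, hS, hn, ht, rfl⟩ := h
    rw [pr_ιMulti, Finset.sum_eq_single S]
    · refine congrArg _ (funext fun i => ?_)
      split_ifs with hi
      · exact norProj_eq ρ γ (hn i hi)
      · exact tanProj_eq ρ γ (ht i hi)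
    · intro S' hS' hne
      -- Two different sets with `ℓ` elements: some slot of `S'` lies outside `S`, so a tangential
      -- vector is projected to the normal space.
      obtain ⟨i, hi, hi'⟩ : ∃ i ∈ S', i ∉ S := by
        by_contra! h
        exact hne (Finset.eq_of_subset_of_card_le h
          (by rw [hS, (Finset.mem_powersetCard.1 hS').2]))
      refine AlternatingMap.map_coord_zero _ i ?_
      rw [if_pos hi]
      exact norProj_fixed ρ γ (ht i hi')
    · intro h
      exact (h (Finset.mem_powersetCard.2 ⟨Finset.subset_univ _, hS⟩)).elim

/-- If `ℓ(γ) > k` there are no twisted multivectors of degree `k`. -/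
theorem twistedPart_eq_bot {γ : Γ} (h : k < ell ρ γ) : twistedPart ρ γ k = ⊥ := by
  refine (Submodule.span_eq_bot).2 ?_
  rintro _ ⟨S, w, hS, -⟩
  have := S.card_le_univ
  rw [hS, Fintype.card_fin] at this
  omega

/-! #### Smoothness -/

/-- If no factor of the cut-off vanishes, the chain makes steps of length at most `√ε`. The bound
depends on the base point only through `x₀`, which gives locally uniform supports in
`pFam_cutMonomial`. -/
theorem norm_sub_le_of_cutPsi_ne_zero {x₀ x : V} {y : Fin k → V} (hne : cutPsi ϱ ε x₀ x y ≠ 0)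
    (hε : 0 < ε) (i : Fin k) : ‖y i - x₀‖ ≤ (k + 1) * √ε := by
  have hstep : ∀ j : Fin (k + 1), ‖chain x₀ x y j.castSucc - chain x₀ x y j.succ‖ ≤ √ε := by
    intro j
    have h1 := Finset.prod_ne_zero_iff.1 hne j (Finset.mem_univ _)
    have h2 : ‖chain x₀ x y j.castSucc - chain x₀ x y j.succ‖ ^ 2 / ε ≤ 3 / 4 := by
      by_contra h
      exact h1 (ϱ.eq_zero _ (not_le.1 h))
    rw [div_le_iff₀ hε] at h2
    exact Real.le_sqrt_of_sq_le (by linarith)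
  have hdist : ∀ j : Fin (k + 2), ‖chain x₀ x y j - x₀‖ ≤ (j : ℕ) * √ε := by
    intro j
    induction j using Fin.induction with
    | zero => simp [chain]
    | succ j ih =>
      have h1 := hstep j
      rw [norm_sub_rev] at h1
      calc ‖chain x₀ x y j.succ - x₀‖
          = ‖(chain x₀ x y j.succ - chain x₀ x y j.castSucc) +
              (chain x₀ x y j.castSucc - x₀)‖ := by congr 1; abel
        _ ≤ √ε + (j : ℕ) * √ε := (norm_add_le _ _).trans (add_le_add h1 (by simpa using ih))
        _ = ((j.succ : Fin (k + 2)) : ℕ) * √ε := by rw [Fin.val_succ]; push_cast; ring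
  have h := hdist i.castSucc.succ
  have e : chain x₀ x y i.castSucc.succ = y i := by
    simp only [chain, Fin.cons_succ, Fin.snoc_castSucc]
  rw [e] at h
  refine h.trans (mul_le_mul_of_nonneg_right ?_ (Real.sqrt_nonneg ε))
  have := i.2
  simp only [Fin.val_succ, Fin.val_castSucc]
  push_cast
  have : (i : ℝ) ≤ k := by exact_mod_cast i.2.le
  linarith

theorem contDiff_cutPsi_param {Y : Type*} [NormedAddCommGroup Y] [NormedSpace ℝ Y] {a b : Y → V}
    {c : Y → Fin k → V} (ha : ContDiff ℝ ∞ a) (hb : ContDiff ℝ ∞ b) (hc : ContDiff ℝ ∞ c) :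
    ContDiff ℝ ∞ fun p => cutPsi ϱ ε (a p) (b p) (c p) := by
  have hch : ∀ j : Fin (k + 2), ContDiff ℝ ∞ fun p => chain (a p) (b p) (c p) j :=
    contDiff_pi.1 (contDiff_cons ha (contDiff_snoc hb hc))
  exact contDiff_prod fun j _ => ϱ.smooth.comp ((((hch _).sub (hch _)).norm_sq ℝ).div_const ε)

/-- The cut-off monomials form a smooth family in the base point, so `PFam.usmooth` makes `L₂` of a
restricted cochain smooth. -/
theorem pFam_cutMonomial (γ : Γ) (I : Fin k → Fin (Module.finrank ℝ V)) :
    PFam fun (_ : PUnit.{max u v + 1}) (x : V) =>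
      extendUnit (Γ := Γ) (cutMonomial ϱ hε (ρ γ x) x I) := by
  refine ⟨fun A hA => ?_, fun c => USmooth.of_single ?_⟩
  · obtain ⟨R, hR⟩ := hA.isBounded.exists_norm_le
    refine ⟨Metric.closedBall 0 (R + (k + 1) * √ε), isCompact_closedBall _ _, fun _ c s hs y hy => ?_⟩
    rw [comp_extendUnit, cutMonomial_apply]
    have : cutPsi ϱ ε (ρ γ s) s y = 0 := by
      by_contra hne
      refine hy ?_
      have hR0 : 0 ≤ R := (norm_nonneg _).trans (hR s hs)
      rw [mem_closedBall_zero_iff, pi_norm_le_iff_of_nonneg (by positivity)]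
      intro i
      have h1 := norm_sub_le_of_cutPsi_ne_zero ϱ hne hε i
      calc ‖y i‖ = ‖ρ γ s + (y i - ρ γ s)‖ := by congr 1; abel
        _ ≤ R + (k + 1) * √ε := (norm_add_le _ _).trans (add_le_add (by
            rw [LinearIsometryEquiv.norm_map]; exact hR s hs) h1)
    simp [this]
  · have h : ContDiff ℝ ∞ fun p : V × (Fin k → V) => (cutMonomial ϱ hε (ρ γ p.1) p.1 I).1 p.2 := by
      refine (contDiff_cutPsi_param ϱ ((ρ γ).contDiff.comp contDiff_fst) contDiff_fst
        contDiff_snd).mul (contDiff_prod fun j _ => contDiff_const.inner ℝ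
          (((contDiff_apply ℝ V j).comp contDiff_snd).sub contDiff_fst))
    simp only [comp_extendUnit]
    by_cases hc : ∀ i, c i = 1
    · simpa only [hc, implies_true, if_true] using fun _ => h
    · simpa only [hc, if_false] using fun _ => contDiff_const

theorem dual_L₂_apply (f : testFun V k → Γ × V → ℝ) (γ : Γ) (α : Module.Dual ℝ (⋀[ℝ]^k V))
    (x : V) : α (L₂ ρ ϱ hε f γ x) = ∑ I : Fin k → Fin (Module.finrank ℝ V),
      f (cutMonomial ϱ hε (ρ γ x) x I) (γ, ρ γ x) *
        α (exteriorPower.ιMulti ℝ k fun j => stdOrthonormalBasis ℝ V (I j)) := by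
  unfold L₂
  rw [map_sum]
  exact Finset.sum_congr rfl fun I _ => map_smul _ _ _

theorem contDiff_extendUnit_cutMonomial {F : crossTest Γ V k → Γ × V → ℝ}
    (hF : F ∈ cochains Γ V k) (γ : Γ) (I : Fin k → Fin (Module.finrank ℝ V)) :
    ContDiff ℝ ∞ fun p : V × V => F (extendUnit (cutMonomial ϱ hε (ρ γ p.1) p.1 I)) (γ, p.2) := by
  have h := (pFam_cutMonomial.{u, v} ρ ϱ hε γ I).usmooth hF γ
  exact h.contDiff PUnit.unit

theorem contDiff_restrict_cutMonomial {F : crossTest Γ V k → Γ × V → ℝ} (hF : F ∈ cochains Γ V k)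
    (γ : Γ) (I : Fin k → Fin (Module.finrank ℝ V)) :
    ContDiff ℝ ∞ fun x : V => restrict F (cutMonomial ϱ hε (ρ γ x) x I) (γ, ρ γ x) := by
  have h' : ContDiff ℝ ∞ fun x : V => (x, ρ γ x) := contDiff_id.prodMk (ρ γ).contDiff
  unfold restrict
  have h := ContDiff.comp (contDiff_extendUnit_cutMonomial ρ ϱ hε hF γ I) h'
  rw [Function.comp_def] at h
  exact h

theorem contDiff_L₂ {F : crossTest Γ V k → Γ × V → ℝ} (hF : F ∈ cochains Γ V k) (γ : Γ)
    (α : Module.Dual ℝ (⋀[ℝ]^k V)) : ContDiff ℝ ∞ fun x => α (L₂ ρ ϱ hε (restrict F) γ x) := by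
  have e : (fun x => α (L₂ ρ ϱ hε (restrict F) γ x)) = fun x =>
      ∑ I : Fin k → Fin (Module.finrank ℝ V), restrict F (cutMonomial ϱ hε (ρ γ x) x I) (γ, ρ γ x) *
        α (exteriorPower.ιMulti ℝ k fun j => stdOrthonormalBasis ℝ V (I j)) :=
    funext fun x => dual_L₂_apply ρ ϱ hε _ γ α x
  rw [e]
  exact ContDiff.sum fun I _ => (contDiff_restrict_cutMonomial ρ ϱ hε hF γ I).mul contDiff_const

/-! #### Averages -/

theorem isLinearMap_restrict {F : crossTest Γ V k → Γ × V → ℝ} (hF : IsLinearMap ℝ F) :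
    IsLinearMap ℝ (restrict F) := by
  have e1 : ∀ φ ψ : testFun V k, extendUnit (Γ := Γ) (φ + ψ) = extendUnit φ + extendUnit ψ :=
    fun φ ψ => crossTest_ext fun c x => by
      classical
      simp only [comp_add, comp_extendUnit]
      split_ifs <;> simp
  have e2 : ∀ (r : ℝ) (φ : testFun V k), extendUnit (Γ := Γ) (r • φ) = r • extendUnit φ :=
    fun r φ => crossTest_ext fun c x => by
      classical
      simp only [comp_smul, comp_extendUnit]
      split_ifs <;> simp
  exact ⟨fun φ ψ => by rw [restrict, e1, hF.map_add]; rfl,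
    fun r φ => by rw [restrict, e2, hF.map_smul]; rfl⟩

/-- `L₃ L₂` as a linear map. -/
def L₃₂ : (testFun V k → Γ × V → ℝ) →ₗ[ℝ] ((γ : Γ) → fixed ρ γ → ⋀[ℝ]^k V) where
  toFun f := L₃ ρ (L₂ ρ ϱ hε f)
  map_add' f g := by
    funext γ x
    simp [L₃, L₂, add_smul, Finset.sum_add_distrib]
  map_smul' c f := by
    funext γ x
    simp [L₃, L₂, mul_smul, Finset.smul_sum]

/-- The action of the group on families of multivector fields on the fixed spaces. -/
theorem exists_conj (g γ : Γ) (x : fixed ρ γ) :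
    ∃ (γ' : Γ) (e : g * γ' * g⁻¹ = γ) (x' : fixed ρ γ'), e ▸ fixedMap ρ g γ' x' = x := by
  obtain ⟨γ', rfl⟩ : ∃ γ', g * γ' * g⁻¹ = γ := ⟨g⁻¹ * γ * g, by group⟩
  refine ⟨γ', rfl, ⟨ρ g⁻¹ x, ?_⟩, Subtype.ext (rho_apply_inv_self ρ g x)⟩
  have := map_mem_fixed ρ g⁻¹ _ x.2
  have e : g⁻¹ * (g * γ' * g⁻¹) * g⁻¹⁻¹ = γ' := by group
  rwa [e] at this

theorem L₃₂_act {f : testFun V k → Γ × V → ℝ} (hf : IsLinearMap ℝ f) (g γ : Γ) (x : fixed ρ γ) :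
    L₃₂ ρ ϱ hε (act ρ g f) (g * γ * g⁻¹) (fixedMap ρ g γ x) =
      exteriorPower.map k ((ρ g).toLinearEquiv : V →ₗ[ℝ] V) (L₃₂ ρ ϱ hε f γ x) := by
  change pr ρ _ k (L₂ ρ ϱ hε (act ρ g f) (g * γ * g⁻¹) (ρ g x)) = _
  rw [L₂_act ρ ϱ hε hf, pr_map]
  rfl

theorem avg_eq (f : testFun V k → Γ × V → ℝ) :
    L₃₂ ρ ϱ hε (avg ρ f) = (Fintype.card Γ : ℝ)⁻¹ • ∑ g, L₃₂ ρ ϱ hε (act ρ g f) := by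
  rw [avg, map_smul, map_sum]

/-- An average has the same localization if the localization is invariant. -/
theorem L₃₂_avg_eq {f : testFun V k → Γ × V → ℝ} (hf : IsLinearMap ℝ f)
    (hinv : ∀ g γ x, L₃₂ ρ ϱ hε f (g * γ * g⁻¹) (fixedMap ρ g γ x) =
      exteriorPower.map k ((ρ g).toLinearEquiv : V →ₗ[ℝ] V) (L₃₂ ρ ϱ hε f γ x)) :
    L₃₂ ρ ϱ hε (avg ρ f) = L₃₂ ρ ϱ hε f := by
  have h : ∀ g, L₃₂ ρ ϱ hε (act ρ g f) = L₃₂ ρ ϱ hε f := by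
    intro g
    funext γ x
    obtain ⟨γ', rfl, x', rfl⟩ := exists_conj ρ g γ x
    rw [L₃₂_act ρ ϱ hε hf, hinv]
  rw [avg_eq]
  simp only [h, Finset.sum_const, Finset.card_univ]
  rw [← Nat.cast_smul_eq_nsmul ℝ, smul_smul, inv_mul_cancel₀ (by simp), one_smul]

theorem isLinearMap_act {f : testFun V k → Γ × V → ℝ} (hf : IsLinearMap ℝ f) (g : Γ) :
    IsLinearMap ℝ (act ρ g f) := by
  refine ⟨fun φ ψ => ?_, fun r φ => ?_⟩
  · funext q
    have e : tMap ρ g (φ + ψ) = tMap ρ g φ + tMap ρ g ψ := rfl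
    simp only [act_apply, e, hf.map_add, Pi.add_apply]
  · funext q
    have e : tMap ρ g (r • φ) = r • tMap ρ g φ := rfl
    simp only [act_apply, e, hf.map_smul, Pi.smul_apply]

theorem isLinearMap_avg {f : testFun V k → Γ × V → ℝ} (hf : IsLinearMap ℝ f) :
    IsLinearMap ℝ (avg ρ f) := by
  refine ⟨fun φ ψ => ?_, fun r φ => ?_⟩
  · simp [avg, (isLinearMap_act ρ hf _).map_add, Finset.sum_add_distrib]
  · simp [avg, (isLinearMap_act ρ hf _).map_smul, Finset.smul_sum, smul_comm r]

theorem L_eq (F : crossTest Γ V k → Γ × V → ℝ) :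
    L ρ ϱ hε F = L₃₂ ρ ϱ hε (avg ρ (restrict F)) := rfl

theorem L_mem {F : crossTest Γ V k → Γ × V → ℝ} (hF : F ∈ cochains Γ V k) :
    L ρ ϱ hε F ∈ twistedFields ρ k := by
  have hl := isLinearMap_restrict hF.1
  refine ⟨fun γ α => ?_, fun γ x => pr_mem ρ γ _, fun g γ x => ?_⟩
  · rw [L_eq, avg_eq]
    simp only [Pi.smul_apply, Finset.sum_apply, map_smul, map_sum]
    refine (ContDiff.sum fun g _ => ?_).const_smul _
    -- Smoothness of `L₂` is known for the restricted cochain itself. Equivariance expresses each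
    -- translate in the average by the restricted cochain at a conjugate group element.
    obtain ⟨γ', rfl⟩ : ∃ γ', g * γ' * g⁻¹ = γ := ⟨g⁻¹ * γ * g, by group⟩
    have e : ∀ x : fixed ρ (g * γ' * g⁻¹), α (L₃₂ ρ ϱ hε (act ρ g (restrict F)) _ x) =
        (α ∘ₗ exteriorPower.map k ((ρ g).toLinearEquiv : V →ₗ[ℝ] V) ∘ₗ pr ρ γ' k)
          (L₂ ρ ϱ hε (restrict F) γ' (ρ g⁻¹ x)) := by
      intro x
      have h := L₂_act ρ ϱ hε hl g γ' (ρ g⁻¹ x)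
      rw [rho_apply_inv_self] at h
      change α (pr ρ _ k (L₂ ρ ϱ hε (act ρ g (restrict F)) (g * γ' * g⁻¹) x)) = _
      rw [h, pr_map]
      rfl
    simp only [e]
    exact (contDiff_L₂ ρ ϱ hε hF γ' _).comp ((ρ g⁻¹).contDiff.comp
      (fixed ρ (g * γ' * g⁻¹)).subtypeL.contDiff)
  · have h := L₃₂_act ρ ϱ hε (isLinearMap_avg ρ hl) g γ x
    rwa [act_avg] at h

theorem L_hochB {F : crossTest Γ V k → Γ × V → ℝ} (hF : F ∈ cochains Γ V k) :
    L ρ ϱ hε (hochB ρ k F) = 0 := by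
  have hl := isLinearMap_restrict hF.1
  rw [L_eq, restrict_hochB ρ hF.1.map_zero, ← bA_avg]
  exact L₃_L₂_bA ρ ϱ hε (isLinearMap_avg ρ hl).map_zero

theorem isLinearMap_L :
    IsLinearMap ℝ fun F : cochains Γ V k => L ρ ϱ hε F.1 := by
  have h : ∀ F : crossTest Γ V k → Γ × V → ℝ, L ρ ϱ hε F =
      L₃₂ ρ ϱ hε ((Fintype.card Γ : ℝ)⁻¹ • ∑ g, actₗ ρ g (restrict F)) := fun F => rfl
  have e1 : ∀ F G : crossTest Γ V k → Γ × V → ℝ, restrict (F + G) = restrict F + restrict G :=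
    fun _ _ => rfl
  have e2 : ∀ (c : ℝ) (F : crossTest Γ V k → Γ × V → ℝ), restrict (c • F) = c • restrict F :=
    fun _ _ => rfl
  refine ⟨fun F G => ?_, fun c F => ?_⟩
  · simp only [h, Submodule.coe_add, e1, map_add, Finset.sum_add_distrib, smul_add]
  · simp only [h, Submodule.coe_smul, e2, map_smul, ← Finset.smul_sum, smul_comm _ c]

end Localization
/-! ### The normal twisted cocycle -/

section Omega

universe u v

/-! ### Iterated Hadamard division in several slots. -/

section Hadamard

variable {ι X V : Type*} [NormedAddCommGroup X] [NormedSpace ℝ X] [NormedAddCommGroup V]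
  [NormedSpace ℝ V] [FiniteDimensional ℝ X] [FiniteDimensional ℝ V] {n : ℕ}

/-- Iterated difference quotients of a uniformly smooth family. -/
theorem USmooth.exists_multi_hadamard {ψ : ι → X × (Fin n → V) → ℝ} (hψ : USmooth ψ)
    (e : Fin n → V) (T : Finset (Fin n)) :
    ∃ R : ι → (X × (Fin n → V)) × (Fin n → ℝ) → ℝ, USmooth R ∧ ∀ i x P r,
      ∑ S ∈ T.powerset, (-1 : ℝ) ^ S.card * ψ i (x, fun j => if j ∈ S then P j + r j • e j else P j) =
        (∏ j ∈ T, r j) * R i ((x, P), r) := by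
  classical
  induction T using Finset.induction_on with
  | empty => exact ⟨fun i p => ψ i p.1, hψ.comp contDiff_fst, fun i x P r => by simp⟩
  | insert a T ha ih =>
    obtain ⟨R, hR, h⟩ := ih
    have hu : ContDiff ℝ ∞ fun p : ((X × (Fin n → V)) × (Fin n → ℝ)) × ℝ =>
        (((p.1.1.1, p.1.1.2 + Pi.single a (p.2 • e a)), p.1.2) : (X × (Fin n → V)) × (Fin n → ℝ)) := by
      have h1 : ContDiff ℝ ∞ fun p : ((X × (Fin n → V)) × (Fin n → ℝ)) × ℝ =>
          (Pi.single a (p.2 • e a) : Fin n → V) := by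
        have : (fun p : ((X × (Fin n → V)) × (Fin n → ℝ)) × ℝ =>
          (Pi.single a (p.2 • e a) : Fin n → V)) = fun p => p.2 • (Pi.single a (e a) : Fin n → V) :=
          funext fun p => (Pi.single_smul' a p.2 (e a))
        rw [this]
        fun_prop
      fun_prop
    -- The sum over subsets of `insert a T` is the sum for `T` at `P` minus that at the point whose
    -- slot `a` has been moved by `r a • e a`; this difference is divided by `r a`. The order of the
    -- difference produces the factor `-1`.
    obtain ⟨g, hg, hg', -⟩ := (hR.comp hu).exists_hadamard
    refine ⟨fun i p => -1 * g i (p, p.2 a), (hg.comp (u := fun p => (p, p.2 a))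
      (by fun_prop)).const_mul (-1), fun i x P r => ?_⟩
    have h0 := hg' i ((x, P), r) (r a)
    have e1 : ∀ S ∈ T.powerset, (-1 : ℝ) ^ (insert a S).card *
        ψ i (x, fun j => if j ∈ insert a S then P j + r j • e j else P j) =
        -((-1 : ℝ) ^ S.card * ψ i (x, fun j => if j ∈ S then
          (P + Pi.single a (r a • e a) : Fin n → V) j + r j • e j else (P + Pi.single a (r a • e a) : Fin n → V) j)) := by
      intro S hS
      have haS : a ∉ S := fun h => ha (Finset.mem_powerset.1 hS h)
      rw [Finset.card_insert_of_notMem haS, pow_succ]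
      have e2 : (fun j => if j ∈ insert a S then P j + r j • e j else P j) = fun j => if j ∈ S then
          (P + Pi.single a (r a • e a) : Fin n → V) j + r j • e j else (P + Pi.single a (r a • e a) : Fin n → V) j := by
        funext j
        by_cases hj : j = a
        · subst hj; simp [haS]
        · simp [hj]
      rw [e2]
      ring
    rw [Finset.sum_powerset_insert ha, Finset.sum_congr rfl e1, Finset.sum_neg_distrib, h, h,
      Finset.prod_insert ha]
    simp only [zero_smul, Pi.single_zero, add_zero] at h0
    linear_combination -(∏ j ∈ T, r j) * h0

end Hadamard

variable {Γ : Type u} {V : Type v} [NormedAddCommGroup V] [Group Γ] [Fintype Γ]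
  [InnerProductSpace ℝ V] [FiniteDimensional ℝ V] {k : ℕ} {ρ : Γ →* (V ≃ₗᵢ[ℝ] V)}
  (β : NormalCoordinates ρ) (γ : Γ)

theorem contDiff_coordY (m : Fin (ell ρ γ)) : ContDiff ℝ ∞ (coordY β γ m) :=
  (LinearMap.toContinuousLinearMap (coordY β γ m)).contDiff

theorem contDiff_coordY' (m : Fin (ell ρ γ)) : ContDiff ℝ ∞ (coordY' β γ m) :=
  (contDiff_coordY β γ m).comp (ρ γ⁻¹).contDiff

theorem contDiff_zPoint (σ : Equiv.Perm (Fin (ell ρ γ))) (i : ℕ) :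
    ContDiff ℝ ∞ (zPoint β γ σ i) := by
  refine ContDiff.add (LinearMap.toContinuousLinearMap (tanProj ρ γ)).contDiff
    (ContDiff.sum fun m _ => ContDiff.smul ?_ contDiff_const)
  split_ifs
  · exact contDiff_coordY' β γ m
  · exact contDiff_coordY β γ m

/-- One step of the chain changes a single coordinate, so it is a multiple of one basis vector, with
factor `ỹ - y`. This is what makes the numerator of `Omega` divisible by the denominator. -/
theorem zPoint_succ (σ : Equiv.Perm (Fin (ell ρ γ))) (i : Fin (ell ρ γ)) (v : V) :
    zPoint β γ σ ((i : ℕ) + 1) v = zPoint β γ σ i v +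
      (coordY' β γ (σ i) v - coordY β γ (σ i) v) • (β γ (σ i) : V) := by
  have h : ∀ m, (if (σ.symm m : ℕ) < (i : ℕ) + 1 then coordY' β γ m v else coordY β γ m v) •
      (β γ m : V) = (if (σ.symm m : ℕ) < i then coordY' β γ m v else coordY β γ m v) • (β γ m : V) +
        if m = σ i then (coordY' β γ (σ i) v - coordY β γ (σ i) v) • (β γ (σ i) : V) else 0 := by
    intro m
    by_cases hm : m = σ i
    · subst hm
      simp [← add_smul]
    · have h1 : (σ.symm m : ℕ) ≠ i := fun h => hm (by
        rw [← Fin.ext h, Equiv.apply_symm_apply])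
      have h2 : (σ.symm m : ℕ) < (i : ℕ) + 1 ↔ (σ.symm m : ℕ) < i := by omega
      simp [hm, h2]
  unfold zPoint
  rw [Finset.sum_congr rfl fun m _ => h m, Finset.sum_add_distrib, Finset.sum_ite_eq']
  simp [add_assoc]

theorem sub_rho_inv_mem_normal (v : V) : v - ρ γ⁻¹ v ∈ normal ρ γ := by
  rw [Submodule.mem_orthogonal]
  intro u hu
  rw [inner_sub_right, inner_rho, inv_inv, (mem_fixed ρ).1 hu, sub_self]

/-- On the normal space `1 - γ⁻¹` is injective, as a vector in its kernel is both fixed and normal.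
By finite dimension it is surjective. -/
theorem exists_sub_rho_inv_eq {w : V} (hw : w ∈ normal ρ γ) : ∃ v ∈ normal ρ γ, v - ρ γ⁻¹ v = w := by
  let f : normal ρ γ →ₗ[ℝ] normal ρ γ := LinearMap.codRestrict _
    ((LinearMap.id - ((ρ γ⁻¹).toLinearEquiv : V →ₗ[ℝ] V)) ∘ₗ (normal ρ γ).subtype)
    fun v => sub_rho_inv_mem_normal γ (v : V)
  have hf : ∀ v, (f v : V) = v - ρ γ⁻¹ v := fun v => rfl
  have hinj : Function.Injective f := by
    rw [← LinearMap.ker_eq_bot, LinearMap.ker_eq_bot']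
    intro v hv
    have h1 : (v : V) - ρ γ⁻¹ v = 0 := by rw [← hf, hv]; rfl
    have h2 : (v : V) ∈ fixed ρ γ := by
      rw [mem_fixed]
      conv_lhs => rw [sub_eq_zero.1 h1, rho_apply_inv_self]
    have h3 := (Submodule.mem_orthogonal _ _).1 v.2 v h2
    exact Subtype.ext (inner_self_eq_zero.1 h3)
  obtain ⟨v, hv⟩ := LinearMap.injective_iff_surjective.1 hinj ⟨w, hw⟩
  exact ⟨v, v.2, by rw [← hf, hv]⟩

theorem coordY_basis (i j : Fin (ell ρ γ)) : coordY β γ i (β γ j : V) = if i = j then 1 else 0 := by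
  simp [coordY, Finsupp.single_apply, eq_comm]

theorem coordY_fixed (i : Fin (ell ρ γ)) {v : V} (hv : v ∈ fixed ρ γ) : coordY β γ i v = 0 := by
  have : (normal ρ γ).orthogonalProjectionOnto v = 0 := by
    refine Subtype.ext ?_
    exact norProj_fixed ρ γ hv
  simp [coordY, this]

theorem sum_coordY (v : V) : ∑ m, coordY β γ m v • (β γ m : V) = norProj ρ γ v := by
  have h := congrArg (Subtype.val : normal ρ γ → V)
    ((β γ).sum_repr ((normal ρ γ).orthogonalProjectionOnto v))
  rw [AddSubmonoidClass.coe_finsetSum] at h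
  exact h

/-- The set where the denominator of the normal twisted cocycle does not vanish is dense. -/
theorem dense_coordY_ne : Dense {v | ∀ j, coordY β γ j v ≠ coordY' β γ j v} := by
  have h : {v | ∀ j, coordY β γ j v ≠ coordY' β γ j v} =
      ⋂ j, {v | coordY β γ j v ≠ coordY' β γ j v} := by ext; simp
  rw [h]
  refine dense_iInter_of_isOpen (fun j => isOpen_ne_fun (contDiff_coordY β γ j).continuous
    (contDiff_coordY' β γ j).continuous) fun j => ?_
  let K : Submodule ℝ V := LinearMap.ker (coordY β γ j -
    coordY β γ j ∘ₗ ((ρ γ⁻¹).toLinearEquiv : V →ₗ[ℝ] V))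
  have hK : {v | coordY β γ j v ≠ coordY' β γ j v} = (K : Set V)ᶜ := by
    ext v
    simp only [Set.mem_ofPred_eq, Set.mem_compl_iff, SetLike.mem_coe, K, LinearMap.mem_ker,
      LinearMap.sub_apply, sub_eq_zero]
    rfl
  rw [hK, ← interior_eq_empty_iff_dense_compl]
  by_contra hne
  have htop := Submodule.eq_top_of_nonempty_interior' K (Set.nonempty_iff_ne_empty.2 hne)
  -- The form `y_j - ỹ_j` takes the value `1` at the vector whose displacement is the `j`-th basis
  -- vector, so its kernel is a proper subspace.
  obtain ⟨v, -, hv⟩ := exists_sub_rho_inv_eq γ (β γ j).2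
  have h1 : v ∈ K := htop ▸ trivial
  have h2 : coordY β γ j v - coordY β γ j (ρ γ⁻¹ v) = 0 := h1
  rw [← map_sub, hv, coordY_basis, if_pos rfl] at h2
  exact one_ne_zero h2

/-- The numerator of the normal twisted cocycle. -/
def omegaNum (ψ : (Fin (ell ρ γ) → V) → ℝ) (v : V) : ℝ :=
  ((ell ρ γ).factorial : ℝ)⁻¹ *
      (∑ σ : Equiv.Perm (Fin (ell ρ γ)), ((Equiv.Perm.sign σ : ℤ) : ℝ) *
        ∑ S : Finset (Fin (ell ρ γ)), (-1 : ℝ) ^ S.card *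
          ψ fun i => zPoint β γ σ (if i ∈ S then (i : ℕ) + 1 else i) v)

variable {ι X : Type*} [NormedAddCommGroup X] [NormedSpace ℝ X] [FiniteDimensional ℝ X]

/-- For each permutation the sum over `S` is an iterated difference with steps `ỹ_{σ(i)} -
y_{σ(i)}`, and Hadamard division extracts the product of the steps. Up to the sign `(-1)^ℓ` this
product is the denominator, independently of `σ`. -/
theorem exists_omega_quotient {ψ : ι → X → (Fin (ell ρ γ) → V) → ℝ}
    (hψ : USmooth fun i (p : X × (Fin (ell ρ γ) → V)) => ψ i p.1 p.2) :
    ∃ Q : ι → X × V → ℝ, USmooth Q ∧ ∀ i x v, omegaNum β γ (ψ i x) v =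
      (∏ j, (coordY β γ j v - coordY' β γ j v)) * Q i (x, v) := by
  choose R hR h using fun σ : Equiv.Perm (Fin (ell ρ γ)) =>
    hψ.exists_multi_hadamard (fun i => (β γ (σ i) : V)) Finset.univ
  let P : Equiv.Perm (Fin (ell ρ γ)) → V → Fin (ell ρ γ) → V := fun σ v i => zPoint β γ σ i v
  let r : Equiv.Perm (Fin (ell ρ γ)) → V → Fin (ell ρ γ) → ℝ := fun σ v i =>
    coordY' β γ (σ i) v - coordY β γ (σ i) v
  refine ⟨fun i p => ((ell ρ γ).factorial : ℝ)⁻¹ * ∑ σ : Equiv.Perm (Fin (ell ρ γ)),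
    (((Equiv.Perm.sign σ : ℤ) : ℝ) * (-1) ^ (ell ρ γ)) * R σ i ((p.1, P σ p.2), r σ p.2),
    (USmooth.sum _ fun σ _ => ((hR σ).comp ?_).const_mul _).const_mul _, fun i x v => ?_⟩
  · refine (contDiff_fst.prodMk (contDiff_pi.2 fun i => ?_)).prodMk (contDiff_pi.2 fun i => ?_)
    · exact (contDiff_zPoint β γ σ i).comp contDiff_snd
    · exact ((contDiff_coordY' β γ _).comp contDiff_snd).sub
        ((contDiff_coordY β γ _).comp contDiff_snd)
  · rw [omegaNum, mul_left_comm]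
    congr 1
    rw [Finset.mul_sum]
    refine Finset.sum_congr rfl fun σ _ => ?_
    have h1 := h σ i x (P σ v) (r σ v)
    rw [Finset.powerset_univ] at h1
    have e1 : ∀ S : Finset (Fin (ell ρ γ)),
        (fun i : Fin (ell ρ γ) => zPoint β γ σ (if i ∈ S then (i : ℕ) + 1 else i) v) =
        fun j => if j ∈ S then P σ v j + r σ v j • (β γ (σ j) : V) else P σ v j := by
      intro S
      funext j
      split_ifs
      · exact zPoint_succ β γ σ j v
      · rfl
    have e2 : ∏ j, r σ v j = (-1) ^ (ell ρ γ) * ∏ j, (coordY β γ j v - coordY' β γ j v) := by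
      rw [← Equiv.prod_comp σ fun j => coordY β γ j v - coordY' β γ j v]
      have : ∀ j, r σ v j = -1 * (coordY β γ (σ j) v - coordY' β γ (σ j) v) := fun j => by
        simp only [r]; ring
      rw [Finset.prod_congr rfl fun j _ => this j, Finset.prod_mul_distrib]
      simp
    simp only [e1]
    rw [h1, e2]
    ring

/-- The denominator is nonzero on a dense set, so any continuous quotient is the extension by
continuity. -/
theorem omega_eq_of_quotient {ψ : (Fin (ell ρ γ) → V) → ℝ} {Q : V → ℝ} (hQ : Continuous Q)
    (h : ∀ v, omegaNum β γ ψ v = (∏ j, (coordY β γ j v - coordY' β γ j v)) * Q v) (v : V) :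
    Omega β γ ψ v = Q v := by
  refine extendFrom_eq (dense_coordY_ne β γ v) ?_
  refine (hQ.continuousWithinAt (x := v)).congr' ?_
  filter_upwards [self_mem_nhdsWithin] with w hw
  have hne : ∏ j, (coordY β γ j w - coordY' β γ j w) ≠ 0 :=
    Finset.prod_ne_zero_iff.2 fun j _ => sub_ne_zero.2 (hw j)
  rw [eq_div_iff hne, mul_comm]
  exact (h w).symm

theorem usmooth_omega {ψ : ι → X → (Fin (ell ρ γ) → V) → ℝ}
    (hψ : USmooth fun i (p : X × (Fin (ell ρ γ) → V)) => ψ i p.1 p.2) :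
    USmooth fun i (p : X × V) => Omega β γ (ψ i p.1) p.2 := by
  obtain ⟨Q, hQ, h⟩ := exists_omega_quotient β γ hψ
  have e : (fun i (p : X × V) => Omega β γ (ψ i p.1) p.2) = Q := by
    funext i p
    exact omega_eq_of_quotient β γ ((hQ.contDiff i).continuous.comp (by fun_prop)) (h i p.1) p.2
  rw [e]
  exact hQ

/-- With this, identities for `Omega` are checked on numerators, after multiplication by the
denominator. -/
theorem omega_mul_prod {ψ : (Fin (ell ρ γ) → V) → ℝ} (hψ : ContDiff ℝ ∞ ψ) (v : V) :
    omegaNum β γ ψ v = (∏ j, (coordY β γ j v - coordY' β γ j v)) * Omega β γ ψ v := by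
  have h1 : USmooth fun (_ : Unit) (p : ℝ × (Fin (ell ρ γ) → V)) => ψ p.2 :=
    USmooth.of_single fun _ => hψ.comp contDiff_snd
  obtain ⟨Q, hQ, h⟩ := exists_omega_quotient (X := ℝ) β γ (ψ := fun _ _ => ψ) h1
  rw [omega_eq_of_quotient β γ (Q := fun v => Q () (0, v))
    ((hQ.contDiff ()).continuous.comp (by fun_prop)) (h () 0) v]
  exact h () 0 v

/-! #### Boundedness of the cochains -/

theorem USmooth.iteratedFDeriv {Y : Type*} [NormedAddCommGroup Y] [NormedSpace ℝ Y]
    {f : ι → Y → ℝ} (hf : USmooth f) : ∀ (n : ℕ) (m : Fin n → Y),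
      USmooth fun i y => iteratedFDeriv ℝ n (f i) y m
  | 0, m => by simpa using hf
  | n + 1, m => by
    have h := (USmooth.iteratedFDeriv hf n (Fin.tail m)).fderiv (m 0)
    have e : (fun i y => _root_.iteratedFDeriv ℝ (n + 1) (f i) y m) = fun i y =>
        _root_.fderiv ℝ (fun y => _root_.iteratedFDeriv ℝ n (f i) y (Fin.tail m)) y (m 0) := by
      funext i y
      rw [iteratedFDeriv_succ_apply_left]
      have hd : DifferentiableAt ℝ (_root_.iteratedFDeriv ℝ n (f i)) y :=
        ((hf.contDiff i).differentiable_iteratedFDeriv (by exact_mod_cast WithTop.coe_lt_top n)) y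
      have h2 := ((ContinuousMultilinearMap.apply ℝ (fun _ : Fin n => Y) ℝ
        (Fin.tail m)).hasFDerivAt.comp y hd.hasFDerivAt).fderiv
      exact (congrArg (fun L => L (m 0)) h2).symm
    rw [e]
    exact h

variable {β γ} in
theorem usmooth_polyAct {ξ : fixed ρ γ → ⋀[ℝ]^k V}
    (hξ : ∀ α : Module.Dual ℝ (⋀[ℝ]^k V), ContDiff ℝ ∞ fun x => α (ξ x))
    {φ : ι → testFun V k} (hφ : USmooth fun i => (φ i).1) :
    USmooth fun i (p : V × (Fin (ell ρ γ) → V)) => polyAct β γ ξ (φ i) p.1 p.2 := by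
  unfold polyAct
  refine USmooth.const_mul (USmooth.sum _ fun a _ => ?_) _
  refine USmooth.smul (c := fun p : V × (Fin (ell ρ γ) → V) => _)
    (f := fun i (p : V × (Fin (ell ρ γ) → V)) => _)
    ((hφ.iteratedFDeriv _ _).comp (u := fun p : V × (Fin (ell ρ γ) → V) => fun i : Fin k =>
      if h : (i : ℕ) < k - ell ρ γ then p.1 else p.2 ⟨i - (k - ell ρ γ), by omega⟩) ?_) ?_
  · refine contDiff_pi.2 fun i => ?_
    split_ifs
    · exact contDiff_fst
    · exact (contDiff_apply ℝ V _).comp contDiff_snd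
  · exact (hξ _).comp ((fixed ρ γ).orthogonalProjectionOnto.contDiff.comp contDiff_fst)

theorem usmooth_preT₁ {ξ : (γ : Γ) → fixed ρ γ → ⋀[ℝ]^k V}
    (hξ : ∀ γ, ∀ α : Module.Dual ℝ (⋀[ℝ]^k V), ContDiff ℝ ∞ fun x => α (ξ γ x))
    {φ : ι → testFun V k} (hφ : USmooth fun i => (φ i).1) (γ : Γ) :
    USmooth fun i t => preT₁ β ξ (φ i) (γ, t) :=
  -- The point at which the derivatives are taken and the point at which `Omega` is evaluated are
  -- independent in `usmooth_omega`; here they are put equal.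
  (usmooth_omega β γ (usmooth_polyAct (hξ γ) hφ)).comp (u := fun t => (t, t))
    (contDiff_id.prodMk contDiff_id)

/-! #### Linearity -/

theorem continuous_omega {ψ : (Fin (ell ρ γ) → V) → ℝ} (hψ : ContDiff ℝ ∞ ψ) :
    Continuous (Omega β γ ψ) := by
  have h1 : USmooth fun (_ : Unit) (p : ℝ × (Fin (ell ρ γ) → V)) => ψ p.2 :=
    USmooth.of_single fun _ => hψ.comp contDiff_snd
  exact ((usmooth_omega (X := ℝ) β γ (ψ := fun _ _ => ψ) h1).contDiff ()).continuous.comp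
    (g := fun p : ℝ × V => Omega β γ ψ p.2) (f := fun v => (0, v)) (by fun_prop)

theorem omega_add {ψ ψ' : (Fin (ell ρ γ) → V) → ℝ} (hψ : ContDiff ℝ ∞ ψ) (hψ' : ContDiff ℝ ∞ ψ')
    (v : V) : Omega β γ (fun w => ψ w + ψ' w) v = Omega β γ ψ v + Omega β γ ψ' v := by
  refine omega_eq_of_quotient β γ (Q := fun v => Omega β γ ψ v + Omega β γ ψ' v)
    ((continuous_omega β γ hψ).add (continuous_omega β γ hψ')) (fun v => ?_) v
  rw [mul_add, ← omega_mul_prod β γ hψ, ← omega_mul_prod β γ hψ']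
  simp only [omegaNum, mul_add, Finset.sum_add_distrib]

theorem omega_smul (c : ℝ) {ψ : (Fin (ell ρ γ) → V) → ℝ} (hψ : ContDiff ℝ ∞ ψ)
    (v : V) : Omega β γ (fun w => c * ψ w) v = c * Omega β γ ψ v := by
  refine omega_eq_of_quotient β γ (Q := fun v => c * Omega β γ ψ v)
    (continuous_const.mul (continuous_omega β γ hψ)) (fun v => ?_) v
  rw [mul_left_comm, ← omega_mul_prod β γ hψ]
  simp only [omegaNum, mul_left_comm _ c, ← Finset.mul_sum]

variable {β γ}

theorem contDiff_polyAct (ξ : fixed ρ γ → ⋀[ℝ]^k V) (φ : testFun V k) (v : V) :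
    ContDiff ℝ ∞ (polyAct β γ ξ φ v) := by
  unfold polyAct
  refine contDiff_const.mul (ContDiff.sum fun a _ => contDiff_const.mul ?_)
  have h := (USmooth.of_single (ι := Unit) (fun _ => φ.2.1)).iteratedFDeriv (k - ell ρ γ)
    fun i => Pi.single (Fin.castLE (Nat.sub_le _ _) i) (stdOrthonormalBasis ℝ (fixed ρ γ) (a i) : V)
  refine (h.contDiff ()).comp (f := fun w : Fin (ell ρ γ) → V => fun i : Fin k =>
      if h : (i : ℕ) < k - ell ρ γ then v else w ⟨i - (k - ell ρ γ), by omega⟩)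
    (contDiff_pi.2 fun i => ?_)
  split_ifs
  · exact contDiff_const
  · exact contDiff_apply ℝ V _

theorem polyAct_add_right (ξ : fixed ρ γ → ⋀[ℝ]^k V) (φ ψ : testFun V k) (v : V) :
    polyAct β γ ξ (φ + ψ) v = fun w => polyAct β γ ξ φ v w + polyAct β γ ξ ψ v w := by
  funext w
  simp only [polyAct, ← mul_add, ← Finset.sum_add_distrib]
  congr 1
  refine Finset.sum_congr rfl fun a _ => ?_
  congr 1
  have e : (φ + ψ).1 = φ.1 + ψ.1 := rfl
  rw [e, iteratedFDeriv_add_apply (contDiff_infty.1 φ.2.1 _).contDiffAt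
    (contDiff_infty.1 ψ.2.1 _).contDiffAt]
  rfl

theorem polyAct_smul_right (ξ : fixed ρ γ → ⋀[ℝ]^k V) (c : ℝ) (φ : testFun V k) (v : V) :
    polyAct β γ ξ (c • φ) v = fun w => c * polyAct β γ ξ φ v w := by
  funext w
  simp only [polyAct, mul_left_comm c, Finset.mul_sum]
  refine Finset.sum_congr rfl fun a _ => ?_
  have e : (c • φ).1 = c • φ.1 := rfl
  rw [e, iteratedFDeriv_const_smul_apply (contDiff_infty.1 φ.2.1 _).contDiffAt]
  simp only [smul_apply, smul_eq_mul]

theorem polyAct_add_left (ξ ξ' : fixed ρ γ → ⋀[ℝ]^k V) (φ : testFun V k) (v : V) :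
    polyAct β γ (ξ + ξ') φ v = fun w => polyAct β γ ξ φ v w + polyAct β γ ξ' φ v w := by
  funext w
  simp only [polyAct, Pi.add_apply, map_add, add_mul, Finset.sum_add_distrib, mul_add]

theorem polyAct_smul_left (c : ℝ) (ξ : fixed ρ γ → ⋀[ℝ]^k V) (φ : testFun V k) (v : V) :
    polyAct β γ (c • ξ) φ v = fun w => c * polyAct β γ ξ φ v w := by
  funext w
  simp only [polyAct, Pi.smul_apply, map_smul, smul_eq_mul, mul_left_comm c, Finset.mul_sum,
    mul_assoc]

variable (β)

theorem isLinearMap_preT₁ (ξ : (γ : Γ) → fixed ρ γ → ⋀[ℝ]^k V) : IsLinearMap ℝ (preT₁ β ξ) := by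
  refine ⟨fun φ ψ => ?_, fun c φ => ?_⟩
  · funext q
    simp only [preT₁, polyAct_add_right, Pi.add_apply]
    exact omega_add β q.1 (contDiff_polyAct _ _ _) (contDiff_polyAct _ _ _) q.2
  · funext q
    simp only [preT₁, polyAct_smul_right, Pi.smul_apply]
    exact omega_smul β q.1 c (contDiff_polyAct _ _ _) q.2

theorem preT₁_add (ξ ξ' : (γ : Γ) → fixed ρ γ → ⋀[ℝ]^k V) :
    preT₁ β (ξ + ξ') = preT₁ β ξ + preT₁ β ξ' := by
  funext φ q
  simp only [preT₁, Pi.add_apply, polyAct_add_left]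
  exact omega_add β q.1 (contDiff_polyAct _ _ _) (contDiff_polyAct _ _ _) q.2

theorem preT₁_smul (c : ℝ) (ξ : (γ : Γ) → fixed ρ γ → ⋀[ℝ]^k V) :
    preT₁ β (c • ξ) = c • preT₁ β ξ := by
  funext φ q
  simp only [preT₁, Pi.smul_apply, polyAct_smul_left]
  exact omega_smul β q.1 c (contDiff_polyAct _ _ _) q.2

theorem isLinearMap_T : IsLinearMap ℝ fun ξ : twistedFields ρ k => T β ξ.1 := by
  have h : ∀ ξ : (γ : Γ) → fixed ρ γ → ⋀[ℝ]^k V, T β ξ = fun φ q => ∑ c : Fin k → Γ,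
      ((Fintype.card Γ : ℝ)⁻¹ • ∑ g, actₗ ρ g (preT₁ β ξ)) (twist ρ c φ)
        (q.1 * (Fin.partialProd c (Fin.last k))⁻¹, q.2) := fun ξ => rfl
  refine ⟨fun ξ ξ' => ?_, fun c ξ => ?_⟩
  · funext φ q
    simp only [h, Submodule.coe_add, preT₁_add, map_add, Finset.sum_add_distrib, smul_add,
      Pi.add_apply]
  · funext φ q
    simp only [h, Submodule.coe_smul, preT₁_smul, map_smul, ← Finset.smul_sum, smul_comm _ c,
      Pi.smul_apply]

theorem isLinearMap_T₂ {f : testFun V k → Γ × V → ℝ} (hf : IsLinearMap ℝ f) :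
    IsLinearMap ℝ (T₂ ρ f) := by
  refine ⟨fun φ ψ => ?_, fun r φ => ?_⟩
  · funext q
    have e : ∀ c, twist ρ c (φ + ψ) = twist ρ c φ + twist ρ c ψ := fun _ => rfl
    simp only [T₂, e, hf.map_add, Pi.add_apply, Finset.sum_add_distrib]
  · funext q
    have e : ∀ c, twist ρ c (r • φ) = r • twist ρ c φ := fun _ => rfl
    simp only [T₂, e, hf.map_smul, Pi.smul_apply, Finset.smul_sum]

theorem T₂_mem_cochains {f : testFun V k → Γ × V → ℝ} (hf : IsLinearMap ℝ f)
    (hb : ∀ {ι : Type (max u v)} (φ : ι → testFun V k), (USmooth fun i => (φ i).1) → ∀ γ,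
      USmooth fun i t => f (φ i) (γ, t)) : T₂ ρ f ∈ cochains Γ V k := by
  refine mem_cochains_of_usmooth (isLinearMap_T₂ hf) fun φ hφ g => ?_
  unfold T₂
  refine USmooth.sum _ fun c _ => hb (fun i => twist ρ c (φ i)) ?_
    (g * (Fin.partialProd c (Fin.last k))⁻¹)
  exact (hφ.2 c).comp (u := fun (x : Fin k → V) i => ρ (Fin.partialProd c i.castSucc)⁻¹ (x i))
    (contDiff_pi.2 fun i => (ρ _).contDiff.comp (contDiff_apply ℝ V i))

theorem T_mem_cochains {ξ : (γ : Γ) → fixed ρ γ → ⋀[ℝ]^k V}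
    (hξ : ∀ γ, ∀ α : Module.Dual ℝ (⋀[ℝ]^k V), ContDiff ℝ ∞ fun x => α (ξ γ x)) :
    T β ξ ∈ cochains Γ V k := by
  refine T₂_mem_cochains (isLinearMap_avg ρ (isLinearMap_preT₁ β ξ)) fun φ hφ γ => ?_
  have e : (fun i t => avg ρ (preT₁ β ξ) (φ i) (γ, t)) = fun i t => (Fintype.card Γ : ℝ)⁻¹ *
      ∑ g, preT₁ β ξ (tMap ρ g (φ i)) (g⁻¹ * γ * g, ρ g⁻¹ t) := by
    funext i t
    simp [avg, Finset.sum_apply, act_apply]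
  unfold T₁
  rw [e]
  refine USmooth.const_mul (USmooth.sum _ fun g _ => ?_) _
  refine (usmooth_preT₁ β hξ (φ := fun i => tMap ρ g (φ i)) ?_ (g⁻¹ * γ * g)).comp (ρ g⁻¹).contDiff
  exact hφ.comp (u := fun (x : Fin k → V) i => ρ g (x i))
    (contDiff_pi.2 fun i => (ρ g).contDiff.comp (contDiff_apply ℝ V i))

end Omega
/-! ### The cocycle property -/

section Cocycle

universe u v

/-! ### Derivatives of test functions after substitution or multiplication of arguments. -/

section Slots

variable {V : Type*} [NormedAddCommGroup V] [InnerProductSpace ℝ V] [FiniteDimensional ℝ V]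
  {k p : ℕ}

theorem contDiff_insertNth (j : Fin (k + 1)) (P : V) :
    ContDiff ℝ ∞ fun y : Fin k → V => (Fin.insertNth j P y : Fin (k + 1) → V) :=
  contDiff_pi.2 fun l => by
    refine Fin.succAboveCases j ?_ (fun l => ?_) l
    · simpa using contDiff_const
    · simpa using contDiff_apply ℝ V l

/-- Substitution of one argument. -/
def tInsert (j : Fin (k + 1)) (P : V) (ψ : testFun V (k + 1)) : testFun V k :=
  ⟨fun y => ψ.1 (Fin.insertNth j P y), comp_mem_testFun ψ.2
    (j := fun y : Fin k → V => (Fin.insertNth j P y : Fin (k + 1) → V))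
    (r := fun x i => x (j.succAbove i)) (contDiff_insertNth j P) (by fun_prop)
    (fun x => by ext i; simp)⟩

theorem tInsert_zero (t : V) (ψ : testFun V (k + 1)) : tInsert 0 t ψ = tCons t ψ :=
  Subtype.ext (funext fun y => congrArg ψ.1 (Fin.insertNth_zero' t y))

theorem tInsert_last (t : V) (ψ : testFun V (k + 1)) : tInsert (Fin.last k) t ψ = tSnoc t ψ :=
  Subtype.ext (funext fun y => congrArg ψ.1 (Fin.insertNth_last' t y))

/-- Substituting a constant is composition with an affine map, whose linear part only renumbers the
slots. -/
theorem iteratedFDeriv_tInsert (j : Fin (k + 1)) (P : V) (ψ : testFun V (k + 1)) (x : Fin k → V)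
    (s : Fin p → Fin k) (e : Fin p → V) :
    iteratedFDeriv ℝ p (tInsert j P ψ).1 x (fun l => Pi.single (s l) (e l)) =
      iteratedFDeriv ℝ p ψ.1 (Fin.insertNth j P x : Fin (k + 1) → V)
        (fun l => Pi.single (j.succAbove (s l)) (e l)) := by
  let A : (Fin k → V) →L[ℝ] (Fin (k + 1) → V) := ContinuousLinearMap.pi
    (Fin.insertNth (α := fun _ => (Fin k → V) →L[ℝ] V) j 0
      (fun l => ContinuousLinearMap.proj (φ := fun _ => V) l))
  have hA : ∀ y, A y = (Fin.insertNth j 0 y : Fin (k + 1) → V) := by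
    intro y
    funext l
    refine Fin.succAboveCases j ?_ (fun l => ?_) l
    · simp [A]
    · simp [A]
  have hP : ∀ y : Fin k → V, (Fin.insertNth j P y : Fin (k + 1) → V) = A y + Pi.single j P := by
    intro y
    rw [hA]
    funext l
    refine Fin.succAboveCases j ?_ (fun l => ?_) l
    · simp
    · simp
  have h1 : (tInsert j P ψ).1 = (fun z => ψ.1 (z + Pi.single j P)) ∘ A :=
    funext fun y => congrArg ψ.1 (hP y)
  have h2 : ContDiff ℝ p fun z => ψ.1 (z + Pi.single j P) :=
    (contDiff_infty.1 ψ.2.1 p).comp (contDiff_id.add contDiff_const)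
  rw [h1, A.iteratedFDeriv_comp_right h2 x le_rfl, iteratedFDeriv_comp_add_right, hP,
    ContinuousMultilinearMap.compContinuousLinearMap_apply]
  congr 1
  funext l
  rw [hA]
  funext m
  refine Fin.succAboveCases j ?_ (fun m => ?_) m
  · simp
  · simp only [Fin.insertNth_apply_succAbove, Pi.single_apply, Fin.succAbove_right_inj]

theorem predAbove_eq_iff (i s : Fin k) (l : Fin (k + 1)) (h : s ≠ i) :
    i.predAbove l = s ↔ l = i.castSucc.succAbove s := by
  have h1 : (s : ℕ) ≠ i := fun e => h (Fin.ext e)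
  simp only [predAbove_eq, Fin.succAbove, Fin.ext_iff, Fin.lt_def, Fin.val_castSucc]
  split_ifs <;> simp only [Fin.val_castSucc, Fin.val_succ] <;> omega

theorem iteratedFDeriv_tMerge (i : Fin k) (ψ : testFun V (k + 1)) (x : Fin k → V)
    (m : Fin p → Fin k → V) :
    iteratedFDeriv ℝ p (tMerge i ψ).1 x m =
      iteratedFDeriv ℝ p ψ.1 (fun l => x (i.predAbove l)) (fun a l => m a (i.predAbove l)) := by
  let A : (Fin k → V) →L[ℝ] (Fin (k + 1) → V) :=
    ContinuousLinearMap.pi fun l => ContinuousLinearMap.proj (i.predAbove l)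
  have h1 : (tMerge i ψ).1 = ψ.1 ∘ A := rfl
  rw [h1, A.iteratedFDeriv_comp_right (contDiff_infty.1 ψ.2.1 p) x le_rfl]
  rfl

theorem single_predAbove_ne {i s : Fin k} (h : s ≠ i) (e : V) :
    (fun l => (Pi.single s e : Fin k → V) (i.predAbove l)) = Pi.single (i.castSucc.succAbove s) e := by
  funext l
  simp only [Pi.single_apply, predAbove_eq_iff i s l h]

theorem single_predAbove_self (i : Fin k) (e : V) :
    (fun l => (Pi.single i e : Fin k → V) (i.predAbove l)) =
      Pi.single i.castSucc e + Pi.single i.succ e := by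
  funext l
  have h : i.predAbove l = i ↔ l = i.castSucc ∨ l = i.succ := by
    simp only [predAbove_eq, Fin.ext_iff, Fin.val_castSucc, Fin.val_succ]
    split_ifs <;> omega
  have h2 : i.castSucc ≠ i.succ := by simp [Fin.ext_iff]
  simp only [Pi.single_apply, h, Pi.add_apply]
  by_cases h3 : l = i.castSucc
  · simp [h3, h2]
  · simp [h3]

theorem succAbove_castSucc_eq_succ {i s : Fin k} (h : s ≠ i) :
    i.castSucc.succAbove s = i.succ.succAbove s := by
  have h1 : (s : ℕ) ≠ i := fun e => h (Fin.ext e)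
  simp only [Fin.succAbove, Fin.ext_iff, Fin.lt_def, Fin.val_castSucc, Fin.val_succ]
  split_ifs <;> simp only [Fin.val_castSucc, Fin.val_succ] <;> omega

theorem insertNth_castSucc_eq (i : Fin k) (x : Fin k → V) :
    (Fin.insertNth i.castSucc (x i) x : Fin (k + 1) → V) = fun l => x (i.predAbove l) := by
  funext l
  refine Fin.succAboveCases i.castSucc ?_ (fun l => ?_) l
  · simp
  · simp

theorem insertNth_succ_eq (i : Fin k) (x : Fin k → V) :
    (Fin.insertNth i.succ (x i) x : Fin (k + 1) → V) = fun l => x (i.predAbove l) := by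
  funext l
  refine Fin.succAboveCases i.succ ?_ (fun l => ?_) l
  · simp
  · rw [Fin.insertNth_apply_succAbove]
    refine congrArg x (Fin.ext ?_)
    simp only [predAbove_eq, Fin.succAbove, Fin.lt_def, Fin.val_succ, Fin.val_castSucc]
    split_ifs <;> simp only [Fin.val_succ, Fin.val_castSucc] at * <;> omega

/-- The Leibniz rule for the multiplication of two arguments in a slot which is differentiated. -/
theorem iteratedFDeriv_tMerge_eq_add (i : Fin k) (ψ : testFun V (k + 1)) (x : Fin k → V)
    {s : Fin p → Fin k} (hs : Function.Injective s) (e : Fin p → V) (l₀ : Fin p) (hl : s l₀ = i) :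
    iteratedFDeriv ℝ p (tMerge i ψ).1 x (fun l => Pi.single (s l) (e l)) =
      iteratedFDeriv ℝ p (tInsert i.castSucc (x i) ψ).1 x (fun l => Pi.single (s l) (e l)) +
        iteratedFDeriv ℝ p (tInsert i.succ (x i) ψ).1 x (fun l => Pi.single (s l) (e l)) := by
  rw [iteratedFDeriv_tMerge, iteratedFDeriv_tInsert, iteratedFDeriv_tInsert, insertNth_castSucc_eq,
    insertNth_succ_eq]
  have h1 : (fun a l => (Pi.single (s a) (e a) : Fin k → V) (i.predAbove l)) =
      Function.update (fun a => (Pi.single (i.castSucc.succAbove (s a)) (e a) : Fin (k + 1) → V)) l₀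
        (Pi.single i.castSucc (e l₀) + Pi.single i.succ (e l₀)) := by
    funext a
    by_cases ha : a = l₀
    · subst ha
      rw [Function.update_self, hl, single_predAbove_self]
    · rw [Function.update_of_ne ha]
      exact single_predAbove_ne (fun h => ha (hs (h.trans hl.symm))) _
  have h2 : (fun a => (Pi.single (i.succ.succAbove (s a)) (e a) : Fin (k + 1) → V)) =
      Function.update (fun a => (Pi.single (i.castSucc.succAbove (s a)) (e a) : Fin (k + 1) → V)) l₀
        (Pi.single i.castSucc (e l₀)) := by
    funext a
    by_cases ha : a = l₀
    · subst ha
      rw [Function.update_self, hl]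
      simp
    · rw [Function.update_of_ne ha, succAbove_castSucc_eq_succ fun h => ha (hs (h.trans hl.symm))]
  have h3 : (fun a => (Pi.single (i.castSucc.succAbove (s a)) (e a) : Fin (k + 1) → V)) =
      Function.update (fun a => (Pi.single (i.castSucc.succAbove (s a)) (e a) : Fin (k + 1) → V)) l₀
        (Pi.single i.succ (e l₀)) := by
    funext a
    by_cases ha : a = l₀
    · subst ha
      rw [Function.update_self, hl]
      simp
    · rw [Function.update_of_ne ha]
  rw [h1, ContinuousMultilinearMap.map_update_add, ← h2, ← h3]
  exact add_comm _ _

/-- The shape taken by the coboundary once the product rule has written every inner face as a sum of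
two neighbours. -/
theorem telescope_eq_zero (A : Fin (k + 1) → ℝ) :
    A 0 + (∑ i : Fin k, (-1 : ℝ) ^ ((i : ℕ) + 1) * (A i.castSucc + A i.succ)) +
      (-1 : ℝ) ^ (k + 1) * A (Fin.last k) = 0 := by
  induction k with
  | zero => simp
  | succ k ih =>
    have h := ih fun j => A j.castSucc
    rw [Fin.sum_univ_castSucc]
    simp only [Fin.castSucc_zero, Fin.val_castSucc, Fin.val_last, Fin.succ_last] at *
    have h2 : ∀ i : Fin k, i.castSucc.succ = i.succ.castSucc := fun i => rfl
    simp only [h2]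
    rw [pow_succ (-1 : ℝ) (k + 1)]
    linear_combination h

end Slots

variable {Γ : Type u} {V : Type v} [NormedAddCommGroup V] [Group Γ] [Fintype Γ]
  [InnerProductSpace ℝ V] [FiniteDimensional ℝ V] {k : ℕ} {ρ : Γ →* (V ≃ₗᵢ[ℝ] V)}
  (β : NormalCoordinates ρ) (γ : Γ)

theorem zPoint_zero (σ : Equiv.Perm (Fin (ell ρ γ))) (v : V) : zPoint β γ σ 0 v = v := by
  simp only [zPoint, not_lt_zero, if_false, sum_coordY]
  exact tan_add_nor ρ γ v

/-- `v` and `γ⁻¹ v` have the same tangential part, since their difference is normal. The chain thus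
ends at the source of the arrow, the point substituted by the last face. -/
theorem zPoint_ell (σ : Equiv.Perm (Fin (ell ρ γ))) (v : V) :
    zPoint β γ σ (ell ρ γ) v = ρ γ⁻¹ v := by
  simp only [zPoint, Fin.is_lt, if_true, coordY', sum_coordY]
  have h := tanProj_normal ρ γ (sub_rho_inv_mem_normal γ v)
  rw [map_sub, sub_eq_zero] at h
  rw [h]
  exact tan_add_nor ρ γ _

/-- The arguments at which a cochain `preT₁` is evaluated. -/
def evalPoint (k : ℕ) (σ : Equiv.Perm (Fin (ell ρ γ))) (v : V) (S : Finset (Fin (ell ρ γ)))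
    (i : Fin k) : V :=
  if h : (i : ℕ) < k - ell ρ γ then v
    else zPoint β γ σ (if (⟨i - (k - ell ρ γ), by omega⟩ : Fin (ell ρ γ)) ∈ S
      then i - (k - ell ρ γ) + 1 else i - (k - ell ρ γ)) v

/-- The contribution of one permutation and one choice of differentiations to `preT₁`. -/
def slotSum (σ : Equiv.Perm (Fin (ell ρ γ))) (v : V) (e : Fin (k - ell ρ γ) → V)
    (φ : testFun V k) : ℝ :=
  ∑ S : Finset (Fin (ell ρ γ)), (-1 : ℝ) ^ S.card *
    iteratedFDeriv ℝ (k - ell ρ γ) φ.1 (evalPoint β γ k σ v S)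
      (fun i => Pi.single (Fin.castLE (Nat.sub_le _ _) i) (e i))

/-- The product rule in slot `i`. In a slot that is differentiated it is Leibniz' rule at `v`. In a
difference slot it reads `(fg)(z) - (fg)(z') = f(z) (g(z) - g(z')) + (f(z) - f(z')) g(z')` with `z =
z^m`, `z' = z^{m+1}`. The truncated subtractions give `z⁰ = v` in the first case, so both cases
share one formula. -/
theorem slotSum_tMerge (σ : Equiv.Perm (Fin (ell ρ γ))) (v : V) (e : Fin (k - ell ρ γ) → V)
    (i : Fin k) (ψ : testFun V (k + 1)) :
    slotSum β γ σ v e (tMerge i ψ) =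
      slotSum β γ σ v e (tInsert i.castSucc (zPoint β γ σ (i - (k - ell ρ γ)) v) ψ) +
      slotSum β γ σ v e (tInsert i.succ (zPoint β γ σ (i + 1 - (k - ell ρ γ)) v) ψ) := by
  classical
  have hinj : Function.Injective (Fin.castLE (Nat.sub_le k (ell ρ γ))) := Fin.castLE_injective _
  by_cases hi : (i : ℕ) < k - ell ρ γ
  · have h1 : (i : ℕ) - (k - ell ρ γ) = 0 := by omega
    have h2 : (i : ℕ) + 1 - (k - ell ρ γ) = 0 := by omega
    rw [h1, h2, zPoint_zero]
    simp only [slotSum, ← Finset.sum_add_distrib, ← mul_add]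
    refine Finset.sum_congr rfl fun S _ => ?_
    have h3 : evalPoint β γ k σ v S i = v := dif_pos hi
    have h4 := iteratedFDeriv_tMerge_eq_add i ψ (evalPoint β γ k σ v S) hinj e ⟨i, hi⟩ rfl
    rw [h3] at h4
    rw [h4]
  · let m : Fin (ell ρ γ) := ⟨i - (k - ell ρ γ), by omega⟩
    have hm : (i : ℕ) + 1 - (k - ell ρ γ) = (m : ℕ) + 1 := by simp only [m]; omega
    have hm' : (i : ℕ) - (k - ell ρ γ) = (m : ℕ) := rfl
    rw [hm, hm']
    have hne : ∀ l : Fin (k - ell ρ γ), Fin.castLE (Nat.sub_le k (ell ρ γ)) l ≠ i := by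
      intro l h
      have := l.2
      exact hi (by rw [← h]; exact this)
    rw [← sub_eq_zero, slotSum, slotSum, slotSum, ← Finset.sum_add_distrib,
      ← Finset.sum_sub_distrib]
    have hin : ∀ S, m ∈ S → evalPoint β γ k σ v S i = zPoint β γ σ ((m : ℕ) + 1) v := fun S hS => by
      have : (⟨i - (k - ell ρ γ), by omega⟩ : Fin (ell ρ γ)) ∈ S := hS
      rw [evalPoint, dif_neg hi, if_pos this]
    have hout : ∀ S, m ∉ S → evalPoint β γ k σ v S i = zPoint β γ σ m v := fun S hS => by
      have : (⟨i - (k - ell ρ γ), by omega⟩ : Fin (ell ρ γ)) ∉ S := hS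
      rw [evalPoint, dif_neg hi, if_neg this]
    have hother : ∀ S l, l ≠ i → evalPoint β γ k σ v (insert m S) l = evalPoint β γ k σ v S l := by
      intro S l hl
      unfold evalPoint
      split_ifs with h1 h2 h3 h3
      · rfl
      · rfl
      · refine absurd h2 ?_
        rw [Finset.mem_insert, not_or]
        refine ⟨fun h => hl (Fin.ext ?_), h3⟩
        have := congrArg Fin.val h
        simp only [m] at this
        omega
      · exact absurd (Finset.mem_insert_of_mem h3) h2
      · rfl
    have key : ∀ S, m ∉ S → (Fin.insertNth i.castSucc (zPoint β γ σ m v)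
          (evalPoint β γ k σ v (insert m S)) : Fin (k + 1) → V) =
        Fin.insertNth i.succ (zPoint β γ σ ((m : ℕ) + 1) v) (evalPoint β γ k σ v S) := by
      intro S hS
      funext l
      refine Fin.succAboveCases i.castSucc ?_ (fun l => ?_) l
      · have h1 : i.castSucc = i.succ.succAbove i := by simp
        rw [Fin.insertNth_apply_same]
        conv_rhs => rw [h1, Fin.insertNth_apply_succAbove]
        exact (hout S hS).symm
      · rw [Fin.insertNth_apply_succAbove]
        by_cases hl : l = i
        · subst hl
          rw [hin _ (Finset.mem_insert_self m S)]
          simp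
        · rw [succAbove_castSucc_eq_succ hl, Fin.insertNth_apply_succAbove, hother S l hl]
    set c : Fin (k - ell ρ γ) → Fin (k + 1) → V := fun l =>
      Pi.single (M := fun _ => V) (i.castSucc.succAbove (Fin.castLE (Nat.sub_le k (ell ρ γ)) l)) (e l) with hc
    set g : (Fin (k + 1) → V) → ℝ := fun y => iteratedFDeriv ℝ (k - ell ρ γ) ψ.1 y c with hg
    have e1 : ∀ x, iteratedFDeriv ℝ (k - ell ρ γ) (tMerge i ψ).1 x
        (fun l => Pi.single (Fin.castLE (Nat.sub_le _ _) l) (e l)) =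
        g fun l => x (i.predAbove l) := by
      intro x
      rw [iteratedFDeriv_tMerge]
      exact congrArg _ (funext fun a => single_predAbove_ne (hne a) _)
    have e2 : ∀ P x, iteratedFDeriv ℝ (k - ell ρ γ) (tInsert i.castSucc P ψ).1 x
        (fun l => Pi.single (Fin.castLE (Nat.sub_le _ _) l) (e l)) =
        g (Fin.insertNth i.castSucc P x : Fin (k + 1) → V) := fun P x =>
      iteratedFDeriv_tInsert _ _ _ _ _ _
    have e3 : ∀ P x, iteratedFDeriv ℝ (k - ell ρ γ) (tInsert i.succ P ψ).1 x
        (fun l => Pi.single (Fin.castLE (Nat.sub_le _ _) l) (e l)) =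
        g (Fin.insertNth i.succ P x : Fin (k + 1) → V) := by
      intro P x
      rw [iteratedFDeriv_tInsert]
      simp only [hg, hc, succAbove_castSucc_eq_succ (hne _)]
    simp only [e1, e2, e3]
    -- Subsets are paired as `S` and `insert m S`. The two mixed values, at `(z^m, z^{m+1})`, agree
    -- by `key` and cancel because of the opposite signs.
    have e4 : ∀ S, m ∉ S →
        ((-1 : ℝ) ^ S.card * g (fun l => evalPoint β γ k σ v S (i.predAbove l)) -
          ((-1 : ℝ) ^ S.card * g (Fin.insertNth i.castSucc (zPoint β γ σ m v)
              (evalPoint β γ k σ v S) : Fin (k + 1) → V) +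
            (-1 : ℝ) ^ S.card * g (Fin.insertNth i.succ (zPoint β γ σ ((m : ℕ) + 1) v)
              (evalPoint β γ k σ v S) : Fin (k + 1) → V))) +
        ((-1 : ℝ) ^ (insert m S).card *
            g (fun l => evalPoint β γ k σ v (insert m S) (i.predAbove l)) -
          ((-1 : ℝ) ^ (insert m S).card * g (Fin.insertNth i.castSucc (zPoint β γ σ m v)
              (evalPoint β γ k σ v (insert m S)) : Fin (k + 1) → V) +
            (-1 : ℝ) ^ (insert m S).card * g (Fin.insertNth i.succ (zPoint β γ σ ((m : ℕ) + 1) v)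
              (evalPoint β γ k σ v (insert m S)) : Fin (k + 1) → V))) = 0 := by
      intro S hS
      rw [← insertNth_castSucc_eq, hout S hS, ← insertNth_succ_eq,
        hin _ (Finset.mem_insert_self m S), key S hS, Finset.card_insert_of_notMem hS, pow_succ]
      ring
    rw [← Finset.sum_filter_add_sum_filter_not _ (fun S => m ∉ S)]
    have e5 : ∀ f : Finset (Fin (ell ρ γ)) → ℝ, ∑ S with ¬ m ∉ S, f S =
        ∑ S with m ∉ S, f (insert m S) := by
      intro f
      refine (Finset.sum_nbij' (fun S => insert m S) (fun S => S.erase m) ?_ ?_ ?_ ?_ ?_).symm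
      · intro S _; simp
      · intro S _; simp
      · intro S hS; exact Finset.erase_insert (by simpa using hS)
      · intro S hS; exact Finset.insert_erase (by simpa using hS)
      · intro S _; rfl
    rw [e5, ← Finset.sum_add_distrib]
    exact Finset.sum_eq_zero fun S hS => e4 S (by simpa using hS)

theorem omegaNum_polyAct (ξ : fixed ρ γ → ⋀[ℝ]^k V) (φ : testFun V k) (v : V) :
    omegaNum β γ (polyAct β γ ξ φ v) v = ∑ σ : Equiv.Perm (Fin (ell ρ γ)),
      ∑ a : Fin (k - ell ρ γ) → Fin (Module.finrank ℝ (fixed ρ γ)),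
      (((ell ρ γ).factorial : ℝ)⁻¹ * ((Equiv.Perm.sign σ : ℤ) : ℝ) *
        ((k - ell ρ γ).factorial : ℝ)⁻¹ * exteriorPower.pairingDual ℝ V k
        (exteriorPower.ιMulti ℝ k fun i : Fin k =>
          if h : (i : ℕ) < k - ell ρ γ then
            (innerₗ V) (stdOrthonormalBasis ℝ (fixed ρ γ) (a ⟨i, h⟩) : V)
          else coordY β γ ⟨i - (k - ell ρ γ), by omega⟩)
        (ξ ((fixed ρ γ).orthogonalProjectionOnto v))) *
      slotSum β γ σ v (fun i => (stdOrthonormalBasis ℝ (fixed ρ γ) (a i) : V)) φ := by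
  unfold omegaNum slotSum polyAct
  simp only [Finset.mul_sum]
  refine Finset.sum_congr rfl fun σ _ => ?_
  rw [Finset.sum_comm]
  refine Finset.sum_congr rfl fun a _ => Finset.sum_congr rfl fun S _ => ?_
  have e : (fun i : Fin k => if h : (i : ℕ) < k - ell ρ γ then v
      else zPoint β γ σ (if (⟨i - (k - ell ρ γ), by omega⟩ : Fin (ell ρ γ)) ∈ S
        then i - (k - ell ρ γ) + 1 else i - (k - ell ρ γ)) v) = evalPoint β γ k σ v S := rfl
  rw [e]
  ring

/-- The telescope runs over the slot `j` of insertion, with the point `z^{j-(k-ℓ)}`. Its ends are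
`z⁰ = v` and, because of `ℓ ≤ k`, `z^ℓ = γ⁻¹ v`, the points of the first and the last face. -/
theorem slotSum_bA (hk : ell ρ γ ≤ k) (σ : Equiv.Perm (Fin (ell ρ γ))) (v : V)
    (e : Fin (k - ell ρ γ) → V) (ψ : testFun V (k + 1)) :
    slotSum β γ σ v e (tCons v ψ) +
      (∑ i : Fin k, (-1 : ℝ) ^ ((i : ℕ) + 1) * slotSum β γ σ v e (tMerge i ψ)) +
      (-1 : ℝ) ^ (k + 1) * slotSum β γ σ v e (tSnoc (ρ γ⁻¹ v) ψ) = 0 := by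
  have h := telescope_eq_zero fun j : Fin (k + 1) =>
    slotSum β γ σ v e (tInsert j (zPoint β γ σ (j - (k - ell ρ γ)) v) ψ)
  have e1 : k - (k - ell ρ γ) = ell ρ γ := by omega
  simp only [Fin.val_castSucc, Fin.val_succ, ← slotSum_tMerge, tInsert_zero, tInsert_last,
    Fin.val_zero, Nat.zero_sub, zPoint_zero, Fin.val_last, e1, zPoint_ell] at h
  exact h

/-- Multiplied by the denominator the identity is one between numerators, where `slotSum_bA` applies
to each permutation and each choice of tangential derivatives. The denominator is then removed by
density and continuity. -/
theorem bA_preT₁ {ξ : (γ : Γ) → fixed ρ γ → ⋀[ℝ]^k V}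
    (hξ : ∀ γ, ∀ α : Module.Dual ℝ (⋀[ℝ]^k V), ContDiff ℝ ∞ fun x => α (ξ γ x))
    (hξ' : ∀ γ x, ξ γ x ∈ twistedPart ρ γ k) : bA ρ k (preT₁ β ξ) = 0 := by
  funext ψ ⟨γ, v⟩
  rcases lt_or_ge k (ell ρ γ) with hk | hk
  -- For `k < ℓ` the truncated `k - ℓ` has no meaning, but then the field vanishes.
  · have h0 : ∀ x, ξ γ x = 0 := fun x => by
      have := hξ' γ x
      rwa [twistedPart_eq_bot ρ hk, Submodule.mem_bot] at this
    have h1 : ∀ φ v, preT₁ β ξ φ (γ, v) = 0 := fun φ v => by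
      have e : ξ γ = (0 : ℝ) • ξ γ := funext fun x => by simp [h0]
      unfold preT₁
      simp only
      rw [e, polyAct_smul_left, omega_smul β γ 0 (contDiff_polyAct _ _ _), zero_mul]
    simp [bA_apply, h1]
  · have hD : ∀ φ v, (∏ j, (coordY β γ j v - coordY' β γ j v)) * preT₁ β ξ φ (γ, v) =
        omegaNum β γ (polyAct β γ (ξ γ) φ v) v := fun φ v =>
      (omega_mul_prod β γ (contDiff_polyAct _ _ _) v).symm
    have hzero : ∀ v, (∏ j, (coordY β γ j v - coordY' β γ j v)) *
        bA ρ k (preT₁ β ξ) ψ (γ, v) = 0 := by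
      intro v
      rw [bA_apply, mul_add, mul_add, hD, Finset.mul_sum]
      simp only [mul_left_comm (∏ j, (coordY β γ j v - coordY' β γ j v)), hD, omegaNum_polyAct]
      rw [← mul_zero (1 : ℝ)]
      simp only [Finset.mul_sum]
      rw [Finset.sum_comm (s := (Finset.univ : Finset (Fin k))), ← Finset.sum_add_distrib,
        ← Finset.sum_add_distrib, mul_zero]
      refine Finset.sum_eq_zero fun σ _ => ?_
      rw [Finset.sum_comm (s := (Finset.univ : Finset (Fin k))), ← Finset.sum_add_distrib,
        ← Finset.sum_add_distrib]
      refine Finset.sum_eq_zero fun a _ => ?_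
      have h := slotSum_bA β γ hk σ v (fun i => (stdOrthonormalBasis ℝ (fixed ρ γ) (a i) : V)) ψ
      simp only [mul_left_comm ((-1 : ℝ) ^ _) _ (slotSum _ _ _ _ _ _), ← Finset.mul_sum]
      rw [← mul_add, ← mul_add, h, mul_zero]
    -- Continuity of the coboundary is obtained by writing it as the restriction of the Hochschild
    -- coboundary of a cochain on the crossed product.
    have hsm : T₂ ρ (preT₁ β ξ) ∈ cochains Γ V k :=
      T₂_mem_cochains (isLinearMap_preT₁ β ξ) fun φ hφ γ => usmooth_preT₁ β hξ hφ γ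
    have hcont : Continuous fun v => bA ρ k (preT₁ β ξ) ψ (γ, v) := by
      have h0 := (isLinearMap_preT₁ β ξ).map_zero
      rw [← restrict_T₂ ρ h0, ← restrict_hochB ρ (isLinearMap_T₂ (isLinearMap_preT₁ β ξ)).map_zero]
      exact ((hochB_mem ρ hsm).2.1 _ γ).continuous
    have hcl : IsClosed {v | bA ρ k (preT₁ β ξ) ψ (γ, v) = 0} :=
      isClosed_eq hcont continuous_const
    have hsub : {v | ∀ j, coordY β γ j v ≠ coordY' β γ j v} ⊆
        {v | bA ρ k (preT₁ β ξ) ψ (γ, v) = 0} := fun w hw =>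
      (mul_eq_zero.1 (hzero w)).resolve_left
        (Finset.prod_ne_zero_iff.2 fun j _ => sub_ne_zero.2 (hw j))
    exact (hcl.closure_subset_iff.2 hsub) (dense_coordY_ne β γ v)

theorem hochB_T {ξ : (γ : Γ) → fixed ρ γ → ⋀[ℝ]^k V} (hξ : ξ ∈ twistedFields ρ k) :
    hochB ρ k (T β ξ) = 0 := by
  unfold T T₁
  rw [hochB_T₂ ρ (isLinearMap_avg ρ (isLinearMap_preT₁ β ξ)) fun g => act_avg ρ g _, bA_avg,
    bA_preT₁ β hξ.1 hξ.2.1]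
  funext φ q
  simp [T₂, avg, act]

end Cocycle
/-! ### `L ∘ T = id` -/

section Inverse

universe u v

open Filter Topology

/-! ### Expansion of alternating maps in bases. -/

section Alternating

variable {E W : Type*} [NormedAddCommGroup E] [InnerProductSpace ℝ E] [AddCommGroup W] [Module ℝ W]
  {κ : Type*} [Fintype κ] {p : ℕ}

theorem sum_prod_inner_smul (b : OrthonormalBasis κ ℝ E) (G : MultilinearMap ℝ (fun _ : Fin p => E) W)
    (w : Fin p → E) :
    ∑ I : Fin p → κ, (∏ j, inner ℝ (b (I j)) (w j)) • G (fun j => b (I j)) = G w := by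
  classical
  have e : w = fun j => ∑ m, inner ℝ (b m) (w j) • b m := funext fun j => (b.sum_repr' (w j)).symm
  conv_rhs => rw [e, MultilinearMap.map_sum]
  refine Finset.sum_congr rfl fun I _ => ?_
  rw [MultilinearMap.map_smul_univ]

/-- In the expansion of the determinant every permutation contributes `G t`: its sign cancels the
one from reordering the arguments. -/
theorem sum_det_inner_smul (b : OrthonormalBasis κ ℝ E) (G : E [⋀^Fin p]→ₗ[ℝ] W) (t : Fin p → E) :
    ∑ a : Fin p → κ, (Matrix.of fun i j => inner ℝ (b (a j)) (t i)).det • G (fun j => b (a j)) =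
      (p.factorial : ℝ) • G t := by
  classical
  have h : ∀ a : Fin p → κ, (Matrix.of fun i j => inner ℝ (b (a j)) (t i)).det =
      ∑ π : Equiv.Perm (Fin p), ((Equiv.Perm.sign π : ℤ) : ℝ) * ∏ j, inner ℝ (b (a j)) (t (π j)) :=
    fun a => Matrix.det_apply' _
  simp only [h, Finset.sum_smul, mul_smul]
  rw [Finset.sum_comm]
  simp only [← Finset.smul_sum]
  have h2 : ∀ π : Equiv.Perm (Fin p), ((Equiv.Perm.sign π : ℤ) : ℝ) •
      ∑ a : Fin p → κ, (∏ j, inner ℝ (b (a j)) (t (π j))) • G (fun j => b (a j)) = G t := by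
    intro π
    have := sum_prod_inner_smul b G.toMultilinearMap (t ∘ π)
    simp only [AlternatingMap.coe_multilinearMap, Function.comp_apply] at this
    rw [this]
    have h3 := G.map_perm t π
    have h4 : (t ∘ π) = fun j => t (π j) := rfl
    rw [h3, Units.smul_def, ← Int.cast_smul_eq_zsmul ℝ, smul_smul, ← Int.cast_mul, ← Units.val_mul,
      Int.units_mul_self]
    simp
  simp only [h2, Finset.sum_const, Finset.card_univ, Fintype.card_perm, Fintype.card_fin]
  rw [← Nat.cast_smul_eq_nsmul ℝ]

theorem alternating_eq_det_smul {n : ℕ} (e : Module.Basis (Fin n) ℝ E) (f : E [⋀^Fin n]→ₗ[ℝ] W)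
    (w : Fin n → E) : f w = e.det w • f e := by
  have h : f = (LinearMap.toSpanSingleton ℝ W (f e)).compAlternatingMap e.det := by
    refine Module.Basis.ext_alternating e fun i hi => ?_
    let σ : Equiv.Perm (Fin n) := Equiv.ofBijective i (Finite.injective_iff_bijective.1 hi)
    change f (e ∘ σ) = (LinearMap.toSpanSingleton ℝ W (f e)).compAlternatingMap e.det (e ∘ σ)
    simp [AlternatingMap.map_perm, Module.Basis.det_self]
  conv_lhs => rw [h]
  rfl

end Alternating

/-! ### Separation of the tangential and the normal slots. -/

section Split

variable {k ℓ : ℕ}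

/-- The first `k - ℓ` and the last `ℓ` of `k` slots. -/
def slotEquiv (hk : ℓ ≤ k) : Fin (k - ℓ) ⊕ Fin ℓ ≃ Fin k :=
  finSumFinEquiv.trans (finCongr (Nat.sub_add_cancel hk))

theorem slotEquiv_inl (hk : ℓ ≤ k) (j : Fin (k - ℓ)) :
    slotEquiv hk (Sum.inl j) = Fin.castLE (Nat.sub_le _ _) j := by
  ext; simp [slotEquiv]

theorem slotEquiv_inr_val (hk : ℓ ≤ k) (m : Fin ℓ) :
    (slotEquiv hk (Sum.inr m) : ℕ) = k - ℓ + m := by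
  simp [slotEquiv]

theorem dite_eq_sumElim (hk : ℓ ≤ k) {α : Type*} (f : Fin (k - ℓ) → α) (g : Fin ℓ → α) :
    (fun i : Fin k => if h : (i : ℕ) < k - ℓ then f ⟨i, h⟩ else g ⟨i - (k - ℓ), by omega⟩) =
      Sum.elim f g ∘ (slotEquiv hk).symm := by
  rw [Equiv.eq_comp_symm]
  funext s
  rcases s with j | m
  · have h : ((slotEquiv hk (Sum.inl j) : Fin k) : ℕ) < k - ℓ := by
      rw [slotEquiv_inl]; exact j.2
    simp only [Function.comp_apply, Sum.elim_inl, dif_pos h]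
    congr 1
  · have h : ¬ ((slotEquiv hk (Sum.inr m) : Fin k) : ℕ) < k - ℓ := by
      rw [slotEquiv_inr_val]; omega
    simp only [Function.comp_apply, Sum.elim_inr, dif_neg h]
    congr 1
    ext
    simp [slotEquiv_inr_val]

theorem prod_slots (hk : ℓ ≤ k) (g : Fin k → ℝ) : ∏ i, g i =
    (∏ j, g (slotEquiv hk (Sum.inl j))) * ∏ m, g (slotEquiv hk (Sum.inr m)) := by
  rw [← Fintype.prod_sum_type fun s => g (slotEquiv hk s)]
  exact (Equiv.prod_comp (slotEquiv hk) g).symm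

theorem sdiff_image_castLE (hk : ℓ ≤ k) :
    (Finset.univ : Finset (Fin k)) \ Finset.univ.image (Fin.castLE (Nat.sub_le k ℓ)) =
      Finset.univ.image fun m => slotEquiv hk (Sum.inr m) := by
  ext i
  obtain ⟨s, rfl⟩ := (slotEquiv hk).surjective i
  have : Fin.castLE (Nat.sub_le k ℓ) = fun j => slotEquiv hk (Sum.inl j) :=
    funext fun j => (slotEquiv_inl hk j).symm
  rw [this]
  rcases s with j | m <;> simp

variable {V W : Type*} [NormedAddCommGroup V] [InnerProductSpace ℝ V] [AddCommGroup W] [Module ℝ W]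

/-- An alternating map as an alternating map of the first arguments. -/
def altLeft (hk : ℓ ≤ k) (G : V [⋀^Fin k]→ₗ[ℝ] W) (A : Submodule ℝ V) (n : Fin ℓ → V) :
    A [⋀^Fin (k - ℓ)]→ₗ[ℝ] W where
  toFun t := G (Sum.elim (fun j => (t j : V)) n ∘ (slotEquiv hk).symm)
  map_update_add' := by
    intro _ t j x y
    have h : ∀ z : A, Sum.elim (fun i => (Function.update t j z i : V)) n ∘ (slotEquiv hk).symm =
        Function.update (Sum.elim (fun i => (t i : V)) n ∘ (slotEquiv hk).symm)
          (slotEquiv hk (Sum.inl j)) z := by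
      intro z
      rw [Equiv.comp_symm_eq]
      funext s
      rcases s with i | m
      · by_cases hi : i = j
        · subst hi; simp
        · simp [hi, Function.update_of_ne]
      · simp
    simp only [h, Submodule.coe_add, AlternatingMap.map_update_add]
  map_update_smul' := by
    intro _ t j c x
    have h : ∀ z : A, Sum.elim (fun i => (Function.update t j z i : V)) n ∘ (slotEquiv hk).symm =
        Function.update (Sum.elim (fun i => (t i : V)) n ∘ (slotEquiv hk).symm)
          (slotEquiv hk (Sum.inl j)) z := by
      intro z
      rw [Equiv.comp_symm_eq]
      funext s
      rcases s with i | m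
      · by_cases hi : i = j
        · subst hi; simp
        · simp [hi, Function.update_of_ne]
      · simp
    simp only [h, Submodule.coe_smul, AlternatingMap.map_update_smul]
  map_eq_zero_of_eq' t i j h hij :=
    G.map_eq_zero_of_eq _ (i := slotEquiv hk (Sum.inl i)) (j := slotEquiv hk (Sum.inl j))
      (by simp [h]) (by simpa using hij)

/-- An alternating map as an alternating map of the last arguments. -/
def altRight (hk : ℓ ≤ k) (G : V [⋀^Fin k]→ₗ[ℝ] W) (A : Submodule ℝ V) (t : Fin (k - ℓ) → V) :
    A [⋀^Fin ℓ]→ₗ[ℝ] W where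
  toFun n := G (Sum.elim t (fun j => (n j : V)) ∘ (slotEquiv hk).symm)
  map_update_add' := by
    intro _ n j x y
    have h : ∀ z : A, Sum.elim t (fun i => (Function.update n j z i : V)) ∘ (slotEquiv hk).symm =
        Function.update (Sum.elim t (fun i => (n i : V)) ∘ (slotEquiv hk).symm)
          (slotEquiv hk (Sum.inr j)) z := by
      intro z
      rw [Equiv.comp_symm_eq]
      funext s
      rcases s with i | m
      · simp
      · by_cases hi : m = j
        · subst hi; simp
        · simp [hi, Function.update_of_ne]
    simp only [h, Submodule.coe_add, AlternatingMap.map_update_add]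
  map_update_smul' := by
    intro _ n j c x
    have h : ∀ z : A, Sum.elim t (fun i => (Function.update n j z i : V)) ∘ (slotEquiv hk).symm =
        Function.update (Sum.elim t (fun i => (n i : V)) ∘ (slotEquiv hk).symm)
          (slotEquiv hk (Sum.inr j)) z := by
      intro z
      rw [Equiv.comp_symm_eq]
      funext s
      rcases s with i | m
      · simp
      · by_cases hi : m = j
        · subst hi; simp
        · simp [hi, Function.update_of_ne]
    simp only [h, Submodule.coe_smul, AlternatingMap.map_update_smul]
  map_eq_zero_of_eq' n i j h hij :=
    G.map_eq_zero_of_eq _ (i := slotEquiv hk (Sum.inr i)) (j := slotEquiv hk (Sum.inr j))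
      (by simp [h]) (by simpa using hij)

end Split

variable {Γ : Type u} {V : Type v} [NormedAddCommGroup V] [Group Γ] [Fintype Γ]
  [InnerProductSpace ℝ V] [FiniteDimensional ℝ V] {k : ℕ} {ρ : Γ →* (V ≃ₗᵢ[ℝ] V)}
  (β : NormalCoordinates ρ) (γ : Γ)

/-- The linear forms which are paired with a twisted multivector. -/
def pairForm (k : ℕ) (a : Fin (k - ell ρ γ) → Fin (Module.finrank ℝ (fixed ρ γ))) :
    ⋀[ℝ]^k (Module.Dual ℝ V) :=
  exteriorPower.ιMulti ℝ k fun i : Fin k =>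
    if h : (i : ℕ) < k - ell ρ γ then
      (innerₗ V) (stdOrthonormalBasis ℝ (fixed ρ γ) (a ⟨i, h⟩) : V)
    else coordY β γ ⟨i - (k - ell ρ γ), by omega⟩

/-- The vectors spanning the twisted multivectors. -/
def pairVec (hk : ell ρ γ ≤ k) (a : Fin (k - ell ρ γ) → Fin (Module.finrank ℝ (fixed ρ γ)))
    (σ : Equiv.Perm (Fin (ell ρ γ))) : Fin k → V :=
  Sum.elim (fun j => (stdOrthonormalBasis ℝ (fixed ρ γ) (a j) : V)) (fun m => (β γ (σ m) : V)) ∘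
    (slotEquiv hk).symm

/-- The matrix of the pairing is block triangular because the normal coordinates vanish on fixed
vectors. -/
theorem pairForm_join (hk : ell ρ γ ≤ k)
    (a : Fin (k - ell ρ γ) → Fin (Module.finrank ℝ (fixed ρ γ)))
    (t : Fin (k - ell ρ γ) → fixed ρ γ) (n : Fin (ell ρ γ) → normal ρ γ) :
    exteriorPower.pairingDual ℝ V k (pairForm β γ k a) (exteriorPower.ιMulti ℝ k
      (Sum.elim (fun j => (t j : V)) (fun m => (n m : V)) ∘ (slotEquiv hk).symm)) =
    (Matrix.of fun i j => inner ℝ (stdOrthonormalBasis ℝ (fixed ρ γ) (a j)) (t i)).det *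
      (β γ).det n := by
  have e := dite_eq_sumElim hk
    (fun j => (innerₗ V) (stdOrthonormalBasis ℝ (fixed ρ γ) (a j) : V)) (coordY β γ)
  rw [pairForm, e, exteriorPower.pairingDual_ιMulti_ιMulti,
    ← Matrix.det_submatrix_equiv_self (slotEquiv hk), Module.Basis.det_apply,
    ← Matrix.det_transpose ((β γ).toMatrix n), ← Matrix.det_fromBlocks_zero₁₂ _
      (Matrix.of fun i j => inner ℝ (stdOrthonormalBasis ℝ (fixed ρ γ) (a j) : V) (n i : V))]
  congr 1
  ext r s
  rcases r with r | r <;> rcases s with s | s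
  · simp
  · simpa using coordY_fixed β γ s (t r).2
  · simp
  · simp [coordY, Module.Basis.toMatrix_apply]

/-- An induction principle: up to a sign the normal factors of a spanning vector can be moved to the
last `ℓ` slots. -/
theorem span_join (hk : ell ρ γ ≤ k) {τ : ⋀[ℝ]^k V} (hτ : τ ∈ twistedPart ρ γ k)
    {P : ⋀[ℝ]^k V → Prop} (hadd : ∀ a b, P a → P b → P (a + b)) (hsmul : ∀ (c : ℝ) a, P a → P (c • a))
    (hjoin : ∀ (t : Fin (k - ell ρ γ) → fixed ρ γ) (n : Fin (ell ρ γ) → normal ρ γ),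
      P (exteriorPower.ιMulti ℝ k
        (Sum.elim (fun j => (t j : V)) (fun m => (n m : V)) ∘ (slotEquiv hk).symm))) : P τ := by
  classical
  induction hτ using Submodule.span_induction with
  | zero => simpa using hsmul 0 _ (hjoin 0 0)
  | add a b _ _ ha hb => exact hadd _ _ ha hb
  | smul c a _ ha => exact hsmul c a ha
  | mem τ h =>
    obtain ⟨S, w, hS, hn, ht, rfl⟩ := h
    let R : Finset (Fin k) := Finset.univ.image fun m => slotEquiv hk (Sum.inr m)
    have hR : R.card = S.card := by
      rw [hS, Finset.card_image_of_injective _ fun a b hab => by simpa using hab, Finset.card_univ,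
        Fintype.card_fin]
    let e : {x // x ∈ R} ≃ {x // x ∈ S} := Finset.equivOfCardEq hR
    let π : Equiv.Perm (Fin k) := e.extendSubtype
    have h1 : ∀ m, w (π (slotEquiv hk (Sum.inr m))) ∈ normal ρ γ := fun m =>
      hn _ (e.extendSubtype_mem _ (by simp [R]))
    have h2 : ∀ j, w (π (slotEquiv hk (Sum.inl j))) ∈ fixed ρ γ := fun j =>
      ht _ (e.extendSubtype_not_mem _ (by simp [R]))
    have h3 := hjoin (fun j => ⟨_, h2 j⟩) fun m => ⟨_, h1 m⟩
    have h4 : Sum.elim (fun j => w (π (slotEquiv hk (Sum.inl j))))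
        (fun m => w (π (slotEquiv hk (Sum.inr m)))) ∘ (slotEquiv hk).symm = w ∘ π := by
      rw [Equiv.comp_symm_eq]
      funext s
      rcases s with j | m <;> rfl
    have h5 : exteriorPower.ιMulti ℝ k w =
        ((Equiv.Perm.sign π : ℤ) : ℝ) • exteriorPower.ιMulti ℝ k (w ∘ π) := by
      rw [AlternatingMap.map_perm, Units.smul_def, ← Int.cast_smul_eq_zsmul ℝ, smul_smul,
        ← Int.cast_mul, ← Units.val_mul, Int.units_mul_self]
      simp
    rw [h5, ← h4]
    exact hsmul _ _ h3

/-- The coefficients used by `polyAct` determine a twisted multivector. In the tangential slots the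
sum over all ordered indices counts everything `(k - ℓ)!` times; in the normal slots the degree is
maximal, so the determinant in the basis `β γ` is the only coefficient. -/
theorem sum_pairing_smul (hk : ell ρ γ ≤ k) {τ : ⋀[ℝ]^k V} (hτ : τ ∈ twistedPart ρ γ k) :
    ∑ a, ((k - ell ρ γ).factorial : ℝ)⁻¹ •
      exteriorPower.pairingDual ℝ V k (pairForm β γ k a) τ •
        exteriorPower.ιMulti ℝ k (pairVec β γ hk a 1) = τ := by
  rw [← Finset.smul_sum]
  refine span_join γ hk (P := fun τ => ((k - ell ρ γ).factorial : ℝ)⁻¹ • ∑ a,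
      exteriorPower.pairingDual ℝ V k (pairForm β γ k a) τ •
        exteriorPower.ιMulti ℝ k (pairVec β γ hk a 1) = τ) hτ (fun a b ha hb => ?_)
    (fun c a ha => ?_) fun t n => ?_
  · simp only [map_add, add_smul, Finset.sum_add_distrib, smul_add, ha, hb]
  · simp only [map_smul, smul_assoc, ← Finset.smul_sum]
    rw [smul_comm, ha]
  · simp only [pairForm_join, mul_smul]
    have h1 : ∀ a, (β γ).det n • exteriorPower.ιMulti ℝ k (pairVec β γ hk a 1) =
        altLeft hk (exteriorPower.ιMulti ℝ k) (fixed ρ γ) (fun m => (n m : V))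
          fun j => stdOrthonormalBasis ℝ (fixed ρ γ) (a j) := by
      intro a
      exact (alternating_eq_det_smul (β γ) (altRight hk (exteriorPower.ιMulti ℝ k) (normal ρ γ)
        fun j => (stdOrthonormalBasis ℝ (fixed ρ γ) (a j) : V)) n).symm
    simp only [h1]
    rw [sum_det_inner_smul, smul_smul, inv_mul_cancel₀ (by positivity), one_smul]
    rfl

theorem sum_sign_smul_pairVec (hk : ell ρ γ ≤ k)
    (a : Fin (k - ell ρ γ) → Fin (Module.finrank ℝ (fixed ρ γ))) :
    ∑ σ : Equiv.Perm (Fin (ell ρ γ)), ((Equiv.Perm.sign σ : ℤ) : ℝ) •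
      exteriorPower.ιMulti ℝ k (pairVec β γ hk a σ) =
    ((ell ρ γ).factorial : ℝ) • exteriorPower.ιMulti ℝ k (pairVec β γ hk a 1) := by
  have h : ∀ σ : Equiv.Perm (Fin (ell ρ γ)), ((Equiv.Perm.sign σ : ℤ) : ℝ) •
      exteriorPower.ιMulti ℝ k (pairVec β γ hk a σ) =
      exteriorPower.ιMulti ℝ k (pairVec β γ hk a 1) := by
    intro σ
    have h1 := (altRight hk (exteriorPower.ιMulti ℝ k) (normal ρ γ)
        fun j => (stdOrthonormalBasis ℝ (fixed ρ γ) (a j) : V)).map_perm (β γ) σ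
    have h2 : exteriorPower.ιMulti ℝ k (pairVec β γ hk a σ) = Equiv.Perm.sign σ •
      exteriorPower.ιMulti ℝ k (pairVec β γ hk a 1) := h1
    rw [h2, Units.smul_def, ← Int.cast_smul_eq_zsmul ℝ, smul_smul, ← Int.cast_mul,
      ← Units.val_mul, Int.units_mul_self]
    simp
  simp only [h, Finset.sum_const, Finset.card_univ, Fintype.card_perm, Fintype.card_fin]
  rw [← Nat.cast_smul_eq_nsmul ℝ]

/-! #### The local computation -/

/-- Each of the distinct slots occurs in one linear factor, so a derivative in a slot replaces that
factor by its value on the direction. -/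
theorem iteratedFDeriv_prod_slots (l : Fin k → V →L[ℝ] ℝ) (x : V) : ∀ (n : ℕ) (s : Fin n → Fin k),
    Function.Injective s → ∀ (e : Fin n → V) (y : Fin k → V),
    iteratedFDeriv ℝ n (fun y : Fin k → V => ∏ i, l i (y i - x)) y (fun a => Pi.single (s a) (e a)) =
      (∏ a, l (s a) (e a)) * ∏ i ∈ Finset.univ \ Finset.univ.image s, l i (y i - x)
  | 0, s, hs, e, y => by simp
  | n + 1, s, hs, e, y => by
    have hsm : ContDiff ℝ ∞ fun y : Fin k → V => ∏ i, l i (y i - x) :=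
      contDiff_prod fun i _ => (l i).contDiff.comp ((contDiff_apply ℝ V i).sub contDiff_const)
    have ih := iteratedFDeriv_prod_slots l x n (fun a => s (Fin.succ a))
      (hs.comp (Fin.succ_injective n)) fun a => e (Fin.succ a)
    rw [iteratedFDeriv_succ_apply_left]
    have hd : DifferentiableAt ℝ (iteratedFDeriv ℝ n fun y : Fin k → V => ∏ i, l i (y i - x)) y :=
      (hsm.differentiable_iteratedFDeriv (by exact_mod_cast WithTop.coe_lt_top n)) y
    have h2 := ((ContinuousMultilinearMap.apply ℝ (fun _ : Fin n => Fin k → V) ℝ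
      (fun a => Pi.single (s (Fin.succ a)) (e (Fin.succ a)))).hasFDerivAt.comp y hd.hasFDerivAt)
    have h3 : ∀ z : Fin k → V, (⇑(ContinuousMultilinearMap.apply ℝ (fun _ : Fin n => Fin k → V) ℝ
        (fun a => Pi.single (s (Fin.succ a)) (e (Fin.succ a)))) ∘
        (iteratedFDeriv ℝ n fun y : Fin k → V => ∏ i, l i (y i - x))) z =
        (∏ a, l (s (Fin.succ a)) (e (Fin.succ a))) *
          ∏ i ∈ Finset.univ \ Finset.univ.image (fun a => s (Fin.succ a)), l i (z i - x) := fun z => ih z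
    have hmem : s 0 ∈ Finset.univ \ Finset.univ.image fun a => s (Fin.succ a) := by
      simp only [Finset.mem_sdiff, Finset.mem_univ, Finset.mem_image, true_and, not_exists]
      exact fun a h => Fin.succ_ne_zero a (hs h)
    have herase : (Finset.univ \ Finset.univ.image fun a => s (Fin.succ a)).erase (s 0) =
        Finset.univ \ Finset.univ.image s := by
      ext i
      simp only [Finset.mem_erase, Finset.mem_sdiff, Finset.mem_univ, Finset.mem_image, true_and,
        not_exists, Fin.forall_fin_succ, ne_eq]
      rw [eq_comm]
    -- The last derivative is computed along a line, on which the remaining product is affine in the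
    -- parameter.
    have hline : HasDerivAt (fun r : ℝ => y + r • (Pi.single (s 0) (e 0) : Fin k → V))
        (Pi.single (s 0) (e 0) : Fin k → V) 0 := by
      simpa using ((hasDerivAt_id (0 : ℝ)).smul_const
        (Pi.single (s 0) (e 0) : Fin k → V)).const_add y
    have h4 := HasFDerivAt.comp_hasDerivAt (0 : ℝ) (by rw [zero_smul, add_zero]; exact h2) hline
    have h5 : ((⇑(ContinuousMultilinearMap.apply ℝ (fun _ : Fin n => Fin k → V) ℝ
        (fun a => Pi.single (s (Fin.succ a)) (e (Fin.succ a)))) ∘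
        (iteratedFDeriv ℝ n fun y : Fin k → V => ∏ i, l i (y i - x))) ∘
        fun r : ℝ => y + r • (Pi.single (s 0) (e 0) : Fin k → V)) = fun r =>
        (∏ a, l (s (Fin.succ a)) (e (Fin.succ a))) * ((l (s 0) (y (s 0) - x) + r * l (s 0) (e 0)) *
          ∏ i ∈ Finset.univ \ Finset.univ.image s, l i (y i - x)) := by
      funext r
      rw [Function.comp_apply, h3, ← Finset.mul_prod_erase _ _ hmem, herase]
      congr 2
      · simp only [Pi.add_apply, Pi.smul_apply, Pi.single_eq_same, add_sub_right_comm, map_add,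
          map_smul, smul_eq_mul]
      · refine Finset.prod_congr rfl fun i hi => ?_
        have : i ≠ s 0 := by
          rintro rfl
          simp at hi
        simp [this]
    rw [h5] at h4
    have h6 : HasDerivAt (fun r : ℝ => (∏ a, l (s (Fin.succ a)) (e (Fin.succ a))) *
        ((l (s 0) (y (s 0) - x) + r * l (s 0) (e 0)) *
          ∏ i ∈ Finset.univ \ Finset.univ.image s, l i (y i - x)))
        ((∏ a, l (s (Fin.succ a)) (e (Fin.succ a))) * ((1 * l (s 0) (e 0)) *
          ∏ i ∈ Finset.univ \ Finset.univ.image s, l i (y i - x))) 0 :=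
      ((((hasDerivAt_id (0 : ℝ)).mul_const (l (s 0) (e 0))).const_add _).mul_const _).const_mul _
    have h7 := h4.unique h6
    rw [Fin.prod_univ_succ]
    refine Eq.trans ?_ (h7.trans (by ring))
    rfl

/-- Near the diagonal the cut-off influences neither derivatives nor differences; this is why the
composition with `T` does not depend on `ϱ` and `ε`. -/
theorem eventually_cutPsi_eq_one (ϱ : CutOff) {ε : ℝ} (x : V) :
    ∀ᶠ y in 𝓝 (fun _ : Fin k => x), cutPsi ϱ ε x x y = 1 := by
  have h : ∀ j : Fin (k + 1), ∀ᶠ y in 𝓝 (fun _ : Fin k => x),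
      ‖chain x x y j.castSucc - chain x x y j.succ‖ ^ 2 / ε < 1 / 2 := by
    intro j
    have hch : ∀ i : Fin (k + 2), ContDiff ℝ ∞ fun y : Fin k → V => chain x x y i :=
      contDiff_pi.1 (contDiff_cons contDiff_const (contDiff_snoc contDiff_const contDiff_id))
    have hc : Continuous fun y : Fin k → V =>
        ‖chain x x y j.castSucc - chain x x y j.succ‖ ^ 2 / ε :=
      ((((hch _).sub (hch _)).norm_sq ℝ).div_const ε).continuous
    have hcst : ∀ i : Fin (k + 2), chain x x (fun _ : Fin k => x) i = x := by
      intro i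
      unfold chain
      refine Fin.cases ?_ (fun i => ?_) i
      · simp
      · refine Fin.lastCases ?_ (fun i => ?_) i <;> simp
    refine hc.continuousAt.eventually_lt continuousAt_const ?_
    simp [hcst]
  filter_upwards [eventually_all.2 h] with y hy
  exact Finset.prod_eq_one fun j _ => ϱ.eq_one _ (hy j).le

theorem omega_eq_of_eventually {ψ : (Fin (ell ρ γ) → V) → ℝ} {x : V} {c : ℝ}
    (h : ∀ᶠ v in 𝓝 x, omegaNum β γ ψ v = (∏ j, (coordY β γ j v - coordY' β γ j v)) * c) :
    Omega β γ ψ x = c := by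
  refine extendFrom_eq (dense_coordY_ne β γ x) (tendsto_const_nhds.congr' ?_)
  filter_upwards [self_mem_nhdsWithin, nhdsWithin_le_nhds h] with w hw hw'
  have hne : ∏ j, (coordY β γ j w - coordY' β γ j w) ≠ 0 :=
    Finset.prod_ne_zero_iff.2 fun j _ => sub_ne_zero.2 (hw j)
  rw [eq_div_iff hne, mul_comm]
  exact hw'.symm

theorem zPoint_fixed (σ : Equiv.Perm (Fin (ell ρ γ))) (i : ℕ) {x : V} (hx : x ∈ fixed ρ γ) :
    zPoint β γ σ i x = x := by
  have hx' : ρ γ⁻¹ x = x := by conv_lhs => rw [← (mem_fixed ρ).1 hx, rho_inv_apply_self]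
  simp only [zPoint, coordY', hx', coordY_fixed β γ _ hx, ite_self, zero_smul,
    Finset.sum_const_zero, add_zero]
  exact tanProj_eq ρ γ hx

variable (ϱ : CutOff) {ε : ℝ} (hε : 0 < ε)

/-- All points of the chain tend to `x` when `v` does, so near `x` the monomial may be taken without
its cut-off. The first `k - ℓ` linear factors are differentiated. In the others the differences are
exact multiples of `y_j - ỹ_j`, so the quotient is constant near `x` and the extension by continuity
has this value. -/
theorem omega_polyAct_cutMonomial (hk : ell ρ γ ≤ k) (ξ : fixed ρ γ → ⋀[ℝ]^k V) (x : fixed ρ γ)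
    (I : Fin k → Fin (Module.finrank ℝ V)) :
    Omega β γ (polyAct β γ ξ (cutMonomial ϱ hε (x : V) x I) x) x =
      ∑ a, ∑ σ : Equiv.Perm (Fin (ell ρ γ)), (((k - ell ρ γ).factorial : ℝ)⁻¹ *
        exteriorPower.pairingDual ℝ V k (pairForm β γ k a) (ξ x) *
        (((ell ρ γ).factorial : ℝ)⁻¹ * ((Equiv.Perm.sign σ : ℤ) : ℝ))) *
        ∏ j, inner ℝ (stdOrthonormalBasis ℝ V (I j)) (pairVec β γ hk a σ j) := by
  set l : Fin k → V →L[ℝ] ℝ := fun j => innerSL ℝ (stdOrthonormalBasis ℝ V (I j)) with hl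
  set c : (Fin (k - ell ρ γ) → Fin (Module.finrank ℝ (fixed ρ γ))) → ℝ := fun a =>
    ((k - ell ρ γ).factorial : ℝ)⁻¹ *
        exteriorPower.pairingDual ℝ V k (pairForm β γ k a) (ξ x) with hc
  have hloc : ∀ᶠ w in 𝓝 (fun _ : Fin (ell ρ γ) => (x : V)),
      polyAct β γ ξ (cutMonomial ϱ hε (x : V) x I) x w = ∑ a, (c a *
        ∏ j, l (slotEquiv hk (Sum.inl j)) (stdOrthonormalBasis ℝ (fixed ρ γ) (a j))) *
        ∏ m, l (slotEquiv hk (Sum.inr m)) (w m - x) := by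
    have h1 : ∀ᶠ y in 𝓝 (fun _ : Fin k => (x : V)), (cutMonomial ϱ hε (x : V) x I).1 =ᶠ[𝓝 y]
        fun y => ∏ i, l i (y i - x) := by
      refine eventually_eventually_nhds.2 ?_
      filter_upwards [eventually_cutPsi_eq_one ϱ (ε := ε) (k := k) (x : V)] with y hy
      rw [cutMonomial_apply, hy, one_mul]
      rfl
    set q : (Fin (ell ρ γ) → V) → Fin k → V := fun w i => if h : (i : ℕ) < k - ell ρ γ then (x : V)
        else w ⟨i - (k - ell ρ γ), by omega⟩ with hq
    have hqc : Continuous q := continuous_pi fun i => by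
      simp only [hq]
      split_ifs
      · exact continuous_const
      · exact continuous_apply _
    have hq0 : q (fun _ => (x : V)) = fun _ => (x : V) := by
      funext i
      simp only [hq]
      split_ifs <;> rfl
    have h2 := (hqc.continuousAt (x := fun _ => (x : V))).eventually (by rw [hq0]; exact h1)
    filter_upwards [h2] with w hw
    have hq' : ∀ m, q w (slotEquiv hk (Sum.inr m)) = w m := by
      intro m
      have := dite_eq_sumElim hk (fun _ => (x : V)) w
      change q w = _ at this
      rw [this]
      simp
    unfold polyAct
    rw [Finset.mul_sum]
    refine Finset.sum_congr rfl fun a _ => ?_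
    have h3 := (hw.iteratedFDeriv ℝ (k - ell ρ γ)).eq_of_nhds
    have h4 := iteratedFDeriv_prod_slots l (x : V) (k - ell ρ γ) (Fin.castLE (Nat.sub_le _ _))
      (Fin.castLE_injective _) (fun i => (stdOrthonormalBasis ℝ (fixed ρ γ) (a i) : V)) (q w)
    rw [sdiff_image_castLE hk, Finset.prod_image fun _ _ _ _ h => by simpa using h] at h4
    simp only [hq'] at h4
    change _ * (_ * iteratedFDeriv ℝ (k - ell ρ γ) (cutMonomial ϱ hε (x : V) x I).1 (q w) _) = _
    rw [h3, h4]
    have h5 : (fixed ρ γ).orthogonalProjectionOnto (x : V) = x :=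
      Submodule.orthogonalProjectionOnto_mem_subspace_eq_self x
    rw [h5]
    simp only [hc, slotEquiv_inl]
    rw [pairForm]
    ring
  refine omega_eq_of_eventually β γ ?_
  have hz : ∀ (σ : Equiv.Perm (Fin (ell ρ γ))) (S : Finset (Fin (ell ρ γ))), ∀ᶠ v in 𝓝 (x : V),
      polyAct β γ ξ (cutMonomial ϱ hε (x : V) x I) x
        (fun i => zPoint β γ σ (if i ∈ S then (i : ℕ) + 1 else i) v) = ∑ a, (c a *
        ∏ j, l (slotEquiv hk (Sum.inl j)) (stdOrthonormalBasis ℝ (fixed ρ γ) (a j))) *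
        ∏ m, l (slotEquiv hk (Sum.inr m))
          (zPoint β γ σ (if m ∈ S then (m : ℕ) + 1 else m) v - x) := by
    intro σ S
    have hcz : Continuous fun v => fun i : Fin (ell ρ γ) =>
        zPoint β γ σ (if i ∈ S then (i : ℕ) + 1 else i) v :=
      continuous_pi fun i => (contDiff_zPoint β γ σ _).continuous
    have : (fun i : Fin (ell ρ γ) => zPoint β γ σ (if i ∈ S then (i : ℕ) + 1 else i) (x : V)) =
        fun _ => (x : V) := funext fun i => zPoint_fixed β γ σ _ x.2
    exact (ContinuousAt.tendsto (hcz.continuousAt (x := (x : V)))).eventually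
      (this.symm ▸ hloc)
  filter_upwards [eventually_all.2 fun σ => eventually_all.2 (hz σ)] with v hv
  unfold omegaNum
  simp only [hv]
  -- The sum over `S` is the expansion of a product of differences, and by `zPoint_succ` each
  -- difference is `y - ỹ` times the linear form on a basis vector.
  have hdiff : ∀ σ : Equiv.Perm (Fin (ell ρ γ)), ∑ S : Finset (Fin (ell ρ γ)), (-1 : ℝ) ^ S.card *
      ∏ m, l (slotEquiv hk (Sum.inr m)) (zPoint β γ σ (if m ∈ S then (m : ℕ) + 1 else m) v - x) =
      (∏ j, (coordY β γ j v - coordY' β γ j v)) *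
        ∏ m, l (slotEquiv hk (Sum.inr m)) (β γ (σ m)) := by
    intro σ
    rw [← Equiv.prod_comp σ fun j => coordY β γ j v - coordY' β γ j v, ← Finset.prod_mul_distrib]
    have h1 : ∀ m : Fin (ell ρ γ), (coordY β γ (σ m) v - coordY' β γ (σ m) v) *
        l (slotEquiv hk (Sum.inr m)) (β γ (σ m)) =
        l (slotEquiv hk (Sum.inr m)) (zPoint β γ σ m v - x) -
          l (slotEquiv hk (Sum.inr m)) (zPoint β γ σ ((m : ℕ) + 1) v - x) := by
      intro m
      rw [zPoint_succ, ← map_sub, ← smul_eq_mul, ← map_smul]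
      congr 1
      module
    rw [Finset.prod_congr rfl fun m _ => h1 m, Finset.prod_sub, Finset.powerset_univ]
    refine Finset.sum_congr rfl fun S _ => ?_
    rw [mul_assoc, ← Finset.prod_sdiff (Finset.subset_univ S)]
    congr 2
    · exact Finset.prod_congr rfl fun m hm => by simp [(Finset.mem_sdiff.1 hm).2]
    · exact Finset.prod_congr rfl fun m hm => by simp [hm]
  have h2 : ∀ a (σ : Equiv.Perm (Fin (ell ρ γ))),
      ∏ j, inner ℝ (stdOrthonormalBasis ℝ V (I j)) (pairVec β γ hk a σ j) =
      (∏ j, l (slotEquiv hk (Sum.inl j)) (stdOrthonormalBasis ℝ (fixed ρ γ) (a j))) *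
        ∏ m, l (slotEquiv hk (Sum.inr m)) (β γ (σ m)) := by
    intro a σ
    rw [prod_slots hk]
    simp [pairVec, hl]
  simp only [h2]
  have h3 : ∀ σ : Equiv.Perm (Fin (ell ρ γ)), ∑ S : Finset (Fin (ell ρ γ)), (-1 : ℝ) ^ S.card *
      ∑ a, (c a * ∏ j, l (slotEquiv hk (Sum.inl j)) (stdOrthonormalBasis ℝ (fixed ρ γ) (a j))) *
        ∏ m, l (slotEquiv hk (Sum.inr m))
          (zPoint β γ σ (if m ∈ S then (m : ℕ) + 1 else m) v - x) =
      ∑ a, (c a * ∏ j, l (slotEquiv hk (Sum.inl j)) (stdOrthonormalBasis ℝ (fixed ρ γ) (a j))) *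
        ((∏ j, (coordY β γ j v - coordY' β γ j v)) *
          ∏ m, l (slotEquiv hk (Sum.inr m)) (β γ (σ m))) := by
    intro σ
    simp only [← hdiff, Finset.mul_sum]
    rw [Finset.sum_comm]
    exact Finset.sum_congr rfl fun a _ => Finset.sum_congr rfl fun S _ => by ring
  rw [Finset.sum_congr rfl fun σ _ => by rw [h3 σ]]
  simp only [Finset.mul_sum]
  rw [Finset.sum_comm]
  exact Finset.sum_congr rfl fun a _ => Finset.sum_congr rfl fun σ _ => by ring

theorem L₃₂_preT₁ {ξ : (γ : Γ) → fixed ρ γ → ⋀[ℝ]^k V} (hξ : ∀ γ x, ξ γ x ∈ twistedPart ρ γ k) :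
    L₃₂ ρ ϱ hε (preT₁ β ξ) = ξ := by
  funext γ x
  -- `L₂` already returns `ξ` on the fixed space, and the projection has no effect.
  have hfin : L₂ ρ ϱ hε (preT₁ β ξ) γ x = ξ γ x := by
    have hx : ρ γ (x : V) = x := x.2
    rcases lt_or_ge k (ell ρ γ) with hk | hk
    · have h0 : ∀ x, ξ γ x = 0 := fun x => by
        have := hξ γ x
        rwa [twistedPart_eq_bot ρ hk, Submodule.mem_bot] at this
      have h1 : ∀ φ v, preT₁ β ξ φ (γ, v) = 0 := fun φ v => by
        have e : ξ γ = (0 : ℝ) • ξ γ := funext fun x => by simp [h0]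
        unfold preT₁
        simp only
        rw [e, polyAct_smul_left, omega_smul β γ 0 (contDiff_polyAct _ _ _), zero_mul]
      simp [L₂, h1, h0]
    · unfold L₂ preT₁
      simp only [hx, omega_polyAct_cutMonomial β γ ϱ hε hk, Finset.sum_smul]
      rw [Finset.sum_comm]
      conv_rhs => rw [← sum_pairing_smul β γ hk (hξ γ x)]
      refine Finset.sum_congr rfl fun a _ => ?_
      rw [Finset.sum_comm]
      simp only [mul_smul, ← Finset.smul_sum, sum_prod_inner_smul_ιMulti]
      rw [sum_sign_smul_pairVec, smul_smul (((ell ρ γ).factorial : ℝ)⁻¹),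
        inv_mul_cancel₀ (by positivity), one_smul]
  change pr ρ γ k (L₂ ρ ϱ hε (preT₁ β ξ) γ x) = ξ γ x
  rw [hfin]
  exact pr_eq_self ρ (hξ γ x)

theorem restrict_T₂_preT₁ (ξ : (γ : Γ) → fixed ρ γ → ⋀[ℝ]^k V) :
    restrict (T₂ ρ (preT₁ β ξ)) = preT₁ β ξ :=
  restrict_T₂ ρ (isLinearMap_preT₁ β ξ).map_zero

/-- The second average acts on an invariant cochain and the first does not change the localization,
because the localization of `preT₁ β ξ` is `ξ`, which is itself invariant. -/
theorem L_T {ξ : (γ : Γ) → fixed ρ γ → ⋀[ℝ]^k V} (hξ : ξ ∈ twistedFields ρ k) :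
    L ρ ϱ hε (T β ξ) = ξ := by
  have hl := isLinearMap_preT₁ β ξ
  have hli := isLinearMap_avg ρ hl
  rw [L_eq, T, T₁, restrict_T₂ ρ hli.map_zero, avg_eq_self ρ fun g => act_avg ρ g _,
    L₃₂_avg_eq ρ ϱ hε hl, L₃₂_preT₁ β ϱ hε hξ.2.1]
  rw [L₃₂_preT₁ β ϱ hε hξ.2.1]
  exact hξ.2.2

end Inverse
/-! ### Exterior and interior multiplication -/

section Exterior

universe u v

variable {V : Type v} [NormedAddCommGroup V] [InnerProductSpace ℝ V]

/-- Exterior multiplication by a vector. -/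
def wed (v : V) : Module.End ℝ (ExteriorAlgebra ℝ V) := LinearMap.mulLeft ℝ (ExteriorAlgebra.ι ℝ v)

/-- Interior multiplication by a vector. -/
def con (v : V) : Module.End ℝ (ExteriorAlgebra ℝ V) := CliffordAlgebra.contractLeft (innerₗ V v)

theorem wed_apply (v : V) (x : ExteriorAlgebra ℝ V) : wed v x = ExteriorAlgebra.ι ℝ v * x := rfl

theorem wed_add (v w : V) (x : ExteriorAlgebra ℝ V) : wed (v + w) x = wed v x + wed w x := by
  simp [wed_apply, add_mul]

theorem wed_sub (v w : V) (x : ExteriorAlgebra ℝ V) : wed (v - w) x = wed v x - wed w x := by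
  simp [wed_apply, sub_mul]

theorem wed_smul (c : ℝ) (v : V) (x : ExteriorAlgebra ℝ V) : wed (c • v) x = c • wed v x := by
  simp [wed_apply]

theorem wed_sum {κ : Type*} (s : Finset κ) (v : κ → V) (x : ExteriorAlgebra ℝ V) :
    wed (∑ i ∈ s, v i) x = ∑ i ∈ s, wed (v i) x := by
  simp [wed_apply, Finset.sum_mul]

theorem wed_wed_self (v : V) (x : ExteriorAlgebra ℝ V) : wed v (wed v x) = 0 := by
  simp [wed_apply, ← mul_assoc]

theorem wed_wed (v w : V) (x : ExteriorAlgebra ℝ V) : wed v (wed w x) = -wed w (wed v x) := by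
  rw [eq_neg_iff_add_eq_zero, wed_apply, wed_apply, wed_apply, wed_apply, ← mul_assoc, ← mul_assoc,
    ← add_mul, ExteriorAlgebra.ι_add_mul_swap, zero_mul]

theorem con_wed (v w : V) (x : ExteriorAlgebra ℝ V) :
    con v (wed w x) = inner ℝ v w • x - wed w (con v x) :=
  CliffordAlgebra.contractLeft_ι_mul _ _ _

theorem con_con_self (v : V) (x : ExteriorAlgebra ℝ V) : con v (con v x) = 0 :=
  CliffordAlgebra.contractLeft_contractLeft _ _

theorem con_con (v w : V) (x : ExteriorAlgebra ℝ V) : con v (con w x) = -con w (con v x) :=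
  CliffordAlgebra.contractLeft_comm _ _ _

theorem con_algebraMap (v : V) (r : ℝ) : con v (algebraMap ℝ (ExteriorAlgebra ℝ V) r) = 0 :=
  CliffordAlgebra.contractLeft_algebraMap 0 _ r

variable {n : ℕ} {e : Fin n → V}

theorem con_wed_self (he : Orthonormal ℝ e) (j : Fin n) (x : ExteriorAlgebra ℝ V) :
    con (e j) (wed (e j) x) = x - wed (e j) (con (e j) x) := by
  rw [con_wed, real_inner_self_eq_norm_sq, he.1 j, one_pow, one_smul]

theorem con_wed_ne (he : Orthonormal ℝ e) {i j : Fin n} (hij : i ≠ j) (x : ExteriorAlgebra ℝ V) :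
    con (e i) (wed (e j) x) = -wed (e j) (con (e i) x) := by
  rw [con_wed, he.2 hij, zero_smul, zero_sub]

variable (e) in
/-- The composition of the operators `con (e j) ∘ wed (e j)` for `j` in a list. -/
def conWed : List (Fin n) → ExteriorAlgebra ℝ V → ExteriorAlgebra ℝ V
  | [], x => x
  | j :: l, x => con (e j) (wed (e j) (conWed l x))

theorem conWed_wed_ne (he : Orthonormal ℝ e) {j : Fin n} : ∀ {l : List (Fin n)}, j ∉ l → ∀ x,
    conWed e l (wed (e j) x) = wed (e j) (conWed e l x)
  | [], _, x => rfl
  | i :: l, hj, x => by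
    rw [List.mem_cons, not_or] at hj
    rw [conWed, conWed_wed_ne he hj.2, wed_wed, map_neg, con_wed_ne he (Ne.symm hj.1), neg_neg, conWed]

theorem conWed_wed (he : Orthonormal ℝ e) {j : Fin n} : ∀ {l : List (Fin n)}, j ∈ l → ∀ x,
    conWed e l (wed (e j) x) = 0
  | i :: l, hj, x => by
    by_cases h : j ∈ l
    · rw [conWed, conWed_wed he h, map_zero, map_zero]
    · obtain rfl : j = i := (List.mem_cons.1 hj).resolve_right h
      rw [conWed, conWed_wed_ne he h, wed_wed_self, map_zero]

theorem conWed_eq_self (he : Orthonormal ℝ e) {x : ExteriorAlgebra ℝ V}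
    (hx : ∀ j, con (e j) x = 0) : ∀ l : List (Fin n), conWed e l x = x
  | [] => rfl
  | j :: l => by
    rw [conWed, conWed_eq_self he hx l, con_wed_self he, hx, map_zero, sub_zero]

theorem conWed_linear (l : List (Fin n)) : IsLinearMap ℝ (conWed e l) := by
  induction l with
  | nil => exact ⟨fun _ _ => rfl, fun _ _ => rfl⟩
  | cons j l ih =>
    exact ⟨fun x y => by simp only [conWed, ih.map_add, map_add],
      fun c x => by simp only [conWed, ih.map_smul, map_smul]⟩

/-- An element of the exterior algebra is a scalar if all its contractions vanish. -/
theorem eq_algebraMap_of_con (b : OrthonormalBasis (Fin n) ℝ V) {x : ExteriorAlgebra ℝ V}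
    (hx : ∀ j, con (b j) x = 0) :
    x = algebraMap ℝ (ExteriorAlgebra ℝ V) (ExteriorAlgebra.algebraMapInv x) := by
  have he := b.orthonormal
  have hl := conWed_linear (e := b) (List.finRange n)
  -- The composition of all `con (b j) ∘ wed (b j)` is the projection onto the scalars: it kills
  -- every multiple of a basis vector. On elements with vanishing contractions it is the identity.
  have h : ∀ x : ExteriorAlgebra ℝ V, conWed b (List.finRange n) x =
      algebraMap ℝ (ExteriorAlgebra ℝ V) (ExteriorAlgebra.algebraMapInv x) := by
    intro x
    induction x using CliffordAlgebra.left_induction with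
    | algebraMap r =>
      rw [conWed_eq_self he fun j => con_algebraMap _ _]
      exact congrArg _ (ExteriorAlgebra.algebraMap_leftInverse V r).symm
    | add x y hx hy => rw [hl.map_add, hx, hy, map_add, map_add]
    | ι_mul x v _ =>
      have h1 : CliffordAlgebra.ι 0 v * x = wed (∑ j, inner ℝ (b j) v • b j) x := by
        rw [b.sum_repr']; rfl
      have h2 : ExteriorAlgebra.algebraMapInv (CliffordAlgebra.ι (0 : QuadraticForm ℝ V) v * x) =
          (0 : ℝ) := by
        change ExteriorAlgebra.algebraMapInv (ExteriorAlgebra.ι ℝ v * x) = (0 : ℝ)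
        rw [map_mul]
        simp [ExteriorAlgebra.algebraMapInv]
      rw [h2, map_zero, h1, wed_sum]
      have h3 := map_sum (hl.mk' _) (fun j => wed (inner ℝ (b j) v • b j) x) Finset.univ
      simp only [IsLinearMap.mk'_apply] at h3
      rw [h3]
      refine Finset.sum_eq_zero fun j _ => ?_
      rw [wed_smul, hl.map_smul, conWed_wed he (List.mem_finRange j), smul_zero]
  rw [← h, conWed_eq_self he hx]

/-! #### The projection onto the multiples of a volume element -/

variable (e) in
/-- The composition of the projections `wed (e j) ∘ con (e j)` for `j` in a list. -/
def volProj : List (Fin n) → Module.End ℝ (ExteriorAlgebra ℝ V)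
  | [] => 1
  | j :: l => wed (e j) ∘ₗ con (e j) ∘ₗ volProj l

theorem volProj_cons (j : Fin n) (l : List (Fin n)) (x : ExteriorAlgebra ℝ V) :
    volProj e (j :: l) x = wed (e j) (con (e j) (volProj e l x)) := rfl

theorem wed_con_comm (he : Orthonormal ℝ e) (i j : Fin n) (x : ExteriorAlgebra ℝ V) :
    wed (e i) (con (e i) (wed (e j) (con (e j) x))) =
      wed (e j) (con (e j) (wed (e i) (con (e i) x))) := by
  by_cases hij : i = j
  · rw [hij]
  · rw [con_wed_ne he hij, con_wed_ne he (Ne.symm hij), map_neg, map_neg, wed_wed, neg_neg, con_con,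
      map_neg, map_neg]

theorem wed_con_volProj (he : Orthonormal ℝ e) {j : Fin n} : ∀ {l : List (Fin n)}, j ∈ l → ∀ x,
    wed (e j) (con (e j) (volProj e l x)) = volProj e l x
  | i :: l, hj, x => by
    rcases List.mem_cons.1 hj with rfl | h
    · rw [volProj_cons, con_wed_self he, map_sub, wed_wed_self, sub_zero]
    · rw [volProj_cons, wed_con_comm he, wed_con_volProj he h]

theorem volProj_wed_con (he : Orthonormal ℝ e) (j : Fin n) (l : List (Fin n)) (x) :
    volProj e l (wed (e j) (con (e j) x)) = wed (e j) (con (e j) (volProj e l x)) := by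
  induction l with
  | nil => rfl
  | cons i l ih => rw [volProj_cons, ih, wed_con_comm he, volProj_cons]

/-- This operator is the derivation extending the orthogonal projection onto the span of an
orthonormal `e`; on a product of eigenvectors it acts by the sum of the eigenvalues. For the normal
basis it counts normal factors. -/
theorem sum_wed_con_ιMulti {k : ℕ} {w : Fin k → V} {c : Fin k → ℝ}
    (h : ∀ i, ∑ j, inner ℝ (e j) (w i) • e j = c i • w i) :
    ∑ j, wed (e j) (con (e j) (ExteriorAlgebra.ιMulti ℝ k w)) =
      (∑ i, c i) • ExteriorAlgebra.ιMulti ℝ k w := by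
  induction k with
  | zero =>
    simp only [ExteriorAlgebra.ιMulti_zero_apply, Finset.univ_eq_empty, Finset.sum_empty, zero_smul]
    refine Finset.sum_eq_zero fun j _ => ?_
    rw [← map_one (algebraMap ℝ (ExteriorAlgebra ℝ V)), con_algebraMap, map_zero]
  | succ k ih =>
    have ih' := ih (w := Matrix.vecTail w) (c := fun i => c i.succ) fun i => h i.succ
    rw [ExteriorAlgebra.ιMulti_succ_apply]
    simp only [← wed_apply, con_wed, map_sub, map_smul]
    rw [Finset.sum_sub_distrib]
    have h1 : ∀ j, wed (e j) (wed (w 0) (con (e j) (ExteriorAlgebra.ιMulti ℝ k (Matrix.vecTail w)))) =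
        - wed (w 0) (wed (e j) (con (e j) (ExteriorAlgebra.ιMulti ℝ k (Matrix.vecTail w)))) :=
      fun j => wed_wed _ _ _
    simp only [h1, Finset.sum_neg_distrib, ← map_sum, ih', ← wed_smul, ← wed_sum]
    rw [h 0, Fin.sum_univ_succ, add_smul, wed_add, wed_smul, wed_smul, map_smul, sub_neg_eq_add]

end Exterior

/-! ### The normal volume projection and the projection onto twisted multivectors. -/

section Division

universe u v

variable {Γ : Type u} {V : Type v} [NormedAddCommGroup V] [Group Γ] [Fintype Γ]
  [InnerProductSpace ℝ V] [FiniteDimensional ℝ V] {k : ℕ} (ρ : Γ →* (V ≃ₗᵢ[ℝ] V)) (γ : Γ)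

/-- An orthonormal basis of the normal space. -/
def normalVec (j : Fin (ell ρ γ)) : V := stdOrthonormalBasis ℝ (normal ρ γ) j

theorem orthonormal_normalVec : Orthonormal ℝ (normalVec ρ γ) :=
  (stdOrthonormalBasis ℝ (normal ρ γ)).orthonormal.comp_linearIsometry (normal ρ γ).subtypeₗᵢ

theorem sum_inner_normalVec (v : V) :
    ∑ j, inner ℝ (normalVec ρ γ j) v • normalVec ρ γ j = norProj ρ γ v := by
  have h1 := (stdOrthonormalBasis ℝ (normal ρ γ)).sum_repr' ⟨_, norProj_mem ρ γ v⟩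
  have h2 := congrArg (Subtype.val : normal ρ γ → V) h1
  rw [AddSubmonoidClass.coe_finsetSum] at h2
  refine Eq.trans ?_ h2
  refine Finset.sum_congr rfl fun j _ => ?_
  have h3 : inner ℝ (normalVec ρ γ j) v = inner ℝ (normalVec ρ γ j) (norProj ρ γ v) := by
    conv_lhs => rw [← tan_add_nor ρ γ v, inner_add_right]
    have : inner ℝ (normalVec ρ γ j) (tanProj ρ γ v) = 0 :=
      Submodule.inner_left_of_mem_orthogonal (tanProj_mem ρ γ v)
        (stdOrthonormalBasis ℝ (normal ρ γ) j).2
    rw [this, zero_add]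
  rw [h3]
  rfl

/-- The counting operator acts on the component with normal slots `S` by `|S|`, whereas composing
`volProj` with it gives `ℓ` times `volProj`. Hence `volProj` kills all components with `|S| ≠ ℓ`,
and `pr` keeps the others. -/
theorem volProj_normalVec_pr (τ : ⋀[ℝ]^k V) :
    volProj (normalVec ρ γ) (List.finRange _) (pr ρ γ k τ : ⋀[ℝ]^k V) =
      volProj (normalVec ρ γ) (List.finRange _) (τ : ExteriorAlgebra ℝ V) := by
  classical
  set p := volProj (normalVec ρ γ) (List.finRange _) with hp
  have he := orthonormal_normalVec ρ γ
  suffices h : p ∘ₗ (⋀[ℝ]^k V).subtype ∘ₗ pr ρ γ k = p ∘ₗ (⋀[ℝ]^k V).subtype from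
    LinearMap.congr_fun h τ
  refine exteriorPower.linearMap_ext ?_
  ext w
  change p (pr ρ γ k (exteriorPower.ιMulti ℝ k w) : ⋀[ℝ]^k V) =
    p (exteriorPower.ιMulti ℝ k w : ⋀[ℝ]^k V)
  have h0 : ∀ S : Finset (Fin k), S.card ≠ ell ρ γ → p (ExteriorAlgebra.ιMulti ℝ k
      fun i => (if i ∈ S then norProj ρ γ else tanProj ρ γ) (w i)) = 0 := by
    intro S hS
    set x := ExteriorAlgebra.ιMulti ℝ k
      fun i => (if i ∈ S then norProj ρ γ else tanProj ρ γ) (w i)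
    have h1 := sum_wed_con_ιMulti (e := normalVec ρ γ) (k := k)
      (w := fun i => (if i ∈ S then norProj ρ γ else tanProj ρ γ) (w i))
      (c := fun i => if i ∈ S then 1 else 0) fun i => by
        rw [sum_inner_normalVec]
        split_ifs
        · rw [norProj_eq ρ γ (norProj_mem ρ γ _), one_smul]
        · rw [norProj_fixed ρ γ (tanProj_mem ρ γ _), zero_smul]
    have h2 : p (∑ j, wed (normalVec ρ γ j) (con (normalVec ρ γ j) x)) = (ell ρ γ : ℝ) • p x := by
      rw [map_sum]
      simp only [hp, volProj_wed_con he, wed_con_volProj he (List.mem_finRange _), Finset.sum_const,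
        Finset.card_univ, Fintype.card_fin]
      rw [← Nat.cast_smul_eq_nsmul ℝ]
    rw [h1, map_smul, Finset.sum_boole, Finset.filter_mem_eq_inter, Finset.univ_inter,
      ← sub_eq_zero, ← sub_smul, smul_eq_zero] at h2
    refine h2.resolve_left ?_
    rw [sub_eq_zero]
    exact_mod_cast hS
  have h1 : ExteriorAlgebra.ιMulti ℝ k w = ∑ S : Finset (Fin k), ExteriorAlgebra.ιMulti ℝ k
      fun i => (if i ∈ S then norProj ρ γ else tanProj ρ γ) (w i) := by
    have h2 := (ExteriorAlgebra.ιMulti ℝ k (M := V)).toMultilinearMap.map_add_univ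
      (fun i => norProj ρ γ (w i)) (fun i => tanProj ρ γ (w i))
    have h3 : ((fun i => norProj ρ γ (w i)) + fun i => tanProj ρ γ (w i)) = w :=
      funext fun i => by rw [Pi.add_apply, add_comm, tan_add_nor]
    rw [h3] at h2
    refine h2.trans (Finset.sum_congr rfl fun S _ => congrArg (ExteriorAlgebra.ιMulti ℝ k) ?_)
    funext i
    by_cases hi : i ∈ S <;> simp [hi]
  rw [pr_ιMulti, exteriorPower.ιMulti_apply_coe, h1, AddSubmonoidClass.coe_finsetSum, map_sum,
    map_sum, ← Finset.sum_subset (Finset.subset_univ (Finset.powersetCard (ell ρ γ) Finset.univ))]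
  · rfl
  · intro S _ hS
    refine h0 S fun h => hS ?_
    simp [h]

end Division

/-! ### Division of multivector fields -/

section WeakSmooth

universe v

variable {X : Type*} [NormedAddCommGroup X] [NormedSpace ℝ X] {N N' : Type*} [AddCommGroup N]
  [Module ℝ N] [AddCommGroup N'] [Module ℝ N']

/-- Smooth maps into a vector space without topology. -/
def WSmooth (f : X → N) : Prop := ∀ α : Module.Dual ℝ N, ContDiff ℝ ∞ fun x => α (f x)

theorem WSmooth.map {f : X → N} (hf : WSmooth f) (T : N →ₗ[ℝ] N') : WSmooth fun x => T (f x) :=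
  fun α => hf (α ∘ₗ T)

theorem WSmooth.comp {Y : Type*} [NormedAddCommGroup Y] [NormedSpace ℝ Y] {f : X → N}
    (hf : WSmooth f) {u : Y → X} (hu : ContDiff ℝ ∞ u) : WSmooth fun y => f (u y) :=
  fun α => (hf α).comp hu

theorem WSmooth.add {f g : X → N} (hf : WSmooth f) (hg : WSmooth g) : WSmooth fun x => f x + g x :=
  fun α => by simpa using (hf α).add (hg α)

theorem WSmooth.sub {f g : X → N} (hf : WSmooth f) (hg : WSmooth g) : WSmooth fun x => f x - g x :=
  fun α => by simpa using (hf α).sub (hg α)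

theorem WSmooth.smul {f : X → N} (hf : WSmooth f) {c : X → ℝ} (hc : ContDiff ℝ ∞ c) :
    WSmooth fun x => c x • f x :=
  fun α => by simpa using hc.mul (hf α)

theorem WSmooth.sum {κ : Type*} (s : Finset κ) {f : κ → X → N} (hf : ∀ i ∈ s, WSmooth (f i)) :
    WSmooth fun x => ∑ i ∈ s, f i x :=
  fun α => by simpa using ContDiff.sum fun i hi => hf i hi α

theorem WSmooth.zero : WSmooth fun _ : X => (0 : N) := fun α => by simpa using contDiff_const

theorem WSmooth.wed {V : Type v} [NormedAddCommGroup V] [InnerProductSpace ℝ V]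
    [FiniteDimensional ℝ V] {a : X → V} (ha : ContDiff ℝ ∞ a) {f : X → ExteriorAlgebra ℝ V}
    (hf : WSmooth f) : WSmooth fun x => OrbHoch.wed (a x) (f x) := by
  have h : ∀ x, OrbHoch.wed (a x) (f x) = ∑ j, inner ℝ (stdOrthonormalBasis ℝ V j) (a x) •
      OrbHoch.wed (stdOrthonormalBasis ℝ V j) (f x) := by
    intro x
    conv_lhs => rw [← (stdOrthonormalBasis ℝ V).sum_repr' (a x), wed_sum]
    simp only [wed_smul]
  simp only [h]
  exact WSmooth.sum _ fun j _ => (hf.map _).smul (contDiff_const.inner ℝ ha)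

theorem WSmooth.exists_hadamard [FiniteDimensional ℝ X] [Module.Finite ℝ N] {f : X × ℝ → N}
    (hf : WSmooth f) : ∃ g : X × ℝ → N, WSmooth g ∧ ∀ x r, f (x, r) - f (x, 0) = r • g (x, r) := by
  let b := Module.finBasis ℝ N
  choose g hg h1 _ using fun i => OrbHoch.exists_hadamard (hf (b.coord i))
  refine ⟨fun p => ∑ i, g i p • b i, fun α => ?_, fun x r => ?_⟩
  · simp only [map_sum, map_smul, smul_eq_mul]
    exact ContDiff.sum fun i _ => (hg i).mul contDiff_const
  · rw [← b.sum_repr (f (x, r) - f (x, 0)), Finset.smul_sum]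
    refine Finset.sum_congr rfl fun i _ => ?_
    rw [smul_smul, ← smul_eq_mul, ← h1]
    simp

theorem WSmooth.eq_zero_of_ne {f : ℝ → N} (hf : WSmooth f) (h : ∀ s, s ≠ 0 → f s = 0) : f 0 = 0 := by
  refine (Module.forall_dual_apply_eq_zero_iff ℝ _).1 fun α => ?_
  have h1 : (fun s => α (f s)) = fun _ => 0 :=
    (hf α).continuous.ext_on (dense_compl_singleton (0 : ℝ)) continuous_const fun s hs => by
      simp [h s hs]
  exact congrFun h1 0

end WeakSmooth

section Division

universe u v

variable {Γ : Type u} {V : Type v} [NormedAddCommGroup V] [Group Γ] [Fintype Γ]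
  [InnerProductSpace ℝ V] [FiniteDimensional ℝ V] {k : ℕ} (ρ : Γ →* (V ≃ₗᵢ[ℝ] V)) (γ : Γ)

instance finite_exteriorAlgebra : Module.Finite ℝ (ExteriorAlgebra ℝ V) :=
  Module.Finite.of_basis (Module.finBasis ℝ V).ExteriorAlgebra

/-- The displacement of a point by `γ⁻¹`. -/
def displ (t : V) : V := t - ρ γ⁻¹ t

theorem contDiff_displ : ContDiff ℝ ∞ (displ ρ γ) :=
  contDiff_id.sub (ρ γ⁻¹).contDiff

theorem displ_sub_smul (t w : V) (c : ℝ) :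
    displ ρ γ (t - c • w) = displ ρ γ t - c • displ ρ γ w := by
  simp only [displ, map_sub, map_smul]
  module

/-- One step of the division: along a normal direction. -/
theorem exists_wed_sub_step {κ : V → ExteriorAlgebra ℝ V} (hκ : WSmooth κ)
    (ha : ∀ t, wed (displ ρ γ t) (κ t) = 0) {e w : V} (he : inner ℝ e e = (1 : ℝ))
    (hw : displ ρ γ w = e) :
    ∃ C : V → ExteriorAlgebra ℝ V, WSmooth C ∧ ∀ t, κ t - wed (displ ρ γ t) (C t) =
      wed e (con e (κ (t - inner ℝ e (displ ρ γ t) • w))) := by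
  have hin : ContDiff ℝ ∞ fun t => inner ℝ e (displ ρ γ t) :=
    contDiff_const.inner ℝ (contDiff_displ ρ γ)
  have hr : ContDiff ℝ ∞ fun t => t - inner ℝ e (displ ρ γ t) • w :=
    contDiff_id.sub (hin.smul contDiff_const)
  -- Let `s` be the point reached from `t` along `w` where the `e`-component of the displacement
  -- vanishes. The primitive is the difference of `con e κ` at `t` and `s`, divided by that
  -- component at `t`.
  obtain ⟨g, hg, h1⟩ := WSmooth.exists_hadamard (f := fun p : V × ℝ =>
    con e (κ (p.1 - inner ℝ e (displ ρ γ p.1) • w + p.2 • w)))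
    ((hκ.map (con e)).comp ((hr.comp contDiff_fst).add (contDiff_snd.smul contDiff_const)))
  have hC : WSmooth fun t => g (t, inner ℝ e (displ ρ γ t)) := hg.comp (contDiff_id.prodMk hin)
  have h2 : ∀ t, inner ℝ e (displ ρ γ t) • g (t, inner ℝ e (displ ρ γ t)) =
      con e (κ t) - con e (κ (t - inner ℝ e (displ ρ γ t) • w)) := by
    intro t
    rw [← h1]
    simp
  refine ⟨_, hC, fun t => ?_⟩
  have h3 : ∀ t, inner ℝ e (displ ρ γ t) ≠ (0 : ℝ) →
      κ t - wed (displ ρ γ t) (g (t, inner ℝ e (displ ρ γ t))) -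
        wed e (con e (κ (t - inner ℝ e (displ ρ γ t) • w))) = 0 := by
    intro t ht
    set s : V := t - inner ℝ e (displ ρ γ t) • w with hs
    have hd : displ ρ γ s = displ ρ γ t - inner ℝ e (displ ρ γ t) • e := by
      rw [hs, displ_sub_smul, hw]
    -- Contracting `displ ∧ κ = 0` with `e` recovers `κ` times the `e`-component at `t`; the same at
    -- `s`, where this component is zero, gives `h5`.
    have h4 : wed (displ ρ γ t) (con e (κ t)) = inner ℝ e (displ ρ γ t) • κ t := by
      have := con_wed e (displ ρ γ t) (κ t)
      rw [ha, map_zero] at this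
      exact (sub_eq_zero.1 this.symm).symm
    have h5 : wed (displ ρ γ s) (con e (κ s)) = 0 := by
      have := con_wed e (displ ρ γ s) (κ s)
      rw [ha, map_zero, hd, inner_sub_right, inner_smul_right, he, mul_one, sub_self,
        zero_smul, zero_sub, ← hd] at this
      exact neg_eq_zero.1 this.symm
    have h6 : wed (displ ρ γ t) (con e (κ s)) = inner ℝ e (displ ρ γ t) • wed e (con e (κ s)) := by
      rw [hd, wed_sub, wed_smul] at h5
      exact sub_eq_zero.1 h5
    refine (smul_eq_zero.1 (?_ : inner ℝ e (displ ρ γ t) • _ = _)).resolve_left ht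
    rw [smul_sub, smul_sub, ← map_smul, h2, map_sub, h4, h6]
    abel
  have hline : ContDiff ℝ ∞ fun r : ℝ => t - inner ℝ e (displ ρ γ t) • w + r • w :=
    contDiff_const.add (contDiff_id.smul contDiff_const)
  have hdl : ∀ r : ℝ, inner ℝ e (displ ρ γ (t - inner ℝ e (displ ρ γ t) • w + r • w)) = r := by
    intro r
    have : t - inner ℝ e (displ ρ γ t) • w + r • w = t - (inner ℝ e (displ ρ γ t) - r) • w := by
      module
    rw [this, displ_sub_smul, hw, inner_sub_right, inner_smul_right, he]
    ring
  by_cases ht : inner ℝ e (displ ρ γ t) = (0 : ℝ)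
  -- Where the component vanishes, the identity follows by continuity along the line in direction
  -- `w`, on which the component is the parameter itself.
  · have h7 := WSmooth.eq_zero_of_ne (((hκ.sub (WSmooth.wed (contDiff_displ ρ γ) hC)).sub
      (((hκ.comp hr).map (con e)).map (wed e))).comp hline) fun r hr => h3 _ (by rwa [hdl])
    simp only [ht, zero_smul, sub_zero, add_zero] at h7
    simp only [ht, zero_smul, sub_zero]
    exact sub_eq_zero.1 h7
  · exact sub_eq_zero.1 (h3 t ht)

/-- Exactness of a Koszul complex whose regular sequence consists of the normal components of the
displacement. One division for each normal direction moves the point into `V^γ` and leaves the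
normal volume part of `κ` there as the only obstruction. By `volProj_normalVec_pr` this part only
depends on `pr κ`, which vanishes. -/
theorem exists_eq_wed_displ {κ : V → ⋀[ℝ]^k V} (hκ : WSmooth κ)
    (ha : ∀ t, wed (displ ρ γ t) (κ t : ExteriorAlgebra ℝ V) = 0)
    (hpr : ∀ x ∈ fixed ρ γ, pr ρ γ k (κ x) = 0) :
    ∃ η : V → ExteriorAlgebra ℝ V, WSmooth η ∧ ∀ t, (κ t : ExteriorAlgebra ℝ V) =
      wed (displ ρ γ t) (η t) := by
  set e := normalVec ρ γ with hee
  have heo := orthonormal_normalVec ρ γ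
  have h1 : ∀ j, inner ℝ (e j) (e j) = (1 : ℝ) := fun j => by
    rw [real_inner_self_eq_norm_sq, heo.1 j, one_pow]
  choose w hw using fun j => exists_sub_rho_inv_eq γ (stdOrthonormalBasis ℝ (normal ρ γ) j).2
  have key : ∀ l : List (Fin (ell ρ γ)), ∃ (C : V → ExteriorAlgebra ℝ V) (r : V → V), WSmooth C ∧
      ContDiff ℝ ∞ r ∧ (∀ t, (κ t : ExteriorAlgebra ℝ V) - wed (displ ρ γ t) (C t) =
        volProj e l (κ (r t))) ∧ (∀ j t, inner ℝ (e j) (displ ρ γ t) = (0 : ℝ) →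
          inner ℝ (e j) (displ ρ γ (r t)) = (0 : ℝ)) ∧
        ∀ j ∈ l, ∀ t, inner ℝ (e j) (displ ρ γ (r t)) = (0 : ℝ) := by
    intro l
    induction l with
    | nil =>
      exact ⟨fun _ => 0, id, WSmooth.zero, contDiff_id, fun t => by simp [volProj],
        fun j t h => h, by simp⟩
    | cons j l ih =>
      obtain ⟨C, r, hC, hr, h2, h3, h4⟩ := ih
      have hκ' : WSmooth fun t => volProj e l (κ (r t)) :=
        ((hκ.comp hr).map (⋀[ℝ]^k V).subtype).map (volProj e l)
      obtain ⟨C', hC', h5⟩ := exists_wed_sub_step ρ γ hκ' (fun t => by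
        rw [← h2, map_sub, ha, wed_wed_self, sub_zero]) (h1 j) (hw j).2
      have h6 : ∀ i t, inner ℝ (e i) (displ ρ γ (t - inner ℝ (e j) (displ ρ γ t) • w j)) =
          if i = j then (0 : ℝ) else inner ℝ (e i) (displ ρ γ t) := by
        intro i t
        have hw' : displ ρ γ (w j) = e j := (hw j).2
        rw [displ_sub_smul, hw', inner_sub_right, inner_smul_right]
        split_ifs with hij
        · subst hij
          rw [h1, mul_one, sub_self]
        · have : inner ℝ (e i) (e j) = (0 : ℝ) := heo.2 hij
          rw [this, mul_zero, sub_zero]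
      have hin : ContDiff ℝ ∞ fun t => inner ℝ (e j) (displ ρ γ t) :=
        contDiff_const.inner ℝ (contDiff_displ ρ γ)
      refine ⟨fun t => C t + C' t, fun t => r (t - inner ℝ (e j) (displ ρ γ t) • w j), hC.add hC',
        hr.comp (contDiff_id.sub (hin.smul contDiff_const)), fun t => ?_, fun i t h => ?_,
        fun i hi t => ?_⟩
      · rw [map_add, ← sub_sub, h2, h5]
        rfl
      · refine h3 i _ ?_
        rw [h6, h, ite_self]
      · rcases List.mem_cons.1 hi with rfl | hi
        · refine h3 i _ ?_
          rw [h6, if_pos rfl]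
        · exact h4 i hi _
  obtain ⟨C, r, hC, hr, h2, -, h4⟩ := key (List.finRange _)
  refine ⟨C, hC, fun t => sub_eq_zero.1 ?_⟩
  have hfix : r t ∈ fixed ρ γ := by
    have h5 : displ ρ γ (r t) = 0 := by
      rw [← norProj_eq ρ γ (show displ ρ γ (r t) ∈ _ from sub_rho_inv_mem_normal γ (r t)),
        ← sum_inner_normalVec]
      refine Finset.sum_eq_zero fun j _ => ?_
      rw [← hee, h4 j (List.mem_finRange j) t, zero_smul]
    rw [displ, sub_eq_zero] at h5
    rw [mem_fixed]
    conv_lhs => rw [h5, rho_apply_inv_self]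
  rw [h2, hee, ← volProj_normalVec_pr, hpr _ hfix]
  simp

end Division

/-! ### Operators on test functions -/

section Operators

universe u v

variable {Γ : Type u} {V : Type v} [NormedAddCommGroup V] [Group Γ] [Fintype Γ]
  [InnerProductSpace ℝ V] [FiniteDimensional ℝ V] {k : ℕ} (ρ : Γ →* (V ≃ₗᵢ[ℝ] V))

/-- A coordinate of the source of the arrow `(c, x)` relative to the source of the arrow `q`. -/
def srcCoord (v : V) (q : Γ × V) (c : Γ) (x : V) : ℝ := inner ℝ v (ρ c⁻¹ x - ρ q.1⁻¹ q.2)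

theorem contDiff_srcCoord {Y : Type*} [NormedAddCommGroup Y] [NormedSpace ℝ Y] (v : V) (g c : Γ)
    {t x : Y → V} (ht : ContDiff ℝ ∞ t) (hx : ContDiff ℝ ∞ x) :
    ContDiff ℝ ∞ fun y => srcCoord ρ v (g, t y) c (x y) :=
  contDiff_const.inner ℝ (((ρ c⁻¹).contDiff.comp hx).sub ((ρ g⁻¹).contDiff.comp ht))

theorem srcCoord_add_smul (v w : V) (q : Γ × V) (c : Γ) (x : V) (s : ℝ) :
    srcCoord ρ v q c (x + s • ρ c w) = srcCoord ρ v q c x + s * inner ℝ v w := by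
  simp only [srcCoord, map_add, map_smul, rho_inv_apply_self, inner_sub_right, inner_add_right,
    inner_smul_right]
  ring

/-- Multiplication by a coordinate of the source of the last arrow relative to the source of
`q`. -/
def uMul (v : V) (q : Γ × V) (φ : crossTest Γ V (k + 1)) : crossTest Γ V (k + 1) :=
  ofComp (fun c x => srcCoord ρ v q (c (Fin.last k)) (x (Fin.last k)) * comp φ c x) fun c =>
    ⟨(contDiff_srcCoord ρ v q.1 _ contDiff_const (contDiff_apply ℝ V _)).mul (φ.2 c).1,
      HasCompactSupport.mul_left (φ.2 c).2⟩

@[simp] theorem comp_uMul (v : V) (q : Γ × V) (φ : crossTest Γ V (k + 1)) (c : Fin (k + 1) → Γ)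
    (x : Fin (k + 1) → V) : comp (uMul ρ v q φ) c x =
      srcCoord ρ v q (c (Fin.last k)) (x (Fin.last k)) * comp φ c x := rfl

theorem smoothOp_uMul (v : V) : SmoothOp Γ V (k + 1) (k + 1) (uMul ρ v) := by
  refine ⟨fun q => ⟨fun φ ψ => crossTest_ext fun c x => ?_, fun r φ => crossTest_ext fun c x => ?_⟩,
    fun φ hφ g => ?_⟩
  · simp [mul_add]
  · simp [mul_left_comm]
  · refine hφ.pFam_of_formula (κ := Unit)
      (fun _ c p => srcCoord ρ v (g, p.1) (c (Fin.last k)) (p.2 (Fin.last k))) (fun _ c => c)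
      (fun _ _ p => p.2) (fun _ c => contDiff_srcCoord ρ v g _ contDiff_fst
        ((contDiff_apply ℝ V (Fin.last k)).comp contDiff_snd)) (fun _ _ => contDiff_snd)
      (fun _ c S _ K hK => ⟨K, hK, fun s _ x hx hx' => (hx hx').elim⟩) fun i s c x => by simp

theorem uMul_uMul (v w : V) (q : Γ × V) (φ : crossTest Γ V (k + 1)) :
    uMul ρ v q (uMul ρ w q φ) = uMul ρ w q (uMul ρ v q φ) :=
  crossTest_ext fun c x => by simp only [comp_uMul]; ring

theorem srcCoord_mul_left (v : V) (q : Γ × V) (h c : Γ) (x : V) :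
    srcCoord ρ v (h⁻¹ * q.1, ρ h⁻¹ q.2) c x = srcCoord ρ v q c x := by
  simp only [srcCoord, ← rho_mul, mul_inv_rev, inv_inv, mul_assoc, mul_inv_cancel, mul_one]

theorem cons_last' {α : Type*} (a : α) (c : Fin (k + 1) → α) :
    (Fin.cons a c : Fin (k + 1 + 1) → α) (Fin.last (k + 1)) = c (Fin.last k) := by
  rw [← Fin.succ_last, Fin.cons_succ]

theorem uMul_consSlice (v : V) (q : Γ × V) (h : Γ) (φ : crossTest Γ V (k + 1 + 1)) :
    uMul ρ v (h⁻¹ * q.1, ρ h⁻¹ q.2) (consSlice (h, q.2) φ) = consSlice (h, q.2) (uMul ρ v q φ) :=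
  crossTest_ext fun c x => by
    simp only [comp_uMul, comp_consSlice, cons_last', srcCoord_mul_left]

/-- Composition of arrows does not change the source of the last one. Hence multiplication by source
coordinates commutes with every inner face. -/
theorem src_split_last (i : Fin (k + 1)) (h : Γ) (c : Fin (k + 1) → Γ) (x : Fin (k + 1) → V) :
    ρ (splitLabel i h c (Fin.last (k + 1)))⁻¹ (splitPoint ρ i h x (Fin.last (k + 1))) =
      ρ (c (Fin.last k))⁻¹ (x (Fin.last k)) := by
  have h1 : Fin.last (k + 1) ≠ i.castSucc := (Fin.castSucc_ne_last i).symm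
  by_cases hi : i = Fin.last k
  · subst hi
    simp only [splitLabel, splitPoint, h1, if_false, Fin.succ_last, if_true, ← rho_mul]
    simp
  · have h2 : Fin.last (k + 1) ≠ i.succ := by
      rw [← Fin.succ_last]
      exact fun h => hi (Fin.succ_injective _ h).symm
    have h3 : i.predAbove (Fin.last (k + 1)) = Fin.last k := by simp
    simp only [splitLabel, splitPoint, h1, h2, if_false, h3]

theorem uMul_merge (v : V) (q : Γ × V) (i : Fin (k + 1)) (φ : crossTest Γ V (k + 1 + 1)) :
    uMul ρ v q (merge ρ i φ) = merge ρ i (uMul ρ v q φ) :=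
  crossTest_ext fun c x => by
    simp only [comp_uMul, comp_merge, Finset.mul_sum]
    refine Finset.sum_congr rfl fun h _ => ?_
    simp only [srcCoord, src_split_last]

/-! #### Adding an arrow -/

variable (ϱ : CutOff) {ε : ℝ}

/-- The cut-off forces the new last point to stay near a point that is already controlled, so
inserted arrows do not destroy compact supports. -/
theorem exists_compact_cut (hε : 0 < ε) {X : Type*} [NormedAddCommGroup X] [NormedSpace ℝ X]
    {b : X × (Fin k → V) → V} (hb : Continuous b) {S : Set X} (hS : IsCompact S)
    {K : Set (Fin k → V)} (hK : IsCompact K) :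
    ∃ K' : Set (Fin (k + 1) → V), IsCompact K' ∧ ∀ s ∈ S, ∀ x ∉ K', (fun i => x (Fin.castSucc i)) ∈ K →
      ϱ.toFun (‖b (s, fun i => x (Fin.castSucc i)) - x (Fin.last k)‖ ^ 2 / ε) = 0 := by
  obtain ⟨M, hM⟩ := (hS.prod hK).exists_bound_of_continuousOn hb.continuousOn
  refine ⟨(fun p : (Fin k → V) × V => (Fin.snoc (α := fun _ => V) p.1 p.2 : Fin (k + 1) → V)) ''
    (K ×ˢ Metric.closedBall 0 (M + √ε)), (hK.prod (isCompact_closedBall _ _)).image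
      (contDiff_snoc contDiff_snd contDiff_fst).continuous, fun s hs x hx hxK => ?_⟩
  refine ϱ.eq_zero _ ?_
  by_contra hle
  rw [not_lt, div_le_iff₀ hε] at hle
  refine hx ⟨(fun i => x (Fin.castSucc i), x (Fin.last k)), ⟨hxK, ?_⟩, ?_⟩
  · rw [mem_closedBall_zero_iff]
    have h1 : ‖b (s, fun i => x (Fin.castSucc i)) - x (Fin.last k)‖ ≤ √ε :=
      Real.le_sqrt_of_sq_le (by linarith)
    have h2 := hM (s, fun i => x (Fin.castSucc i)) ⟨hs, hxK⟩
    have h3 := norm_sub_norm_le (x (Fin.last k)) (b (s, fun i => x (Fin.castSucc i)))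
    rw [norm_sub_rev] at h3
    linarith
  · exact Fin.snoc_init_self x

theorem contDiff_init : ContDiff ℝ ∞ fun (x : Fin (k + 1) → V) (i : Fin k) => x i.castSucc :=
  contDiff_pi.2 fun i => contDiff_apply ℝ V i.castSucc

theorem contDiff_cut {Y : Type*} [NormedAddCommGroup Y] [NormedSpace ℝ Y] {a b : Y → V}
    (ha : ContDiff ℝ ∞ a) (hb : ContDiff ℝ ∞ b) :
    ContDiff ℝ ∞ fun y => ϱ.toFun (‖a y - b y‖ ^ 2 / ε) :=
  ϱ.smooth.comp (((ha.sub hb).norm_sq ℝ).div_const ε)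

variable (hε : 0 < ε)

/-- Multiplication of the last label by `g`. -/
def mulLast (g : Γ) (c : Fin (k + 1) → Γ) (l : Fin (k + 1)) : Γ :=
  if l = Fin.last k then c l * g else c l

open Classical in
/-- The insertion of a last arrow with label `g` which is composable up to the cut-off. -/
def ins (g : Γ) (φ : crossTest Γ V (k + 1)) : crossTest Γ V (k + 1 + 1) :=
  ofComp (fun c x => if c (Fin.last (k + 1)) = g then
      ϱ.toFun (‖ρ (c (Fin.last k).castSucc)⁻¹ (x (Fin.last k).castSucc) - x (Fin.last (k + 1))‖ ^ 2 / ε) *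
        comp φ (mulLast g fun i => c i.castSucc) (fun i => x i.castSucc) else 0) fun c => by
    by_cases hc : c (Fin.last (k + 1)) = g
    · simp only [hc, if_true]
      have h2 := φ.2 (mulLast g fun i => c i.castSucc)
      obtain ⟨K', hK', h'⟩ := exists_compact_cut (X := ℝ) ϱ hε
        (b := fun p : ℝ × (Fin (k + 1) → V) => ρ (c (Fin.last k).castSucc)⁻¹ (p.2 (Fin.last k)))
        (by fun_prop) (isCompact_singleton (x := (0 : ℝ))) h2.2
      refine mem_testFun_of_support ((contDiff_cut ϱ ((ρ _).contDiff.comp (contDiff_apply ℝ V _))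
        (contDiff_apply ℝ V _)).mul (h2.1.comp contDiff_init)) hK' fun x hx => ?_
      by_cases hx' : (fun i : Fin (k + 1) => x i.castSucc) ∈
          tsupport fun x : Fin (k + 1) → V => φ.1 fun i => (mulLast g (fun i => c i.castSucc) i, x i)
      · rw [h' 0 rfl x hx hx', zero_mul]
      · rw [comp_eq_zero_of_notMem_tsupport subset_rfl hx', mul_zero]
    · simp only [hc, if_false]
      exact (testFun V _).zero_mem

open Classical in
theorem comp_ins (g : Γ) (φ : crossTest Γ V (k + 1)) (c : Fin (k + 1 + 1) → Γ) (x : Fin (k + 1 + 1) → V) :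
    comp (ins ρ ϱ hε g φ) c x = if c (Fin.last (k + 1)) = g then
      ϱ.toFun (‖ρ (c (Fin.last k).castSucc)⁻¹ (x (Fin.last k).castSucc) - x (Fin.last (k + 1))‖ ^ 2 / ε) *
        comp φ (mulLast g fun i => c i.castSucc) (fun i => x i.castSucc) else 0 := rfl

theorem smoothOp_ins (g : Γ) : SmoothOp Γ V (k + 1) (k + 1 + 1) fun _ => ins ρ ϱ hε g := by
  classical
  refine ⟨fun q => ⟨fun φ ψ => crossTest_ext fun c x => ?_, fun r φ => crossTest_ext fun c x => ?_⟩,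
    fun φ hφ g' => ?_⟩
  · simp only [comp_ins, comp_add]
    split_ifs <;> ring
  · simp only [comp_ins, comp_smul]
    split_ifs <;> ring
  · refine hφ.pFam_of_formula (κ := Unit)
      (fun _ c p => if c (Fin.last (k + 1)) = g then ϱ.toFun (‖ρ (c (Fin.last k).castSucc)⁻¹
        (p.2 (Fin.last k).castSucc) - p.2 (Fin.last (k + 1))‖ ^ 2 / ε) else 0)
      (fun _ c => mulLast g fun i => c i.castSucc)
      (fun _ _ p i => p.2 i.castSucc) (fun _ c => ?_)
      (fun _ _ => contDiff_init.comp contDiff_snd)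
      (fun _ c S hS K hK => ?_) fun i s c x => ?_
    · split_ifs
      · exact contDiff_cut ϱ ((ρ _).contDiff.comp ((contDiff_apply ℝ V _).comp contDiff_snd))
          ((contDiff_apply ℝ V _).comp contDiff_snd)
      · exact contDiff_const
    · obtain ⟨K', hK', h'⟩ := exists_compact_cut ϱ hε
        (b := fun p : V × (Fin (k + 1) → V) => ρ (c (Fin.last k).castSucc)⁻¹ (p.2 (Fin.last k)))
        (by fun_prop) hS hK
      refine ⟨K', hK', fun s hs x hx hx' => ?_⟩
      have := h' s hs x hx hx'
      simp only at this
      rw [this, ite_self]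
    · simp only [comp_ins, Finset.univ_unique, Finset.sum_singleton]
      split_ifs <;> simp

theorem mulLast_cons (g a : Γ) (c : Fin (k + 1) → Γ) :
    mulLast g (Fin.cons a c : Fin (k + 1 + 1) → Γ) = Fin.cons a (mulLast g c) := by
  funext l
  refine Fin.cases ?_ (fun l => ?_) l
  · simp [mulLast, Fin.ext_iff]
  · simp [mulLast, Fin.ext_iff]

theorem cons_comp_castSucc {α : Type*} (a : α) (c : Fin (k + 1) → α) :
    (fun i : Fin (k + 1) => (Fin.cons a c : Fin (k + 1 + 1) → α) i.castSucc) =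
      Fin.cons a fun i : Fin k => c i.castSucc := by
  funext l
  refine Fin.cases ?_ (fun l => ?_) l
  · simp
  · rw [← Fin.succ_castSucc, Fin.cons_succ, Fin.cons_succ]

theorem ins_consSlice (g h : Γ) (t : V) (φ : crossTest Γ V (k + 1 + 1)) :
    ins ρ ϱ hε g (consSlice (h, t) φ) = consSlice (h, t) (ins ρ ϱ hε g φ) :=
  crossTest_ext fun c x => by
    classical
    have h1 : (Fin.last (k + 1)).castSucc = (Fin.last k).castSucc.succ := rfl
    have h2 : (Fin.cons h c : Fin (k + 1 + 1 + 1) → Γ) (Fin.last (k + 1 + 1)) = c (Fin.last (k + 1)) :=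
      cons_last' h c
    have h3 : (Fin.cons t x : Fin (k + 1 + 1 + 1) → V) (Fin.last (k + 1 + 1)) = x (Fin.last (k + 1)) :=
      cons_last' t x
    simp only [comp_ins, comp_consSlice, h1, h2, h3, Fin.cons_succ, cons_comp_castSucc,
      mulLast_cons]

theorem splitLabel_init (i : Fin k) (h : Γ) (c : Fin (k + 1) → Γ) :
    (fun l : Fin (k + 1) => splitLabel i.castSucc h c l.castSucc) =
      splitLabel i h fun l => c l.castSucc := by
  funext l
  simp only [splitLabel, predAbove_eq, Fin.ext_iff, Fin.val_castSucc, Fin.val_succ]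
  rfl

theorem splitPoint_init (i : Fin k) (h : Γ) (x : Fin (k + 1) → V) :
    (fun l : Fin (k + 1) => splitPoint ρ i.castSucc h x l.castSucc) =
      splitPoint ρ i h fun l => x l.castSucc := by
  funext l
  simp only [splitPoint, predAbove_eq, Fin.ext_iff, Fin.val_castSucc, Fin.val_succ]
  rfl

theorem splitLabel_mulLast (g : Γ) (i : Fin (k + 1)) (h : Γ) (c : Fin (k + 1) → Γ) :
    mulLast g (splitLabel i h c) = splitLabel i h (mulLast g c) := by
  funext l
  simp only [mulLast, splitLabel, predAbove_eq, Fin.ext_iff, Fin.val_castSucc, Fin.val_succ,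
    Fin.val_last]
  have hi := i.2
  have hl := l.2
  by_cases h1 : (l : ℕ) = i
  · have : ¬ (l : ℕ) = k + 1 := by omega
    simp [h1, show ¬ (i : ℕ) = k + 1 by omega]
  by_cases h2 : (l : ℕ) = i + 1
  · simp only [h2, Nat.add_eq_left, one_ne_zero, if_false, if_true, Nat.add_right_cancel_iff]
    split_ifs <;> simp [mul_assoc]
  · by_cases h3 : (l : ℕ) = k + 1
    · simp [h3, show ¬ k + 1 = (i : ℕ) by omega, show ¬ k = (i : ℕ) by omega, hi]
    · by_cases h4 : (i : ℕ) < l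
      · simp [h1, h2, h3, h4, show ¬ (l : ℕ) - 1 = k by omega]
      · simp [h1, h2, h3, h4, show ¬ (l : ℕ) = k by omega]

theorem splitLabel_castSucc_last (i : Fin k) (h : Γ) (c : Fin (k + 1) → Γ) :
    splitLabel i.castSucc h c (Fin.last (k + 1)) = c (Fin.last k) := by
  have h1 : Fin.last (k + 1) ≠ i.castSucc.castSucc := (Fin.castSucc_ne_last _).symm
  have h2 : Fin.last (k + 1) ≠ i.castSucc.succ := by
    rw [Fin.succ_castSucc]; exact (Fin.castSucc_ne_last _).symm
  simp [splitLabel, h1, h2]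

theorem splitPoint_castSucc_last (i : Fin k) (h : Γ) (x : Fin (k + 1) → V) :
    splitPoint ρ i.castSucc h x (Fin.last (k + 1)) = x (Fin.last k) := by
  have h2 : Fin.last (k + 1) ≠ i.castSucc.succ := by
    rw [Fin.succ_castSucc]; exact (Fin.castSucc_ne_last _).symm
  simp [splitPoint, h2]

theorem merge_ins (g : Γ) (i : Fin (k + 1)) (φ : crossTest Γ V (k + 1 + 1)) :
    merge ρ i.castSucc (ins ρ ϱ hε g φ) = ins ρ ϱ hε g (merge ρ i φ) :=
  crossTest_ext fun c x => by
    classical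
    have e1 : ∀ h, splitLabel i.castSucc h c (Fin.last (k + 1 + 1)) = c (Fin.last (k + 1)) :=
      fun h => splitLabel_castSucc_last i h c
    have e2 : ∀ h, splitPoint ρ i.castSucc h x (Fin.last (k + 1 + 1)) = x (Fin.last (k + 1)) :=
      fun h => splitPoint_castSucc_last ρ i h x
    simp only [comp_merge, comp_ins, e1, e2]
    split_ifs with hc
    · rw [Finset.mul_sum]
      refine Finset.sum_congr rfl fun h _ => ?_
      have h1 := congrFun (splitLabel_init i h c) (Fin.last (k + 1))
      have h2 := congrFun (splitPoint_init ρ i h x) (Fin.last (k + 1))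
      rw [splitLabel_init, splitPoint_init, splitLabel_mulLast, h1, h2, src_split_last]
    · simp

theorem splitLabel_last_last (h : Γ) (c : Fin (k + 1) → Γ) :
    splitLabel (Fin.last k) h c (Fin.last (k + 1)) = h⁻¹ * c (Fin.last k) := by
  simp [splitLabel, Fin.ext_iff]

theorem splitPoint_last_last (h : Γ) (x : Fin (k + 1) → V) :
    splitPoint ρ (Fin.last k) h x (Fin.last (k + 1)) = ρ h⁻¹ (x (Fin.last k)) := by
  simp [splitPoint]

theorem splitPoint_last_init (h : Γ) (x : Fin (k + 1) → V) :
    (fun l : Fin (k + 1) => splitPoint ρ (Fin.last k) h x l.castSucc) = x := by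
  funext l
  have hl : ¬ k < (l : ℕ) := by omega
  simp [splitPoint, predAbove_eq, hl]

/-- `ins` factors the last arrow `a` as `(a g⁻¹) g`, and merging composes the factors again. In the
composition the inserted arrow is exactly composable, so the cut-off is evaluated at distance `0`,
where it is `1`. -/
theorem merge_ins_last (g : Γ) (φ : crossTest Γ V (k + 1)) :
    merge ρ (Fin.last k) (ins ρ ϱ hε g φ) = φ :=
  crossTest_ext fun c x => by
    classical
    have h3 : ∀ h, splitLabel (Fin.last k) h c (Fin.last k).castSucc = h := by
      intro h
      simp [splitLabel]
    have h5 : ∀ h, splitPoint ρ (Fin.last k) h x (Fin.last k).castSucc = x (Fin.last k) :=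
      fun h => congrFun (splitPoint_last_init ρ h x) _
    have h6 : (mulLast g fun l : Fin (k + 1) => splitLabel (Fin.last k) (c (Fin.last k) * g⁻¹) c
        l.castSucc) = c := by
      funext l
      have hl : ¬ k < (l : ℕ) := by omega
      by_cases hlk : l = Fin.last k
      · subst hlk
        simp [mulLast, splitLabel]
      · simp [mulLast, splitLabel, hlk, predAbove_eq, hl]
    simp only [comp_merge, comp_ins, splitLabel_last_last, splitPoint_last_last, h3,
      splitPoint_last_init, h5]
    rw [Finset.sum_eq_single (c (Fin.last k) * g⁻¹)]
    · rw [if_pos (by group), sub_self, norm_zero, h6]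
      rw [show (0 : ℝ) ^ 2 / ε = 0 by simp, ϱ.eq_one 0 (by norm_num), one_mul]
    · intro h _ hh
      rw [if_neg]
      rintro rfl
      exact hh (by group)
    · simp

open Classical in
/-- The insertion of a last arrow with label `g` whose target is close to the source of `q`. -/
def app (g : Γ) (q : Γ × V) (φ : crossTest Γ V k) : crossTest Γ V (k + 1) :=
  ofComp (fun c x => if c (Fin.last k) = g then
      ϱ.toFun (‖ρ q.1⁻¹ q.2 - x (Fin.last k)‖ ^ 2 / ε) *
        comp φ (fun i => c i.castSucc) (fun i => x i.castSucc) else 0) fun c => by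
    by_cases hc : c (Fin.last k) = g
    · simp only [hc, if_true]
      have h2 := φ.2 fun i => c i.castSucc
      obtain ⟨K', hK', h'⟩ := exists_compact_cut (X := ℝ) ϱ hε
        (b := fun p : ℝ × (Fin k → V) => ρ q.1⁻¹ q.2)
        (by fun_prop) (isCompact_singleton (x := (0 : ℝ))) h2.2
      refine mem_testFun_of_support ((contDiff_cut ϱ contDiff_const
        (contDiff_apply ℝ V _)).mul (h2.1.comp contDiff_init)) hK' fun x hx => ?_
      by_cases hx' : (fun i : Fin k => x i.castSucc) ∈
          tsupport fun x : Fin k → V => φ.1 fun i => (c i.castSucc, x i)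
      · rw [h' 0 rfl x hx hx', zero_mul]
      · rw [comp_eq_zero_of_notMem_tsupport subset_rfl hx', mul_zero]
    · simp only [hc, if_false]
      exact (testFun V _).zero_mem

open Classical in
theorem comp_app (g : Γ) (q : Γ × V) (φ : crossTest Γ V k) (c : Fin (k + 1) → Γ)
    (x : Fin (k + 1) → V) : comp (app ρ ϱ hε g q φ) c x = if c (Fin.last k) = g then
      ϱ.toFun (‖ρ q.1⁻¹ q.2 - x (Fin.last k)‖ ^ 2 / ε) *
        comp φ (fun i => c i.castSucc) (fun i => x i.castSucc) else 0 := rfl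

theorem smoothOp_app (g : Γ) : SmoothOp Γ V k (k + 1) (app ρ ϱ hε g) := by
  classical
  refine ⟨fun q => ⟨fun φ ψ => crossTest_ext fun c x => ?_, fun r φ => crossTest_ext fun c x => ?_⟩,
    fun φ hφ g' => ?_⟩
  · simp only [comp_app, comp_add]
    split_ifs <;> ring
  · simp only [comp_app, comp_smul]
    split_ifs <;> ring
  · refine hφ.pFam_of_formula (κ := Unit)
      (fun _ c p => if c (Fin.last k) = g then
        ϱ.toFun (‖ρ g'⁻¹ p.1 - p.2 (Fin.last k)‖ ^ 2 / ε) else 0)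
      (fun _ c i => c i.castSucc)
      (fun _ _ p i => p.2 i.castSucc) (fun _ c => ?_)
      (fun _ _ => contDiff_init.comp contDiff_snd)
      (fun _ c S hS K hK => ?_) fun i s c x => ?_
    · split_ifs
      · exact contDiff_cut ϱ ((ρ _).contDiff.comp contDiff_fst)
          ((contDiff_apply ℝ V _).comp contDiff_snd)
      · exact contDiff_const
    · obtain ⟨K', hK', h'⟩ := exists_compact_cut ϱ hε
        (b := fun p : V × (Fin k → V) => ρ g'⁻¹ p.1) (by fun_prop) hS hK
      refine ⟨K', hK', fun s hs x hx hx' => ?_⟩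
      have := h' s hs x hx hx'
      simp only at this
      rw [this, ite_self]
    · simp only [comp_app, Finset.univ_unique, Finset.sum_singleton]
      split_ifs <;> simp

end Operators

/-! ### Division of test functions -/

section Quotient

universe u v

variable {Γ : Type u} {V : Type v} [NormedAddCommGroup V] [Group Γ] [Fintype Γ]
  [InnerProductSpace ℝ V] [FiniteDimensional ℝ V] {k : ℕ} (ρ : Γ →* (V ≃ₗᵢ[ℝ] V))

/-- The displacement of the last point in the direction `v`, as seen from the source. -/
def shiftLast (v : V) (c : Fin (k + 1) → Γ) (x : Fin (k + 1) → V) (s : ℝ) : Fin (k + 1) → V :=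
  x + Pi.single (Fin.last k) (s • ρ (c (Fin.last k)) v)

theorem shiftLast_last (v : V) (c : Fin (k + 1) → Γ) (x : Fin (k + 1) → V) (s : ℝ) :
    shiftLast ρ v c x s (Fin.last k) = x (Fin.last k) + s • ρ (c (Fin.last k)) v := by
  simp [shiftLast]

theorem shiftLast_zero (v : V) (c : Fin (k + 1) → Γ) (x : Fin (k + 1) → V) :
    shiftLast ρ v c x 0 = x := by
  simp [shiftLast]

theorem shiftLast_shiftLast (v : V) (c : Fin (k + 1) → Γ) (x : Fin (k + 1) → V) (s r : ℝ) :
    shiftLast ρ v c (shiftLast ρ v c x s) r = shiftLast ρ v c x (s + r) := by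
  simp [shiftLast, add_assoc, ← Pi.single_add, ← add_smul]

theorem contDiff_shiftLast {Y : Type*} [NormedAddCommGroup Y] [NormedSpace ℝ Y] (v : V)
    (c : Fin (k + 1) → Γ) {x : Y → Fin (k + 1) → V} {s : Y → ℝ} (hx : ContDiff ℝ ∞ x)
    (hs : ContDiff ℝ ∞ s) : ContDiff ℝ ∞ fun y => shiftLast ρ v c (x y) (s y) :=
  hx.add ((ContinuousLinearMap.single ℝ (fun _ : Fin (k + 1) => V) (Fin.last k)).contDiff.comp
    (hs.smul contDiff_const))

/-- The coordinate of the source of the last arrow. -/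
def lastCoord (v : V) (q : Γ × V) (c : Fin (k + 1) → Γ) (x : Fin (k + 1) → V) : ℝ :=
  srcCoord ρ v q (c (Fin.last k)) (x (Fin.last k))

theorem lastCoord_shiftLast (v w : V) (q : Γ × V) (c : Fin (k + 1) → Γ) (x : Fin (k + 1) → V)
    (s : ℝ) : lastCoord ρ v q c (shiftLast ρ w c x s) = lastCoord ρ v q c x + s * inner ℝ v w := by
  rw [lastCoord, shiftLast_last, srcCoord_add_smul, lastCoord]

/-- On a line in direction `v` the coordinate vanishes at a single parameter, so `f` vanishes off
that parameter and by continuity everywhere on the line. -/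
theorem eq_zero_of_lastCoord_mul {v : V} (hv : inner ℝ v v = (1 : ℝ)) (q : Γ × V)
    (c : Fin (k + 1) → Γ) {f : (Fin (k + 1) → V) → ℝ} (hf : Continuous f) {x : Fin (k + 1) → V}
    (h : ∀ s : ℝ, lastCoord ρ v q c (shiftLast ρ v c x s) * f (shiftLast ρ v c x s) = 0) : f x = 0 := by
  have hc : Continuous fun s : ℝ => f (shiftLast ρ v c x s) :=
    hf.comp (contDiff_shiftLast ρ v c contDiff_const contDiff_id).continuous
  have h1 : (fun s : ℝ => f (shiftLast ρ v c x s)) = fun _ => 0 := by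
    refine hc.ext_on (dense_compl_singleton (-lastCoord ρ v q c x)) continuous_const fun s hs => ?_
    have h2 := h s
    rw [lastCoord_shiftLast, hv, mul_one] at h2
    refine (mul_eq_zero.1 h2).resolve_left fun h3 => hs ?_
    rw [Set.mem_singleton_iff]
    linarith
  simpa only [shiftLast_zero] using congrFun h1 0

variable (ϱ : CutOff)

/-- `Q` is a quotient of `φ` by a coordinate of the source of the last arrow, after the subtraction
of a function which is constant in this coordinate up to a cut-off. -/
def IsQuo (v : V) (q : Γ × V) (φ Q : crossTest Γ V (k + 1)) : Prop :=
  ∀ c x, lastCoord ρ v q c x * comp Q c x = comp φ c x -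
    ϱ.toFun (lastCoord ρ v q c x ^ 2) * comp φ c (shiftLast ρ v c x (-lastCoord ρ v q c x))

variable {ϱ} in
theorem IsQuo.unique {v : V} (hv : inner ℝ v v = (1 : ℝ)) {q : Γ × V} {φ Q Q' : crossTest Γ V (k + 1)}
    (h : IsQuo ρ ϱ v q φ Q) (h' : IsQuo ρ ϱ v q φ Q') : Q = Q' :=
  crossTest_ext fun c x => by
    rw [← sub_eq_zero]
    refine eq_zero_of_lastCoord_mul ρ hv q c (f := fun x => comp Q c x - comp Q' c x)
      ((Q.2 c).1.continuous.sub (Q'.2 c).1.continuous) fun s => ?_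
    rw [mul_sub, h, h', sub_self]

/-- The function minus its value on the hyperplane where the coordinate is zero is divisible by the
coordinate. The cut-off in front of that value restores compact supports and equals `1` near the
hyperplane, so divisibility is kept. -/
theorem exists_isQuo {v : V} (hv : inner ℝ v v = (1 : ℝ)) {ι : Type*} {φ : ι → crossTest Γ V (k + 1)}
    (hφ : BFam φ) (g : Γ) : ∃ Q : ι → V → crossTest Γ V (k + 1), PFam Q ∧
      ∀ i t, IsQuo ρ ϱ v (g, t) (φ i) (Q i t) := by
  have hL : ∀ c : Fin (k + 1) → Γ, ContDiff ℝ ∞ fun p : V × (Fin (k + 1) → V) =>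
      lastCoord ρ v (g, p.1) c p.2 := fun c => contDiff_srcCoord ρ v g _ contDiff_fst
        ((contDiff_apply ℝ V (Fin.last k)).comp contDiff_snd)
  have hsh : ∀ c : Fin (k + 1) → Γ, ContDiff ℝ ∞ fun p : V × (Fin (k + 1) → V) =>
      shiftLast ρ v c p.2 (-lastCoord ρ v (g, p.1) c p.2) := fun c =>
    contDiff_shiftLast ρ v c contDiff_snd (hL c).neg
  -- The function to be divided, in an independent variable `r` that measures the distance from the
  -- hyperplane; `r` will be set equal to the coordinate.
  have h0 : ∀ c, USmooth fun i (p : (V × (Fin (k + 1) → V)) × ℝ) =>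
      comp (φ i) c (shiftLast ρ v c (shiftLast ρ v c p.1.2 (-lastCoord ρ v (g, p.1.1) c p.1.2)) p.2) +
        (-ϱ.toFun (p.2 ^ 2)) *
          comp (φ i) c (shiftLast ρ v c p.1.2 (-lastCoord ρ v (g, p.1.1) c p.1.2)) := fun c =>
    ((hφ.2 c).comp (contDiff_shiftLast ρ v c ((hsh c).comp contDiff_fst) contDiff_snd)).add
      (((hφ.2 c).comp ((hsh c).comp contDiff_fst)).smul
        (ϱ.smooth.comp (contDiff_snd.pow 2)).neg)
  choose G hG h1 _ using fun c => (h0 c).exists_hadamard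
  have h2 : ∀ c i t x, lastCoord ρ v (g, t) c x * G c i ((t, x), lastCoord ρ v (g, t) c x) =
      comp (φ i) c x - ϱ.toFun (lastCoord ρ v (g, t) c x ^ 2) *
        comp (φ i) c (shiftLast ρ v c x (-lastCoord ρ v (g, t) c x)) := by
    intro c i t x
    rw [← h1, shiftLast_zero, shiftLast_shiftLast, neg_add_cancel, shiftLast_zero,
      ϱ.eq_one (0 ^ 2) (by norm_num)]
    ring
  have hu : ∀ c, USmooth fun i (p : V × (Fin (k + 1) → V)) => G c i (p, lastCoord ρ v (g, p.1) c p.2) :=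
    fun c => (hG c).comp (contDiff_id.prodMk (hL c))
  have hs : ∀ A : Set V, IsCompact A → ∃ K : Set (Fin (k + 1) → V), IsCompact K ∧
      ∀ i c, ∀ s ∈ A, ∀ x ∉ K, G c i ((s, x), lastCoord ρ v (g, s) c x) = 0 := by
    intro A _
    obtain ⟨⟨K, hK, hz⟩, -⟩ := hφ
    -- The cut-off vanishes once the coordinate exceeds `1` in absolute value, so shifts by at most
    -- `1` contain the support.
    let K' : Set (Fin (k + 1) → V) := ⋃ c : Fin (k + 1) → Γ,
      (fun p : (Fin (k + 1) → V) × ℝ => shiftLast ρ v c p.1 p.2) '' (K ×ˢ Set.Icc (-1) 1)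
    have hK' : IsCompact K' := isCompact_iUnion fun c => (hK.prod isCompact_Icc).image
      (contDiff_shiftLast ρ v c contDiff_fst contDiff_snd).continuous
    refine ⟨K', hK', fun i c s _ x hx => ?_⟩
    have h3 : ∀ x ∉ K', lastCoord ρ v (g, s) c x * G c i ((s, x), lastCoord ρ v (g, s) c x) = 0 := by
      intro x hx
      have h4 : ∀ r ∈ Set.Icc (-1 : ℝ) 1, shiftLast ρ v c x r ∉ K := by
        intro r hr hxK
        refine hx (Set.mem_iUnion_of_mem c ⟨(shiftLast ρ v c x r, -r), ⟨hxK, ?_⟩, ?_⟩)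
        · exact ⟨by linarith [hr.2], by linarith [hr.1]⟩
        · change shiftLast ρ v c (shiftLast ρ v c x r) (-r) = x
          rw [shiftLast_shiftLast, add_neg_cancel, shiftLast_zero]
      rw [h2]
      have h5 := hz i c x (by simpa only [shiftLast_zero] using h4 0 (by simp))
      rw [h5, zero_sub, neg_eq_zero]
      by_cases h6 : lastCoord ρ v (g, s) c x ^ 2 ≤ 1
      · have h7 := abs_le.1 ((sq_le_one_iff_abs_le_one _).1 h6)
        rw [hz i c _ (h4 _ ⟨by linarith [h7.2], by linarith [h7.1]⟩), mul_zero]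
      · rw [ϱ.eq_zero _ (by linarith), zero_mul]
    have hcont : Continuous fun x => G c i ((s, x), lastCoord ρ v (g, s) c x) :=
      ((hu c).contDiff i).continuous.comp (by fun_prop : Continuous fun x : Fin (k + 1) → V => (s, x))
    have hopen : IsOpen {r : ℝ | shiftLast ρ v c x r ∈ K'ᶜ} :=
      hK'.isClosed.isOpen_compl.preimage
        (contDiff_shiftLast ρ v c contDiff_const contDiff_id).continuous
    have hline : Continuous fun r : ℝ => G c i ((s, shiftLast ρ v c x r),
        lastCoord ρ v (g, s) c (shiftLast ρ v c x r)) :=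
      hcont.comp (contDiff_shiftLast ρ v c contDiff_const contDiff_id).continuous
    -- On the hyperplane itself the quotient vanishes outside `K'` by continuity, from the nearby
    -- points of the line that lie outside `K'` and off the hyperplane.
    have h8 := ((dense_compl_singleton (-lastCoord ρ v (g, s) c x)).open_subset_closure_inter hopen)
      (show (0 : ℝ) ∈ {r : ℝ | shiftLast ρ v c x r ∈ K'ᶜ} by simpa [shiftLast_zero] using hx)
    have h9 : (0 : ℝ) ∈ {r : ℝ | G c i ((s, shiftLast ρ v c x r),
        lastCoord ρ v (g, s) c (shiftLast ρ v c x r)) = 0} := by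
      refine closure_minimal ?_ (isClosed_eq hline continuous_const) h8
      rintro r ⟨hr, hr'⟩
      have h10 := h3 _ hr
      refine (mul_eq_zero.1 h10).resolve_left fun h11 => hr' ?_
      rw [lastCoord_shiftLast, hv, mul_one] at h11
      rw [Set.mem_singleton_iff]
      linarith
    simpa only [Set.mem_ofPred_eq, shiftLast_zero] using h9
  obtain ⟨Q, hQ, hQ'⟩ := exists_pFam (f := fun i s c x => G c i ((s, x), lastCoord ρ v (g, s) c x)) hs hu
  exact ⟨Q, hQ, fun i t c x => by rw [hQ', h2]⟩

theorem exists_isQuo_single {v : V} (hv : inner ℝ v v = (1 : ℝ)) (q : Γ × V)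
    (φ : crossTest Γ V (k + 1)) : ∃ Q, IsQuo ρ ϱ v q φ Q := by
  have hφ : BFam fun _ : Unit => φ :=
    ⟨⟨⋃ c, tsupport (comp φ c), isCompact_iUnion fun c => (φ.2 c).2, fun _ c x hx =>
      image_eq_zero_of_notMem_tsupport fun h => hx (Set.mem_iUnion_of_mem c h)⟩,
      fun c => USmooth.of_single fun _ => (φ.2 c).1⟩
  obtain ⟨Q, -, hQ⟩ := exists_isQuo ρ ϱ hv hφ q.1
  exact ⟨Q () q.2, hQ () q.2⟩

open Classical in
/-- The quotient of a test function by a coordinate of the source of the last arrow. -/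
def quo (v : V) (q : Γ × V) (φ : crossTest Γ V (k + 1)) : crossTest Γ V (k + 1) :=
  if h : ∃ Q, IsQuo ρ ϱ v q φ Q then h.choose else 0

variable {v : V}

theorem isQuo_quo (hv : inner ℝ v v = (1 : ℝ)) (q : Γ × V) (φ : crossTest Γ V (k + 1)) : IsQuo ρ ϱ v q φ (quo ρ ϱ v q φ) := by
  have h := exists_isQuo_single ρ ϱ hv q φ
  rw [quo, dif_pos h]
  exact h.choose_spec

/-- Quotients being unique, linearity of `quo` and its commutation relations are verified through
the defining equation. -/
theorem quo_eq (hv : inner ℝ v v = (1 : ℝ)) {q : Γ × V} {φ Q : crossTest Γ V (k + 1)} (h : IsQuo ρ ϱ v q φ Q) :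
    quo ρ ϱ v q φ = Q :=
  (isQuo_quo ρ ϱ hv q φ).unique ρ hv h

theorem smoothOp_quo (hv : inner ℝ v v = (1 : ℝ)) : SmoothOp Γ V (k + 1) (k + 1) (quo ρ ϱ v) := by
  refine ⟨fun q => ⟨fun φ ψ => ?_, fun r φ => ?_⟩, fun φ hφ g => ?_⟩
  · refine quo_eq ρ ϱ hv fun c x => ?_
    simp only [comp_add, mul_add, isQuo_quo ρ ϱ hv q φ c x, isQuo_quo ρ ϱ hv q ψ c x]
    ring
  · refine quo_eq ρ ϱ hv fun c x => ?_
    simp only [comp_smul, mul_left_comm _ r, isQuo_quo ρ ϱ hv q φ c x]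
    ring
  · obtain ⟨Q, hQ, hQ'⟩ := exists_isQuo ρ ϱ hv hφ g
    have : (fun i t => quo ρ ϱ v (g, t) (φ i)) = Q :=
      funext fun i => funext fun t => quo_eq ρ ϱ hv (hQ' i t)
    rw [this]
    exact hQ

theorem quo_uMul_self (hv : inner ℝ v v = (1 : ℝ)) (q : Γ × V) (φ : crossTest Γ V (k + 1)) :
    quo ρ ϱ v q (uMul ρ v q φ) = φ := by
  refine quo_eq ρ ϱ hv fun c x => ?_
  have h : srcCoord ρ v q (c (Fin.last k))
      (shiftLast ρ v c x (-lastCoord ρ v q c x) (Fin.last k)) = 0 := by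
    have := lastCoord_shiftLast ρ v v q c x (-lastCoord ρ v q c x)
    rwa [hv, mul_one, add_neg_cancel] at this
  rw [comp_uMul, comp_uMul, h, zero_mul, mul_zero, sub_zero, lastCoord]

theorem quo_uMul_orthogonal (hv : inner ℝ v v = (1 : ℝ)) {w : V} (hw : inner ℝ w v = (0 : ℝ)) (q : Γ × V)
    (φ : crossTest Γ V (k + 1)) :
    quo ρ ϱ v q (uMul ρ w q φ) = uMul ρ w q (quo ρ ϱ v q φ) := by
  refine quo_eq ρ ϱ hv fun c x => ?_
  have h : srcCoord ρ w q (c (Fin.last k))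
      (shiftLast ρ v c x (-lastCoord ρ v q c x) (Fin.last k)) =
        srcCoord ρ w q (c (Fin.last k)) (x (Fin.last k)) := by
    have := lastCoord_shiftLast ρ w v q c x (-lastCoord ρ v q c x)
    rwa [hw, mul_zero, add_zero] at this
  rw [comp_uMul, comp_uMul, comp_uMul, h, mul_left_comm, isQuo_quo ρ ϱ hv q φ c x]
  ring

theorem comp_uMul_quo (hv : inner ℝ v v = (1 : ℝ)) (q : Γ × V) (φ : crossTest Γ V (k + 1)) (c : Fin (k + 1) → Γ)
    (x : Fin (k + 1) → V) : comp (uMul ρ v q (quo ρ ϱ v q φ)) c x = comp φ c x -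
      ϱ.toFun (lastCoord ρ v q c x ^ 2) * comp φ c (shiftLast ρ v c x (-lastCoord ρ v q c x)) :=
  isQuo_quo ρ ϱ hv q φ c x

end Quotient

/-! ### The Koszul complex -/

section AbstractKoszul

variable {M : Type*} [AddCommGroup M] [Module ℝ M] {n : ℕ}

/-- Elimination of the positive degree part of a Koszul cocycle. -/
theorem exists_sub_koszul (δ : Module.End ℝ M) (U D E I : Fin n → Module.End ℝ M)
    (S : Submodule ℝ M) (hδδ : ∀ y, δ (δ y) = 0) (hδI : ∀ j y, δ (I j y) + I j (δ y) = U j y)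
    (hδD : ∀ j y, δ (D j y) = D j (δ y) + E j y - D j (U j (E j y)))
    (hIE : ∀ j y, I j (E j y) + E j (I j y) = y)
    (hIE' : ∀ i j y, i ≠ j → I i (E j y) = -E j (I i y)) (hII : ∀ i j y, I i (I j y) = -I j (I i y))
    (hII0 : ∀ j y, I j (I j y) = 0)
    (hID : ∀ i j y, I i (D j y) = D j (I i y)) (hIU : ∀ i j y, I i (U j y) = U j (I i y))
    (hD : ∀ j, ∀ y ∈ S, D j y ∈ S) (hI : ∀ j, ∀ y ∈ S, I j y ∈ S) (hS : ∀ y ∈ S, δ y ∈ S)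
    {y : M} (hy : y ∈ S) (h0 : δ y = 0) : ∃ C ∈ S, ∀ j, I j (y - δ C) = 0 := by
  have key : ∀ s : Finset (Fin n), ∃ C ∈ S, ∀ j ∈ s, I j (y - δ C) = 0 := by
    intro s
    induction s using Finset.induction_on with
    | empty => exact ⟨0, S.zero_mem, by simp⟩
    | insert j s _ ih =>
      obtain ⟨C, hC, hs⟩ := ih
      set w := y - δ C with hw
      clear_value w
      have hwS : w ∈ S := hw ▸ S.sub_mem hy (hS _ hC)
      have hw0 : δ w = 0 := by rw [hw, map_sub, h0, hδδ, sub_zero]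
      -- The operators stand for contraction `I`, exterior multiplication `E`, a coordinate `U` and
      -- division `D` by it. Subtracting `δ (D I w)` leaves an expression in `I (E w)` only, which
      -- `I j` kills; the contractions already annihilating `w` anticommute through it.
      have h1 : w - δ (D j (I j w)) = I j (E j w) - D j (U j (I j (E j w))) := by
        have h2 : δ (I j w) = U j w := by rw [← hδI, hw0, map_zero, add_zero]
        have h3 : U j (I j (E j w)) = U j w - U j (E j (I j w)) := by
          rw [← map_sub]
          exact congrArg _ (eq_sub_of_add_eq (hIE j w))
        rw [hδD, h2, h3, map_sub (D j)]
        nth_rewrite 1 [← hIE j w]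
        abel
      have h4 : y - δ (C + D j (I j w)) = w - δ (D j (I j w)) := by
        rw [map_add, hw]; abel
      refine ⟨C + D j (I j w), S.add_mem hC (hD _ _ (hI _ _ hwS)), fun i hi => ?_⟩
      have h5 : I i (I j (E j w)) = 0 := by
        by_cases hij : i = j
        · rw [hij, hII0]
        · have := hs i ((Finset.mem_insert.1 hi).resolve_left hij)
          rw [hII, hIE' i j _ hij, this, map_zero, neg_zero, map_zero, neg_zero]
      rw [h4, h1, map_sub, hID, hIU, h5, map_zero, map_zero, sub_zero]
  obtain ⟨C, hC, h⟩ := key Finset.univ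
  exact ⟨C, hC, fun j => h j (Finset.mem_univ j)⟩

end AbstractKoszul

section Koszul

universe u v

variable {Γ : Type u} {V : Type v} [NormedAddCommGroup V] [Group Γ] [Fintype Γ]
  [InnerProductSpace ℝ V] [FiniteDimensional ℝ V] {k m l : ℕ} (ρ : Γ →* (V ≃ₗᵢ[ℝ] V))
  {N N' : Type*} [AddCommGroup N] [Module ℝ N] [AddCommGroup N'] [Module ℝ N']

/-- The pullback of a functional under an operator on test functions. -/
def pull (𝒜 : Γ × V → crossTest Γ V m → crossTest Γ V l) :
    (crossTest Γ V l → Γ × V → N) →ₗ[ℝ] (crossTest Γ V m → Γ × V → N) where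
  toFun E := fun φ q => E (𝒜 q φ) q
  map_add' _ _ := rfl
  map_smul' _ _ := rfl

@[simp] theorem pull_apply (𝒜 : Γ × V → crossTest Γ V m → crossTest Γ V l)
    (E : crossTest Γ V l → Γ × V → N) (φ : crossTest Γ V m) (q : Γ × V) :
    pull 𝒜 E φ q = E (𝒜 q φ) q := rfl

/-- A linear map applied to the values of a functional. -/
def coef (T : N →ₗ[ℝ] N') : (crossTest Γ V k → Γ × V → N) →ₗ[ℝ] (crossTest Γ V k → Γ × V → N') where
  toFun E := fun φ q => T (E φ q)
  map_add' _ _ := by funext φ q; simp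
  map_smul' _ _ := by funext φ q; simp

@[simp] theorem coef_apply (T : N →ₗ[ℝ] N') (E : crossTest Γ V k → Γ × V → N)
    (φ : crossTest Γ V k) (q : Γ × V) : coef T E φ q = T (E φ q) := rfl

theorem bar_apply (E : crossTest Γ V k → Γ × V → N) (φ : crossTest Γ V (k + 1)) (q : Γ × V) :
    bar ρ E φ q = ∑ h : Γ, E (consSlice (h, q.2) φ) (h⁻¹ * q.1, ρ h⁻¹ q.2) +
      ∑ i : Fin k, (-1 : ℝ) ^ ((i : ℕ) + 1) • E (merge ρ i φ) q := by
  unfold bar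
  rw [Fin.sum_univ_succ]
  simp only [Fin.castSucc_zero, face_zero, ← Fin.succ_castSucc, face_succ_castSucc, Pi.add_apply,
    Finset.sum_apply, Pi.smul_apply, Fin.val_zero, pow_zero, one_smul, Fin.val_succ]
  rfl

theorem bar_coef (T : N →ₗ[ℝ] N') (E : crossTest Γ V k → Γ × V → N) :
    bar ρ (coef T E) = coef T (bar ρ E) := by
  funext φ q
  simp only [bar_apply, coef_apply, map_add, map_sum, map_smul]

theorem bar_zero : bar ρ (0 : crossTest Γ V k → Γ × V → N) = 0 := by
  funext φ q
  simp [bar_apply]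

theorem bar_add (E E' : crossTest Γ V k → Γ × V → N) : bar ρ (E + E') = bar ρ E + bar ρ E' := by
  funext φ q
  simp only [bar_apply, Pi.add_apply, smul_add, Finset.sum_add_distrib]
  abel

theorem bar_smul (c : ℝ) (E : crossTest Γ V k → Γ × V → N) : bar ρ (c • E) = c • bar ρ E := by
  funext φ q
  simp only [bar_apply, Pi.smul_apply, smul_add, Finset.smul_sum, smul_comm c]

theorem bar_sum {κ : Type*} (s : Finset κ) (E : κ → crossTest Γ V k → Γ × V → N) :
    bar ρ (∑ i ∈ s, E i) = ∑ i ∈ s, bar ρ (E i) := by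
  classical
  induction s using Finset.induction_on with
  | empty => simp [bar_zero]
  | insert i s hi ih => rw [Finset.sum_insert hi, Finset.sum_insert hi, bar_add, ih]

variable (V) in
/-- The chosen orthonormal basis of `V`. -/
abbrev onb : OrthonormalBasis (Fin (Module.finrank ℝ V)) ℝ V := stdOrthonormalBasis ℝ V

theorem inner_onb_self (j : Fin (Module.finrank ℝ V)) : inner ℝ (onb V j) (onb V j) = (1 : ℝ) := by
  rw [real_inner_self_eq_norm_sq, (onb V).orthonormal.1 j, one_pow]

theorem inner_onb_ne {i j : Fin (Module.finrank ℝ V)} (h : i ≠ j) :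
    inner ℝ (onb V i) (onb V j) = (0 : ℝ) := (onb V).orthonormal.2 h

/-- The Koszul differential. -/
def kos : Module.End ℝ (crossTest Γ V (k + 1) → Γ × V → ExteriorAlgebra ℝ V) :=
  ∑ j, coef (wed (onb V j)) ∘ₗ pull (uMul ρ (onb V j))

theorem kos_apply (y : crossTest Γ V (k + 1) → Γ × V → ExteriorAlgebra ℝ V)
    (φ : crossTest Γ V (k + 1)) (q : Γ × V) :
    kos ρ y φ q = ∑ j, wed (onb V j) (y (uMul ρ (onb V j) q φ) q) := by
  simp only [kos, LinearMap.sum_apply, Finset.sum_apply]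
  rfl

theorem kos_kos (y : crossTest Γ V (k + 1) → Γ × V → ExteriorAlgebra ℝ V) :
    kos ρ (kos ρ y) = 0 := by
  funext φ q
  simp only [kos_apply, map_sum]
  have h : ∀ S : ExteriorAlgebra ℝ V, S = -S → S = 0 := fun S h => by
    have h2 : (2 : ℝ) • S = 0 := by rw [two_smul]; nth_rewrite 1 [h]; simp
    exact (smul_eq_zero.1 h2).resolve_left two_ne_zero
  refine h _ ?_
  conv_lhs => rw [Finset.sum_comm]
  rw [← Finset.sum_neg_distrib]
  refine Finset.sum_congr rfl fun i _ => ?_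
  rw [← Finset.sum_neg_distrib]
  refine Finset.sum_congr rfl fun j _ => ?_
  rw [wed_wed, uMul_uMul]

theorem bar_kos (y : crossTest Γ V (k + 1) → Γ × V → ExteriorAlgebra ℝ V) :
    bar ρ (kos ρ y) = kos ρ (bar ρ y) := by
  funext φ q
  simp only [bar_apply, kos_apply, map_add, map_sum, map_smul, Finset.sum_add_distrib,
    Finset.smul_sum]
  congr 1
  · rw [Finset.sum_comm]
    refine Finset.sum_congr rfl fun j _ => Finset.sum_congr rfl fun h _ => ?_
    rw [uMul_consSlice]
  · rw [Finset.sum_comm]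
    refine Finset.sum_congr rfl fun j _ => Finset.sum_congr rfl fun h _ => ?_
    rw [uMul_merge]

theorem coef_mem (T : N →ₗ[ℝ] N') {E : crossTest Γ V k → Γ × V → N} (hE : E ∈ vCochains Γ V N k) :
    coef T E ∈ vCochains Γ V N' k := map_mem_vCochains T hE

theorem pull_mem {𝒜 : Γ × V → crossTest Γ V m → crossTest Γ V l} (h : SmoothOp Γ V m l 𝒜)
    {E : crossTest Γ V l → Γ × V → N} (hE : E ∈ vCochains Γ V N l) : pull 𝒜 E ∈ vCochains Γ V N m :=
  h.mem_vCochains' hE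

theorem kos_mem {y : crossTest Γ V (k + 1) → Γ × V → ExteriorAlgebra ℝ V}
    (h : y ∈ vCochains Γ V (ExteriorAlgebra ℝ V) (k + 1)) :
    kos ρ y ∈ vCochains Γ V (ExteriorAlgebra ℝ V) (k + 1) := by
  unfold kos
  rw [LinearMap.sum_apply]
  exact Submodule.sum_mem _ fun j _ => coef_mem (wed (onb V j)) (pull_mem (smoothOp_uMul ρ _) h)

/-- The inclusion of the scalars into the exterior algebra. -/
abbrev scal (V : Type*) [AddCommGroup V] [Module ℝ V] : ℝ →ₗ[ℝ] ExteriorAlgebra ℝ V :=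
  Algebra.linearMap ℝ (ExteriorAlgebra ℝ V)

/-- The scalar part of an element of the exterior algebra. -/
abbrev aug (V : Type*) [AddCommGroup V] [Module ℝ V] : ExteriorAlgebra ℝ V →ₗ[ℝ] ℝ :=
  (ExteriorAlgebra.algebraMapInv (R := ℝ) (M := V)).toLinearMap

theorem aug_scal (r : ℝ) : aug V (scal V r) = r := ExteriorAlgebra.algebraMap_leftInverse V r

theorem aug_wed (v : V) (x : ExteriorAlgebra ℝ V) : aug V (wed v x) = 0 := by
  change ExteriorAlgebra.algebraMapInv (ExteriorAlgebra.ι ℝ v * x) = (0 : ℝ)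
  rw [map_mul]
  simp [ExteriorAlgebra.algebraMapInv]

theorem coef_aug_kos (y : crossTest Γ V (k + 1) → Γ × V → ExteriorAlgebra ℝ V) :
    coef (aug V) (kos ρ y) = 0 := by
  funext φ q
  rw [coef_apply, kos_apply, map_sum]
  exact Finset.sum_eq_zero fun j _ => aug_wed _ _

theorem coef_aug_scal (z : crossTest Γ V k → Γ × V → ℝ) : coef (aug V) (coef (scal V) z) = z := by
  funext φ q
  rw [coef_apply, coef_apply, aug_scal]

theorem kos_scal_eq_zero {z : crossTest Γ V (k + 1) → Γ × V → ℝ}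
    (h : kos ρ (coef (scal V) z) = 0) (j : Fin (Module.finrank ℝ V)) :
    pull (uMul ρ (onb V j)) z = 0 := by
  funext φ q
  have h1 := congrFun (congrFun h φ) q
  rw [kos_apply] at h1
  have h2 := congrArg (fun x => aug V (con (onb V j) x)) h1
  simp only [map_sum, coef_apply, con_wed, map_sub, aug_wed, sub_zero, Pi.zero_apply, map_zero,
    map_smul, aug_scal] at h2
  rw [Finset.sum_eq_single j (fun i _ hi => by rw [inner_onb_ne hi.symm, zero_smul]) (by simp),
    inner_onb_self, one_smul] at h2
  exact h2

/-- Multiplication by a coordinate has the division `quo` as a left inverse on test functions, and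
`quo` commutes with the orthogonal coordinates. The transposed operators satisfy the relations of
`exists_sub_koszul`. The remainder has no contractions, so it is a scalar, and being closed it is
annihilated by the coordinates. -/
theorem exists_koszul (ϱ : CutOff) {y : crossTest Γ V (k + 1) → Γ × V → ExteriorAlgebra ℝ V}
    (hy : y ∈ vCochains Γ V (ExteriorAlgebra ℝ V) (k + 1)) (h : kos ρ y = 0) :
    ∃ C ∈ vCochains Γ V (ExteriorAlgebra ℝ V) (k + 1), ∃ z ∈ vCochains Γ V ℝ (k + 1),
      (∀ j, pull (uMul ρ (onb V j)) z = 0) ∧ y = kos ρ C + coef (scal V) z := by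
  have he := (onb V).orthonormal
  obtain ⟨C, hC, h1⟩ := exists_sub_koszul (kos (k := k) ρ) (fun j => pull (uMul ρ (onb V j)))
    (fun j => pull (quo ρ ϱ (onb V j))) (fun j => coef (wed (onb V j)))
    (fun j => coef (con (onb V j))) (vCochains Γ V (ExteriorAlgebra ℝ V) (k + 1)) (kos_kos ρ)
    (fun j y => by
      funext φ q
      simp only [Pi.add_apply, kos_apply, coef_apply, pull_apply, map_sum, con_wed,
        Finset.sum_sub_distrib]
      rw [add_sub_cancel,
        Finset.sum_eq_single j (fun i _ hi => by rw [inner_onb_ne hi.symm, zero_smul]) (by simp),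
        inner_onb_self, one_smul])
    (fun j y => by
      funext φ q
      simp only [Pi.add_apply, Pi.sub_apply, kos_apply, coef_apply, pull_apply]
      rw [← Finset.add_sum_erase _ _ (Finset.mem_univ j), ← Finset.add_sum_erase _ _
        (Finset.mem_univ j), quo_uMul_self ρ ϱ (inner_onb_self j)]
      have h2 : ∀ i ∈ Finset.univ.erase j, wed (onb V i) (y (quo ρ ϱ (onb V j) q
          (uMul ρ (onb V i) q φ)) q) = wed (onb V i) (y (uMul ρ (onb V i) q
            (quo ρ ϱ (onb V j) q φ)) q) := fun i hi => by
        rw [quo_uMul_orthogonal ρ ϱ (inner_onb_self j) (inner_onb_ne (Finset.ne_of_mem_erase hi))]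
      rw [Finset.sum_congr rfl h2]
      abel)
    (fun j y => by
      funext φ q
      simp only [Pi.add_apply, coef_apply, con_wed_self he]
      abel)
    (fun i j y hij => by
      funext φ q
      simp only [Pi.neg_apply, coef_apply, con_wed_ne he hij])
    (fun i j y => by
      funext φ q
      simp only [Pi.neg_apply, coef_apply, con_con (onb V i)])
    (fun j y => by
      funext φ q
      simp only [coef_apply, con_con_self]
      rfl)
    (fun _ _ _ => rfl) (fun _ _ _ => rfl)
    (fun j y hy => pull_mem (smoothOp_quo ρ ϱ (inner_onb_self j)) hy)
    (fun j y hy => coef_mem _ hy) (fun y hy => kos_mem ρ hy) hy h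
  have h2 : y - kos ρ C = coef (scal V) (coef (aug V) (y - kos ρ C)) := by
    funext φ q
    exact eq_algebraMap_of_con (onb V) fun j => congrFun (congrFun (h1 j) φ) q
  refine ⟨C, hC, coef (aug V) (y - kos ρ C),
    coef_mem _ (Submodule.sub_mem _ hy (kos_mem ρ hC)), kos_scal_eq_zero ρ ?_, ?_⟩
  · rw [← h2, map_sub, h, kos_kos, sub_zero]
  · rw [← h2, add_sub_cancel]

/-- A linear functional which is killed by the coordinates only depends on the values of the test
functions where the source of the last arrow is the source of the point of evaluation. -/
theorem eq_zero_of_pull_uMul (ϱ : CutOff) {z : crossTest Γ V (k + 1) → Γ × V → N} (hz : IsLinearMap ℝ z)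
    (h : ∀ j, pull (uMul ρ (onb V j)) z = 0) {φ : crossTest Γ V (k + 1)} {q : Γ × V}
    (hφ : ∀ c x, ρ (c (Fin.last k))⁻¹ (x (Fin.last k)) = ρ q.1⁻¹ q.2 → comp φ c x = 0) :
    z φ q = 0 := by
  have key : ∀ s : Finset (Fin (Module.finrank ℝ V)), ∃ ψ : crossTest Γ V (k + 1), z ψ q = z φ q ∧
      ∀ c x, (∀ j ∉ s, lastCoord ρ (onb V j) q c x = 0) → comp ψ c x = 0 := by
    intro s
    induction s using Finset.induction_on with
    | empty =>
      refine ⟨φ, rfl, fun c x hx => hφ c x ?_⟩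
      rw [← sub_eq_zero, ← (onb V).sum_repr' (_ - _)]
      refine Finset.sum_eq_zero fun j _ => ?_
      have := hx j (by simp)
      rw [lastCoord, srcCoord] at this
      rw [this, zero_smul]
    | insert j s hj ih =>
      obtain ⟨ψ, h1, h2⟩ := ih
      -- Subtracting a multiple of a coordinate does not change the value of `z`. What remains is a
      -- cut-off times the restriction to a hyperplane, so its vanishing on the intersection of
      -- hyperplanes propagates to a larger intersection with each step.
      refine ⟨ψ - uMul ρ (onb V j) q (quo ρ ϱ (onb V j) q ψ), ?_, fun c x hx => ?_⟩
      · have h3 := congrFun (congrFun (h j) (quo ρ ϱ (onb V j) q ψ)) q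
        rw [pull_apply] at h3
        rw [hz.map_sub, Pi.sub_apply, h3, h1]
        exact sub_zero _
      · have h4 : comp (ψ - uMul ρ (onb V j) q (quo ρ ϱ (onb V j) q ψ)) c x =
            comp ψ c x - comp (uMul ρ (onb V j) q (quo ρ ϱ (onb V j) q ψ)) c x := rfl
        rw [h4, comp_uMul_quo ρ ϱ (inner_onb_self j), sub_sub_cancel, h2, mul_zero]
        intro i hi
        rw [lastCoord_shiftLast]
        by_cases hij : i = j
        · rw [hij, inner_onb_self, mul_one, add_neg_cancel]
        · rw [inner_onb_ne hij, mul_zero, add_zero]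
          exact hx i (by simp [hij, hi])
  obtain ⟨ψ, h1, h2⟩ := key Finset.univ
  have h3 : ψ = 0 := crossTest_ext fun c x => h2 c x (by simp)
  rw [← h1, h3, hz.map_zero, Pi.zero_apply]

/-! ### The contraction -/

variable (ϱ : CutOff) {ε : ℝ} (hε : 0 < ε)

/-- The insertion of an arrow commutes with all faces in `bar` except for the additional inner one,
which returns the original test function. Thus it contracts the `bar` complex for every label `g`.
-/
theorem bar_pull_ins (g : Γ) {E : crossTest Γ V (k + 1 + 1) → Γ × V → N} (hE : bar ρ E = 0) :
    bar ρ (pull (fun _ => ins ρ ϱ hε g) E) = (-1 : ℝ) ^ (k + 1) • E := by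
  funext φ q
  have h := congrFun (congrFun hE (ins ρ ϱ hε g φ)) q
  rw [bar_apply, Fin.sum_univ_castSucc, merge_ins_last, Pi.zero_apply, Pi.zero_apply] at h
  simp only [merge_ins, ← ins_consSlice, Fin.val_castSucc, Fin.val_last] at h
  rw [bar_apply]
  simp only [pull_apply, Pi.smul_apply]
  rw [← add_assoc] at h
  rw [eq_neg_of_add_eq_zero_left h, ← neg_smul]
  congr 1
  ring

/-- The iterated composition of the contractions and the Koszul differential. -/
def kIter (g : Γ) : (p : ℕ) → (crossTest Γ V (p + 1) → Γ × V → ExteriorAlgebra ℝ V) →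
    crossTest Γ V 1 → Γ × V → ExteriorAlgebra ℝ V
  | 0, Y => Y
  | p + 1, Y => kIter g p (kos ρ (pull (fun _ => ins ρ ϱ hε g) Y))

/-- Boundaries of functionals which are linear over the functions on `V`. -/
def IsBdry : (p : ℕ) → (crossTest Γ V (p + 1) → Γ × V → ℝ) → Prop
  | 0, w => w = 0
  | p + 1, w => ∃ z ∈ vCochains Γ V ℝ (p + 1), (∀ j, pull (uMul ρ (onb V j)) z = 0) ∧ w = bar ρ z

/-- The way back up the zigzag. If the contracted problem is solved by `B'`, then `∑ pull ins Y -
B'` is Koszul closed, hence equals `kos C + scal z`. Applying `bar` recovers `∑ Y` up to sign and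
shows it to be `kos` of a `bar`-closed element plus the boundary `bar z`. -/
theorem exists_isBdry : ∀ (p : ℕ) (Y : Γ → crossTest Γ V (p + 1) → Γ × V → ExteriorAlgebra ℝ V),
    (∀ g, Y g ∈ vCochains Γ V (ExteriorAlgebra ℝ V) (p + 1)) → (∀ g, bar ρ (Y g) = 0) →
    (∀ g, kos ρ (Y g) = 0) → ∀ B₀ ∈ vCochains Γ V (ExteriorAlgebra ℝ V) 1, bar ρ B₀ = 0 →
    ∑ g, kIter ρ ϱ hε g p (Y g) = kos (k := 0) ρ B₀ →
    ∃ B ∈ vCochains Γ V (ExteriorAlgebra ℝ V) (p + 1), bar ρ B = 0 ∧ ∃ w, IsBdry ρ p w ∧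
      ∑ g, Y g = kos ρ B + coef (scal V) w
  | 0, Y, _, _, _, B₀, hB₀, hbB₀, h => ⟨B₀, hB₀, hbB₀, 0, rfl, by rw [map_zero, add_zero]; exact h⟩
  | p + 1, Y, hY, hbY, hkY, B₀, hB₀, hbB₀, h => by
    have hm : ∀ g, pull (fun _ => ins ρ ϱ hε g) (Y g) ∈
        vCochains Γ V (ExteriorAlgebra ℝ V) (p + 1) := fun g => pull_mem (smoothOp_ins ρ ϱ hε g) (hY g)
    obtain ⟨B', hB', hbB', w', -, h1⟩ := exists_isBdry p
      (fun g => kos ρ (pull (fun _ => ins ρ ϱ hε g) (Y g))) (fun g => kos_mem ρ (hm g))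
      (fun g => by rw [bar_kos, bar_pull_ins ρ ϱ hε g (hbY g), map_smul, hkY, smul_zero])
      (fun g => kos_kos ρ _) B₀ hB₀ hbB₀ h
    -- In the contracted problem everything is a Koszul image, which has no scalar part.
    have hw' : w' = 0 := by
      have h2 := congrArg (coef (aug V)) h1
      rw [map_sum, map_add, coef_aug_kos, coef_aug_scal, zero_add] at h2
      rw [← h2]
      exact Finset.sum_eq_zero fun g _ => coef_aug_kos ρ _
    rw [hw', map_zero, add_zero, ← map_sum, ← sub_eq_zero, ← map_sub] at h1
    obtain ⟨C, hC, z, hz, hUz, h3⟩ := exists_koszul ρ ϱ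
      (Submodule.sub_mem _ (Submodule.sum_mem _ fun g _ => hm g) hB') h1
    have h4 := congrArg (bar ρ) h3
    have h5 : bar ρ (∑ g, pull (fun _ => ins ρ ϱ hε g) (Y g) - B') =
        (-1 : ℝ) ^ (p + 1) • ∑ g, Y g := by
      rw [sub_eq_add_neg, ← neg_one_smul ℝ B', bar_add, bar_smul, hbB', smul_zero, add_zero, bar_sum,
        Finset.smul_sum]
      exact Finset.sum_congr rfl fun g _ => bar_pull_ins ρ ϱ hε g (hbY g)
    have h6 : ∑ g, Y g = (-1 : ℝ) ^ (p + 1) • ((-1 : ℝ) ^ (p + 1) • ∑ g, Y g) := by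
      rw [smul_smul, ← mul_pow]; norm_num
    rw [h5, bar_add, bar_kos, bar_coef] at h4
    refine ⟨(-1 : ℝ) ^ (p + 1) • bar ρ C, Submodule.smul_mem _ _ (bar_mem ρ hC), ?_,
      (-1 : ℝ) ^ (p + 1) • bar ρ z, ⟨(-1 : ℝ) ^ (p + 1) • z, Submodule.smul_mem _ _ hz,
        fun j => by rw [map_smul, hUz, smul_zero], (bar_smul ρ _ _).symm⟩, ?_⟩
    · rw [bar_smul, bar_bar ρ (isLinearMap_of_mem_vCochains hC), smul_zero]
    · rw [h6, h4, smul_add, map_smul, map_smul]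

end Koszul

/-! ### Cocycles of degree one for the reduced coboundary -/

section DegreeOne

universe u v

variable {Γ : Type u} {V : Type v} [NormedAddCommGroup V] [Group Γ] [Fintype Γ]
  [InnerProductSpace ℝ V] [FiniteDimensional ℝ V] {k : ℕ} (ρ : Γ →* (V ≃ₗᵢ[ℝ] V))
  {N : Type*} [AddCommGroup N] [Module ℝ N]

theorem bar_one (E : crossTest Γ V 1 → Γ × V → N) (φ : crossTest Γ V (1 + 1)) (q : Γ × V) :
    bar ρ E φ q = ∑ h : Γ, E (consSlice (h, q.2) φ) (h⁻¹ * q.1, ρ h⁻¹ q.2) - E (merge ρ 0 φ) q := by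
  rw [bar_apply, sub_eq_add_neg]
  simp

/-- The functional `(f δ_h) ↦ f δ_h * η`. -/
def augF (η : Γ → V → N) : crossTest Γ V 1 → Γ × V → N := fun ψ q =>
  ∑ h, comp ψ (fun _ => h) (fun _ => q.2) • η (h⁻¹ * q.1) (ρ h⁻¹ q.2)

theorem augF_mem {η : Γ → V → N} (hη : ∀ g, WSmooth (η g)) :
    augF ρ η ∈ vCochains Γ V N 1 := by
  intro α
  refine mem_cochains_of_usmooth ⟨fun φ ψ => ?_, fun c φ => ?_⟩ fun φ hφ g => ?_
  · funext q
    simp only [augF, comp_add, add_smul, Finset.sum_add_distrib, map_add, Pi.add_apply]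
  · funext q
    simp only [augF, comp_smul, mul_smul, ← Finset.smul_sum, map_smul, Pi.smul_apply]
  · have e : (fun i t => α (augF ρ η (φ i) (g, t))) = fun i t =>
        ∑ h, α (η (h⁻¹ * g) (ρ h⁻¹ t)) * comp (φ i) (fun _ => h) (fun _ => t) := by
      funext i t
      simp only [augF, map_sum, map_smul, smul_eq_mul, mul_comm]
    rw [e]
    exact USmooth.sum _ fun h _ => ((hφ.2 fun _ => h).comp (u := fun t : V => fun _ : Fin 1 => t)
      (contDiff_pi.2 fun _ => contDiff_id)).smul ((hη _ α).comp (ρ h⁻¹).contDiff)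

theorem bar_augF (η : Γ → V → N) : bar ρ (augF ρ η) = 0 := by
  funext φ q
  rw [bar_one]
  have e1 : ∀ (h : Γ) (c : Fin 1 → Γ), splitLabel (0 : Fin 1) h c =
      Fin.cons h fun _ => h⁻¹ * c 0 := by
    intro h c
    funext l
    fin_cases l <;> simp [splitLabel]
  have e2 : ∀ (h : Γ) (x : Fin 1 → V), splitPoint ρ (0 : Fin 1) h x =
      Fin.cons (x 0) fun _ => ρ h⁻¹ (x 0) := by
    intro h x
    funext l
    fin_cases l <;> simp [splitPoint, predAbove_eq]
  simp only [augF, comp_consSlice, comp_merge, e1, e2, Finset.sum_smul]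
  rw [Pi.zero_apply, Pi.zero_apply, sub_eq_zero]
  rw [Finset.sum_comm (f := fun (h h' : Γ) => comp φ (Fin.cons h' fun _ => h'⁻¹ * h)
    (Fin.cons q.2 fun _ => ρ h'⁻¹ q.2) • η (h⁻¹ * q.1) (ρ h⁻¹ q.2))]
  refine Finset.sum_congr rfl fun h _ => ?_
  refine Fintype.sum_equiv (Equiv.mulLeft h) _ _ fun h' => ?_
  rw [Equiv.coe_mulLeft, inv_mul_cancel_left, ← rho_mul, ← mul_assoc, ← mul_inv_rev]

/-- For a single arrow with label `h` and the target of `q`, the two sources differ by the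
displacement of `h⁻¹ t` under `h⁻¹ γ`, where `q = (γ, t)`. -/
theorem kos_augF (η : Γ → V → ExteriorAlgebra ℝ V) :
    kos (k := 0) ρ (augF ρ η) = augF ρ fun γ t => wed (displ ρ γ t) (η γ t) := by
  funext ψ q
  rw [kos_apply]
  simp only [augF, map_sum, map_smul, comp_uMul]
  rw [Finset.sum_comm]
  refine Finset.sum_congr rfl fun h _ => ?_
  have e : displ ρ (h⁻¹ * q.1) (ρ h⁻¹ q.2) = ∑ j, srcCoord ρ (onb V j) q h q.2 • onb V j := by
    simp only [srcCoord]
    rw [(onb V).sum_repr', displ, ← rho_mul]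
    congr 3
    group
  simp only [e, wed_sum, wed_smul, Finset.smul_sum, smul_smul, mul_comm]

variable (ϱ : CutOff) {ε : ℝ} (hε : 0 < ε)

/-- The test function `(c, x) ↦ ϱ (‖t - x‖² / ε)` on the arrows with label `g`. -/
def pt (g : Γ) (t : V) : crossTest Γ V 1 :=
  app ρ ϱ hε g (1, t) (ofComp (fun _ _ => 1) fun _ => ⟨contDiff_const,
    HasCompactSupport.of_compactSpace _⟩)

open Classical in
theorem comp_pt (g : Γ) (t : V) (c : Fin 1 → Γ) (x : Fin 1 → V) :
    comp (pt ρ ϱ hε g t) c x = if c 0 = g then ϱ.toFun (‖t - x 0‖ ^ 2 / ε) else 0 := by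
  have e : ∀ (c : Fin 0 → Γ) (x : Fin 0 → V), comp (ofComp (fun _ _ => 1) fun _ => ⟨contDiff_const,
    HasCompactSupport.of_compactSpace _⟩ : crossTest Γ V 0) c x = 1 := fun _ _ => rfl
  rw [pt, comp_app, e]
  simp

theorem eq_zero_of_augF (ϱ : CutOff) {η : Γ → V → N} (h : augF ρ η = 0) (γ : Γ) (t : V) : η γ t = 0 := by
  classical
  have h1 := congrFun (congrFun h (pt ρ ϱ one_pos 1 t)) (γ, t)
  simp only [augF, comp_pt, Pi.zero_apply] at h1
  rw [Finset.sum_eq_single 1 (fun h _ hh => by rw [if_neg hh, zero_smul]) (by simp)] at h1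
  simpa [ϱ.eq_one 0 (by norm_num)] using h1

/-- Fixing the first of two arrows leaves a bump function times a number; this lets a closed
functional of degree one be evaluated on bump functions in `eq_augF`. -/
theorem consSlice_ins (g h : Γ) (t : V) (ψ : crossTest Γ V 1) :
    consSlice (h, t) (ins ρ ϱ hε g ψ) =
      comp ψ (fun _ => h * g) (fun _ => t) • pt ρ ϱ hε g (ρ h⁻¹ t) :=
  crossTest_ext fun c x => by
    classical
    have e1 : (Fin.cons h c : Fin 2 → Γ) (Fin.last 1) = c 0 := rfl
    have e2 : (Fin.cons t x : Fin 2 → V) (Fin.last 1) = x 0 := rfl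
    have e3 : (mulLast g fun i : Fin 1 => (Fin.cons h c : Fin 2 → Γ) i.castSucc) =
        fun _ => h * g := by
      funext i
      fin_cases i
      simp [mulLast]
    have e4 : (fun i : Fin 1 => (Fin.cons t x : Fin 2 → V) i.castSucc) = fun _ => t := by
      funext i
      fin_cases i
      rfl
    rw [comp_consSlice, comp_ins, comp_smul, comp_pt, e1, e2, e3, e4]
    simp [mul_comm]

/-- A closed functional of degree one is multiplication by a function. -/
theorem eq_augF (g : Γ) {E : crossTest Γ V 1 → Γ × V → N} (hE : IsLinearMap ℝ E)
    (hb : bar ρ E = 0) :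
    E = augF ρ fun γ t => E (pt ρ ϱ hε g (ρ g t)) (g * γ, ρ g t) := by
  funext ψ q
  have h := congrFun (congrFun hb (ins ρ ϱ hε g ψ)) q
  have e : merge ρ 0 (ins ρ ϱ hε g ψ) = ψ := merge_ins_last ρ ϱ hε g ψ
  rw [bar_one, e, Pi.zero_apply, Pi.zero_apply, sub_eq_zero] at h
  rw [← h, augF]
  refine Fintype.sum_equiv (Equiv.mulRight g) _ _ fun a => ?_
  rw [consSlice_ins, hE.map_smul, Equiv.coe_mulRight, Pi.smul_apply, ← rho_mul, mul_inv_rev,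
    ← mul_assoc, ← mul_assoc, mul_inv_cancel, one_mul, mul_inv_cancel_left]

end DegreeOne

/-! ### The iterated contraction -/

section Iterate

universe u v

variable {Γ : Type u} {V : Type v} [NormedAddCommGroup V] [Group Γ] [Fintype Γ]
  [InnerProductSpace ℝ V] [FiniteDimensional ℝ V] {k : ℕ} (ρ : Γ →* (V ≃ₗᵢ[ℝ] V))
  (ϱ : CutOff) {ε : ℝ} (hε : 0 < ε)

/-- The test function to which the iterated contraction is applied. -/
def iterIns (g : Γ) (q : Γ × V) (ψ : crossTest Γ V 1) :
    (p : ℕ) → (Fin p → Fin (Module.finrank ℝ V)) → crossTest Γ V (p + 1)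
  | 0, _ => ψ
  | p + 1, I => ins ρ ϱ hε g (uMul ρ (onb V (I (Fin.last p))) q
      (iterIns g q ψ p fun i => I i.castSucc))

/-- Each round of contraction and Koszul differential contributes one wedge factor and one inserted
coordinate. -/
theorem kIter_eq_sum (g : Γ) (ψ : crossTest Γ V 1) (q : Γ × V) :
    ∀ (p : ℕ) (Y : crossTest Γ V (p + 1) → Γ × V → ExteriorAlgebra ℝ V),
      kIter ρ ϱ hε g p Y ψ q = ∑ I : Fin p → Fin (Module.finrank ℝ V),
        ExteriorAlgebra.ιMulti ℝ p (fun i => onb V (I i)) * Y (iterIns ρ ϱ hε g q ψ p I) q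
  | 0, Y => by simp [kIter, iterIns]
  | p + 1, Y => by
    rw [kIter, kIter_eq_sum g ψ q p]
    rw [← (Fin.snocEquiv fun _ => Fin (Module.finrank ℝ V)).sum_comp, Fintype.sum_prod_type,
      Finset.sum_comm]
    refine Finset.sum_congr rfl fun I _ => ?_
    rw [kos_apply, Finset.mul_sum]
    refine Finset.sum_congr rfl fun j _ => ?_
    simp only [Fin.snocEquiv, Equiv.coe_fn_mk, iterIns, Fin.snoc_last, Fin.snoc_castSucc,
      ExteriorAlgebra.ιMulti_apply, List.ofFn_succ', List.concat_eq_append, List.prod_append,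
      List.prod_singleton, mul_assoc, pull_apply, wed_apply]

theorem cutPsi_snoc (t : V) (x : Fin (k + 1) → V) :
    cutPsi ϱ ε t (x (Fin.last k)) (fun i => x i.castSucc) = ∏ j : Fin (k + 1), ϱ.toFun
      (‖(Fin.cons t x : Fin (k + 1 + 1) → V) j.castSucc - x j‖ ^ 2 / ε) := by
  have h : (Fin.snoc (α := fun _ => V) (fun i => x i.castSucc) (x (Fin.last k)) :
    Fin (k + 1) → V) = x := Fin.snoc_init_self x
  unfold cutPsi chain
  rw [h]
  simp only [Fin.cons_succ]

-- Starting from a bump function, the insertions force all labels except the last to be trivial, the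
-- cut-offs multiply to `cutPsi`, and the coordinates to a monomial. Writing the labels as `mulLast
-- g c` turns the condition into `c = 1`.
open Classical in
theorem comp_iterIns (g : Γ) (q : Γ × V) (t : V) : ∀ (p : ℕ)
    (I : Fin p → Fin (Module.finrank ℝ V)) (c : Fin (p + 1) → Γ) (x : Fin (p + 1) → V),
      comp (iterIns ρ ϱ hε g q (pt ρ ϱ hε g t) p I) (mulLast g c) x =
        if ∀ i, c i = 1 then cutPsi ϱ ε t (x (Fin.last p)) (fun i => x i.castSucc) *
          ∏ i, inner ℝ (onb V (I i)) (ρ g⁻¹ (x i.castSucc) - ρ q.1⁻¹ q.2) else 0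
  | 0, I, c, x => by
    rw [cutPsi_snoc]
    simp [iterIns, comp_pt, mulLast]
  | p + 1, I, c, x => by
    have e1 : (mulLast g c) (Fin.last (p + 1)) = c (Fin.last (p + 1)) * g := by simp [mulLast]
    have e2 : ∀ i : Fin (p + 1), mulLast g c i.castSucc = c i.castSucc := fun i => by
      simp [mulLast, Fin.ext_iff, i.2.ne]
    have e3 : (mulLast g fun i : Fin (p + 1) => c i.castSucc) (Fin.last p) =
        c (Fin.last p).castSucc * g := by simp [mulLast]
    have e4 : (∀ i, c i = 1) ↔ c (Fin.last (p + 1)) = 1 ∧ ∀ i : Fin (p + 1), c i.castSucc = 1 := by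
      rw [Fin.forall_fin_succ', and_comm]
    rw [iterIns, comp_ins, e1]
    simp only [e2]
    rw [comp_uMul, comp_iterIns g q t p, e3]
    simp only [mul_eq_right, e4]
    by_cases h1 : c (Fin.last (p + 1)) = 1
    · by_cases h2 : ∀ i : Fin (p + 1), c i.castSucc = 1
      · have h3 : cutPsi ϱ ε t (x (Fin.last p).castSucc) (fun i : Fin p => x i.castSucc.castSucc) =
            ∏ j : Fin (p + 1), ϱ.toFun (‖(Fin.cons t x : Fin (p + 1 + 1 + 1) → V)
              j.castSucc.castSucc - x j.castSucc‖ ^ 2 / ε) := by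
          have h4 := cutPsi_snoc (ε := ε) ϱ t fun i : Fin (p + 1) => x i.castSucc
          rw [h4, ← cons_comp_castSucc]
        have h5 : (Fin.cons t x : Fin (p + 1 + 1 + 1) → V) (Fin.last (p + 1)).castSucc =
            x (Fin.last p).castSucc := rfl
        rw [if_pos h1, if_pos h2, if_pos ⟨h1, h2⟩, h2, h3, cutPsi_snoc,
          Fin.prod_univ_castSucc (n := p + 1), h5]
        conv_rhs => rw [Fin.prod_univ_castSucc (f := fun i =>
          inner ℝ (onb V (I i)) (ρ g⁻¹ (x i.castSucc) - ρ q.1⁻¹ q.2))]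
        rw [srcCoord, one_mul, inv_one, map_one]
        simp only [LinearIsometryEquiv.coe_one, id_eq]
        ring
      · rw [if_pos h1, if_neg h2, if_neg fun h => h2 h.2, mul_zero, mul_zero]
    · rw [if_neg h1, if_neg fun h => h1 h.1]

end Iterate

/-! ### The contraction of a cocycle -/

section Contraction

universe u v

variable {Γ : Type u} {V : Type v} [NormedAddCommGroup V] [Group Γ] [Fintype Γ]
  [InnerProductSpace ℝ V] [FiniteDimensional ℝ V] {k : ℕ} (ρ : Γ →* (V ≃ₗᵢ[ℝ] V))
  (ϱ : CutOff) {ε : ℝ} (hε : 0 < ε)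

theorem kIter_mem (g : Γ) : ∀ (p : ℕ) {Y : crossTest Γ V (p + 1) → Γ × V → ExteriorAlgebra ℝ V},
    Y ∈ vCochains Γ V (ExteriorAlgebra ℝ V) (p + 1) →
      kIter ρ ϱ hε g p Y ∈ vCochains Γ V (ExteriorAlgebra ℝ V) 1
  | 0, _, h => h
  | p + 1, _, h => kIter_mem g p (kos_mem ρ (pull_mem (smoothOp_ins ρ ϱ hε g) h))

theorem kIter_closed (g : Γ) : ∀ (p : ℕ)
    {Y : crossTest Γ V (p + 1) → Γ × V → ExteriorAlgebra ℝ V}, bar ρ Y = 0 → kos ρ Y = 0 →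
      bar ρ (kIter ρ ϱ hε g p Y) = 0 ∧ kos (k := 0) ρ (kIter ρ ϱ hε g p Y) = 0
  | 0, _, h, h' => ⟨h, h'⟩
  | p + 1, _, h, h' => kIter_closed g p
    (by rw [bar_kos, bar_pull_ins ρ ϱ hε g h, map_smul, h', smul_zero]) (kos_kos ρ _)

open Classical in
theorem snocSlice_iterIns (g a : Γ) {q : Γ × V} {x y x₀ : V} (hx : ρ q.1⁻¹ q.2 = x)
    (hy : a = g → ρ g x = y) (I : Fin k → Fin (Module.finrank ℝ V)) :
    snocSlice (a, y) (iterIns ρ ϱ hε g q (pt ρ ϱ hε g (ρ g x₀)) k I) =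
      if a = g then extendUnit (tMap ρ g⁻¹ (cutMonomial ϱ hε x₀ x I)) else 0 :=
  crossTest_ext fun c z => by
    classical
    have e1 : (Fin.snoc (α := fun _ => Γ) c a : Fin (k + 1) → Γ) =
        mulLast g (Fin.snoc (α := fun _ => Γ) c (a * g⁻¹)) := by
      funext l
      refine Fin.lastCases ?_ (fun l => ?_) l
      · simp [mulLast]
      · simp [mulLast, Fin.ext_iff, l.2.ne]
    have e2 : (∀ i, (Fin.snoc (α := fun _ => Γ) c (a * g⁻¹) : Fin (k + 1) → Γ) i = 1) ↔
        (∀ i, c i = 1) ∧ a = g := by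
      rw [Fin.forall_fin_succ']
      simp [mul_inv_eq_one]
    rw [comp_snocSlice, e1, comp_iterIns]
    simp only [e2, Fin.snoc_last, Fin.snoc_castSucc, hx]
    by_cases h1 : a = g
    · rw [if_pos h1, comp_extendUnit]
      simp only [h1, and_true]
      split_ifs
      · rw [tMap_apply, cutMonomial_apply, ← hy h1,
          ← cutPsi_map ρ ϱ g x₀ x fun i => ρ g⁻¹ (z i)]
        simp only [rho_apply_inv_self]
      · rfl
    · rw [if_neg h1, if_neg fun h => h1 h.2]
      rfl

/-- The last face consumes the arrow with label `g` and leaves the cut-off monomial on trivial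
labels, translated by `g⁻¹`. This identifies the coefficients in `kIter_eq_sum` with those of `L₂`.
-/
theorem faceL_iterIns {F : crossTest Γ V k → Γ × V → ℝ} (hF : F 0 = 0) (g δ : Γ) (s : V)
    (I : Fin k → Fin (Module.finrank ℝ V)) :
    faceL ρ F (iterIns ρ ϱ hε g (g * δ, ρ g s) (pt ρ ϱ hε g (ρ g s)) k I) (g * δ, ρ g s) =
      act ρ g⁻¹ (restrict F) (cutMonomial ϱ hε s (ρ δ⁻¹ s) I) (δ, s) := by
  classical
  have h0 : ∀ h : Γ, h⁻¹ * (g * δ) = g → ρ g (ρ δ⁻¹ s) = ρ h⁻¹ (ρ g s) := by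
    intro h h1
    have h2 : h⁻¹ * g = g * δ⁻¹ := by rw [eq_mul_inv_iff_mul_eq, mul_assoc, h1]
    rw [← rho_mul, ← rho_mul, h2]
  have h3 : ∀ h : Γ, snocSlice (h⁻¹ * (g * δ), ρ h⁻¹ (ρ g s))
      (iterIns ρ ϱ hε g (g * δ, ρ g s) (pt ρ ϱ hε g (ρ g s)) k I) =
        if h⁻¹ * (g * δ) = g then extendUnit (tMap ρ g⁻¹ (cutMonomial ϱ hε s (ρ δ⁻¹ s) I)) else 0 :=
    fun h => snocSlice_iterIns ρ ϱ hε g _ (x := ρ δ⁻¹ s)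
      (by simp only [mul_inv_rev, rho_mul, rho_inv_apply_self]) (h0 h) I
  simp only [faceL, h3]
  rw [Finset.sum_eq_single (g * δ * g⁻¹)]
  · rw [if_pos (by group), act_apply, restrict, inv_inv]
  · intro h _ hh
    rw [if_neg, hF]
    · rfl
    · intro h1
      rw [inv_mul_eq_iff_eq_mul] at h1
      exact hh (eq_mul_inv_of_mul_eq h1.symm)
  · simp

/-- In the last face the last arrow has the same source as `q`, so its relative coordinates vanish.
-/
theorem faceL_uMul {F : crossTest Γ V k → Γ × V → ℝ} (hF : F 0 = 0) (v : V) :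
    pull (uMul ρ v) (faceL ρ F) = 0 := by
  funext φ q
  rw [pull_apply, faceL]
  refine Finset.sum_eq_zero fun h _ => ?_
  have e : snocSlice (h⁻¹ * q.1, ρ h⁻¹ q.2) (uMul ρ v q φ) = 0 := crossTest_ext fun c x => by
    rw [comp_snocSlice, comp_uMul]
    have : srcCoord ρ v q (h⁻¹ * q.1) (ρ h⁻¹ q.2) = 0 := by
      rw [srcCoord, ← rho_mul, mul_inv_rev, inv_inv, mul_assoc, mul_inv_cancel, mul_one, sub_self,
        inner_zero_right]
    rw [Fin.snoc_last, Fin.snoc_last, this, zero_mul]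
    rfl
  rw [e, hF]
  rfl

theorem faceL_mem {F : crossTest Γ V k → Γ × V → ℝ} (hF : F ∈ cochains Γ V k) :
    faceL ρ F ∈ vCochains Γ V ℝ (k + 1) := by
  rw [← face_last]
  exact face_mem ρ _ (mem_vCochains_real.2 hF)

/-- For a cocycle the last face is, up to sign, `bar F`, and `bar` squares to zero. -/
theorem bar_faceL {F : crossTest Γ V k → Γ × V → ℝ} (hF : IsLinearMap ℝ F)
    (hb : hochB ρ k F = 0) : bar ρ (faceL ρ F) = 0 := by
  rw [hochB_eq_bar] at hb
  have h := congrArg (bar ρ) hb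
  rw [bar_add, bar_bar ρ hF, bar_smul, zero_add, bar_zero] at h
  exact (smul_eq_zero.1 h).resolve_left (pow_ne_zero _ (by norm_num))

theorem L₂_avg (f : testFun V k → Γ × V → ℝ) (γ : Γ) (x : V) : L₂ ρ ϱ hε (avg ρ f) γ x =
    (Fintype.card Γ : ℝ)⁻¹ • ∑ g, L₂ ρ ϱ hε (act ρ g⁻¹ f) γ x := by
  have h : ∑ g, L₂ ρ ϱ hε (act ρ g⁻¹ f) γ x = ∑ g, L₂ ρ ϱ hε (act ρ g f) γ x :=
    _root_.Equiv.sum_comp (Equiv.inv Γ) fun g => L₂ ρ ϱ hε (act ρ g f) γ x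
  rw [h]
  simp only [L₂, avg, Pi.smul_apply, Finset.sum_apply, smul_assoc, ← Finset.smul_sum,
    Finset.sum_smul]
  rw [Finset.sum_comm]

theorem wSmooth_L₂_avg {F : crossTest Γ V k → Γ × V → ℝ} (hF : F ∈ cochains Γ V k) (γ : Γ) :
    WSmooth (L₂ ρ ϱ hε (avg ρ (restrict F)) γ) := by
  have e : L₂ ρ ϱ hε (avg ρ (restrict F)) γ = fun x => (Fintype.card Γ : ℝ)⁻¹ • ∑ g : Γ,
      exteriorPower.map k ((ρ g⁻¹).toLinearEquiv : V →ₗ[ℝ] V)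
        (L₂ ρ ϱ hε (restrict F) (g * γ * g⁻¹) (ρ g x)) := by
    funext x
    rw [L₂_avg]
    refine congrArg _ (Finset.sum_congr rfl fun g _ => ?_)
    rw [← L₂_act ρ ϱ hε (isLinearMap_restrict hF.1), rho_inv_apply_self]
    congr 1
    group
  rw [e]
  have h : ∀ g, WSmooth (L₂ ρ ϱ hε (restrict F) (g * γ * g⁻¹)) :=
    fun g => contDiff_L₂ ρ ϱ hε hF (g * γ * g⁻¹)
  exact (WSmooth.sum _ fun g _ => ((h g).map _).comp (ρ g).contDiff).smul contDiff_const

theorem kos_scal_faceL {F : crossTest Γ V k → Γ × V → ℝ} (hF : F 0 = 0) (c : ℝ) :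
    kos ρ (coef (scal V) (c • faceL ρ F)) = 0 := by
  funext φ q
  rw [kos_apply]
  refine Finset.sum_eq_zero fun j _ => ?_
  have := congrFun (congrFun (faceL_uMul ρ hF (onb V j)) φ) q
  rw [pull_apply] at this
  rw [coef_apply, Pi.smul_apply, Pi.smul_apply, this]
  simp

/-- The contraction of a cocycle is given by its localization. -/
theorem sum_kIter_faceL {F : crossTest Γ V k → Γ × V → ℝ} (hF : F ∈ cochains Γ V k)
    (hb : hochB ρ k F = 0) :
    ∑ g, kIter ρ ϱ hε g k (coef (scal V) ((Fintype.card Γ : ℝ)⁻¹ • faceL ρ F)) =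
      augF ρ fun δ s => (L₂ ρ ϱ hε (avg ρ (restrict F)) δ (ρ δ⁻¹ s) : ExteriorAlgebra ℝ V) := by
  set Y : crossTest Γ V (k + 1) → Γ × V → ExteriorAlgebra ℝ V :=
    coef (scal V) ((Fintype.card Γ : ℝ)⁻¹ • faceL ρ F) with hY
  have hYm : Y ∈ vCochains Γ V (ExteriorAlgebra ℝ V) (k + 1) :=
    coef_mem _ (Submodule.smul_mem _ _ (faceL_mem ρ hF))
  have hYb : bar ρ Y = 0 := by rw [hY, bar_coef, bar_smul, bar_faceL ρ hF.1 hb, smul_zero, map_zero]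
  have hYk : kos ρ Y = 0 := kos_scal_faceL ρ hF.1.map_zero _
  have h1 : ∀ g δ s, kIter ρ ϱ hε g k Y (pt ρ ϱ hε g (ρ g s)) (g * δ, ρ g s) =
      (Fintype.card Γ : ℝ)⁻¹ •
        (L₂ ρ ϱ hε (act ρ g⁻¹ (restrict F)) δ (ρ δ⁻¹ s) : ExteriorAlgebra ℝ V) := by
    intro g δ s
    rw [kIter_eq_sum, L₂]
    simp only [hY, coef_apply, Pi.smul_apply, faceL_iterIns ρ ϱ hε hF.1.map_zero,
      rho_apply_inv_self, Submodule.coe_sum, Submodule.coe_smul, Finset.smul_sum]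
    refine Finset.sum_congr rfl fun I _ => ?_
    rw [exteriorPower.ιMulti_apply_coe, map_smul, mul_smul_comm, Algebra.linearMap_apply,
      ← Algebra.commutes, ← Algebra.smul_def]
  have h2 : ∀ g, kIter ρ ϱ hε g k Y = augF ρ fun δ s => (Fintype.card Γ : ℝ)⁻¹ •
      (L₂ ρ ϱ hε (act ρ g⁻¹ (restrict F)) δ (ρ δ⁻¹ s) : ExteriorAlgebra ℝ V) := by
    intro g
    rw [eq_augF ρ ϱ hε g (isLinearMap_of_mem_vCochains (kIter_mem ρ ϱ hε g k hYm))
      (kIter_closed ρ ϱ hε g k hYb hYk).1]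
    simp only [h1]
  funext ψ q
  simp only [h2, Finset.sum_apply, augF, L₂_avg, Submodule.coe_smul, Submodule.coe_sum,
    Finset.smul_sum]
  rw [Finset.sum_comm]

/-- The image of a cocycle with vanishing localization under the last face is a boundary. -/
theorem isBdry_faceL {F : crossTest Γ V k → Γ × V → ℝ} (hF : F ∈ cochains Γ V k)
    (hb : hochB ρ k F = 0) (hL : L ρ ϱ hε F = 0) : IsBdry ρ k (faceL ρ F) := by
  set Y : crossTest Γ V (k + 1) → Γ × V → ExteriorAlgebra ℝ V :=
    coef (scal V) ((Fintype.card Γ : ℝ)⁻¹ • faceL ρ F) with hY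
  have hYm : Y ∈ vCochains Γ V (ExteriorAlgebra ℝ V) (k + 1) :=
    coef_mem _ (Submodule.smul_mem _ _ (faceL_mem ρ hF))
  have hYb : bar ρ Y = 0 := by rw [hY, bar_coef, bar_smul, bar_faceL ρ hF.1 hb, smul_zero, map_zero]
  have hYk : kos ρ Y = 0 := kos_scal_faceL ρ hF.1.map_zero _
  have hsum := sum_kIter_faceL ρ ϱ hε hF hb
  -- The contraction is Koszul closed; in degree one this says that the displacement annihilates the
  -- localization.
  have ha : ∀ δ t, wed (displ ρ δ t)
      (L₂ ρ ϱ hε (avg ρ (restrict F)) δ (ρ δ⁻¹ t) : ExteriorAlgebra ℝ V) = 0 := by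
    refine eq_zero_of_augF (N := ExteriorAlgebra ℝ V) ρ ϱ ?_
    rw [← kos_augF, ← hsum, map_sum]
    exact Finset.sum_eq_zero fun g _ => (kIter_closed ρ ϱ hε g k hYb hYk).2
  have hpr : ∀ δ, ∀ x ∈ fixed ρ δ, pr ρ δ k (L₂ ρ ϱ hε (avg ρ (restrict F)) δ (ρ δ⁻¹ x)) = 0 := by
    intro δ x hx
    have h1 : ρ δ⁻¹ x = x := by
      nth_rewrite 1 [← (mem_fixed ρ).1 hx]
      exact rho_inv_apply_self ρ δ x
    rw [h1]
    exact congrFun (congrFun hL δ) ⟨x, hx⟩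
  choose η hη hη' using fun δ => exists_eq_wed_displ ρ δ
    ((wSmooth_L₂_avg ρ ϱ hε hF δ).comp (ρ δ⁻¹).contDiff) (ha δ) (hpr δ)
  -- The same `Y` is used for every label. The sum of `|Γ|` copies compensates the factor `|Γ|⁻¹`,
  -- which was included to match the average in `L₁`.
  obtain ⟨B, -, -, w, hw, h⟩ := exists_isBdry ρ ϱ hε k (fun _ => Y) (fun _ => hYm) (fun _ => hYb)
    (fun _ => hYk) (augF ρ η) (augF_mem ρ hη) (bar_augF ρ η) (by
      rw [kos_augF, hsum]
      simp only [hη'])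
  have h1 := congrArg (coef (aug V)) h
  rw [map_sum, map_add, coef_aug_kos, coef_aug_scal, zero_add, coef_aug_scal, ← Finset.smul_sum,
    Finset.sum_const, Finset.card_univ, ← Nat.cast_smul_eq_nsmul ℝ, smul_smul,
    inv_mul_cancel₀ (by simp), one_smul] at h1
  rwa [h1]

end Contraction

/-! ### Cocycles with vanishing localization are coboundaries -/

section Primitive

universe u v

variable {Γ : Type u} {V : Type v} [NormedAddCommGroup V] [Group Γ] [Fintype Γ]
  [InnerProductSpace ℝ V] [FiniteDimensional ℝ V] {k : ℕ} (ρ : Γ →* (V ≃ₗᵢ[ℝ] V))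
  (ϱ : CutOff) {ε : ℝ} (hε : 0 < ε)

open Classical in
theorem snocSlice_app (g h : Γ) (q : Γ × V) (φ : crossTest Γ V k) :
    snocSlice (h⁻¹ * (q.1 * g), ρ h⁻¹ q.2) (app ρ ϱ hε g q φ) = if h = q.1 then φ else 0 := by
  refine crossTest_ext fun c x => ?_
  rw [comp_snocSlice, comp_app]
  simp only [Fin.snoc_last, Fin.snoc_castSucc]
  by_cases hh : h = q.1
  · rw [if_pos hh, if_pos (by rw [hh, inv_mul_cancel_left]), hh, sub_self, norm_zero,
      show (0 : ℝ) ^ 2 / ε = 0 by simp, ϱ.eq_one 0 (by norm_num), one_mul]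
  · rw [if_neg hh, if_neg]
    · rfl
    · rw [← mul_assoc, mul_eq_right, inv_mul_eq_one]
      exact hh

theorem consSlice_app (g h : Γ) (q : Γ × V) (φ : crossTest Γ V (k + 1)) :
    consSlice (h, q.2) (app ρ ϱ hε g q φ) =
      app ρ ϱ hε g (h⁻¹ * q.1, ρ h⁻¹ q.2) (consSlice (h, q.2) φ) :=
  crossTest_ext fun c x => by
    classical
    have e : ρ (h⁻¹ * q.1)⁻¹ (ρ h⁻¹ q.2) = ρ q.1⁻¹ q.2 := by
      rw [← rho_mul]
      congr 2
      group
    simp only [comp_app, comp_consSlice, cons_last', cons_comp_castSucc, e]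

theorem merge_app_castSucc (g : Γ) (i : Fin k) (q : Γ × V) (φ : crossTest Γ V (k + 1)) :
    merge ρ i.castSucc (app ρ ϱ hε g q φ) = app ρ ϱ hε g q (merge ρ i φ) :=
  crossTest_ext fun c x => by
    classical
    simp only [comp_merge, comp_app, splitLabel_castSucc_last, splitPoint_castSucc_last,
      splitLabel_init, splitPoint_init]
    split_ifs
    · rw [Finset.mul_sum]
    · simp

theorem comp_merge_app_last (g : Γ) (q : Γ × V) (φ : crossTest Γ V (k + 1)) (c : Fin (k + 1) → Γ)
    (x : Fin (k + 1) → V) : comp (merge ρ (Fin.last k) (app ρ ϱ hε g q φ)) c x =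
      ϱ.toFun (‖ρ q.1⁻¹ q.2 - ρ g (ρ (c (Fin.last k))⁻¹ (x (Fin.last k)))‖ ^ 2 / ε) *
        comp φ (Fin.snoc (α := fun _ => Γ) (fun i => c i.castSucc) (c (Fin.last k) * g⁻¹)) x := by
  classical
  have h6 : ∀ h, (fun l : Fin (k + 1) => splitLabel (Fin.last k) h c l.castSucc) =
      Fin.snoc (α := fun _ => Γ) (fun i => c i.castSucc) h := by
    intro h
    funext l
    refine Fin.lastCases ?_ (fun l => ?_) l
    · simp [splitLabel]
    · have := l.2
      simp [splitLabel, Fin.ext_iff, predAbove_eq, show (l : ℕ) ≠ k by omega,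
        show (l : ℕ) ≠ k + 1 by omega, show ¬ k < (l : ℕ) by omega]
      rfl
  simp only [comp_merge, comp_app, splitLabel_last_last, splitPoint_last_last, h6,
    splitPoint_last_init]
  rw [Finset.sum_eq_single (c (Fin.last k) * g⁻¹)]
  · rw [if_pos (by group), mul_inv_rev, inv_inv, rho_mul]
  · intro h _ hh
    rw [if_neg]
    intro h7
    exact hh (eq_mul_inv_of_mul_eq (inv_mul_eq_iff_eq_mul.1 h7).symm)
  · simp

/-- Evaluation of the last argument at functions supported near the source. -/
def appPull (g : Γ) : (crossTest Γ V (k + 1) → Γ × V → ℝ) →ₗ[ℝ] (crossTest Γ V k → Γ × V → ℝ) where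
  toFun Z := fun φ q => Z (app ρ ϱ hε g q φ) (q.1 * g, q.2)
  map_add' _ _ := rfl
  map_smul' _ _ := rfl

theorem appPull_apply (g : Γ) (Z : crossTest Γ V (k + 1) → Γ × V → ℝ) (φ : crossTest Γ V k)
    (q : Γ × V) : appPull ρ ϱ hε g Z φ q = Z (app ρ ϱ hε g q φ) (q.1 * g, q.2) := rfl

theorem appPull_mem (g : Γ) {Z : crossTest Γ V (k + 1) → Γ × V → ℝ}
    (hZ : Z ∈ vCochains Γ V ℝ (k + 1)) : appPull ρ ϱ hε g Z ∈ vCochains Γ V ℝ k :=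
  (smoothOp_app ρ ϱ hε g).mem_vCochains hZ (fun a => a * g) (a := fun _ t => t) fun _ => contDiff_id

/-- For every label `g` this inverts the last face: the appended arrow survives only if it is
composable with `q`, and there the cut-off is `1`. -/
theorem appPull_faceL (g : Γ) {F : crossTest Γ V k → Γ × V → ℝ} (hF : F 0 = 0) :
    appPull ρ ϱ hε g (faceL ρ F) = F := by
  funext φ q
  rw [appPull_apply, faceL]
  simp only [snocSlice_app]
  rw [Finset.sum_eq_single q.1 (fun h _ hh => by rw [if_neg hh, hF]; rfl) (by simp), if_pos rfl]

/-- The two test functions agree where the last arrow has the source of the evaluation arrow, and by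
`eq_zero_of_pull_uMul` the functional sees nothing else. -/
theorem merge_last_app_eq {z : crossTest Γ V (k + 1) → Γ × V → ℝ} (hz : IsLinearMap ℝ z)
    (hU : ∀ j, pull (uMul ρ (onb V j)) z = 0) (g : Γ) (q : Γ × V) (φ : crossTest Γ V (k + 1)) :
    z (merge ρ (Fin.last k) (app ρ ϱ hε g q φ)) (q.1 * g, q.2) =
      ∑ h, z (app ρ ϱ hε (h⁻¹ * (q.1 * g)) (h, q.2) (snocSlice (h⁻¹ * q.1, ρ h⁻¹ q.2) φ))
        (q.1 * g, q.2) := by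
  classical
  have hsum : ∀ f : Γ → crossTest Γ V (k + 1), ∑ h, z (f h) (q.1 * g, q.2) =
      z (∑ h, f h) (q.1 * g, q.2) := by
    intro f
    have := congrFun (map_sum (hz.mk' z) f Finset.univ) (q.1 * g, q.2)
    rw [Finset.sum_apply] at this
    exact this.symm
  rw [hsum, ← sub_eq_zero, ← Pi.sub_apply, ← hz.map_sub]
  refine eq_zero_of_pull_uMul ρ ϱ hz hU fun c x hx => ?_
  have e : ∀ ψ ψ' : crossTest Γ V (k + 1), comp (ψ - ψ') c x = comp ψ c x - comp ψ' c x :=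
    fun _ _ => rfl
  rw [e, comp_sum, comp_merge_app_last, sub_eq_zero]
  simp only [comp_app, comp_snocSlice]
  have hc : ∀ h, c (Fin.last k) = h⁻¹ * (q.1 * g) ↔ h = q.1 * g * (c (Fin.last k))⁻¹ := by
    intro h
    rw [eq_inv_mul_iff_mul_eq, eq_mul_inv_iff_mul_eq]
  simp only [hc]
  rw [Finset.sum_ite_eq' Finset.univ, if_pos (Finset.mem_univ _)]
  have hx' : x (Fin.last k) = ρ (q.1 * g * (c (Fin.last k))⁻¹)⁻¹ q.2 := by
    rw [← rho_apply_inv_self ρ (c (Fin.last k)) (x (Fin.last k)), hx, ← rho_mul]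
    congr 2
    group
  have h1 : ρ g (ρ (c (Fin.last k))⁻¹ (x (Fin.last k))) = ρ q.1⁻¹ q.2 := by
    rw [hx, ← rho_mul]
    congr 2
    group
  have h2 : (q.1 * g * (c (Fin.last k))⁻¹)⁻¹ * q.1 = c (Fin.last k) * g⁻¹ := by group
  have h3 : (Fin.snoc (α := fun _ => V) (fun i => x i.castSucc) (x (Fin.last k)) :
    Fin (k + 1) → V) = x := Fin.snoc_init_self x
  rw [h1, h2]
  rw [← hx', h3, sub_self, sub_self]

/-- Appending an arrow adds to `bar` one inner face, which multiplies the last argument with the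
appended one. By `merge_last_app_eq` it becomes the missing last face after reindexing the labels;
this requires the sum over all `g`. -/
theorem sum_appPull_bar {z : crossTest Γ V (k + 1) → Γ × V → ℝ} (hz : IsLinearMap ℝ z)
    (hU : ∀ j, pull (uMul ρ (onb V j)) z = 0) :
    ∑ g, appPull ρ ϱ hε g (bar ρ z) = hochB ρ k (∑ g, appPull ρ ϱ hε g z) := by
  rw [map_sum]
  funext φ q
  have h1 : ∀ g, appPull ρ ϱ hε g (bar ρ z) φ q = bar ρ (appPull ρ ϱ hε g z) φ q +
      (-1 : ℝ) ^ (k + 1) * z (merge ρ (Fin.last k) (app ρ ϱ hε g q φ)) (q.1 * g, q.2) := by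
    intro g
    rw [appPull_apply, bar_apply, bar_apply, Fin.sum_univ_castSucc, add_assoc]
    simp only [consSlice_app, merge_app_castSucc, appPull_apply, Fin.val_castSucc, Fin.val_last,
      smul_eq_mul, mul_assoc]
  simp only [Finset.sum_apply, h1, hochB_eq_bar, Pi.add_apply, Pi.smul_apply, smul_eq_mul,
    Finset.sum_add_distrib, ← Finset.mul_sum]
  congr 2
  simp only [merge_last_app_eq ρ ϱ hε hz hU, faceL, appPull_apply]
  rw [Finset.sum_comm, Finset.sum_comm (f := fun (g h : Γ) => z (app ρ ϱ hε g (h, q.2)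
    (snocSlice (h⁻¹ * q.1, ρ h⁻¹ q.2) φ)) (h * g, q.2))]
  refine Finset.sum_congr rfl fun h _ => ?_
  refine Fintype.sum_equiv (Equiv.mulLeft (h⁻¹ * q.1)) _ _ fun g => ?_
  rw [Equiv.coe_mulLeft]
  simp only [mul_assoc, mul_inv_cancel_left]

theorem mem_coboundaries_of_L_eq_zero {F : crossTest Γ V k → Γ × V → ℝ} (hF : F ∈ cocycles ρ k)
    (hL : L ρ ϱ hε F = 0) : F ∈ coboundaries ρ k := by
  have h := isBdry_faceL ρ ϱ hε hF.1 (LinearMap.mem_ker.1 hF.2) hL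
  have hF0 : F 0 = 0 := hF.1.1.map_zero
  cases k with
  | zero =>
    have h1 := appPull_faceL ρ ϱ hε 1 hF0
    rw [show faceL ρ F = 0 from h, map_zero] at h1
    rw [← h1]
    exact Submodule.zero_mem _
  | succ k =>
    obtain ⟨z, hz, hU, h⟩ := h
    -- Each label recovers `F`, so the sum counts it `|Γ|` times.
    have h1 : ∑ g, appPull ρ ϱ hε g (bar ρ z) = (Fintype.card Γ : ℝ) • F := by
      rw [← h]
      simp only [appPull_faceL ρ ϱ hε _ hF0]
      rw [Finset.sum_const, Finset.card_univ, ← Nat.cast_smul_eq_nsmul ℝ]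
    refine ⟨(Fintype.card Γ : ℝ)⁻¹ • ∑ g, appPull ρ ϱ hε g z, Submodule.smul_mem _ _
      (mem_vCochains_real.1 (Submodule.sum_mem _ fun g _ => appPull_mem ρ ϱ hε g hz)), ?_⟩
    rw [map_smul, ← sum_appPull_bar ρ ϱ hε (isLinearMap_of_mem_vCochains hz) hU, h1, smul_smul,
      inv_mul_cancel₀ (by simp), one_smul]

end Primitive

/-! ### The isomorphism in cohomology -/

section Isomorphism

universe u v

variable {Γ : Type u} {V : Type v} [NormedAddCommGroup V] [Group Γ] [Fintype Γ]
  [InnerProductSpace ℝ V] [FiniteDimensional ℝ V] {k : ℕ} {ρ : Γ →* (V ≃ₗᵢ[ℝ] V)}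
  (β : NormalCoordinates ρ) (ϱ : CutOff) {ε : ℝ} (hε : 0 < ε)

theorem T_mem_cocycles {ξ : (γ : Γ) → fixed ρ γ → ⋀[ℝ]^k V} (hξ : ξ ∈ twistedFields ρ k) :
    T β ξ ∈ cocycles ρ k := ⟨T_mem_cochains β hξ.1, LinearMap.mem_ker.2 (hochB_T β hξ)⟩

variable (ρ k) in
/-- The map `L` on cocycles. -/
def cocycleL : cocycles ρ k →ₗ[ℝ] twistedFields ρ k where
  toFun F := ⟨L ρ ϱ hε F.1, L_mem ρ ϱ hε F.2.1⟩
  map_add' F G := Subtype.ext ((isLinearMap_L ρ ϱ hε).map_add ⟨F.1, F.2.1⟩ ⟨G.1, G.2.1⟩)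
  map_smul' c F := Subtype.ext ((isLinearMap_L ρ ϱ hε).map_smul c ⟨F.1, F.2.1⟩)

theorem cocycleL_T (ξ : twistedFields ρ k) :
    cocycleL k ρ ϱ hε ⟨T β ξ.1, T_mem_cocycles β ξ.2⟩ = ξ := Subtype.ext (L_T β ϱ hε ξ.2)

theorem L_eq_zero_of_mem_coboundaries {F : crossTest Γ V k → Γ × V → ℝ}
    (hF : F ∈ coboundaries ρ k) : L₃₂ ρ ϱ hε (restrict F) = 0 ∧ L ρ ϱ hε F = 0 := by
  cases k with
  | zero =>
    rw [show F = 0 from hF]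
    exact ⟨map_zero (L₃₂ ρ ϱ hε), (isLinearMap_L ρ ϱ hε).map_zero⟩
  | succ k =>
    obtain ⟨G, hG, rfl⟩ := hF
    refine ⟨?_, L_hochB ρ ϱ hε hG⟩
    rw [restrict_hochB ρ hG.1.map_zero]
    exact L₃_L₂_bA ρ ϱ hε (isLinearMap_restrict hG.1).map_zero

theorem ker_cocycleL :
    LinearMap.ker (cocycleL k ρ ϱ hε) = (coboundaries ρ k).submoduleOf (cocycles ρ k) := by
  ext F
  rw [LinearMap.mem_ker, Submodule.submoduleOf, Submodule.mem_comap]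
  refine ⟨fun h => mem_coboundaries_of_L_eq_zero ρ ϱ hε F.2 (congrArg Subtype.val h), fun h =>
    Subtype.ext (L_eq_zero_of_mem_coboundaries ϱ hε h).2⟩

/-- On cocycles, the projection onto the invariants has no effect on the localization. -/
theorem L₃_L₂_restrict_eq_L {F : crossTest Γ V k → Γ × V → ℝ} (hF : F ∈ cocycles ρ k) :
    L₃ ρ (L₂ ρ ϱ hε (restrict F)) = L ρ ϱ hε F := by
  have hξ := L_mem ρ ϱ hε hF.1
  obtain ⟨β⟩ : Nonempty (NormalCoordinates ρ) := ⟨fun γ => Module.finBasis ℝ (normal ρ γ)⟩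
  have hT := T_mem_cocycles β hξ
  -- The cocycle differs from `T (L F)` by a coboundary, on which the localization vanishes with or
  -- without the projection. For `T (L F)` itself the projection is immaterial because `L F` is
  -- invariant.
  have h1 : F - T β (L ρ ϱ hε F) ∈ coboundaries ρ k := by
    refine mem_coboundaries_of_L_eq_zero ρ ϱ hε (Submodule.sub_mem _ hF hT) ?_
    have h := (cocycleL k ρ ϱ hε).map_sub ⟨F, hF⟩ ⟨_, hT⟩
    have h' := cocycleL_T β ϱ hε ⟨_, hξ⟩
    rw [h'] at h
    exact (congrArg Subtype.val h).trans (sub_self _)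
  have h2 : restrict F = restrict (T β (L ρ ϱ hε F)) + restrict (F - T β (L ρ ϱ hε F)) :=
    (add_sub_cancel (restrict (T β (L ρ ϱ hε F))) (restrict F)).symm
  have hl := isLinearMap_preT₁ β (L ρ ϱ hε F)
  change L₃₂ ρ ϱ hε (restrict F) = _
  rw [h2, map_add, (L_eq_zero_of_mem_coboundaries ϱ hε h1).1, add_zero, T, T₁,
    restrict_T₂ ρ (isLinearMap_avg ρ hl).map_zero, L₃₂_avg_eq ρ ϱ hε hl, L₃₂_preT₁ β ϱ hε hξ.2.1]
  rw [L₃₂_preT₁ β ϱ hε hξ.2.1]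
  exact hξ.2.2

variable (ρ k) in
/-- The isomorphism induced by `L` in cohomology. -/
def cohomologyEquiv : HH ρ k ≃ₗ[ℝ] twistedFields ρ k :=
  (Submodule.quotEquivOfEq _ _ (ker_cocycleL ϱ hε).symm).trans
    ((cocycleL k ρ ϱ hε).quotKerEquivOfSurjective fun ξ =>
      ⟨_, cocycleL_T (fun γ => Module.finBasis ℝ (normal ρ γ)) ϱ hε ξ⟩)

theorem cohomologyEquiv_mk (F : cocycles ρ k) :
    cohomologyEquiv k ρ ϱ hε (Submodule.Quotient.mk F) = cocycleL k ρ ϱ hε F := rfl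

end Isomorphism

end OrbHoch

end

theorem mainTheorem12 {Γ V : Type*} [Group Γ] [Fintype Γ] [NormedAddCommGroup V]
    [InnerProductSpace ℝ V] [FiniteDimensional ℝ V] (ρ : Γ →* (V ≃ₗᵢ[ℝ] V))
    (ϱ : CutOff) {ε : ℝ} (hε : 0 < ε) (β : NormalCoordinates ρ) (k : ℕ) :
    -- the Hochschild cochains form a complex
    (∀ F ∈ cochains Γ V k, hochB ρ k F ∈ cochains Γ V (k + 1) ∧
      hochB ρ (k + 1) (hochB ρ k F) = 0) ∧
    -- `L` is a linear cochain map into the twisted multivector fields with zero differential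
    (∀ F ∈ cochains Γ V k, L ρ ϱ hε F ∈ twistedFields ρ k ∧ L ρ ϱ hε (hochB ρ k F) = 0) ∧
    IsLinearMap ℝ (fun F : cochains Γ V k => L ρ ϱ hε F.1) ∧
    -- `T` is a linear cochain map
    (∀ ξ ∈ twistedFields ρ k, T β ξ ∈ cochains Γ V k ∧ hochB ρ k (T β ξ) = 0) ∧
    IsLinearMap ℝ (fun ξ : twistedFields ρ k => T β ξ.1) ∧
    -- `L ∘ T = id`
    (∀ ξ ∈ twistedFields ρ k, L ρ ϱ hε (T β ξ) = ξ) ∧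
    -- the same without the projections onto the invariant cochains
    (∀ ξ ∈ twistedFields ρ k, L₃ ρ (L₂ ρ ϱ hε (restrict (T₂ ρ (preT₁ β ξ)))) = ξ) ∧
    -- on cocycles, the projection in the definition of `L` has no effect
    (∀ F ∈ cocycles ρ k, L₃ ρ (L₂ ρ ϱ hε (restrict F)) = L ρ ϱ hε F) ∧
    -- `L` and `T` induce mutually inverse isomorphisms in cohomology
    ∃ e : HH ρ k ≃ₗ[ℝ] twistedFields ρ k,
      (∀ F : cocycles ρ k, (e (Submodule.Quotient.mk F)).1 = L ρ ϱ hε F.1) ∧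
      ∀ ξ : twistedFields ρ k, ∃ hξ : T β ξ.1 ∈ cocycles ρ k,
        e.symm ξ = Submodule.Quotient.mk ⟨T β ξ.1, hξ⟩ := by
  refine ⟨fun F hF => ⟨hochB_mem ρ hF, hochB_hochB ρ hF.1⟩,
    fun F hF => ⟨L_mem ρ ϱ hε hF, L_hochB ρ ϱ hε hF⟩, isLinearMap_L ρ ϱ hε,
    fun ξ hξ => ⟨T_mem_cochains β hξ.1, hochB_T β hξ⟩, isLinearMap_T β,
    fun ξ hξ => L_T β ϱ hε hξ, fun ξ hξ => ?_, fun F hF => L₃_L₂_restrict_eq_L ϱ hε hF,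
    cohomologyEquiv k ρ ϱ hε, fun F => rfl, fun ξ => ⟨T_mem_cocycles β ξ.2, ?_⟩⟩
  · rw [restrict_T₂_preT₁]
    exact L₃₂_preT₁ β ϱ hε hξ.2.1
  · rw [LinearEquiv.symm_apply_eq, cohomologyEquiv_mk, cocycleL_T]
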